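/- **Theorem (Duality and bispectrality).** Let $R\subset V=\mathbb R^n$ be a reduced irreducible (crystallographic) root system spanning the Euclidean space $V$ with scalar product $(\cdot,\cdot)$, with Weyl group $W$, a fixed base and positive roots $R_+$; let $\alpha^\vee=2\alpha/(\alpha,\alpha)$, let $R^\vee=\{\alpha^\vee\}$ be the dual root system with the corresponding base, and let $P=\{\omega\in V:(\omega,\alpha^\vee)\in\mathbb Z\ \forall\alpha\in R\}$ and $P^\vee=\{\nu\in V:(\nu,\alpha)\in\mathbb Z\ \forall\alpha\in R\}$ be the weight and coweight lattices. Let $m_\alpha=m_{w\alpha}\in\mathbb Z_{\ge0}$ be $W$-invariant multiplicities, and put $m_{\alpha^\vee}=m_\alpha$. Let $q\in\mathbb C^\times$ be not a root of unity, fix a value of $\log q$, and write $q^a=e^{a\log q}$, $[a]=q^a-q^{-a}$. The variables $x,z$ run over the complexification $V_{\mathbb C}=\mathbb C^n$, with $(\cdot,\cdot)$ extended bilinearly. Put $\rho=\frac12\sum_{\alpha\in R_+}m_\alpha\alpha$, $\rho^\vee=\frac12\sum_{\alpha\in R_+}m_\alpha\alpha^\vee$ and $\mathcal N=\{\rho^\vee-\sum_{\alpha\in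 R_+}l_\alpha\alpha^\vee: l_\alpha\in\mathbb R,\ 0\le l_\alpha\le m_\alpha\}$. For given $x$, say that $f:V_{\mathbb C}\to\mathbb C$ has the *normalized BA property at $x$ for $(R,m)$* if $$f(z)=q^{2(x,z)}\sum_{\nu\in\mathcal N\cap P^\vee}\psi_\nu\,q^{2(\nu,z)},\qquad \psi_{\rho^\vee}=\prod_{\alpha\in R_+}\prod_{j=1}^{m_\alpha}[\,j-(\alpha,x)\,],$$ for some $\psi_\nu\in\mathbb C$, and for all $\alpha\in R$ and $s=1,\dots,m_\alpha$ $$f(z+\tfrac12 s\alpha)=f(z-\tfrac12 s\alpha)\quad\text{whenever } q^{2(\alpha^\vee,z)}=1 .$$ Then there are functions $\psi,\psi^\vee:V_{\mathbb C}\times V_{\mathbb C}\to\mathbb C$ (the normalized Baker–Akhiezer functions of $(R,m)$ and $(R^\vee,m)$) such that 1. for every $x$, $\psi(x,\cdot)$ has the normalized BA property at $x$ for $(R,m)$, and for generic $x$ (off the zero set of some nonzero entire function) it is the only function with this property; likewise $\psi^\vee$ for $(R^\vee,m)$ (with the roles of $\alpha$ and $\alpha^\vee$, $P$ and $P^\vee$,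 $\rho$ and $\rho^\vee$ exchanged); 2. (duality) $\psi(x,z)=\psi^\vee(z,x)$ for all $x,z$; 3. (bispectral system) for every minuscule or quasiminuscule weight $\omega\in P$ and every minuscule or quasiminuscule coweight $\pi\in P^\vee$, $$D_z^\omega\psi=\mathfrak m_\omega(x)\,\psi,\qquad D_x^\pi\psi=\mathfrak m_\pi(z)\,\psi,$$ wherever the coefficients of the operator have no vanishing denominator. Here $\mathfrak m_\lambda(x)=\sum_{\tau\in W\lambda}q^{2(\tau,x)}$. A weight $\omega\in P$ is minuscule if $|(\omega,\alpha^\vee)|\le1$ for all $\alpha\in R$, and quasiminuscule if $\omega\in R$ and $|(\omega,\alpha^\vee)|\le1$ for all $\alpha\in R\setminus\{\pm\omega\}$; (quasi)minuscule coweights are the (quasi)minuscule weights of $R^\vee$. With $(T_z^\tau f)(z)=f(z+\tau)$ the Macdonald operator is $$D_z^\omega=\sum_{\tau\in W\omega}a_\tau(z)(T_z^\tau-1)+\sum_{\tau\in W\omega}q^{-2(\rho^\vee,\tau)},$$ $$a_\tau(z)=\prod_{\alpha\in R:(\alpha^\vee,\tau)>0}\frac{[(\alpha^\vee,z)-m_\alpha]}{[(\alpha^\vee,z)]}\prod_{\alpha\in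 R:(\alpha^\vee,\tau)=2}\frac{[(\alpha^\vee,z)-m_\alpha+1]}{[(\alpha^\vee,z)+1]},$$ and $D_x^\pi$ is the same operator for $R^\vee$, acting in $x$ (exchange $\alpha$ and $\alpha^\vee$, $\rho^\vee$ and $\rho$, $z$ and $x$). -/

import Mathlib

open scoped Matrix

noncomputable section

namespace BakerAkhiezer

/-- `q ^ a := exp (a * lq)`, where `lq` is the fixed value of `log q`. -/
def qpow (lq a : ℂ) : ℂ := Complex.exp (a * lq)

/-- `[a] = q ^ a - q ^ (-a)`. -/
def qbr (lq a : ℂ) : ℂ := qpow lq a - qpow lq (-a)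

/-- The inclusion of `V = ℝⁿ` into its complexification `ℂⁿ`. The arguments `x`, `z` of all
functions run over `ℂⁿ`, and `⬝ᵥ` on `ℂⁿ` is the bilinear extension of the scalar product. -/
def cvec {n : ℕ} (v : Fin n → ℝ) : Fin n → ℂ := fun k => (v k : ℂ)

variable {ι : Type*} [Fintype ι] {n : ℕ}

/-- `P` is a root system in the Euclidean space `V = ℝⁿ`, identified with its dual by the scalar
product: weights and coweights are paired by the scalar product, and `α^∨ = 2 α / (α, α)`. -/
structure IsEuclidean (P : RootPairing ι ℝ (Fin n → ℝ) (Fin n → ℝ)) : Prop where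
  pairing_eq : ∀ u v : Fin n → ℝ, P.toLinearMap u v = u ⬝ᵥ v
  coroot_eq : ∀ i, P.coroot i = (2 / (P.root i ⬝ᵥ P.root i)) • P.root i

/-- The weight lattice of `R`. The coweight lattice is the weight lattice of `P.flip`, the dual
root system. -/
def weightLattice (P : RootPairing ι ℝ (Fin n → ℝ) (Fin n → ℝ)) : Set (Fin n → ℝ) :=
  {ω | ∀ i, ∃ k : ℤ, ω ⬝ᵥ P.coroot i = k}

open Classical in
/-- The finite set of positive (co)roots, as indices. -/
def posIdx (P : RootPairing ι ℝ (Fin n → ℝ) (Fin n → ℝ)) (b : P.Base) : Finset ι :=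
  Finset.univ.filter fun i => b.IsPos i

/-- `ρ^∨ = 1/2 ∑_{α > 0} m_α α^∨`. -/
def rhoCheck (P : RootPairing ι ℝ (Fin n → ℝ) (Fin n → ℝ)) (b : P.Base) (m : ι → ℕ) :
    Fin n → ℝ :=
  (1 / 2 : ℝ) • ∑ i ∈ posIdx P b, (m i : ℝ) • P.coroot i

/-- The polytope `N = {ρ^∨ - ∑_{α > 0} l_α α^∨ | 0 ≤ l_α ≤ m_α}` (real `l_α`). -/
def polytope (P : RootPairing ι ℝ (Fin n → ℝ) (Fin n → ℝ)) (b : P.Base) (m : ι → ℕ) :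
    Set (Fin n → ℝ) :=
  {ν | ∃ l : ι → ℝ, (∀ i ∈ posIdx P b, 0 ≤ l i ∧ l i ≤ m i) ∧
    ν = rhoCheck P b m - ∑ i ∈ posIdx P b, l i • P.coroot i}

/-- For a fixed `x`, the function `f = ψ(x, ·)` satisfies the defining properties of a
Baker--Akhiezer function associated to `(R, m)`, with coefficients `c ν = ψ_ν(x)`. -/
structure IsBAAt (lq : ℂ) (P : RootPairing ι ℝ (Fin n → ℝ) (Fin n → ℝ)) (b : P.Base)
    (m : ι → ℕ) (x : Fin n → ℂ) (f : (Fin n → ℂ) → ℂ) (c : (Fin n → ℝ) →₀ ℂ) : Prop where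
  support_subset : ∀ ν ∈ c.support, ν ∈ weightLattice P.flip ∧ ν ∈ polytope P b m
  expansion : ∀ z, f z =
    qpow lq (2 * (x ⬝ᵥ z)) * c.sum fun ν a => a * qpow lq (2 * (cvec ν ⬝ᵥ z))
  quasi_invariance : ∀ i, ∀ s : ℕ, 1 ≤ s → s ≤ m i → ∀ z : Fin n → ℂ,
    qpow lq (2 * (cvec (P.coroot i) ⬝ᵥ z)) = 1 →
      f (z + ((s : ℂ) / 2) • cvec (P.root i)) = f (z - ((s : ℂ) / 2) • cvec (P.root i))

/-- For a fixed `x`, the function `f = ψ(x, ·)` satisfies the defining properties of the normalized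
Baker--Akhiezer function: `ψ_{ρ^∨}(x) = ∏_{α > 0} ∏_{j = 1}^{m_α} [j - (α, x)]`. -/
def IsNormalizedBAAt (lq : ℂ) (P : RootPairing ι ℝ (Fin n → ℝ) (Fin n → ℝ)) (b : P.Base)
    (m : ι → ℕ) (x : Fin n → ℂ) (f : (Fin n → ℂ) → ℂ) : Prop :=
  ∃ c : (Fin n → ℝ) →₀ ℂ, IsBAAt lq P b m x f c ∧
    c (rhoCheck P b m) = ∏ i ∈ posIdx P b, ∏ j ∈ Finset.Icc 1 (m i),
      qbr lq ((j : ℂ) - cvec (P.root i) ⬝ᵥ x)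

/-- `p x` holds for generic `x`, i.e. off the zero set of some nonzero entire function. -/
def ForGeneric (p : (Fin n → ℂ) → Prop) : Prop :=
  ∃ d : (Fin n → ℂ) → ℂ, Differentiable ℂ d ∧ (∃ x, d x ≠ 0) ∧ ∀ x, d x ≠ 0 → p x

/-- Minuscule weights of `R`. -/
def IsMinuscule (P : RootPairing ι ℝ (Fin n → ℝ) (Fin n → ℝ)) (ω : Fin n → ℝ) : Prop :=
  ω ∈ weightLattice P ∧ ∀ i, |ω ⬝ᵥ P.coroot i| ≤ 1

/-- Quasiminuscule weights of `R`: roots `ω = α_j` with `-1 ≤ (ω, α^∨) ≤ 1` for all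
`α ≠ ± α_j`. -/
def IsQuasiminuscule (P : RootPairing ι ℝ (Fin n → ℝ) (Fin n → ℝ)) (ω : Fin n → ℝ) : Prop :=
  ∃ j, ω = P.root j ∧
    ∀ i, P.root i ≠ P.root j → P.root i ≠ -P.root j → |ω ⬝ᵥ P.coroot i| ≤ 1

theorem orbit_finite (P : RootPairing ι ℝ (Fin n → ℝ) (Fin n → ℝ)) [P.IsRootSystem]
    (ω : Fin n → ℝ) : (MulAction.orbit P.weylGroup ω).Finite := by
  have key : ∀ g h : P.weylGroup, (∀ i : ι, P.weylGroupToPerm g i = P.weylGroupToPerm h i) → g • ω = h • ω := by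
    intro g h hgh
    have hl : RootPairing.Hom.weightMap (g : P.Aut).toHom =
        RootPairing.Hom.weightMap (h : P.Aut).toHom := by
      apply LinearMap.ext_on_range (v := P.root) RootPairing.IsRootSystem.span_root_eq_top
      intro i
      have h1 := P.weylGroup_apply_root g i
      have h2 := P.weylGroup_apply_root h i
      rw [hgh i, ← h2] at h1
      exact h1
    exact congrArg (fun l : (Fin n → ℝ) →ₗ[ℝ] (Fin n → ℝ) => l ω) hl
  have hfin : (Set.range fun g : P.weylGroup => fun i : ι => P.weylGroupToPerm g i).Finite := Set.toFinite _
  refine Set.Finite.subset (hfin.image fun e => (Function.extend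
    (fun g : P.weylGroup => fun i : ι => P.weylGroupToPerm g i) (fun g => g • ω) 0) e) ?_
  rintro _ ⟨g, rfl⟩
  refine ⟨_, ⟨g, rfl⟩, ?_⟩
  exact Function.FactorsThrough.extend_apply (fun a c hac => key a c (congrFun hac)) _ _

/-- The orbit `W ω`. -/
def weylOrbit (P : RootPairing ι ℝ (Fin n → ℝ) (Fin n → ℝ)) [P.IsRootSystem]
    (ω : Fin n → ℝ) : Finset (Fin n → ℝ) :=
  (orbit_finite P ω).toFinset

/-- The orbit sum `𝔪_ω(x) = ∑_{τ ∈ W ω} q^{2 (τ, x)}`. -/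
def orbitSum (lq : ℂ) (P : RootPairing ι ℝ (Fin n → ℝ) (Fin n → ℝ)) [P.IsRootSystem]
    (ω : Fin n → ℝ) (x : Fin n → ℂ) : ℂ :=
  ∑ τ ∈ weylOrbit P ω, qpow lq (2 * (cvec τ ⬝ᵥ x))

open Classical in
/-- The coefficient `a_τ(z)` of the Macdonald operator `D_z^ω`. -/
def macdonaldCoeff (lq : ℂ) (P : RootPairing ι ℝ (Fin n → ℝ) (Fin n → ℝ)) (m : ι → ℕ)
    (τ : Fin n → ℝ) (z : Fin n → ℂ) : ℂ :=
  (∏ i with 0 < P.coroot i ⬝ᵥ τ,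
    qbr lq (cvec (P.coroot i) ⬝ᵥ z - m i) / qbr lq (cvec (P.coroot i) ⬝ᵥ z)) *
  ∏ i with P.coroot i ⬝ᵥ τ = 2,
    qbr lq (cvec (P.coroot i) ⬝ᵥ z - m i + 1) / qbr lq (cvec (P.coroot i) ⬝ᵥ z + 1)

/-- The points `z` at which no denominator of a coefficient of `D_z^ω` vanishes. -/
def IsRegularPoint (lq : ℂ) (P : RootPairing ι ℝ (Fin n → ℝ) (Fin n → ℝ)) [P.IsRootSystem]
    (ω : Fin n → ℝ) (z : Fin n → ℂ) : Prop :=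
  ∀ τ ∈ weylOrbit P ω, ∀ i,
    (0 < P.coroot i ⬝ᵥ τ → qbr lq (cvec (P.coroot i) ⬝ᵥ z) ≠ 0) ∧
    (P.coroot i ⬝ᵥ τ = 2 → qbr lq (cvec (P.coroot i) ⬝ᵥ z + 1) ≠ 0)

/-- The Macdonald operator
`D_z^ω = ∑_{τ ∈ W ω} a_τ (T_z^τ - 1) + ∑_{τ ∈ W ω} q^{-2 (ρ^∨, τ)}` for `t_α = q^{-m_α}`,
attached to a (quasi)minuscule weight `ω` of `R`. For a (quasi)minuscule coweight `π`, the operator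
`D_x^π` is the one of the dual root system `P.flip`. -/
def macdonaldOp (lq : ℂ) (P : RootPairing ι ℝ (Fin n → ℝ) (Fin n → ℝ)) [P.IsRootSystem]
    (b : P.Base) (m : ι → ℕ) (ω : Fin n → ℝ) (f : (Fin n → ℂ) → ℂ) (z : Fin n → ℂ) : ℂ :=
  ∑ τ ∈ weylOrbit P ω, macdonaldCoeff lq P m τ z * (f (z + cvec τ) - f z) +
    (∑ τ ∈ weylOrbit P ω, qpow lq (-2 * ((rhoCheck P b m ⬝ᵥ τ : ℝ) : ℂ))) * f z

end BakerAkhiezer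

end

open BakerAkhiezer

noncomputable section

set_option linter.unusedSectionVars false

namespace BakerAkhiezer

open Filter Topology

variable {ι : Type*} {n : ℕ} {lq : ℂ}

local notation "ℝⁿ" => Fin n → ℝ

local notation "ℂⁿ" => Fin n → ℂ

section Exponentials

theorem qpow_add (lq a b : ℂ) : qpow lq (a + b) = qpow lq a * qpow lq b := by
  simp [qpow, add_mul, Complex.exp_add]

theorem qpow_zero (lq : ℂ) : qpow lq 0 = 1 := by simp [qpow]

theorem qpow_ne_zero (lq a : ℂ) : qpow lq a ≠ 0 := Complex.exp_ne_zero _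

theorem qpow_neg (lq a : ℂ) : qpow lq (-a) = (qpow lq a)⁻¹ := by
  simp [qpow, Complex.exp_neg]

theorem qpow_sub (lq a b : ℂ) : qpow lq (a - b) = qpow lq a * (qpow lq b)⁻¹ := by
  rw [sub_eq_add_neg, qpow_add, qpow_neg]

theorem qpow_natCast_mul (lq : ℂ) (k : ℕ) (a : ℂ) : qpow lq (k * a) = qpow lq a ^ k := by
  simp [qpow, mul_assoc, Complex.exp_nat_mul]

theorem qpow_intCast_mul (lq : ℂ) (k : ℤ) (a : ℂ) : qpow lq (k * a) = qpow lq a ^ k := by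
  simp [qpow, mul_assoc, Complex.exp_int_mul]

theorem cvec_add (u v : ℝⁿ) : cvec (u + v) = cvec u + cvec v := by
  ext k; simp [cvec]

theorem cvec_sub (u v : ℝⁿ) : cvec (u - v) = cvec u - cvec v := by
  ext k; simp [cvec]

theorem cvec_neg (u : ℝⁿ) : cvec (-u) = -cvec u := by
  ext k; simp [cvec]

theorem cvec_zero : cvec (0 : ℝⁿ) = 0 := by
  ext k; simp [cvec]

theorem cvec_smul (a : ℝ) (u : ℝⁿ) : cvec (a • u) = (a : ℂ) • cvec u := by
  ext k; simp [cvec]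

theorem cvec_dot_cvec (u v : ℝⁿ) : cvec u ⬝ᵥ cvec v = ((u ⬝ᵥ v : ℝ) : ℂ) := by
  simp [cvec, dotProduct]

/-- The exponential `q ^ (2 (ν, z))`. -/
def ex (lq : ℂ) (ν : ℝⁿ) (z : ℂⁿ) : ℂ := qpow lq (2 * (cvec ν ⬝ᵥ z))

theorem ex_ne_zero (lq : ℂ) (ν : ℝⁿ) (z : ℂⁿ) : ex lq ν z ≠ 0 := qpow_ne_zero _ _

theorem ex_add (lq : ℂ) (μ ν : ℝⁿ) (z : ℂⁿ) : ex lq (μ + ν) z = ex lq μ z * ex lq ν z := by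
  simp [ex, cvec_add, add_dotProduct, mul_add, qpow_add]

theorem ex_zero (lq : ℂ) (z : ℂⁿ) : ex lq 0 z = 1 := by
  simp [ex, cvec_zero, qpow_zero]

theorem ex_neg (lq : ℂ) (ν : ℝⁿ) (z : ℂⁿ) : ex lq (-ν) z = (ex lq ν z)⁻¹ := by
  simp [ex, cvec_neg, qpow_neg]

theorem ex_sub (lq : ℂ) (μ ν : ℝⁿ) (z : ℂⁿ) : ex lq (μ - ν) z = ex lq μ z * (ex lq ν z)⁻¹ := by
  rw [sub_eq_add_neg, ex_add, ex_neg]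

theorem ex_apply_add (lq : ℂ) (ν : ℝⁿ) (z w : ℂⁿ) : ex lq ν (z + w) = ex lq ν z * ex lq ν w := by
  simp [ex, dotProduct_add, mul_add, qpow_add]

theorem ex_apply_zero (lq : ℂ) (ν : ℝⁿ) : ex lq ν 0 = 1 := by
  simp [ex, qpow_zero]

theorem ex_apply_neg (lq : ℂ) (ν : ℝⁿ) (z : ℂⁿ) : ex lq ν (-z) = (ex lq ν z)⁻¹ := by
  simp [ex, qpow_neg]

theorem ex_cvec_comm (lq : ℂ) (μ ν : ℝⁿ) : ex lq μ (cvec ν) = ex lq ν (cvec μ) := by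
  simp [ex, cvec_dot_cvec, dotProduct_comm]

theorem differentiable_dot (u : ℂⁿ) : Differentiable ℂ (fun z : ℂⁿ => u ⬝ᵥ z) := by
  unfold dotProduct; fun_prop

theorem differentiable_qpow (lq : ℂ) : Differentiable ℂ (qpow lq) := by
  unfold qpow; fun_prop

theorem differentiable_qbr (lq : ℂ) : Differentiable ℂ (qbr lq) := by
  unfold qbr qpow; fun_prop

theorem differentiable_ex (lq : ℂ) (ν : ℝⁿ) : Differentiable ℂ (ex lq ν) :=
  (differentiable_qpow lq).comp ((differentiable_dot _).const_mul 2)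

/-- The exponential polynomial with coefficients `c`. -/
def ep (lq : ℂ) (c : ℝⁿ →₀ ℂ) (z : ℂⁿ) : ℂ := c.sum fun ν a => a * ex lq ν z

theorem ep_eq_sum (lq : ℂ) (c : ℝⁿ →₀ ℂ) (z : ℂⁿ) {S : Finset ℝⁿ}
    (hS : c.support ⊆ S) : ep lq c z = ∑ ν ∈ S, c ν * ex lq ν z := by
  rw [ep, Finsupp.sum_of_support_subset c hS]
  simp

theorem ep_add (lq : ℂ) (c d : ℝⁿ →₀ ℂ) (z : ℂⁿ) : ep lq (c + d) z = ep lq c z + ep lq d z := by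
  classical
  exact Finsupp.sum_add_index' (by simp) (by intros; ring)

theorem ep_smul (lq : ℂ) (a : ℂ) (c : ℝⁿ →₀ ℂ) (z : ℂⁿ) : ep lq (a • c) z = a * ep lq c z := by
  rw [ep, Finsupp.sum_smul_index' (by simp), ep, Finsupp.mul_sum]
  simp [mul_assoc]

theorem ep_zero (lq : ℂ) (z : ℂⁿ) : ep lq 0 z = 0 := by simp [ep]

theorem ep_single (lq : ℂ) (ν : ℝⁿ) (a : ℂ) (z : ℂⁿ) :
    ep lq (Finsupp.single ν a) z = a * ex lq ν z := by simp [ep]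

/-- `ep` as a linear map. -/
def epLin (lq : ℂ) : (ℝⁿ →₀ ℂ) →ₗ[ℂ] (ℂⁿ → ℂ) where
  toFun := ep lq
  map_add' c d := by ext z; exact ep_add lq c d z
  map_smul' a c := by ext z; exact ep_smul lq a c z

theorem epLin_apply (lq : ℂ) (c : ℝⁿ →₀ ℂ) (z : ℂⁿ) : epLin lq c z = ep lq c z := rfl

theorem ep_sub (lq : ℂ) (c d : ℝⁿ →₀ ℂ) (z : ℂⁿ) : ep lq (c - d) z = ep lq c z - ep lq d z := by
  simp [← epLin_apply]

theorem ep_sum (lq : ℂ) {κ : Type*} (s : Finset κ) (c : κ → ℝⁿ →₀ ℂ) (z : ℂⁿ) :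
    ep lq (∑ k ∈ s, c k) z = ∑ k ∈ s, ep lq (c k) z := by
  simp [← epLin_apply]

theorem differentiable_ep (lq : ℂ) (c : ℝⁿ →₀ ℂ) : Differentiable ℂ (ep lq c) := by
  have : ep lq c = fun z => ∑ ν ∈ c.support, c ν * ex lq ν z := by
    ext z; exact ep_eq_sum lq c z subset_rfl
  rw [this]
  refine Differentiable.fun_sum fun ν _ => (differentiable_ex lq ν).const_mul _

/-- The span of the exponentials with exponents in `S`. -/
def expSpan (lq : ℂ) (S : Set ℝⁿ) : Submodule ℂ (ℂⁿ → ℂ) :=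
  Submodule.span ℂ (ex lq '' S)

theorem mem_expSpan_iff {S : Set ℝⁿ} {f : ℂⁿ → ℂ} :
    f ∈ expSpan lq S ↔ ∃ c : ℝⁿ →₀ ℂ, ↑c.support ⊆ S ∧ f = ep lq c := by
  rw [expSpan, Finsupp.mem_span_image_iff_linearCombination]
  constructor
  · rintro ⟨c, hc, rfl⟩
    refine ⟨c, hc, ?_⟩
    ext z
    simp [Finsupp.linearCombination_apply, Finsupp.sum, ep]
  · rintro ⟨c, hc, rfl⟩
    refine ⟨c, hc, ?_⟩
    ext z
    simp [Finsupp.linearCombination_apply, Finsupp.sum, ep]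

theorem ep_mem_expSpan (lq : ℂ) {S : Set ℝⁿ} {c : ℝⁿ →₀ ℂ}
    (h : ↑c.support ⊆ S) : ep lq c ∈ expSpan lq S := mem_expSpan_iff.2 ⟨c, h, rfl⟩

theorem ex_mem_expSpan (lq : ℂ) {S : Set ℝⁿ} {ν : ℝⁿ} (h : ν ∈ S) :
    ex lq ν ∈ expSpan lq S := Submodule.subset_span ⟨ν, h, rfl⟩

theorem expSpan_mono (lq : ℂ) {S T : Set ℝⁿ} (h : S ⊆ T) : expSpan lq S ≤ expSpan lq T :=
  Submodule.span_mono (Set.image_mono h)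

theorem differentiable_of_mem_expSpan {S : Set ℝⁿ} {f : ℂⁿ → ℂ}
    (h : f ∈ expSpan lq S) : Differentiable ℂ f := by
  obtain ⟨c, -, rfl⟩ := mem_expSpan_iff.1 h
  exact differentiable_ep lq c

theorem mul_mem_expSpan {S T U : Set ℝⁿ} (hU : ∀ s ∈ S, ∀ t ∈ T, s + t ∈ U)
    {f g : ℂⁿ → ℂ} (hf : f ∈ expSpan lq S) (hg : g ∈ expSpan lq T) : f * g ∈ expSpan lq U := by
  have h := Submodule.mul_mem_mul hf hg
  rw [expSpan, expSpan, Submodule.span_mul_span] at h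
  refine Submodule.span_mono ?_ h
  rintro _ ⟨_, ⟨s, hs, rfl⟩, _, ⟨t, ht, rfl⟩, rfl⟩
  refine ⟨s + t, hU s hs t ht, ?_⟩
  ext z
  exact ex_add lq s t z

theorem const_mem_expSpan (lq : ℂ) {S : Set ℝⁿ} (h : (0 : ℝⁿ) ∈ S) (a : ℂ) :
    (fun _ => a) ∈ expSpan lq S := by
  have := Submodule.smul_mem _ a (ex_mem_expSpan lq h)
  convert this using 1
  ext z
  simp [ex_zero]

theorem prod_mem_expSpan (L : AddSubgroup ℝⁿ) {κ : Type*} (s : Finset κ)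
    (f : κ → ℂⁿ → ℂ) (h : ∀ k ∈ s, f k ∈ expSpan lq (L : Set ℝⁿ)) :
    (fun z => ∏ k ∈ s, f k z) ∈ expSpan lq (L : Set ℝⁿ) := by
  classical
  induction s using Finset.induction_on with
  | empty => simpa using const_mem_expSpan lq L.zero_mem 1
  | insert a s ha ih =>
    have := mul_mem_expSpan (U := (L : Set ℝⁿ)) (fun s hs t ht => L.add_mem hs ht)
      (h a (by simp)) (ih fun k hk => h k (by simp [hk]))
    convert this using 1
    ext z
    simp [Finset.prod_insert ha]

theorem sum_mem_expSpan {S : Set ℝⁿ} {κ : Type*} (s : Finset κ)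
    (f : κ → ℂⁿ → ℂ) (h : ∀ k ∈ s, f k ∈ expSpan lq S) :
    (fun z => ∑ k ∈ s, f k z) ∈ expSpan lq S := by
  have := Submodule.sum_mem _ h
  convert this using 1
  ext z; simp

theorem const_mul_mem_expSpan {S : Set ℝⁿ} {f : ℂⁿ → ℂ} (a : ℂ)
    (h : f ∈ expSpan lq S) : (fun z => a * f z) ∈ expSpan lq S :=
  Submodule.smul_mem _ a h

theorem shift_mem_expSpan {S : Set ℝⁿ} {f : ℂⁿ → ℂ} (w : ℂⁿ)
    (h : f ∈ expSpan lq S) : (fun z => f (z + w)) ∈ expSpan lq S := by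
  obtain ⟨c, hc, rfl⟩ := mem_expSpan_iff.1 h
  have : (fun z => ep lq c (z + w)) = fun z => ∑ ν ∈ c.support, (c ν * ex lq ν w) * ex lq ν z := by
    ext z
    rw [ep_eq_sum lq c _ subset_rfl]
    refine Finset.sum_congr rfl fun ν _ => ?_
    rw [ex_apply_add]; ring
  rw [this]
  exact sum_mem_expSpan _ _ fun ν hν => const_mul_mem_expSpan _ (ex_mem_expSpan lq (hc hν))

end Exponentials

section Density

theorem dense_ne_zero {F : ℂⁿ → ℂ} (hF : Differentiable ℂ F) (h : ∃ x, F x ≠ 0) :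
    Dense {x | F x ≠ 0} := by
  obtain ⟨x, hx⟩ := h
  change Dense ({x | F x = 0}ᶜ)
  rw [← interior_eq_empty_iff_dense_compl]
  by_contra hne
  obtain ⟨w, hw⟩ := Set.nonempty_iff_ne_empty.2 hne
  have hl : Differentiable ℂ (fun ζ : ℂ => F (w + ζ • (x - w))) :=
    hF.comp (by fun_prop)
  have hev : (fun ζ : ℂ => F (w + ζ • (x - w))) =ᶠ[𝓝 0] 0 := by
    have hc : ContinuousAt (fun ζ : ℂ => w + ζ • (x - w)) 0 := by fun_prop
    have : {x | F x = 0} ∈ 𝓝 (w + (0 : ℂ) • (x - w)) := by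
      simpa using mem_interior_iff_mem_nhds.1 hw
    filter_upwards [hc this] with ζ hζ using hζ
  have := (hl.differentiableOn.analyticOnNhd isOpen_univ).eq_of_eventuallyEq
    (g := 0) analyticOnNhd_const hev
  have h1 := congrFun this 1
  simp at h1
  exact hx h1

theorem isOpen_ne_zero {F : ℂⁿ → ℂ} (hF : Differentiable ℂ F) : IsOpen {x | F x ≠ 0} :=
  isOpen_ne_fun hF.continuous continuous_const

theorem residual_ne_zero {F : ℂⁿ → ℂ} (hF : Differentiable ℂ F) (h : ∃ x, F x ≠ 0) :
    ∀ᶠ x in residual ℂⁿ, F x ≠ 0 :=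
  residual_of_dense_open (isOpen_ne_zero hF) (dense_ne_zero hF h)

theorem eq_of_residual {X : Type*} [TopologicalSpace X] [T2Space X] {f g : ℂⁿ → X}
    (hf : Continuous f) (hg : Continuous g) (h : ∀ᶠ x in residual ℂⁿ, f x = g x) : f = g :=
  hf.ext_on (dense_of_mem_residual h) hg fun _ hx => hx

theorem exists_prod_ne_zero {κ : Type*} (s : Finset κ) (F : κ → ℂⁿ → ℂ)
    (hF : ∀ k ∈ s, Differentiable ℂ (F k)) (h : ∀ k ∈ s, ∃ x, F k x ≠ 0) :
    ∃ x, ∏ k ∈ s, F k x ≠ 0 := by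
  have : ∀ᶠ x in residual ℂⁿ, ∀ k ∈ s, F k x ≠ 0 :=
    (Filter.eventually_all_finset s).2 fun k hk => residual_ne_zero (hF k hk) (h k hk)
  obtain ⟨x, hx⟩ := (dense_of_mem_residual this).nonempty
  exact ⟨x, Finset.prod_ne_zero_iff.2 hx⟩

/-- Finitely many nonzero vectors have nonzero scalar product with a generic vector. -/
theorem dense_dot_ne_zero (D : Finset ℝⁿ) (hD : ∀ d ∈ D, d ≠ 0) :
    Dense {v : ℝⁿ | ∀ d ∈ D, d ⬝ᵥ v ≠ 0} := by
  have key : ∀ d : ℝⁿ, d ≠ 0 → {v : ℝⁿ | d ⬝ᵥ v ≠ 0} ∈ residual ℝⁿ := by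
    intro d hd
    have hc : Continuous fun v : ℝⁿ => d ⬝ᵥ v := by unfold dotProduct; fun_prop
    refine residual_of_dense_open (isOpen_ne_fun hc continuous_const) ?_
    intro v
    by_cases hv : d ⬝ᵥ v = 0
    · have hlim : Tendsto (fun t : ℝ => v + t • d) (𝓝[≠] 0) (𝓝 v) := by
        have : Continuous fun t : ℝ => v + t • d := by fun_prop
        simpa using (this.tendsto 0).mono_left nhdsWithin_le_nhds
      refine mem_closure_of_tendsto hlim ?_
      filter_upwards [self_mem_nhdsWithin] with t ht
      rw [dotProduct_add, hv, dotProduct_smul, zero_add, smul_eq_mul]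
      exact mul_ne_zero ht (by simpa using hd)
    · exact subset_closure hv
  have : ∀ᶠ v in residual ℝⁿ, ∀ d ∈ D, d ⬝ᵥ v ≠ 0 :=
    (Filter.eventually_all_finset D).2 fun d hd => key d (hD d hd)
  exact dense_of_mem_residual this

end Density

section Asymptotics

/-- The ray from `z` along which `q ^ (2 (ν, ·))` grows like `exp (t (ν, v))`. -/
def ray (lq : ℂ) (z : ℂⁿ) (v : ℝⁿ) (t : ℝ) : ℂⁿ :=
  z + ((t : ℂ) / (2 * lq)) • cvec v

theorem ray_add (lq : ℂ) (z w : ℂⁿ) (v : ℝⁿ) (t : ℝ) :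
    ray lq (z + w) v t = ray lq z v t + w := by simp [ray]; abel

theorem dot_ray (lq : ℂ) (u : ℝⁿ) (z : ℂⁿ) (v : ℝⁿ) (t : ℝ) :
    cvec u ⬝ᵥ ray lq z v t = cvec u ⬝ᵥ z + (t / (2 * lq)) * ((u ⬝ᵥ v : ℝ) : ℂ) := by
  simp [ray, dotProduct_add, cvec_dot_cvec]

theorem ex_ray (h : lq ≠ 0) (ν : ℝⁿ) (z : ℂⁿ) (v : ℝⁿ) (t : ℝ) :
    ex lq ν (ray lq z v t) = ex lq ν z * (Real.exp (t * (ν ⬝ᵥ v)) : ℂ) := by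
  rw [ray, ex_apply_add]
  congr 1
  rw [ex, qpow, dotProduct_smul, cvec_dot_cvec]
  push_cast
  congr 1
  simp only [smul_eq_mul]
  field_simp

theorem tendsto_exp_neg {a : ℝ} (ha : a < 0) :
    Tendsto (fun t : ℝ => (Real.exp (t * a) : ℂ)) atTop (𝓝 0) := by
  have : Tendsto (fun t : ℝ => Real.exp (t * a)) atTop (𝓝 0) :=
    Real.tendsto_exp_atBot.comp (tendsto_id.atTop_mul_const_of_neg ha)
  exact_mod_cast (Complex.continuous_ofReal.tendsto 0).comp this

theorem tendsto_ep_ray (h : lq ≠ 0) (c : ℝⁿ →₀ ℂ) (v ν₀ : ℝⁿ)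
    (hc : ∀ ν ∈ c.support, ν ≠ ν₀ → ν ⬝ᵥ v < ν₀ ⬝ᵥ v) (z : ℂⁿ) :
    Tendsto (fun t : ℝ => (Real.exp (-(t * (ν₀ ⬝ᵥ v))) : ℂ) * ep lq c (ray lq z v t)) atTop
      (𝓝 (c ν₀ * ex lq ν₀ z)) := by
  classical
  have hsum : ∀ t : ℝ, (Real.exp (-(t * (ν₀ ⬝ᵥ v))) : ℂ) * ep lq c (ray lq z v t)
      = ∑ ν ∈ insert ν₀ c.support,
        c ν * ex lq ν z * (Real.exp (t * (ν ⬝ᵥ v - ν₀ ⬝ᵥ v)) : ℂ) := by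
    intro t
    rw [ep_eq_sum lq c _ (Finset.subset_insert ν₀ _), Finset.mul_sum]
    refine Finset.sum_congr rfl fun ν _ => ?_
    rw [ex_ray h, mul_sub, sub_eq_add_neg, Real.exp_add]
    push_cast
    ring
  simp_rw [hsum]
  have : c ν₀ * ex lq ν₀ z = ∑ ν ∈ insert ν₀ c.support, if ν = ν₀ then c ν₀ * ex lq ν₀ z else 0 := by
    simp
  rw [this]
  refine tendsto_finsetSum _ fun ν hν => ?_
  split_ifs with he
  · subst he; simp
  · have := (tendsto_exp_neg (sub_neg.2 (hc ν (by simpa [he] using hν) he))).const_mul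
      (c ν * ex lq ν z)
    simpa using this

theorem exists_top {c : ℝⁿ →₀ ℂ} (hc : c ≠ 0) {v : ℝⁿ}
    (hv : ∀ μ ∈ c.support, ∀ ν ∈ c.support, μ ≠ ν → μ ⬝ᵥ v ≠ ν ⬝ᵥ v) :
    ∃ ν₀ ∈ c.support, ∀ ν ∈ c.support, ν ≠ ν₀ → ν ⬝ᵥ v < ν₀ ⬝ᵥ v := by
  obtain ⟨ν₀, h₀, hmax⟩ := c.support.exists_max_image (fun ν => ν ⬝ᵥ v)
    (Finsupp.support_nonempty_iff.2 hc)
  exact ⟨ν₀, h₀, fun ν hν hne => lt_of_le_of_ne (hmax ν hν) (hv ν hν ν₀ h₀ hne)⟩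

/-- A dense set of directions separates a finite set of exponents and avoids finitely many
hyperplanes. -/
theorem dense_separating (S D : Finset ℝⁿ) (hD : ∀ d ∈ D, d ≠ 0) :
    Dense {v : ℝⁿ | (∀ μ ∈ S, ∀ ν ∈ S, μ ≠ ν → μ ⬝ᵥ v ≠ ν ⬝ᵥ v) ∧
      ∀ d ∈ D, d ⬝ᵥ v ≠ 0} := by
  classical
  have := dense_dot_ne_zero (((S ×ˢ S).image (fun p => p.1 - p.2)).filter (· ≠ 0) ∪ D) (by
    intro d hd
    simp only [Finset.mem_union, Finset.mem_filter] at hd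
    rcases hd with hd | hd
    · exact hd.2
    · exact hD d hd)
  refine this.mono ?_
  intro v hv
  refine ⟨fun μ hμ ν hν hne he => ?_, fun d hd => hv d (by simp [hd])⟩
  refine hv (μ - ν) ?_ (by rw [sub_dotProduct, he, sub_self])
  simp only [Finset.mem_union, Finset.mem_filter, Finset.mem_image, Finset.mem_product]
  exact Or.inl ⟨⟨(μ, ν), ⟨hμ, hν⟩, rfl⟩, sub_ne_zero.2 hne⟩

theorem ep_injective (h : lq ≠ 0) {c : ℝⁿ →₀ ℂ} (hc : ∀ z, ep lq c z = 0) : c = 0 := by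
  by_contra hne
  obtain ⟨v, hv, -⟩ := (dense_separating c.support ∅ (by simp)).nonempty
  obtain ⟨ν₀, h₀, hmax⟩ := exists_top hne hv
  have := tendsto_ep_ray h c v ν₀ hmax 0
  simp only [hc, mul_zero] at this
  have := tendsto_nhds_unique this tendsto_const_nhds
  exact (mul_ne_zero (Finsupp.mem_support_iff.1 h₀) (ex_ne_zero lq ν₀ 0)) this

theorem ep_injective' (h : lq ≠ 0) {c d : ℝⁿ →₀ ℂ} (hc : ∀ z, ep lq c z = ep lq d z) : c = d :=
  sub_eq_zero.1 (ep_injective h fun z => by rw [ep_sub, hc, sub_self])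

/-- An upper bound for the growth of an exponential polynomial bounds its exponents. -/
theorem exponent_le_of_tendsto (h : lq ≠ 0) {c : ℝⁿ →₀ ℂ} {v : ℝⁿ}
    (hv : ∀ μ ∈ c.support, ∀ ν ∈ c.support, μ ≠ ν → μ ⬝ᵥ v ≠ ν ⬝ᵥ v) {θ : ℝ} {z : ℂⁿ} {L : ℂ}
    (hL : Tendsto (fun t : ℝ => (Real.exp (-(t * θ)) : ℂ) * ep lq c (ray lq z v t)) atTop (𝓝 L)) :
    ∀ ν ∈ c.support, ν ⬝ᵥ v ≤ θ := by
  intro ν hν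
  have hne : c ≠ 0 := by rintro rfl; simp at hν
  obtain ⟨ν₀, h₀, hmax⟩ := exists_top hne hv
  suffices hθ : ν₀ ⬝ᵥ v ≤ θ by
    by_cases he : ν = ν₀
    · rwa [he]
    · exact (hmax ν hν he).le.trans hθ
  by_contra! hlt
  have h1 := tendsto_ep_ray h c v ν₀ hmax z
  have h2 := (tendsto_exp_neg (sub_neg.2 hlt)).mul hL
  have h3 : (fun t : ℝ => (Real.exp (t * (θ - ν₀ ⬝ᵥ v)) : ℂ) *
      ((Real.exp (-(t * θ)) : ℂ) * ep lq c (ray lq z v t))) =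
      fun t : ℝ => (Real.exp (-(t * (ν₀ ⬝ᵥ v))) : ℂ) * ep lq c (ray lq z v t) := by
    ext t
    rw [← mul_assoc, ← Complex.ofReal_mul, ← Real.exp_add]
    congr 3
    ring_nf
  rw [h3] at h2
  have := tendsto_nhds_unique h1 h2
  rw [zero_mul] at this
  exact (mul_ne_zero (Finsupp.mem_support_iff.1 h₀) (ex_ne_zero lq ν₀ z)) this

end Asymptotics

section QBracket

/-- `q` is not a root of unity. -/
def NotRootOfUnity (lq : ℂ) : Prop := ∀ k : ℤ, k ≠ 0 → qpow lq k ≠ 1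

theorem NotRootOfUnity.ne_zero (h : NotRootOfUnity lq) : lq ≠ 0 := by
  rintro rfl
  exact h 1 one_ne_zero (by simp [qpow])

theorem qbr_eq (lq u : ℂ) : qbr lq u = qpow lq (-u) * (qpow lq (2 * u) - 1) := by
  rw [mul_sub, ← qpow_add, mul_one, qbr]
  congr 2
  ring

theorem qbr_eq_zero_iff {lq u : ℂ} : qbr lq u = 0 ↔ qpow lq (2 * u) = 1 := by
  rw [qbr_eq, mul_eq_zero, or_iff_right (qpow_ne_zero _ _), sub_eq_zero]

theorem qbr_neg (lq u : ℂ) : qbr lq (-u) = -qbr lq u := by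
  simp [qbr]

theorem qbr_zero (lq : ℂ) : qbr lq 0 = 0 := by simp [qbr]

theorem qbr_intCast_ne_zero (h : NotRootOfUnity lq) {k : ℤ} (hk : k ≠ 0) : qbr lq k ≠ 0 := by
  rw [Ne, qbr_eq_zero_iff]
  have := h (2 * k) (by omega)
  push_cast at this
  exact this

theorem qbr_natCast_ne_zero (h : NotRootOfUnity lq) {k : ℕ} (hk : k ≠ 0) : qbr lq k ≠ 0 := by
  have := qbr_intCast_ne_zero h (k := k) (by exact_mod_cast hk)
  exact_mod_cast this

theorem qpow_int_mul_half {lq y : ℂ} (hy : qpow lq (2 * y) = 1) (k : ℤ) :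
    qpow lq (-(k * y)) = qpow lq (k * y) := by
  have : qpow lq (k * (2 * y)) = 1 := by rw [qpow_intCast_mul, hy, one_zpow]
  have h2 : qpow lq (k * (2 * y)) = qpow lq (k * y) * qpow lq (k * y) := by
    rw [← qpow_add]; congr 1; ring
  rw [qpow_neg]
  rw [h2] at this
  exact inv_eq_of_mul_eq_one_left this

theorem qbr_add_int_mul {lq y : ℂ} (hy : qpow lq (2 * y) = 1) (k : ℤ) (u : ℂ) :
    qbr lq (u + k * y) = qpow lq (k * y) * qbr lq u := by
  rw [qbr, neg_add, qpow_add, qpow_add, qpow_int_mul_half hy, qbr]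
  ring

theorem hasDerivAt_qbr (lq u : ℂ) : HasDerivAt (qbr lq) (lq * (qpow lq u + qpow lq (-u))) u := by
  unfold qbr qpow
  have h1 : HasDerivAt (fun u : ℂ => Complex.exp (u * lq)) (Complex.exp (u * lq) * (1 * lq)) u :=
    ((hasDerivAt_id u).mul_const lq).cexp
  have h2 : HasDerivAt (fun u : ℂ => Complex.exp (-u * lq)) (Complex.exp (-u * lq) * (-1 * lq)) u :=
    ((hasDerivAt_id u).neg.mul_const lq).cexp
  exact (h1.sub h2).congr_deriv (by ring)

/-- `[a - l] [l] = (q ^ a + q ^ (-a)) - (q ^ (a - 2 l) + q ^ (-(a - 2 l)))`. -/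
theorem qbr_mul_qbr (lq a b : ℂ) : qbr lq (a + b) * qbr lq (a - b) =
      (qpow lq (2 * a) + qpow lq (-(2 * a))) - (qpow lq (2 * b) + qpow lq (-(2 * b))) := by
  simp only [qbr, sub_mul, mul_sub, ← qpow_add]
  rw [show a + b + (a - b) = 2 * a by ring, show a + b + -(a - b) = 2 * b by ring,
    show -(a + b) + (a - b) = -(2 * b) by ring, show -(a + b) + -(a - b) = -(2 * a) by ring]
  ring

end QBracket

/-- A reduced irreducible crystallographic root system in `ℝⁿ`, with invariant multiplicities and a
choice of positive roots, given by a regular coweight `y0` and a regular weight `w0`. -/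
structure EuclRoots (ι : Type*) (n : ℕ) where
  root : ι → Fin n → ℝ
  coroot : ι → Fin n → ℝ
  refl : ι → ι → ι
  mult : ι → ℕ
  y0 : Fin n → ℝ
  w0 : Fin n → ℝ
  nonempty : Nonempty ι
  root_ne : ∀ i, root i ≠ 0
  coroot_eq : ∀ i, coroot i = (2 / (root i ⬝ᵥ root i)) • root i
  root_refl : ∀ i j, root (refl i j) = root j - (root j ⬝ᵥ coroot i) • root i
  int : ∀ i j, ∃ k : ℤ, root i ⬝ᵥ coroot j = k
  root_inj : Function.Injective root
  reduced : ∀ i j (c : ℝ), root j = c • root i → c = 1 ∨ c = -1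
  mult_refl : ∀ i j, mult (refl i j) = mult j
  irr : ∀ U : Submodule ℝ (Fin n → ℝ),
    (∀ i, ∀ u ∈ U, u - (u ⬝ᵥ coroot i) • root i ∈ U) → U = ⊥ ∨ U = ⊤
  y0_int : ∀ i, ∃ k : ℤ, root i ⬝ᵥ y0 = k
  y0_ne : ∀ i, root i ⬝ᵥ y0 ≠ 0
  w0_int : ∀ i, ∃ k : ℤ, coroot i ⬝ᵥ w0 = k
  w0_pos : ∀ i, 0 < coroot i ⬝ᵥ w0 ↔ 0 < root i ⬝ᵥ y0

namespace EuclRoots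

variable (R : EuclRoots ι n)

theorem root_sq_pos (i : ι) : 0 < R.root i ⬝ᵥ R.root i := by
  have h : R.root i ⬝ᵥ R.root i ≠ 0 := by
    rw [Ne, dotProduct_self_eq_zero]; exact R.root_ne i
  have h2 : 0 ≤ R.root i ⬝ᵥ R.root i := Finset.sum_nonneg fun k _ => mul_self_nonneg _
  exact lt_of_le_of_ne h2 (Ne.symm h)

theorem coroot_dot (i : ι) (v : ℝⁿ) :
    R.coroot i ⬝ᵥ v = (2 / (R.root i ⬝ᵥ R.root i)) * (R.root i ⬝ᵥ v) := by
  rw [R.coroot_eq, smul_dotProduct, smul_eq_mul]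

theorem coef_pos (i : ι) : 0 < 2 / (R.root i ⬝ᵥ R.root i) := div_pos two_pos (R.root_sq_pos i)

theorem root_dot_coroot_self (i : ι) : R.root i ⬝ᵥ R.coroot i = 2 := by
  rw [dotProduct_comm, R.coroot_dot]
  exact div_mul_cancel₀ _ (R.root_sq_pos i).ne'

theorem coroot_dot_root_self (i : ι) : R.coroot i ⬝ᵥ R.root i = 2 := by
  rw [dotProduct_comm, R.root_dot_coroot_self]

theorem coroot_ne (i : ι) : R.coroot i ≠ 0 := by
  intro h
  have := R.root_dot_coroot_self i
  simp [h] at this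

theorem coroot_dot_pos {i : ι} {v : ℝⁿ} : 0 < R.coroot i ⬝ᵥ v ↔ 0 < R.root i ⬝ᵥ v := by
  rw [R.coroot_dot, mul_pos_iff_of_pos_left (R.coef_pos i)]

theorem coroot_dot_eq_zero {i : ι} {v : ℝⁿ} : R.coroot i ⬝ᵥ v = 0 ↔ R.root i ⬝ᵥ v = 0 := by
  rw [R.coroot_dot, mul_eq_zero, or_iff_right (R.coef_pos i).ne']

theorem root_eq (i : ι) : R.root i = (2 / (R.coroot i ⬝ᵥ R.coroot i)) • R.coroot i := by
  have h := R.root_sq_pos i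
  rw [R.coroot_eq, smul_dotProduct, dotProduct_smul, smul_smul, smul_eq_mul, smul_eq_mul]
  have : 2 / (2 / R.root i ⬝ᵥ R.root i * (2 / R.root i ⬝ᵥ R.root i * R.root i ⬝ᵥ R.root i)) *
    (2 / R.root i ⬝ᵥ R.root i) = 1 := by field_simp
  rw [this, one_smul]

/-- The reflection in the hyperplane orthogonal to a root. -/
def s (i : ι) (v : ℝⁿ) : ℝⁿ := v - (v ⬝ᵥ R.coroot i) • R.root i

theorem s_eq' (i : ι) (v : ℝⁿ) : R.s i v = v - (v ⬝ᵥ R.root i) • R.coroot i := by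
  rw [s, dotProduct_comm v, R.coroot_dot, R.coroot_eq, smul_smul, dotProduct_comm v, mul_comm]

theorem s_dot (i : ι) (u v : ℝⁿ) : R.s i u ⬝ᵥ v = u ⬝ᵥ R.s i v := by
  rw [s, s_eq', sub_dotProduct, dotProduct_sub, smul_dotProduct, dotProduct_smul, smul_eq_mul,
    smul_eq_mul, dotProduct_comm v]
  ring

theorem s_s (i : ι) (v : ℝⁿ) : R.s i (R.s i v) = v := by
  simp only [s, sub_dotProduct, smul_dotProduct, R.root_dot_coroot_self, smul_eq_mul]
  module

theorem s_dot_s (i : ι) (u v : ℝⁿ) : R.s i u ⬝ᵥ R.s i v = u ⬝ᵥ v := by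
  rw [s_dot, s_s]

theorem root_refl' (i j : ι) : R.root (R.refl i j) = R.s i (R.root j) := R.root_refl i j

theorem coroot_refl' (i j : ι) : R.coroot (R.refl i j) = R.s i (R.coroot j) := by
  rw [R.coroot_eq, R.root_refl', s_dot_s, R.coroot_eq j, s, s, smul_dotProduct]
  module

theorem coroot_refl (i j : ι) :
    R.coroot (R.refl i j) = R.coroot j - (R.coroot j ⬝ᵥ R.root i) • R.coroot i := by
  rw [coroot_refl', s_eq']

theorem refl_refl (i j : ι) : R.refl i (R.refl i j) = j :=
  R.root_inj (by rw [root_refl', root_refl', s_s])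

/-- The reflection as a permutation of the roots. -/
def reflPerm (i : ι) : Equiv.Perm ι := ⟨R.refl i, R.refl i, R.refl_refl i, R.refl_refl i⟩

theorem reflPerm_apply (i j : ι) : R.reflPerm i j = R.refl i j := rfl

/-- The index of the opposite root. -/
def neg (i : ι) : ι := R.refl i i

theorem root_neg (i : ι) : R.root (R.neg i) = -R.root i := by
  rw [neg, R.root_refl, R.root_dot_coroot_self]; module

theorem coroot_neg (i : ι) : R.coroot (R.neg i) = -R.coroot i := by
  rw [neg, R.coroot_refl, R.coroot_dot_root_self]; module

theorem mult_neg (i : ι) : R.mult (R.neg i) = R.mult i := R.mult_refl i i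

theorem neg_neg (i : ι) : R.neg (R.neg i) = i := R.root_inj (by simp [root_neg])

theorem neg_ne (i : ι) : R.neg i ≠ i := by
  intro h
  have := R.root_neg i
  rw [h] at this
  have h2 := R.root_sq_pos i
  rw [eq_neg_iff_add_eq_zero, ← two_smul ℝ, smul_eq_zero] at this
  exact R.root_ne i (this.resolve_left two_ne_zero)

/-- Taking opposite roots as a permutation. -/
def negPerm : Equiv.Perm ι := ⟨R.neg, R.neg, R.neg_neg, R.neg_neg⟩

theorem coroot_inj : Function.Injective R.coroot := by
  intro i j h
  apply R.root_inj
  rw [R.root_eq, R.root_eq j, h]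

theorem eq_or_eq_neg_of_smul {i j : ι} {c : ℝ} (h : R.root j = c • R.root i) :
    j = i ∨ j = R.neg i := by
  rcases R.reduced i j c h with rfl | rfl
  · left; apply R.root_inj; simpa using h
  · right; apply R.root_inj; rw [root_neg]; simpa using h

/-- The dual root system. -/
@[simps] def dual : EuclRoots ι n where
  root := R.coroot
  coroot := R.root
  refl := R.refl
  mult := R.mult
  y0 := R.w0
  w0 := R.y0
  nonempty := R.nonempty
  root_ne := R.coroot_ne
  coroot_eq := R.root_eq
  root_refl := R.coroot_refl
  int i j := by rw [dotProduct_comm]; exact R.int j i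
  root_inj := R.coroot_inj
  reduced i j c h := by
    have h2 : R.root j = ((2 / (R.coroot j ⬝ᵥ R.coroot j)) * c *
        (2 / (R.root i ⬝ᵥ R.root i))) • R.root i := by
      rw [mul_assoc, mul_smul, mul_smul, ← R.coroot_eq i, ← h]
      exact R.root_eq j
    rcases R.eq_or_eq_neg_of_smul h2 with rfl | rfl
    · left
      have : (c - 1) • R.coroot j = 0 := by rw [sub_smul, ← h]; simp
      exact sub_eq_zero.1 ((smul_eq_zero.1 this).resolve_right (R.coroot_ne j))
    · right
      have : (c + 1) • R.coroot i = 0 := by rw [add_smul, ← h, R.coroot_neg]; simp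
      exact eq_neg_of_add_eq_zero_left ((smul_eq_zero.1 this).resolve_right (R.coroot_ne i))
  mult_refl := R.mult_refl
  irr U hU := R.irr U fun i u hu => by
    have := hU i u hu
    rwa [← R.s_eq'] at this
  y0_int := R.w0_int
  y0_ne i h := by
    have h1 := R.w0_pos i
    have h2 := R.w0_pos (R.neg i)
    rw [h] at h1
    rw [R.coroot_neg, R.root_neg, neg_dotProduct, h, neg_dotProduct] at h2
    have h3 := R.y0_ne i
    rcases lt_or_gt_of_ne h3 with h4 | h4
    · exact absurd (h2.2 (by linarith)) (by simp)
    · exact absurd (h1.2 h4) (by simp)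
  w0_int := R.y0_int
  w0_pos i := (R.w0_pos i).symm

theorem dual_s (i : ι) (v : ℝⁿ) : R.dual.s i v = R.s i v := (R.s_eq' i v).symm

theorem coroot_dot_w0 (i : ι) : R.coroot i ⬝ᵥ R.w0 ≠ 0 := R.dual.y0_ne i

theorem sign_coroot (i : ι) (v : ℝⁿ) :
    SignType.sign (R.coroot i ⬝ᵥ v) = SignType.sign (R.root i ⬝ᵥ v) := by
  rw [R.coroot_dot, sign_mul, sign_pos (R.coef_pos i), one_mul]

/-- A vector is regular if it is orthogonal to no root. -/
def Reg (v : ℝⁿ) : Prop := ∀ i, R.root i ⬝ᵥ v ≠ 0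

theorem reg_y0 : R.Reg R.y0 := R.y0_ne

theorem dual_reg {v : ℝⁿ} : R.dual.Reg v ↔ R.Reg v :=
  forall_congr' fun _ => not_congr R.coroot_dot_eq_zero

theorem Reg.neg {R : EuclRoots ι n} {v : ℝⁿ} (h : R.Reg v) : R.Reg (-v) := fun i => by
  simpa using h i

/-- The coweight lattice. -/
def coweight : AddSubgroup ℝⁿ where
  carrier := {ν | ∀ i, ∃ k : ℤ, ν ⬝ᵥ R.root i = k}
  add_mem' {a b} ha hb i := by
    obtain ⟨k, hk⟩ := ha i
    obtain ⟨l, hl⟩ := hb i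
    exact ⟨k + l, by rw [add_dotProduct, hk, hl]; push_cast; rfl⟩
  zero_mem' i := ⟨0, by simp⟩
  neg_mem' {a} ha i := by
    obtain ⟨k, hk⟩ := ha i
    exact ⟨-k, by rw [neg_dotProduct, hk]; push_cast; rfl⟩

/-- The coroot lattice. -/
def corootLattice : AddSubgroup ℝⁿ := AddSubgroup.closure (Set.range R.coroot)

theorem coroot_mem (i : ι) : R.coroot i ∈ R.corootLattice :=
  AddSubgroup.subset_closure ⟨i, rfl⟩

theorem coroot_mem_coweight (i : ι) : R.coroot i ∈ R.coweight := fun j => by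
  rw [dotProduct_comm]; exact R.int j i

theorem corootLattice_le : R.corootLattice ≤ R.coweight :=
  (AddSubgroup.closure_le _).2 (by rintro _ ⟨i, rfl⟩; exact R.coroot_mem_coweight i)

theorem span_root : Submodule.span ℝ (Set.range R.root) = ⊤ := by
  refine (R.irr _ fun i u hu => ?_).resolve_left fun h => ?_
  · exact sub_mem hu (Submodule.smul_mem _ _ (Submodule.subset_span ⟨i, rfl⟩))
  · obtain ⟨i⟩ := R.nonempty
    have : R.root i ∈ Submodule.span ℝ (Set.range R.root) := Submodule.subset_span ⟨i, rfl⟩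
    rw [h, Submodule.mem_bot] at this
    exact R.root_ne i this

theorem eq_zero_of_forall_dot_root {v : ℝⁿ} (h : ∀ i, v ⬝ᵥ R.root i = 0) : v = 0 := by
  have : ∀ w ∈ Submodule.span ℝ (Set.range R.root), v ⬝ᵥ w = 0 := by
    intro w hw
    induction hw using Submodule.span_induction with
    | mem x hx => obtain ⟨i, rfl⟩ := hx; exact h i
    | zero => simp
    | add x y _ _ hx hy => rw [dotProduct_add, hx, hy, add_zero]
    | smul a x _ hx => rw [dotProduct_smul, hx, smul_zero]
  have := this v (by rw [span_root]; trivial)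
  rwa [dotProduct_self_eq_zero] at this

/-- The convex set with support function at most `H`. -/
def body (H : ℝⁿ → ℝ) : Set ℝⁿ := {ν | ∀ v, ν ⬝ᵥ v ≤ H v}

variable [Fintype ι]

theorem finite_coweight_body (H : ℝⁿ → ℝ) : (↑R.coweight ∩ body H).Finite := by
  have : ((fun ν : ℝⁿ => fun i => ν ⬝ᵥ R.root i) '' (↑R.coweight ∩ body H)).Finite := by
    refine Set.Finite.subset (Set.Finite.pi (t := fun i =>
      (fun k : ℤ => (k : ℝ)) '' Set.Icc ⌊-H (-R.root i)⌋ ⌈H (R.root i)⌉)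
      (fun i => (Set.finite_Icc _ _).image _)) ?_
    rintro _ ⟨ν, ⟨h1, h2⟩, rfl⟩ i -
    obtain ⟨k, hk⟩ := h1 i
    refine ⟨k, ⟨?_, ?_⟩, hk.symm⟩
    · have := h2 (-R.root i)
      rw [dotProduct_neg, hk] at this
      have h3 : -H (-R.root i) ≤ k := by linarith
      exact Int.floor_le_iff.2 (by linarith)
    · have := h2 (R.root i)
      rw [hk] at this
      exact Int.le_ceil_iff.2 (by linarith)
  refine this.of_finite_image ?_
  intro μ _ ν _ h
  have h0 : μ - ν = 0 := R.eq_zero_of_forall_dot_root fun i => by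
    rw [sub_dotProduct, sub_eq_zero]; exact congrFun h i
  exact sub_eq_zero.1 h0

theorem sum_neg (f : ι → ℝ) : ∑ i, f (R.neg i) = ∑ i, f i :=
  Equiv.sum_comp R.negPerm f

/-- `∑_{g > 0} f = 1/2 ∑ f` for `f` even and `g` odd, `f = 0` where `g = 0`. -/
theorem sum_filter_pos (f g : ι → ℝ) (hf : ∀ i, f (R.neg i) = f i) (hg : ∀ i, g (R.neg i) = -g i)
    (h0 : ∀ i, g i = 0 → f i = 0) : ∑ i with 0 < g i, f i = (1 / 2) * ∑ i, f i := by
  have h1 : ∑ i with 0 < g i, f i = ∑ i, if 0 < g i then f i else 0 := Finset.sum_filter _ _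
  have h2 : ∑ i, (if 0 < g i then f i else 0) = ∑ i, if g i < 0 then f i else 0 := by
    rw [← R.sum_neg]
    refine Finset.sum_congr rfl fun i _ => ?_
    rw [hf, hg]; simp
  have h3 : ∑ i, f i = (∑ i, if 0 < g i then f i else 0) + ∑ i, if g i < 0 then f i else 0 := by
    rw [← Finset.sum_add_distrib]
    refine Finset.sum_congr rfl fun i _ => ?_
    rcases lt_trichotomy (g i) 0 with h | h | h
    · simp [h, h.not_gt]
    · simp [h, h0 i h]
    · simp [h, h.not_gt]
  rw [h1, h3, ← h2]; ring

/-- The half sum of the coroots which are positive on `v`, with multiplicities. On a wall, the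
contributions of the coroots orthogonal to `v` cancel. -/
def rhoV (v : ℝⁿ) : ℝⁿ :=
  (1 / 4 : ℝ) • ∑ i, ((SignType.sign (R.coroot i ⬝ᵥ v) : ℝ) * R.mult i) • R.coroot i

/-- The support function of the polytope. -/
def hN (v : ℝⁿ) : ℝ := (1 / 4) * ∑ i, (R.mult i : ℝ) * |R.coroot i ⬝ᵥ v|

theorem rhoV_dot (v w : ℝⁿ) : R.rhoV v ⬝ᵥ w =
    (1 / 4) * ∑ i, (SignType.sign (R.coroot i ⬝ᵥ v) : ℝ) * R.mult i * (R.coroot i ⬝ᵥ w) := by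
  rw [rhoV, smul_dotProduct, sum_dotProduct]
  simp

theorem rhoV_dot_self (v : ℝⁿ) : R.rhoV v ⬝ᵥ v = R.hN v := by
  rw [rhoV_dot, hN]
  congr 1
  refine Finset.sum_congr rfl fun i _ => ?_
  rw [← sign_mul_self]; ring

theorem sign_mul_le_abs (x y : ℝ) : (SignType.sign x : ℝ) * y ≤ |y| := by
  rcases lt_trichotomy x 0 with h | h | h
  · simp [sign_neg h, neg_le_abs]
  · simp [h]
  · simp [sign_pos h, le_abs_self]

theorem rhoV_dot_le (v w : ℝⁿ) : R.rhoV v ⬝ᵥ w ≤ R.hN w := by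
  rw [rhoV_dot, hN]
  refine mul_le_mul_of_nonneg_left (Finset.sum_le_sum fun i _ => ?_) (by norm_num)
  have := mul_le_mul_of_nonneg_left (sign_mul_le_abs (R.coroot i ⬝ᵥ v) (R.coroot i ⬝ᵥ w))
    (Nat.cast_nonneg (α := ℝ) (R.mult i))
  linarith

theorem rhoV_mem_body (v : ℝⁿ) : R.rhoV v ∈ body R.hN := R.rhoV_dot_le v

theorem rhoV_congr {v w : ℝⁿ}
    (h : ∀ i, SignType.sign (R.root i ⬝ᵥ v) = SignType.sign (R.root i ⬝ᵥ w)) :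
    R.rhoV v = R.rhoV w := by
  simp only [rhoV, sign_coroot, h]

theorem continuous_hN : Continuous R.hN := by
  unfold hN dotProduct; fun_prop

theorem rhoV_neg (v : ℝⁿ) : R.rhoV (-v) = -R.rhoV v := by
  simp [rhoV, dotProduct_neg, Left.sign_neg]

theorem s_rhoV (i : ι) (v : ℝⁿ) : R.s i (R.rhoV v) = R.rhoV (R.s i v) := by
  have hs : ∀ (a : ℝ) (w : ℝⁿ), R.s i (a • w) = a • R.s i w := by
    intro a w; rw [s, s, smul_dotProduct]; module
  have hadd : ∀ (S : Finset ι) (f : ι → ℝⁿ), R.s i (∑ j ∈ S, f j) = ∑ j ∈ S, R.s i (f j) := by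
    intro S f
    simp only [s, sum_dotProduct, Finset.sum_smul, Finset.sum_sub_distrib]
  rw [rhoV, hs, hadd, rhoV]
  congr 1
  refine Finset.sum_nbij' (R.refl i) (R.refl i) (by simp) (by simp)
    (fun j _ => R.refl_refl i j) (fun j _ => R.refl_refl i j) fun j _ => ?_
  rw [hs, coroot_refl', s_dot_s, R.mult_refl]

end EuclRoots

namespace EuclRoots

variable (R : EuclRoots ι n)

/-- The function `q ^ (2 ((α^∨, z) + c)) - 1`. -/
def wall (lq : ℂ) (i : ι) (c : ℂ) (z : ℂⁿ) : ℂ :=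
  qpow lq (2 * (cvec (R.coroot i) ⬝ᵥ z + c)) - 1

theorem wall_eq (lq : ℂ) (i : ι) (c : ℂ) (z : ℂⁿ) :
    R.wall lq i c z = qpow lq (2 * c) * ex lq (R.coroot i) z - 1 := by
  rw [wall, ex, ← qpow_add]; ring_nf

theorem wall_eq_zero {i : ι} {c : ℂ} {z : ℂⁿ} :
    R.wall lq i c z = 0 ↔ qpow lq (2 * (cvec (R.coroot i) ⬝ᵥ z + c)) = 1 := sub_eq_zero

theorem differentiable_wall (lq : ℂ) (i : ι) (c : ℂ) : Differentiable ℂ (R.wall lq i c) :=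
  ((differentiable_qpow lq).comp (((differentiable_dot _).add_const c).const_mul 2)).sub_const 1

theorem wall_mem_expSpan (lq : ℂ) (i : ι) (c : ℂ) :
    R.wall lq i c ∈ expSpan lq (R.corootLattice : Set ℝⁿ) := by
  have h1 := const_mul_mem_expSpan (qpow lq (2 * c))
    (ex_mem_expSpan lq (S := (R.corootLattice : Set ℝⁿ)) (R.coroot_mem i))
  have h2 := const_mem_expSpan lq (S := (R.corootLattice : Set ℝⁿ))
    R.corootLattice.zero_mem 1
  have := sub_mem h1 h2
  convert this using 1
  ext z
  exact R.wall_eq lq i c z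

/-- A set of exponents stable under translation by the coroot lattice. -/
def Stable (S : Set ℝⁿ) : Prop :=
  S ⊆ R.coweight ∧ ∀ ν ∈ S, ∀ μ ∈ R.corootLattice, ν + μ ∈ S

theorem stable_coweight : R.Stable R.coweight :=
  ⟨subset_rfl, fun _ hν _ hμ => add_mem hν (R.corootLattice_le hμ)⟩

/-- The number of steps to the chosen representative of the `α^∨`-string of `ν`. -/
def strIdx (i : ι) (ν : ℝⁿ) : ℤ := ⌊(ν ⬝ᵥ R.root i) / 2⌋

/-- The representative of the `α^∨`-string of `ν`. -/
def strRep (i : ι) (ν : ℝⁿ) : ℝⁿ := ν - (R.strIdx i ν : ℝ) • R.coroot i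

theorem strRep_add (i : ι) (ν : ℝⁿ) (k : ℤ) :
    R.strRep i (ν + (k : ℝ) • R.coroot i) = R.strRep i ν := by
  have : R.strIdx i (ν + (k : ℝ) • R.coroot i) = R.strIdx i ν + k := by
    rw [strIdx, add_dotProduct, smul_dotProduct, R.coroot_dot_root_self, smul_eq_mul, add_div,
      mul_div_cancel_right₀ _ two_ne_zero, Int.floor_add_intCast, strIdx]
  rw [strRep, this, strRep]
  push_cast
  module

theorem strRep_eq_iff {i : ι} {μ ν : ℝⁿ} :
    R.strRep i μ = R.strRep i ν ↔ ∃ k : ℤ, μ = ν + (k : ℝ) • R.coroot i := by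
  constructor
  · intro h
    refine ⟨R.strIdx i μ - R.strIdx i ν, ?_⟩
    rw [strRep, strRep, sub_eq_iff_eq_add] at h
    refine h.trans ?_
    push_cast
    module
  · rintro ⟨k, rfl⟩
    exact R.strRep_add i ν k

theorem intCast_smul_coroot_mem (i : ι) (k : ℤ) : (k : ℝ) • R.coroot i ∈ R.corootLattice := by
  rw [Int.cast_smul_eq_zsmul]
  exact zsmul_mem (R.coroot_mem i) k

theorem strRep_mem {S : Set ℝⁿ} (hS : R.Stable S) (i : ι) {ν : ℝⁿ} (h : ν ∈ S) :
    R.strRep i ν ∈ S := by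
  rw [strRep, sub_eq_add_neg]
  exact hS.2 _ h _ (neg_mem (R.intCast_smul_coroot_mem i _))

theorem strRep_dot {i : ι} {ν : ℝⁿ} (h : ν ∈ R.coweight) :
    R.strRep i ν ⬝ᵥ R.root i = 0 ∨ R.strRep i ν ⬝ᵥ R.root i = 1 := by
  obtain ⟨k, hk⟩ := h i
  have h1 : R.strRep i ν ⬝ᵥ R.root i = ((k - 2 * R.strIdx i ν : ℤ) : ℝ) := by
    rw [strRep, sub_dotProduct, smul_dotProduct, R.coroot_dot_root_self, hk]
    push_cast
    simp only [smul_eq_mul]; ring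
  have h2 : (R.strIdx i ν : ℝ) ≤ k / 2 := by rw [← hk]; exact Int.floor_le _
  have h3 : (k : ℝ) / 2 < R.strIdx i ν + 1 := by rw [← hk]; exact Int.lt_floor_add_one _
  have h4 : 2 * R.strIdx i ν ≤ k := by
    have : (2 * R.strIdx i ν : ℝ) ≤ k := by linarith
    exact_mod_cast this
  have h5 : k < 2 * R.strIdx i ν + 2 := by
    have : (k : ℝ) < 2 * R.strIdx i ν + 2 := by linarith
    exact_mod_cast this
  rw [h1]
  rcases (by omega : k - 2 * R.strIdx i ν = 0 ∨ k - 2 * R.strIdx i ν = 1) with h | h <;>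
    rw [h] <;> simp

theorem ex_apply_smul_root (lq : ℂ) (ν : ℝⁿ) (a : ℂ) (i : ι) :
    ex lq ν (a • cvec (R.root i)) = qpow lq (2 * a * ((ν ⬝ᵥ R.root i : ℝ) : ℂ)) := by
  rw [ex, dotProduct_smul, cvec_dot_cvec]
  congr 1
  simp only [smul_eq_mul]; ring

theorem coroot_dot_add_smul (i : ι) (z : ℂⁿ) (a : ℂ) :
    cvec (R.coroot i) ⬝ᵥ (z + a • cvec (R.root i)) = cvec (R.coroot i) ⬝ᵥ z + 2 * a := by
  rw [dotProduct_add, dotProduct_smul, cvec_dot_cvec, R.coroot_dot_root_self]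
  push_cast
  simp only [smul_eq_mul]; ring

theorem ex_eq_on_wall {i : ι} {c : ℂ} {z : ℂⁿ} (hz : R.wall lq i c z = 0)
    (ν : ℝⁿ) : ex lq ν z = qpow lq (-(2 * c) * R.strIdx i ν) * ex lq (R.strRep i ν) z := by
  have h1 : ex lq (R.coroot i) z = qpow lq (-(2 * c)) := by
    rw [wall_eq, sub_eq_zero] at hz
    rw [qpow_neg]
    exact eq_inv_of_mul_eq_one_right hz
  have h2 : ν = R.strRep i ν + (R.strIdx i ν : ℝ) • R.coroot i := by rw [strRep]; module
  have h3 : ex lq ((R.strIdx i ν : ℝ) • R.coroot i) z = qpow lq (-(2 * c) * R.strIdx i ν) := by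
    rw [ex, cvec_smul, smul_dotProduct]
    push_cast
    rw [mul_comm _ (R.strIdx i ν : ℂ), qpow_intCast_mul, ← h1, ex, ← qpow_intCast_mul]
    congr 1
    simp only [smul_eq_mul]; ring
  conv_lhs => rw [h2, ex_add, h3, mul_comm]

/-- An exponential polynomial vanishing on a wall has vanishing string sums. -/
theorem string_sum_eq_zero (hlq : lq ≠ 0) {d : ℝⁿ →₀ ℂ}
    (hd : (d.support : Set ℝⁿ) ⊆ R.coweight) {i : ι} {c : ℂ}
    (h : ∀ z, R.wall lq i c z = 0 → ep lq d z = 0) :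
    ∑ μ ∈ d.support, Finsupp.single (R.strRep i μ) (d μ * qpow lq (-(2 * c) * R.strIdx i μ))
      = (0 : ℝⁿ →₀ ℂ) := by
  classical
  set r : ℝⁿ →₀ ℂ :=
    ∑ μ ∈ d.support, Finsupp.single (R.strRep i μ) (d μ * qpow lq (-(2 * c) * R.strIdx i μ)) with hr
  have hrw : ∀ z, R.wall lq i c z = 0 → ep lq r z = 0 := by
    intro z hz
    rw [← h z hz, hr, ep_sum, ep_eq_sum lq d z subset_rfl]
    refine Finset.sum_congr rfl fun μ _ => ?_
    rw [ep_single, R.ex_eq_on_wall hz μ]; ring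
  have hsupp : ∀ ν ∈ r.support, ν ⬝ᵥ R.root i = 0 ∨ ν ⬝ᵥ R.root i = 1 := by
    intro ν hν
    have : ν ∈ d.support.image (R.strRep i) := by
      by_contra hcon
      refine Finsupp.mem_support_iff.1 hν ?_
      rw [hr, Finsupp.finsetSum_apply]
      refine Finset.sum_eq_zero fun μ hμ => ?_
      rw [Finsupp.single_apply, if_neg]
      rintro rfl
      exact hcon (Finset.mem_image_of_mem _ hμ)
    obtain ⟨μ, hμ, rfl⟩ := Finset.mem_image.1 this
    exact R.strRep_dot (hd hμ)
  set r0 := r.filter (fun ν => ν ⬝ᵥ R.root i = 0) with hr0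
  set r1 := r.filter (fun ν => ¬ ν ⬝ᵥ R.root i = 0) with hr1
  have hr01 : r0 + r1 = r := Finsupp.filter_add_filter_not r _
  have h0 : ∀ ν ∈ r0.support, ν ⬝ᵥ R.root i = 0 := fun ν hν => by
    rw [hr0, Finsupp.support_filter, Finset.mem_filter] at hν; exact hν.2
  have h1 : ∀ ν ∈ r1.support, ν ⬝ᵥ R.root i = 1 := fun ν hν => by
    rw [hr1, Finsupp.support_filter, Finset.mem_filter] at hν
    exact (hsupp ν hν.1).resolve_left hν.2
  have hshift : ∀ (e : ℝⁿ →₀ ℂ) (p : ℝ), (∀ ν ∈ e.support, ν ⬝ᵥ R.root i = p) →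
      ∀ z a, ep lq e (z + a • cvec (R.root i)) = qpow lq (2 * a * p) * ep lq e z := by
    intro e p he z a
    rw [ep_eq_sum lq e _ subset_rfl, ep_eq_sum lq e _ subset_rfl, Finset.mul_sum]
    refine Finset.sum_congr rfl fun ν hν => ?_
    rw [ex_apply_add, R.ex_apply_smul_root, he ν hν]; ring
  have hboth : ∀ z, R.wall lq i c z = 0 → ep lq r0 z = 0 ∧ ep lq r1 z = 0 := by
    intro z hz
    have e1 := hrw z hz
    have hpi : qpow lq (2 * (Real.pi * Complex.I / (2 * lq))) = -1 := by
      rw [qpow, ← Complex.exp_pi_mul_I]; congr 1; field_simp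
    have e2 := hrw (z + (Real.pi * Complex.I / (2 * lq)) • cvec (R.root i)) (by
      rw [wall_eq_zero, R.coroot_dot_add_smul, add_right_comm, mul_add, qpow_add,
        R.wall_eq_zero.1 hz, qpow_mul_two_of_neg_one hpi, one_mul])
    rw [← hr01, ep_add, hshift r0 0 h0, hshift r1 1 h1] at e2
    rw [← hr01, ep_add] at e1
    simp only [Complex.ofReal_zero, mul_zero, qpow_zero, Complex.ofReal_one, mul_one, hpi] at e2
    constructor
    · linear_combination (e1 + e2) / 2
    · linear_combination (e1 - e2) / 2
  have hall : ∀ z, ep lq r0 z = 0 ∧ ep lq r1 z = 0 := by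
    intro z
    have hz : R.wall lq i c (z + (-(cvec (R.coroot i) ⬝ᵥ z + c) / 2) • cvec (R.root i)) = 0 := by
      rw [wall_eq_zero, R.coroot_dot_add_smul]
      convert qpow_zero lq using 2
      ring
    obtain ⟨a, b⟩ := hboth _ hz
    rw [hshift r0 0 h0] at a
    rw [hshift r1 1 h1] at b
    exact ⟨(mul_eq_zero.1 a).resolve_left (qpow_ne_zero _ _),
      (mul_eq_zero.1 b).resolve_left (qpow_ne_zero _ _)⟩
  rw [← hr01, ep_injective hlq fun z => (hall z).1, ep_injective hlq fun z => (hall z).2, add_zero]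
where
  qpow_mul_two_of_neg_one {lq a : ℂ} (h : qpow lq (2 * a) = -1) : qpow lq (2 * (2 * a)) = 1 := by
    rw [two_mul (2 * a), qpow_add, h]; norm_num

/-- An exponential polynomial vanishing on a wall is divisible by the equation of the wall. -/
theorem exists_eq_wall_mul (hlq : lq ≠ 0) {S : Set ℝⁿ} (hS : R.Stable S)
    {f : ℂⁿ → ℂ} (hf : f ∈ expSpan lq S) {i : ι} {c : ℂ} (h : ∀ z, R.wall lq i c z = 0 → f z = 0) :
    ∃ g ∈ expSpan lq S, ∀ z, f z = R.wall lq i c z * g z := by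
  obtain ⟨d, hd, rfl⟩ := mem_expSpan_iff.1 hf
  set M := (expSpan lq S).map (LinearMap.mulLeft ℂ (R.wall lq i c)) with hM
  suffices hmem : ep lq d ∈ M by
    obtain ⟨g, hg, he⟩ := hmem
    exact ⟨g, hg, fun z => (congrFun he z).symm⟩
  have base : ∀ ν ∈ S, ex lq (ν + R.coroot i) - qpow lq (-(2 * c)) • ex lq ν ∈ M := by
    intro ν hν
    refine ⟨qpow lq (-(2 * c)) • ex lq ν, Submodule.smul_mem _ _ (ex_mem_expSpan lq hν), ?_⟩
    ext z
    simp only [LinearMap.mulLeft_apply, Pi.mul_apply, Pi.smul_apply, Pi.sub_apply, smul_eq_mul,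
      wall_eq, ex_add, qpow_neg]
    field_simp [qpow_ne_zero]
  have hSk : ∀ ν ∈ S, ∀ k : ℤ, ν + (k : ℝ) • R.coroot i ∈ S := fun ν hν k =>
    hS.2 ν hν _ (R.intCast_smul_coroot_mem i k)
  have key : ∀ ν ∈ S, ∀ k : ℤ,
      ex lq (ν + (k : ℝ) • R.coroot i) - qpow lq (-(2 * c) * k) • ex lq ν ∈ M := by
    intro ν hν k
    induction k using Int.induction_on with
    | zero => simp [qpow_zero]
    | succ k ih =>
      have h1 := base _ (hSk ν hν k)
      have h2 := M.smul_mem (qpow lq (-(2 * c))) ih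
      have := M.add_mem h1 h2
      convert this using 1
      have e1 : ν + (((k : ℤ) + 1 : ℤ) : ℝ) • R.coroot i
          = ν + ((k : ℤ) : ℝ) • R.coroot i + R.coroot i := by push_cast; module
      have e2 : qpow lq (-(2 * c) * (((k : ℤ) + 1 : ℤ) : ℂ))
          = qpow lq (-(2 * c)) * qpow lq (-(2 * c) * ((k : ℤ) : ℂ)) := by
        rw [← qpow_add]; push_cast; ring_nf
      rw [e1, e2, smul_sub, smul_smul]
      abel
    | pred k ih =>
      have h1 := base _ (hSk ν hν (-k - 1))
      have e1 : ν + ((-(k : ℤ) - 1 : ℤ) : ℝ) • R.coroot i + R.coroot i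
          = ν + ((-(k : ℤ) : ℤ) : ℝ) • R.coroot i := by push_cast; module
      rw [e1] at h1
      have e2 : qpow lq (-(2 * c) * ((-(k : ℤ) : ℤ) : ℂ))
          = qpow lq (-(2 * c)) * qpow lq (-(2 * c) * ((-(k : ℤ) - 1 : ℤ) : ℂ)) := by
        rw [← qpow_add]; push_cast; ring_nf
      have := M.smul_mem (qpow lq (-(2 * c)))⁻¹ (M.sub_mem ih h1)
      rw [e2, mul_smul] at this
      convert this using 1
      rw [sub_sub_sub_cancel_left, ← smul_sub, smul_smul, inv_mul_cancel₀ (qpow_ne_zero _ _),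
        one_smul]
  have hr := R.string_sum_eq_zero hlq (hd.trans hS.1) h
  have hsplit : ep lq d = ∑ μ ∈ d.support,
      d μ • (ex lq μ - qpow lq (-(2 * c) * R.strIdx i μ) • ex lq (R.strRep i μ)) := by
    ext z
    have h0 : ep lq (∑ μ ∈ d.support,
      Finsupp.single (R.strRep i μ) (d μ * qpow lq (-(2 * c) * R.strIdx i μ))) z = 0 := by
      rw [hr, ep_zero]
    rw [ep_sum] at h0
    simp only [ep_single] at h0
    rw [ep_eq_sum lq d z subset_rfl, Finset.sum_apply]
    simp only [Pi.smul_apply, Pi.sub_apply, smul_eq_mul, mul_sub, Finset.sum_sub_distrib]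
    rw [eq_sub_iff_add_eq]
    simp only [← mul_assoc]
    rw [h0, add_zero]
  rw [hsplit]
  refine M.sum_mem fun μ hμ => M.smul_mem _ ?_
  have h2 : μ = R.strRep i μ + (R.strIdx i μ : ℝ) • R.coroot i := by rw [strRep]; module
  have := key (R.strRep i μ) (R.strRep_mem hS i (hd hμ)) (R.strIdx i μ)
  rwa [← h2] at this

theorem eventually_qpow_ne (hlq : lq ≠ 0) (a b : ℂ) (hb : b ≠ 0) :
    ∀ᶠ t in 𝓝[≠] (0 : ℂ), qpow lq (2 * (a + b * t)) ≠ 1 := by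
  have h : HasDerivAt (fun t : ℂ => qpow lq (2 * (a + b * t)))
      (Complex.exp (2 * (a + b * 0) * lq) * (2 * (b * 1) * lq)) 0 :=
    (((((hasDerivAt_id (0 : ℂ)).const_mul b).const_add a).const_mul 2).mul_const lq).cexp
  exact h.eventually_ne (mul_ne_zero (Complex.exp_ne_zero _) (by simp [hb, hlq]))

/-- The path through `z` in the direction of a root, normalized so that the coroot has
derivative `1`. -/
def path (i : ι) (z : ℂⁿ) (t : ℂ) : ℂⁿ := z + (t / 2) • cvec (R.root i)

theorem path_zero (i : ι) (z : ℂⁿ) : R.path i z 0 = z := by simp [path]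

theorem continuous_path (i : ι) (z : ℂⁿ) : Continuous (R.path i z) := by
  unfold path; fun_prop

theorem coroot_dot_path (i j : ι) (z : ℂⁿ) (t : ℂ) : cvec (R.coroot j) ⬝ᵥ R.path i z t
      = cvec (R.coroot j) ⬝ᵥ z + ((R.coroot j ⬝ᵥ R.root i : ℝ) : ℂ) / 2 * t := by
  rw [path, dotProduct_add, dotProduct_smul, cvec_dot_cvec]
  simp only [smul_eq_mul]; ring

theorem coroot_dot_path_self (i : ι) (z : ℂⁿ) (t : ℂ) :
    cvec (R.coroot i) ⬝ᵥ R.path i z t = cvec (R.coroot i) ⬝ᵥ z + t := by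
  rw [coroot_dot_path, R.coroot_dot_root_self]; push_cast; ring

theorem exists_orthogonal {i j : ι} (h1 : j ≠ i) (h2 : j ≠ R.neg i) :
    ∃ w : ℝⁿ, R.coroot i ⬝ᵥ w = 0 ∧ R.coroot j ⬝ᵥ w ≠ 0 := by
  set w := R.root j - (R.root j ⬝ᵥ R.coroot i / 2) • R.root i with hw
  have hi : R.coroot i ⬝ᵥ w = 0 := by
    rw [hw, dotProduct_sub, dotProduct_smul, R.coroot_dot_root_self, dotProduct_comm]
    simp
  have hne : w ≠ 0 := by
    intro h0
    rcases R.eq_or_eq_neg_of_smul (sub_eq_zero.1 h0) with h | h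
    · exact h1 h
    · exact h2 h
  refine ⟨w, hi, fun h => hne ?_⟩
  have hri := R.coroot_dot_eq_zero.1 hi
  have hrj := R.coroot_dot_eq_zero.1 h
  have : w ⬝ᵥ w = 0 := by
    conv_lhs => rw [hw]
    rw [sub_dotProduct, smul_dotProduct, hrj, hri, smul_zero, sub_zero]
  exact dotProduct_self_eq_zero.1 this

/-- A property that holds at the generic points of a wall holds on the wall. -/
theorem eq_zero_on_wall (hq : NotRootOfUnity lq) {J : Type*} (s : Finset J) (k : J → ι)
    (e : J → ℂ) {i : ι} {c : ℂ} (hk : ∀ j ∈ s, k j ≠ i ∧ k j ≠ R.neg i)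
    {G : ℂⁿ → ℂ} (hG : Continuous G)
    (h : ∀ z, R.wall lq i c z = 0 → (∀ j ∈ s, R.wall lq (k j) (e j) z ≠ 0) → G z = 0)
    (z : ℂⁿ) (hz : R.wall lq i c z = 0) : G z = 0 := by
  set p : ℂⁿ → ℂⁿ := fun x =>
    x + (-(cvec (R.coroot i) ⬝ᵥ x - cvec (R.coroot i) ⬝ᵥ z) / 2) • cvec (R.root i) with hp
  have hpd : Differentiable ℂ p := by
    have := differentiable_dot (cvec (R.coroot i))
    fun_prop
  have hpw : ∀ x, R.wall lq i c (p x) = 0 := by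
    intro x
    rw [← hz, wall, wall, R.coroot_dot_add_smul]
    congr 4
    ring
  have hres : ∀ᶠ x in residual ℂⁿ, ∀ j ∈ s, R.wall lq (k j) (e j) (p x) ≠ 0 := by
    refine (Filter.eventually_all_finset s).2 fun j hj => ?_
    refine residual_ne_zero ((R.differentiable_wall lq _ _).comp hpd) ?_
    obtain ⟨w, hw1, hw2⟩ := R.exists_orthogonal (hk j hj).1 (hk j hj).2
    set t : ℂ := (1 - (cvec (R.coroot (k j)) ⬝ᵥ z + e j)) / ((R.coroot (k j) ⬝ᵥ w : ℝ) : ℂ) with ht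
    refine ⟨z + t • cvec w, ?_⟩
    have hpz : p (z + t • cvec w) = z + t • cvec w := by
      simp [hp, dotProduct_add, cvec_dot_cvec, hw1]
    have hw2' : ((R.coroot (k j) ⬝ᵥ w : ℝ) : ℂ) ≠ 0 := by exact_mod_cast hw2
    rw [hpz, wall, sub_ne_zero, dotProduct_add, dotProduct_smul, cvec_dot_cvec]
    have : 2 * (cvec (R.coroot (k j)) ⬝ᵥ z + t • ((R.coroot (k j) ⬝ᵥ w : ℝ) : ℂ) + e j)
        = ((2 : ℤ) : ℂ) := by
      rw [ht, smul_eq_mul, div_mul_cancel₀ _ hw2']; push_cast; ring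
    rw [this]
    exact hq 2 (by norm_num)
  have hGp := eq_of_residual (hG.comp hpd.continuous) continuous_const
    (hres.mono fun x hx => h _ (hpw x) hx)
  have := congrFun hGp z
  simpa [hp] using this

/-- A function with removable singularities along walls is an exponential polynomial. -/
theorem exists_expSpan_of_removable (hq : NotRootOfUnity lq) {S : Set ℝⁿ}
    (hS : R.Stable S) {J : Type*} (s : Finset J) (k : J → ι) (e : J → ℂ)
    {f g : ℂⁿ → ℂ} (hf : f ∈ expSpan lq S) (hfg : ∀ z, (∀ j ∈ s, R.wall lq (k j) (e j) z ≠ 0) →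
      f z = (∏ j ∈ s, R.wall lq (k j) (e j) z) * g z)
    (hlim : ∀ j ∈ s, ∀ z, R.wall lq (k j) (e j) z = 0 →
      (∀ l ∈ s, k l ≠ k j → k l ≠ R.neg (k j) → R.wall lq (k l) (e l) z ≠ 0) →
      Tendsto (fun t : ℂ => t * g (R.path (k j) z t)) (𝓝[≠] 0) (𝓝 0)) :
    ∃ h ∈ expSpan lq S, ∀ z, (∀ j ∈ s, R.wall lq (k j) (e j) z ≠ 0) → h z = g z := by
  classical
  have main : ∀ t ⊆ s, ∀ f ∈ expSpan lq S,
      (∀ z, (∀ j ∈ s, R.wall lq (k j) (e j) z ≠ 0) →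
        f z = (∏ j ∈ t, R.wall lq (k j) (e j) z) * g z) →
      ∃ h ∈ expSpan lq S, ∀ z, (∀ j ∈ s, R.wall lq (k j) (e j) z ≠ 0) → h z = g z := by
    intro t
    induction t using Finset.induction_on with
    | empty => intro _ f hf hfg; exact ⟨f, hf, fun z hz => by simpa using hfg z hz⟩
    | insert a t ha ih =>
      intro hts f hf hfg
      have has : a ∈ s := hts (Finset.mem_insert_self _ _)
      have hvan : ∀ z, R.wall lq (k a) (e a) z = 0 → f z = 0 := by
        refine R.eq_zero_on_wall hq (s.filter fun l => k l ≠ k a ∧ k l ≠ R.neg (k a)) k e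
          (fun j hj => (Finset.mem_filter.1 hj).2)
          (differentiable_of_mem_expSpan hf).continuous ?_
        intro z hz hgen
        have hgen' : ∀ l ∈ s, k l ≠ k a → k l ≠ R.neg (k a) → R.wall lq (k l) (e l) z ≠ 0 :=
          fun l hl h1 h2 => hgen l (Finset.mem_filter.2 ⟨hl, h1, h2⟩)
        have hl := hlim a has z hz hgen'
        have hreg : ∀ᶠ τ in 𝓝[≠] (0 : ℂ), ∀ j ∈ s, R.wall lq (k j) (e j) (R.path (k a) z τ) ≠ 0 := by
          refine (Filter.eventually_all_finset s).2 fun j hj => ?_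
          by_cases h0 : R.wall lq (k j) (e j) z = 0
          · have hdot : R.coroot (k j) ⬝ᵥ R.root (k a) ≠ 0 := by
              by_cases h1 : k j = k a
              · rw [h1, R.coroot_dot_root_self]; norm_num
              by_cases h2 : k j = R.neg (k a)
              · rw [h2, R.coroot_neg, neg_dotProduct, R.coroot_dot_root_self]; norm_num
              · exact absurd h0 (hgen' j hj h1 h2)
            have := eventually_qpow_ne hq.ne_zero (cvec (R.coroot (k j)) ⬝ᵥ z + e j)
              (((R.coroot (k j) ⬝ᵥ R.root (k a) : ℝ) : ℂ) / 2)
              (div_ne_zero (by exact_mod_cast hdot) two_ne_zero)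
            filter_upwards [this] with τ hτ
            rw [wall, R.coroot_dot_path, sub_ne_zero]
            convert hτ using 3
            ring
          · have hc : ContinuousAt (fun τ => R.wall lq (k j) (e j) (R.path (k a) z τ)) 0 :=
              ((R.differentiable_wall lq _ _).continuous.comp (R.continuous_path _ _)).continuousAt
            have : R.wall lq (k j) (e j) (R.path (k a) z 0) ≠ 0 := by rwa [path_zero]
            exact (hc.eventually_ne this).filter_mono nhdsWithin_le_nhds
        have hd : Tendsto (fun τ : ℂ => R.wall lq (k a) (e a) (R.path (k a) z τ) / τ) (𝓝[≠] 0)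
            (𝓝 (Complex.exp (2 * (cvec (R.coroot (k a)) ⬝ᵥ z + e a + 0) * lq) * (2 * 1 * lq))) := by
          have h1 : HasDerivAt (fun τ : ℂ => R.wall lq (k a) (e a) (R.path (k a) z τ))
              (Complex.exp (2 * (cvec (R.coroot (k a)) ⬝ᵥ z + e a + 0) * lq) * (2 * 1 * lq)) 0 := by
            have := (((((hasDerivAt_id (0 : ℂ)).const_add
              (cvec (R.coroot (k a)) ⬝ᵥ z + e a)).const_mul 2).mul_const lq).cexp).sub_const 1
            refine this.congr_of_eventuallyEq (Eventually.of_forall fun τ => ?_)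
            simp only [wall, R.coroot_dot_path_self, qpow, id]
            ring_nf
          have h2 := h1.tendsto_slope
          refine h2.congr' ?_
          filter_upwards [self_mem_nhdsWithin] with τ hτ
          rw [slope_def_field, path_zero, hz, sub_zero, sub_zero]
        have hcont : ∀ (F : ℂⁿ → ℂ), Continuous F →
            Tendsto (fun τ : ℂ => F (R.path (k a) z τ)) (𝓝[≠] 0) (𝓝 (F z)) := by
          intro F hF
          have := (hF.comp (R.continuous_path (k a) z)).tendsto 0
          simp only [Function.comp, path_zero] at this
          exact this.mono_left nhdsWithin_le_nhds
        have hprod := hcont (fun x => ∏ j ∈ t, R.wall lq (k j) (e j) x)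
          (continuous_finsetProd _ fun j _ => (R.differentiable_wall lq _ _).continuous)
        have hfz := hcont f (differentiable_of_mem_expSpan hf).continuous
        have hlimf := (hd.mul hprod).mul hl
        rw [mul_zero] at hlimf
        refine tendsto_nhds_unique (hfz.congr' ?_) hlimf
        filter_upwards [hreg, self_mem_nhdsWithin] with τ hτ hτ0
        rw [hfg _ hτ, Finset.prod_insert ha]
        have : τ ≠ 0 := hτ0
        field_simp
      obtain ⟨f1, hf1, hff1⟩ := R.exists_eq_wall_mul hq.ne_zero hS hf hvan
      refine ih (fun j hj => hts (Finset.mem_insert_of_mem hj)) f1 hf1 fun z hz => ?_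
      have := hfg z hz
      rw [hff1, Finset.prod_insert ha, mul_assoc] at this
      exact mul_left_cancel₀ (hz a has) this
  exact main s subset_rfl f hf hfg

end EuclRoots

section Faces

theorem tendsto_ep_ray_face (h : lq ≠ 0) (c : ℝⁿ →₀ ℂ) (v : ℝⁿ) (θ : ℝ)
    (hc : ∀ ν ∈ c.support, ν ⬝ᵥ v ≤ θ) (z : ℂⁿ) :
    Tendsto (fun t : ℝ => (Real.exp (-(t * θ)) : ℂ) * ep lq c (ray lq z v t)) atTop
      (𝓝 (ep lq (c.filter fun ν => ν ⬝ᵥ v = θ) z)) := by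
  classical
  have hsum : ∀ t : ℝ, (Real.exp (-(t * θ)) : ℂ) * ep lq c (ray lq z v t)
      = ∑ ν ∈ c.support, c ν * ex lq ν z * (Real.exp (t * (ν ⬝ᵥ v - θ)) : ℂ) := by
    intro t
    rw [ep_eq_sum lq c _ subset_rfl, Finset.mul_sum]
    refine Finset.sum_congr rfl fun ν _ => ?_
    rw [ex_ray h, mul_sub, sub_eq_add_neg, Real.exp_add]
    push_cast
    ring
  simp_rw [hsum]
  rw [ep_eq_sum lq _ z (S := c.support)
    (by rw [Finsupp.support_filter]; exact Finset.filter_subset _ _)]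
  refine tendsto_finsetSum _ fun ν hν => ?_
  rw [Finsupp.filter_apply]
  split_ifs with he
  · simp [he]
  · have := (tendsto_exp_neg (sub_neg.2 (lt_of_le_of_ne (hc ν hν) he))).const_mul
      (c ν * ex lq ν z)
    simpa using this

theorem face_of_tendsto (h : lq ≠ 0) {c : ℝⁿ →₀ ℂ} {v : ℝⁿ} {θ : ℝ} {L : ℂⁿ → ℂ}
    (hL : ∀ z, Tendsto (fun t : ℝ => (Real.exp (-(t * θ)) : ℂ) * ep lq c (ray lq z v t)) atTop
      (𝓝 (L z))) :
    (∀ ν ∈ c.support, ν ⬝ᵥ v ≤ θ) ∧ ∀ z, ep lq (c.filter fun ν => ν ⬝ᵥ v = θ) z = L z := by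
  classical
  have h1 : ∀ ν ∈ c.support, ν ⬝ᵥ v ≤ θ := by
    by_contra! hcon
    obtain ⟨ν₁, hν₁, hlt⟩ := hcon
    obtain ⟨ν₀, h₀, hmax⟩ := c.support.exists_max_image (fun ν => ν ⬝ᵥ v) ⟨ν₁, hν₁⟩
    have hθ : θ < ν₀ ⬝ᵥ v := hlt.trans_le (hmax _ hν₁)
    have : c.filter (fun ν => ν ⬝ᵥ v = ν₀ ⬝ᵥ v) = 0 := by
      refine ep_injective h fun z => ?_
      have e1 := tendsto_ep_ray_face h c v _ hmax z
      have e2 := (tendsto_exp_neg (sub_neg.2 hθ)).mul (hL z)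
      rw [zero_mul] at e2
      refine tendsto_nhds_unique e1 (e2.congr fun t => ?_)
      rw [← mul_assoc, ← Complex.ofReal_mul, ← Real.exp_add]
      congr 3
      ring_nf
    have := DFunLike.congr_fun this ν₀
    rw [Finsupp.filter_apply, if_pos rfl] at this
    exact Finsupp.mem_support_iff.1 h₀ this
  exact ⟨h1, fun z => tendsto_nhds_unique (tendsto_ep_ray_face h c v θ h1 z) (hL z)⟩

end Faces

namespace EuclRoots

variable (R : EuclRoots ι n)

/-- `v` and `w` lie on the positive and on the negative side of the wall of a root, next to the
point `v1` of the wall. -/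
structure Adj (i : ι) (v1 v w : ℝⁿ) : Prop where
  wall : R.root i ⬝ᵥ v1 = 0
  ne : ∀ j, j ≠ i → j ≠ R.neg i → R.root j ⬝ᵥ v1 ≠ 0
  left : ∀ j, j ≠ i → j ≠ R.neg i →
    SignType.sign (R.root j ⬝ᵥ v) = SignType.sign (R.root j ⬝ᵥ v1)
  right : ∀ j, j ≠ i → j ≠ R.neg i →
    SignType.sign (R.root j ⬝ᵥ w) = SignType.sign (R.root j ⬝ᵥ v1)
  pos : 0 < R.root i ⬝ᵥ v
  neg : R.root i ⬝ᵥ w < 0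

theorem Adj.reg {R : EuclRoots ι n} {i : ι} {v1 v w : ℝⁿ} (h : R.Adj i v1 v w) : R.Reg v := by
  intro j
  by_cases h1 : j = i
  · rw [h1]; exact h.pos.ne'
  by_cases h2 : j = R.neg i
  · rw [h2, R.root_neg, neg_dotProduct]; exact (neg_neg_of_pos h.pos).ne
  · rw [← sign_ne_zero, h.left j h1 h2, sign_ne_zero]; exact h.ne j h1 h2

theorem Adj.reg_right {R : EuclRoots ι n} {i : ι} {v1 v w : ℝⁿ} (h : R.Adj i v1 v w) : R.Reg w := by
  intro j
  by_cases h1 : j = i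
  · rw [h1]; exact h.neg.ne
  by_cases h2 : j = R.neg i
  · rw [h2, R.root_neg, neg_dotProduct]; exact (neg_pos_of_neg h.neg).ne'
  · rw [← sign_ne_zero, h.right j h1 h2, sign_ne_zero]; exact h.ne j h1 h2

variable [Fintype ι]

theorem isOpen_setOf_sign (v : ℝⁿ) (hv : R.Reg v) :
    IsOpen {w | ∀ i, SignType.sign (R.root i ⬝ᵥ w) = SignType.sign (R.root i ⬝ᵥ v)} := by
  simp only [Set.ofPred_forall]
  refine isOpen_iInter_of_finite fun i => ?_
  have hc : Continuous fun w : ℝⁿ => R.root i ⬝ᵥ w := by unfold dotProduct; fun_prop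
  rcases lt_or_gt_of_ne (hv i) with h | h
  · simp only [sign_neg h, sign_eq_neg_one_iff]; exact isOpen_lt hc continuous_const
  · simp only [sign_pos h, sign_eq_one_iff]; exact isOpen_lt continuous_const hc

theorem reg_of_sign {v w : ℝⁿ} (hv : R.Reg v)
    (h : ∀ i, SignType.sign (R.root i ⬝ᵥ w) = SignType.sign (R.root i ⬝ᵥ v)) : R.Reg w := by
  intro i
  rw [← sign_ne_zero, h, sign_ne_zero]; exact hv i

/-- A property of regular vectors which depends only on the chamber and passes across walls holds
for all chambers. -/
theorem chain (p : ℝⁿ → Prop)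
    (hs : ∀ v w, R.Reg v → (∀ i, SignType.sign (R.root i ⬝ᵥ v) = SignType.sign (R.root i ⬝ᵥ w)) →
      p v → p w) (hadj : ∀ i v1 v w, R.Adj i v1 v w → p v → p w) {v w : ℝⁿ} (hv : R.Reg v)
    (hw : R.Reg w) (h : p v) : p w := by
  classical
  suffices main : ∀ N : ℕ, ∀ v w : ℝⁿ, R.Reg v → R.Reg w →
      (Finset.univ.filter fun j => SignType.sign (R.root j ⬝ᵥ v) ≠
        SignType.sign (R.root j ⬝ᵥ w)).card ≤ N → p v → p w from
    main _ v w hv hw le_rfl h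
  clear hv hw h v w
  intro N
  induction N with
  | zero =>
    intro v w hv hw hN h
    refine hs v w hv (fun i => ?_) h
    by_contra hne
    rw [Nat.le_zero, Finset.card_eq_zero] at hN
    have : i ∈ (∅ : Finset ι) := hN ▸ (by simpa using hne)
    simp at this
  | succ N ih =>
    intro v w hv hw hN h
    -- a generic endpoint in the chamber of `w`
    set D : Finset ℝⁿ := (Finset.univ.image fun ij : ι × ι =>
      (R.root ij.1 ⬝ᵥ v) • R.root ij.2 - (R.root ij.2 ⬝ᵥ v) • R.root ij.1).filter (· ≠ 0) with hD
    obtain ⟨w', hw's, hw'D⟩ := (dense_dot_ne_zero D (by simp [hD])).inter_open_nonempty _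
      (R.isOpen_setOf_sign w hw) ⟨w, fun i => rfl⟩ |>.imp fun _ h => h
    have hw' := R.reg_of_sign hw hw's
    refine hs w' w hw' hw's ?_
    by_cases hsep : (Finset.univ.filter fun j => SignType.sign (R.root j ⬝ᵥ v) ≠
        SignType.sign (R.root j ⬝ᵥ w')).Nonempty
    swap
    · refine hs v w' hv (fun i => ?_) h
      by_contra hne
      exact hsep ⟨i, by simpa using hne⟩
    set T : ι → ℝ := fun j => (R.root j ⬝ᵥ v) / (R.root j ⬝ᵥ v - R.root j ⬝ᵥ w') with hT
    obtain ⟨i, hi, hmin⟩ := Finset.exists_min_image _ T hsep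
    have hi' : SignType.sign (R.root i ⬝ᵥ v) ≠ SignType.sign (R.root i ⬝ᵥ w') := by simpa using hi
    wlog hpos : 0 < R.root i ⬝ᵥ v generalizing i
    · have hneg : R.root i ⬝ᵥ v < 0 := lt_of_le_of_ne (not_lt.1 hpos) (hv i)
      have hTn : T (R.neg i) = T i := by
        simp only [hT, R.root_neg, neg_dotProduct]
        rw [← neg_sub', neg_div_neg_eq]
      have hsg : SignType.sign (R.root (R.neg i) ⬝ᵥ v) ≠ SignType.sign (R.root (R.neg i) ⬝ᵥ w') := by
        simpa [R.root_neg, Left.sign_neg] using hi'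
      refine this (R.neg i) (by simpa using hsg) (fun j hj => by rw [hTn]; exact hmin j hj) hsg ?_
      rw [R.root_neg, neg_dotProduct]; linarith
    have hnegw : R.root i ⬝ᵥ w' < 0 := by
      refine lt_of_le_of_ne (not_lt.1 fun hp => hi' ?_) (hw' i)
      rw [sign_pos hpos, sign_pos hp]
    set u := w' - v with hu
    have hline : ∀ j (t : ℝ), R.root j ⬝ᵥ (v + t • u) =
        (1 - t) * (R.root j ⬝ᵥ v) + t * (R.root j ⬝ᵥ w') := by
      intro j t
      rw [hu, dotProduct_add, dotProduct_smul, dotProduct_sub, smul_eq_mul]; ring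
    have hTi0 : 0 < T i := div_pos hpos (by linarith)
    have hTi1 : T i < 1 := (div_lt_one (by linarith)).2 (by linarith)
    have hmid : ∀ j, j ≠ i → j ≠ R.neg i →
        SignType.sign (R.root j ⬝ᵥ (v + T i • u)) = SignType.sign (R.root j ⬝ᵥ v) := by
      intro j hji hjn
      rw [hline]
      by_cases hsg : SignType.sign (R.root j ⬝ᵥ v) = SignType.sign (R.root j ⬝ᵥ w')
      · rcases lt_or_gt_of_ne (hv j) with hj | hj
        · rw [sign_neg hj] at hsg ⊢
          have := sign_eq_neg_one_iff.1 hsg.symm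
          exact sign_neg (by nlinarith)
        · rw [sign_pos hj] at hsg ⊢
          have := sign_eq_one_iff.1 hsg.symm
          exact sign_pos (by nlinarith)
      · have hle := hmin j (by simpa using hsg)
        have hneT : T i ≠ T j := by
          intro he
          have hden : ∀ l, SignType.sign (R.root l ⬝ᵥ v) ≠ SignType.sign (R.root l ⬝ᵥ w') →
              R.root l ⬝ᵥ v - R.root l ⬝ᵥ w' ≠ 0 := fun l hl h0 => hl (by rw [sub_eq_zero.1 h0])
          simp only [hT] at he
          rw [div_eq_div_iff (hden i hi') (hden j hsg)] at he
          set d := (R.root i ⬝ᵥ v) • R.root j - (R.root j ⬝ᵥ v) • R.root i with hd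
          have hd0 : d ≠ 0 := by
            intro h0
            have : R.root j = ((R.root j ⬝ᵥ v) / (R.root i ⬝ᵥ v)) • R.root i := by
              rw [div_eq_inv_mul, mul_smul, ← sub_eq_zero.1 h0, smul_smul,
                inv_mul_cancel₀ hpos.ne', one_smul]
            rcases R.eq_or_eq_neg_of_smul this with h1 | h1
            · exact hji h1
            · exact hjn h1
          refine hw'D d ?_ ?_
          · simp only [hD, Finset.mem_filter, Finset.mem_image, Finset.mem_univ, true_and]
            exact ⟨⟨(i, j), rfl⟩, hd0⟩
          · rw [hd, sub_dotProduct, smul_dotProduct, smul_dotProduct, smul_eq_mul, smul_eq_mul]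
            linarith
        have hlt := lt_of_le_of_ne hle hneT
        rcases lt_or_gt_of_ne (hv j) with hj | hj
        · have hwj : 0 < R.root j ⬝ᵥ w' := by
            refine lt_of_le_of_ne (not_lt.1 fun hp => hsg ?_) (hw' j).symm
            rw [sign_neg hj, sign_neg hp]
          rw [sign_neg hj]
          have : T i < -(R.root j ⬝ᵥ v) / (R.root j ⬝ᵥ w' - R.root j ⬝ᵥ v) := by
            rw [← neg_sub (R.root j ⬝ᵥ v), neg_div_neg_eq]; exact hlt
          rw [lt_div_iff₀ (by linarith)] at this
          exact sign_neg (by linarith)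
        · have hwj : R.root j ⬝ᵥ w' < 0 := by
            refine lt_of_le_of_ne (not_lt.1 fun hp => hsg ?_) (hw' j)
            rw [sign_pos hj, sign_pos hp]
          rw [sign_pos hj]
          have := hlt
          simp only [hT] at this hlt
          rw [lt_div_iff₀ (by linarith)] at this
          exact sign_pos (by simp only [hT]; linarith)
    have hzero : R.root i ⬝ᵥ (v + T i • u) = 0 := by
      rw [hline]
      have : R.root i ⬝ᵥ v - R.root i ⬝ᵥ w' ≠ 0 := by linarith
      simp only [hT]
      field_simp
      ring
    have hc : ∀ j, Continuous fun t : ℝ => R.root j ⬝ᵥ (v + t • u) := by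
      intro j; simp only [hline]; fun_prop
    have hev : ∀ᶠ t in 𝓝[>] (T i), (∀ j, j ≠ i → j ≠ R.neg i →
        SignType.sign (R.root j ⬝ᵥ (v + t • u)) = SignType.sign (R.root j ⬝ᵥ (v + T i • u))) ∧
        R.root i ⬝ᵥ (v + t • u) < 0 := by
      refine (Filter.eventually_all.2 fun j => ?_).and ?_
      · by_cases hj1 : j = i
        · exact Eventually.of_forall fun t h1 => absurd hj1 h1
        by_cases hj2 : j = R.neg i
        · exact Eventually.of_forall fun t _ h2 => absurd hj2 h2
        have hne : R.root j ⬝ᵥ (v + T i • u) ≠ 0 := by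
          rw [← sign_ne_zero, hmid j hj1 hj2, sign_ne_zero]; exact hv j
        rcases lt_or_gt_of_ne hne with h0 | h0
        · filter_upwards [((hc j).continuousAt.eventually_lt continuousAt_const h0).filter_mono
            nhdsWithin_le_nhds] with t ht _ _
          rw [sign_neg h0, sign_neg ht]
        · filter_upwards [(continuousAt_const.eventually_lt (hc j).continuousAt h0).filter_mono
            nhdsWithin_le_nhds] with t ht _ _
          rw [sign_pos h0, sign_pos ht]
      · filter_upwards [self_mem_nhdsWithin] with t ht
        have ht' : T i < t := ht
        rw [hline] at hzero ⊢
        nlinarith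
    obtain ⟨t, ht1, ht2⟩ := hev.exists
    have hA : R.Adj i (v + T i • u) v (v + t • u) :=
      ⟨hzero, fun j h1 h2 => by
        rw [← sign_ne_zero, hmid j h1 h2, sign_ne_zero]; exact hv j,
        fun j h1 h2 => (hmid j h1 h2).symm, ht1, hpos, ht2⟩
    refine ih (v + t • u) w' hA.reg_right hw' ?_ (hadj _ _ _ _ hA h)
    rw [← Nat.lt_succ_iff]
    refine lt_of_lt_of_le (Finset.card_lt_card ?_) hN
    rw [Finset.ssubset_iff_of_subset]
    · refine ⟨i, by simp only [Finset.mem_filter, Finset.mem_univ, true_and, ← hw's i]; exact hi', ?_⟩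
      simp only [Finset.mem_filter, Finset.mem_univ, true_and, not_not]
      rw [sign_neg ht2, sign_neg hnegw]
    · intro j
      simp only [Finset.mem_filter, Finset.mem_univ, true_and]
      intro hj
      by_cases hj1 : j = i
      · rw [hj1, ← hw's i]; exact hi'
      by_cases hj2 : j = R.neg i
      · rw [hj2, R.root_neg, neg_dotProduct, neg_dotProduct, Left.sign_neg, Left.sign_neg,
          ← hw's i]
        exact fun h => hi' (neg_injective h)
      · rw [← hw's j]
        rw [ht1 j hj1 hj2, hmid j hj1 hj2] at hj
        exact hj

theorem Adj.rhoV_left {R : EuclRoots ι n} {i : ι} {v1 v w : ℝⁿ} (h : R.Adj i v1 v w) :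
    R.rhoV v = R.rhoV v1 + ((R.mult i : ℝ) / 2) • R.coroot i := by
  classical
  have key : ∀ j, ((SignType.sign (R.coroot j ⬝ᵥ v) : ℝ) * R.mult j) • R.coroot j
      = ((SignType.sign (R.coroot j ⬝ᵥ v1) : ℝ) * R.mult j) • R.coroot j +
        ((if j = i then (R.mult i : ℝ) • R.coroot i else 0) +
        (if j = R.neg i then (R.mult i : ℝ) • R.coroot i else 0)) := by
    intro j
    rw [R.sign_coroot, R.sign_coroot]
    by_cases h1 : j = i
    · subst h1
      rw [h.wall, sign_pos h.pos, if_pos rfl, if_neg (R.neg_ne j).symm]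
      simp
    by_cases h2 : j = R.neg i
    · subst h2
      have := h.pos
      rw [R.root_neg, neg_dotProduct, neg_dotProduct, h.wall, Left.sign_neg, sign_pos h.pos,
        if_neg h1, if_pos rfl, R.coroot_neg, R.mult_neg]
      simp
    · rw [h.left j h1 h2]; simp [h1, h2]
  rw [rhoV, Finset.sum_congr rfl fun j _ => key j, Finset.sum_add_distrib, Finset.sum_add_distrib,
    Finset.sum_ite_eq' , Finset.sum_ite_eq', if_pos (Finset.mem_univ _), if_pos (Finset.mem_univ _),
    rhoV]
  module

theorem Adj.symm {R : EuclRoots ι n} {i : ι} {v1 v w : ℝⁿ} (h : R.Adj i v1 v w) :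
    R.Adj (R.neg i) v1 w v where
  wall := by rw [R.root_neg, neg_dotProduct, h.wall, neg_zero]
  ne j h1 h2 := h.ne j (by rwa [R.neg_neg] at h2) h1
  left j h1 h2 := h.right j (by rwa [R.neg_neg] at h2) h1
  right j h1 h2 := h.left j (by rwa [R.neg_neg] at h2) h1
  pos := by rw [R.root_neg, neg_dotProduct]; linarith [h.neg]
  neg := by rw [R.root_neg, neg_dotProduct]; linarith [h.pos]

theorem Adj.rhoV_right {R : EuclRoots ι n} {i : ι} {v1 v w : ℝⁿ} (h : R.Adj i v1 v w) :
    R.rhoV w = R.rhoV v1 - ((R.mult i : ℝ) / 2) • R.coroot i := by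
  rw [h.symm.rhoV_left, R.coroot_neg, R.mult_neg]; module

theorem rhoV_dot_root_wall {i : ι} {v1 : ℝⁿ} (h : R.root i ⬝ᵥ v1 = 0) :
    R.rhoV v1 ⬝ᵥ R.root i = 0 := by
  have h1 : R.s i v1 = v1 := by
    rw [s_eq', dotProduct_comm, h]; simp
  have h2 := R.s_rhoV i v1
  rw [h1, s_eq', sub_eq_self, smul_eq_zero] at h2
  exact h2.resolve_right (R.coroot_ne i)

theorem Adj.s_rhoV {R : EuclRoots ι n} {i : ι} {v1 v w : ℝⁿ} (h : R.Adj i v1 v w) :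
    R.s i (R.rhoV v) = R.rhoV w := by
  rw [h.rhoV_left, h.rhoV_right, s_eq', add_dotProduct, R.rhoV_dot_root_wall h.wall,
    smul_dotProduct, R.coroot_dot_root_self]
  simp only [smul_eq_mul]
  module

/-- Sums over reflection-invariant sets of exponents do not depend on the chamber. -/
theorem sum_rhoV_eq {β : Type*} [AddCommMonoid β] (F : ℝ → β) (O : Finset ℝⁿ)
    (hO : ∀ i, ∀ τ ∈ O, R.s i τ ∈ O) {v w : ℝⁿ} (hv : R.Reg v) (hw : R.Reg w) :
    ∑ τ ∈ O, F (R.rhoV v ⬝ᵥ τ) = ∑ τ ∈ O, F (R.rhoV w ⬝ᵥ τ) := by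
  refine R.chain (fun w => ∑ τ ∈ O, F (R.rhoV v ⬝ᵥ τ) = ∑ τ ∈ O, F (R.rhoV w ⬝ᵥ τ))
    (fun a b _ hab h => by rw [h, R.rhoV_congr hab]) (fun i v1 a b hab h => ?_) hv hw rfl
  rw [h, ← hab.s_rhoV]
  refine Finset.sum_nbij' (R.s i) (R.s i) (hO i) (hO i) (fun j _ => R.s_s i j)
    (fun j _ => R.s_s i j) fun τ _ => ?_
  rw [s_dot_s]

end EuclRoots

/-- The local factor of the coefficients of the Macdonald operators. -/
def fac (lq : ℂ) (m : ℕ) (k : ℝ) (y : ℂ) : ℂ :=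
  (if 0 < k then qbr lq (y - m) / qbr lq y else 1) *
    if k = 2 then qbr lq (y - m + 1) / qbr lq (y + 1) else 1

theorem fac_of_nonpos (lq : ℂ) (m : ℕ) {k : ℝ} (hk : k ≤ 0) (y : ℂ) : fac lq m k y = 1 := by
  rw [fac, if_neg hk.not_gt, if_neg (by rintro rfl; norm_num at hk), mul_one]

theorem fac_one (lq : ℂ) (m : ℕ) (y : ℂ) : fac lq m 1 y = qbr lq (y - m) / qbr lq y := by
  simp [fac]

theorem fac_two (lq : ℂ) (m : ℕ) (y : ℂ) : fac lq m 2 y =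
    qbr lq (y - m) / qbr lq y * (qbr lq (y - m + 1) / qbr lq (y + 1)) := by
  simp [fac]

theorem fac_add_int_mul {lq y : ℂ} (hy : qpow lq (2 * y) = 1) (m : ℕ) (k : ℝ) (l : ℤ) (u : ℂ) :
    fac lq m k (u + l * y) = fac lq m k u := by
  have h : ∀ a b : ℂ, qbr lq (a + l * y) / qbr lq (b + l * y) = qbr lq a / qbr lq b := by
    intro a b
    rw [qbr_add_int_mul hy, qbr_add_int_mul hy, mul_div_mul_left _ _ (qpow_ne_zero _ _)]
  rw [fac, fac, ← h (u - m), ← h (u - m + 1)]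
  congr 4 <;> ring_nf

theorem continuousAt_fac {m : ℕ} {k : ℝ} {y : ℂ} (h1 : 0 < k → qbr lq y ≠ 0)
    (h2 : k = 2 → qbr lq (y + 1) ≠ 0) : ContinuousAt (fac lq m k) y := by
  have hc := (differentiable_qbr lq).continuous
  unfold fac
  refine ContinuousAt.mul ?_ ?_
  · split_ifs with h
    · exact ContinuousAt.div (by fun_prop) (by fun_prop) (h1 h)
    · exact continuousAt_const
  · split_ifs with h
    · exact ContinuousAt.div (by fun_prop) (by fun_prop) (h2 h)
    · exact continuousAt_const

theorem tendsto_div_qbr (hlq : lq ≠ 0) {y : ℂ} (hy : qbr lq y = 0) :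
    ∃ C : ℂ, Tendsto (fun t : ℂ => t / qbr lq (y + t)) (𝓝[≠] 0) (𝓝 C) := by
  have hd := (hasDerivAt_qbr lq y)
  have hne : lq * (qpow lq y + qpow lq (-y)) ≠ 0 := by
    have : qpow lq y = qpow lq (-y) := sub_eq_zero.1 hy
    rw [← this, ← two_mul]
    exact mul_ne_zero hlq (mul_ne_zero two_ne_zero (qpow_ne_zero _ _))
  have := (hasDerivAt_iff_tendsto_slope_zero.1 hd).inv₀ hne
  refine ⟨_, this.congr fun t => ?_⟩
  rw [hy, sub_zero, smul_eq_mul, mul_inv, inv_inv, div_eq_mul_inv]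

theorem qbr_add_natCast {lq y : ℂ} (hy : qpow lq (2 * y) = 1) (u : ℂ) :
    qbr lq (y + u) = qpow lq y * qbr lq u := by
  have := qbr_add_int_mul hy 1 u
  simp only [Int.cast_one, one_mul] at this
  rw [add_comm, this]

theorem qbr_add_intCast_ne_zero {lq y : ℂ} (hq : NotRootOfUnity lq) (hy : qpow lq (2 * y) = 1)
    {k : ℤ} (hk : k ≠ 0) : qbr lq (y + k) ≠ 0 := by
  rw [qbr_add_natCast hy]
  exact mul_ne_zero (qpow_ne_zero _ _) (qbr_intCast_ne_zero hq hk)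

theorem qbr_eq_zero_of {lq y : ℂ} (hy : qpow lq (2 * y) = 1) : qbr lq y = 0 := qbr_eq_zero_iff.2 hy

theorem tendsto_mul_fac {lq y : ℂ} (hq : NotRootOfUnity lq) (hy : qpow lq (2 * y) = 1) (m : ℕ)
    {k : ℤ} (hk : 0 < k) (hk2 : k ≤ 2) :
    ∃ C : ℂ, Tendsto (fun t : ℂ => t * fac lq m k (y + t)) (𝓝[≠] 0) (𝓝 C) ∧ ((m : ℤ) < k → C = 0) := by
  obtain ⟨C, hC⟩ := tendsto_div_qbr hq.ne_zero (qbr_eq_zero_of hy)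
  have hc := (differentiable_qbr lq).continuous
  have hy1 : qbr lq (y + 1) ≠ 0 := by
    have := qbr_add_intCast_ne_zero hq hy one_ne_zero; exact_mod_cast this
  have hrest : ∀ {g : ℂ → ℂ}, ContinuousAt g 0 → Tendsto g (𝓝[≠] 0) (𝓝 (g 0)) :=
    fun h => h.tendsto.mono_left nhdsWithin_le_nhds
  rcases (by omega : k = 1 ∨ k = 2) with rfl | rfl
  · refine ⟨C * qbr lq (y + 0 - m),
      (hC.mul (hrest (g := fun t => qbr lq (y + t - m)) (by fun_prop))).congr fun t => ?_, ?_⟩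
    · rw [Int.cast_one, fac_one]; ring
    · intro hm
      have : m = 0 := by omega
      subst this
      simp [qbr_eq_zero_of hy]
  · refine ⟨C * qbr lq (y + 0 - m) * (qbr lq (y + 0 - m + 1) / qbr lq (y + 0 + 1)),
      ((hC.mul (hrest (g := fun t => qbr lq (y + t - m)) (by fun_prop))).mul
      (hrest (g := fun t => qbr lq (y + t - m + 1) / qbr lq (y + t + 1)) ?_)).congr fun t => ?_, ?_⟩
    · refine ContinuousAt.div (by fun_prop) (by fun_prop) (by simpa using hy1)
    · rw [Int.cast_ofNat, fac_two]; ring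
    · intro hm
      rcases (by omega : m = 0 ∨ m = 1) with rfl | rfl
      · simp [qbr_eq_zero_of hy]
      · simp [qbr_eq_zero_of hy]

/-- The product of the factors of two opposite roots has at most a simple pole on the wall. -/
theorem tendsto_mul_fac_fac {lq y : ℂ} (hq : NotRootOfUnity lq) (hy : qpow lq (2 * y) = 1) (m : ℕ)
    {k : ℤ} (hk : |k| ≤ 2) :
    ∃ C : ℂ, Tendsto (fun t : ℂ => t * (fac lq m k (y + t) * fac lq m (-k) (-(y + t)))) (𝓝[≠] 0)
      (𝓝 C) ∧ ((m : ℤ) < |k| → C = 0) ∧ (k = 0 → C = 0) := by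
  rw [abs_le] at hk
  rcases lt_trichotomy k 0 with h | rfl | h
  · obtain ⟨C, hC, hC0⟩ := tendsto_mul_fac hq (y := -y)
      (by rw [mul_neg, qpow_neg, hy, inv_one]) m (k := -k) (by omega) (by omega)
    have hneg : Tendsto (fun t : ℂ => -t) (𝓝[≠] 0) (𝓝[≠] 0) := by
      refine tendsto_nhdsWithin_of_tendsto_nhds_of_eventually_within _ ?_ ?_
      · simpa using (continuous_neg.tendsto (0 : ℂ)).mono_left nhdsWithin_le_nhds
      · filter_upwards [self_mem_nhdsWithin] with t ht
        simpa using ht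
    refine ⟨-C, ((hC.comp hneg).neg).congr fun t => ?_, fun hm => ?_, fun h0 => by omega⟩
    · have : (k : ℝ) ≤ 0 := by exact_mod_cast h.le
      rw [fac_of_nonpos lq m this]
      simp only [Function.comp]
      push_cast
      rw [neg_add]; ring
    · rw [hC0 (by rwa [abs_of_neg h] at hm), neg_zero]
  · refine ⟨0, ?_, fun _ => rfl, fun _ => rfl⟩
    simp only [Int.cast_zero, neg_zero, fac_of_nonpos lq m le_rfl, mul_one]
    exact tendsto_id.mono_left nhdsWithin_le_nhds
  · obtain ⟨C, hC, hC0⟩ := tendsto_mul_fac hq hy m h hk.2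
    refine ⟨C, hC.congr fun t => ?_, fun hm => hC0 (by rwa [abs_of_pos h] at hm),
      fun h0 => by omega⟩
    have : -(k : ℝ) ≤ 0 := by simp; exact_mod_cast h.le
    rw [fac_of_nonpos lq m this, mul_one]

/-- The second pole of the factor of a quasiminuscule weight. -/
theorem tendsto_mul_fac_two {lq y : ℂ} (hq : NotRootOfUnity lq) (hy : qpow lq (2 * (y + 1)) = 1)
    (m : ℕ) : ∃ C : ℂ, Tendsto (fun t : ℂ => t * fac lq m 2 (y + t)) (𝓝[≠] 0) (𝓝 C) ∧
      (m = 0 → C = 0) := by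
  obtain ⟨C, hC⟩ := tendsto_div_qbr hq.ne_zero (qbr_eq_zero_of hy)
  have hc := (differentiable_qbr lq).continuous
  have hy1 : qbr lq y ≠ 0 := by
    have := qbr_add_intCast_ne_zero hq hy (k := -1) (by norm_num)
    push_cast at this
    rwa [add_neg_cancel_right] at this
  have hrest : ∀ {g : ℂ → ℂ}, ContinuousAt g 0 → Tendsto g (𝓝[≠] 0) (𝓝 (g 0)) :=
    fun h => h.tendsto.mono_left nhdsWithin_le_nhds
  refine ⟨C * qbr lq (y + 0 - m + 1) * (qbr lq (y + 0 - m) / qbr lq (y + 0)),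
      ((hC.mul (hrest (g := fun t => qbr lq (y + t - m + 1)) (by fun_prop))).mul
      (hrest (g := fun t => qbr lq (y + t - m) / qbr lq (y + t)) ?_)).congr fun t => ?_, ?_⟩
  · refine ContinuousAt.div (by fun_prop) (by fun_prop) (by simpa using hy1)
  · rw [fac_two, add_right_comm y 1 t]; ring
  · rintro rfl
    simp [qbr_eq_zero_of hy]

namespace EuclRoots

variable (R : EuclRoots ι n)

/-- Quasi-invariance of a function. -/
def QI (lq : ℂ) (f : ℂⁿ → ℂ) : Prop :=
  ∀ i, ∀ s : ℕ, 1 ≤ s → s ≤ R.mult i → ∀ z : ℂⁿ,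
    qpow lq (2 * (cvec (R.coroot i) ⬝ᵥ z)) = 1 → f (R.path i z s) = f (R.path i z (-s))

theorem QI.int {R : EuclRoots ι n} {f : ℂⁿ → ℂ} (h : R.QI lq f) {i : ι} {k : ℤ}
    (hk : |k| ≤ R.mult i) {z : ℂⁿ} (hz : qpow lq (2 * (cvec (R.coroot i) ⬝ᵥ z)) = 1) :
    f (R.path i z k) = f (R.path i z (-k)) := by
  obtain ⟨s, rfl | rfl⟩ := k.eq_nat_or_neg
  · rcases Nat.eq_zero_or_pos s with rfl | hs
    · simp
    · have := h i s hs (by simpa using hk) z hz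
      exact_mod_cast this
  · rcases Nat.eq_zero_or_pos s with rfl | hs
    · simp
    · have := h i s hs (by simpa using hk) z hz
      push_cast
      rw [_root_.neg_neg]
      exact this.symm

/-- The set of weights of a Macdonald operator. -/
structure MQ (O : Finset ℝⁿ) : Prop where
  s_mem : ∀ i, ∀ τ ∈ O, R.s i τ ∈ O
  int : ∀ τ ∈ O, ∀ i, ∃ k : ℤ, R.coroot i ⬝ᵥ τ = k ∧ (|k| ≤ 1 ∨ τ = R.root i ∨ τ = -R.root i)

theorem MQ.int' {R : EuclRoots ι n} {O : Finset ℝⁿ} (h : R.MQ O) {τ : ℝⁿ}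
    (hτ : τ ∈ O) (i : ι) : ∃ k : ℤ, R.coroot i ⬝ᵥ τ = k ∧ |k| ≤ 2 ∧ (k = 2 → τ = R.root i) ∧
      (k = -2 → τ = -R.root i) := by
  obtain ⟨k, hk, h1 | h1 | h1⟩ := h.int τ hτ i
  · exact ⟨k, hk, by omega, by rintro rfl; norm_num at h1, by rintro rfl; norm_num at h1⟩
  · have : (k : ℝ) = (2 : ℤ) := by rw [← hk, h1, R.coroot_dot_root_self]; norm_num
    have : k = 2 := by exact_mod_cast this
    exact ⟨k, hk, by rw [this]; norm_num, fun _ => h1, by omega⟩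
  · have : (k : ℝ) = (-2 : ℤ) := by
      rw [← hk, h1, dotProduct_neg, R.coroot_dot_root_self]; norm_num
    have : k = -2 := by exact_mod_cast this
    exact ⟨k, hk, by rw [this]; norm_num, by omega, fun _ => h1⟩

variable [Fintype ι]

/-- The coefficient of the Macdonald operator. -/
def coeff (lq : ℂ) (τ : ℝⁿ) (z : ℂⁿ) : ℂ :=
  ∏ j, fac lq (R.mult j) (R.coroot j ⬝ᵥ τ) (cvec (R.coroot j) ⬝ᵥ z)

/-- The Macdonald operator. -/
def Dop (lq : ℂ) (O : Finset ℝⁿ) (f : ℂⁿ → ℂ) (z : ℂⁿ) : ℂ :=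
  ∑ τ ∈ O, R.coeff lq τ z * (f (z + cvec τ) - f z) +
    (∑ τ ∈ O, qpow lq (-2 * ((R.rhoV R.y0 ⬝ᵥ τ : ℝ) : ℂ))) * f z

/-- The points away from the poles of the coefficients. -/
def RegPt (lq : ℂ) (z : ℂⁿ) : Prop :=
  ∀ j, R.wall lq j 0 z ≠ 0 ∧ R.wall lq j 1 z ≠ 0

theorem wall_ne_zero_iff {j : ι} {c : ℂ} {z : ℂⁿ} :
    R.wall lq j c z ≠ 0 ↔ qbr lq (cvec (R.coroot j) ⬝ᵥ z + c) ≠ 0 := by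
  rw [Ne, Ne, R.wall_eq_zero, qbr_eq_zero_iff]

theorem coeff_path_neg {i : ι} {z : ℂⁿ}
    (hz : qpow lq (2 * (cvec (R.coroot i) ⬝ᵥ z)) = 1) (τ : ℝⁿ) (t : ℂ) :
    R.coeff lq (R.s i τ) (R.path i z (-t)) = R.coeff lq τ (R.path i z t) := by
  unfold coeff
  rw [← Equiv.prod_comp (R.reflPerm i)]
  refine Finset.prod_congr rfl fun j _ => ?_
  obtain ⟨k, hk⟩ := R.int i j
  rw [reflPerm_apply, R.mult_refl, R.coroot_refl', s_dot_s, ← fac_add_int_mul hz _ _ k]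
  congr 1
  rw [s_eq', dotProduct_comm (R.coroot j), hk, cvec_sub, cvec_smul, sub_dotProduct, smul_dotProduct,
    coroot_dot_path, coroot_dot_path, coroot_dot_path, R.coroot_dot_root_self,
    dotProduct_comm (R.coroot j), hk]
  push_cast
  simp only [smul_eq_mul]
  ring

/-- The base point of the translate of a path. -/
def trans (i : ι) (τ : ℝⁿ) (z : ℂⁿ) : ℂⁿ :=
  z + cvec τ - ((((R.coroot i ⬝ᵥ τ : ℝ) : ℂ)) / 2) • cvec (R.root i)

theorem path_add (i : ι) (τ : ℝⁿ) (z : ℂⁿ) (t : ℂ) :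
    R.path i z t + cvec τ = R.path i (R.trans i τ z) (t + ((R.coroot i ⬝ᵥ τ : ℝ) : ℂ)) := by
  unfold path trans; module

theorem path_add_s (i : ι) (τ : ℝⁿ) (z : ℂⁿ) (t : ℂ) : R.path i z (-t) + cvec (R.s i τ) =
      R.path i (R.trans i τ z) (-(t + ((R.coroot i ⬝ᵥ τ : ℝ) : ℂ))) := by
  unfold path trans s
  rw [cvec_sub, cvec_smul, dotProduct_comm τ]; module

theorem coroot_dot_trans (i : ι) (τ : ℝⁿ) (z : ℂⁿ) :
    cvec (R.coroot i) ⬝ᵥ R.trans i τ z = cvec (R.coroot i) ⬝ᵥ z := by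
  unfold trans
  rw [dotProduct_sub, dotProduct_add, dotProduct_smul, cvec_dot_cvec, cvec_dot_cvec,
    R.coroot_dot_root_self]
  push_cast
  simp only [smul_eq_mul]; ring

/-- The odd part of a function along a path. -/
def odd (f : ℂⁿ → ℂ) (i : ι) (z : ℂⁿ) (t : ℂ) : ℂ :=
  f (R.path i z t) - f (R.path i z (-t))

theorem Dop_odd {O : Finset ℝⁿ} (hO : R.MQ O) (f : ℂⁿ → ℂ) {i : ι}
    {z : ℂⁿ} (hz : qpow lq (2 * (cvec (R.coroot i) ⬝ᵥ z)) = 1) (t : ℂ) :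
    R.odd (R.Dop lq O f) i z t = ∑ τ ∈ O, R.coeff lq τ (R.path i z t) *
      (R.odd f i (R.trans i τ z) (t + ((R.coroot i ⬝ᵥ τ : ℝ) : ℂ)) - R.odd f i z t) +
      (∑ τ ∈ O, qpow lq (-2 * ((R.rhoV R.y0 ⬝ᵥ τ : ℝ) : ℂ))) * R.odd f i z t := by
  have h1 : ∑ τ ∈ O, R.coeff lq τ (R.path i z (-t)) *
      (f (R.path i z (-t) + cvec τ) - f (R.path i z (-t))) =
      ∑ τ ∈ O, R.coeff lq τ (R.path i z t) *
      (f (R.path i (R.trans i τ z) (-(t + ((R.coroot i ⬝ᵥ τ : ℝ) : ℂ)))) -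
        f (R.path i z (-t))) := by
    refine Finset.sum_nbij' (R.s i) (R.s i) (hO.s_mem i) (hO.s_mem i) (fun j _ => R.s_s i j)
      (fun j _ => R.s_s i j) fun τ _ => ?_
    rw [← R.path_add_s, ← R.coeff_path_neg hz, R.s_s, _root_.neg_neg]
  rw [odd, Dop, Dop, h1]
  simp only [R.path_add i, odd]
  rw [add_sub_add_comm, ← Finset.sum_sub_distrib, ← mul_sub]
  congr 1
  refine Finset.sum_congr rfl fun τ _ => ?_
  ring

theorem coeff_split (lq : ℂ) (τ : ℝⁿ) (z : ℂⁿ) (i : ι) [DecidableEq ι] :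
    R.coeff lq τ z = fac lq (R.mult i) (R.coroot i ⬝ᵥ τ) (cvec (R.coroot i) ⬝ᵥ z) *
      fac lq (R.mult i) (-(R.coroot i ⬝ᵥ τ)) (-(cvec (R.coroot i) ⬝ᵥ z)) *
      ∏ j ∈ Finset.univ \ {i, R.neg i},
        fac lq (R.mult j) (R.coroot j ⬝ᵥ τ) (cvec (R.coroot j) ⬝ᵥ z) := by
  rw [coeff, ← Finset.prod_sdiff (Finset.subset_univ {i, R.neg i}),
    Finset.prod_pair (R.neg_ne i).symm, mul_comm, R.mult_neg, R.coroot_neg, cvec_neg,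
    neg_dotProduct, neg_dotProduct]

/-- Regularity of the other factors. -/
def OtherReg (lq : ℂ) (i : ι) (z : ℂⁿ) : Prop :=
  ∀ j, j ≠ i → j ≠ R.neg i → R.wall lq j 0 z ≠ 0 ∧ R.wall lq j 1 z ≠ 0

theorem tendsto_other {i : ι} {z : ℂⁿ} (h : R.OtherReg lq i z)
    [DecidableEq ι] (τ : ℝⁿ) {γ : ℂ → ℂⁿ} {t0 : ℂ} (hγ : ContinuousAt γ t0)
    (h0 : γ t0 = z) : ContinuousAt (fun t => ∏ j ∈ Finset.univ \ {i, R.neg i},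
        fac lq (R.mult j) (R.coroot j ⬝ᵥ τ) (cvec (R.coroot j) ⬝ᵥ γ t)) t0 := by
  refine tendsto_finsetProd _ fun j hj => ?_
  simp only [Finset.mem_sdiff, Finset.mem_univ, Finset.mem_insert, Finset.mem_singleton,
    not_or, true_and] at hj
  obtain ⟨h1, h2⟩ := h j hj.1 hj.2
  rw [wall_ne_zero_iff, ← h0] at h1 h2
  rw [add_zero] at h1
  have hc : ContinuousAt (fun t => cvec (R.coroot j) ⬝ᵥ γ t) t0 :=
    ContinuousAt.comp (g := fun z => cvec (R.coroot j) ⬝ᵥ z)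
      (differentiable_dot _).continuous.continuousAt hγ
  exact ContinuousAt.comp (g := fac lq (R.mult j) (R.coroot j ⬝ᵥ τ))
    (f := fun t => cvec (R.coroot j) ⬝ᵥ γ t) (continuousAt_fac (fun _ => h1) fun _ => h2) hc

end EuclRoots

/-- The quasi-periodic exponential polynomial `q ^ (2 (x, z)) ∑ c_ν q ^ (2 (ν, z))`. -/
def bf (lq : ℂ) (x : ℂⁿ) (c : ℝⁿ →₀ ℂ) (z : ℂⁿ) : ℂ :=
  qpow lq (2 * (x ⬝ᵥ z)) * ep lq c z

theorem differentiable_bf (lq : ℂ) (x : ℂⁿ) (c : ℝⁿ →₀ ℂ) : Differentiable ℂ (bf lq x c) :=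
  ((differentiable_qpow lq).comp ((differentiable_dot x).const_mul 2)).mul (differentiable_ep lq c)

namespace EuclRoots

variable (R : EuclRoots ι n) [Fintype ι]

theorem tendsto_nhdsNE {X : Type*} [TopologicalSpace X] {g : ℂ → X} {t0 : ℂ}
    (h : ContinuousAt g t0) : Tendsto g (𝓝[≠] t0) (𝓝 (g t0)) :=
  h.tendsto.mono_left nhdsWithin_le_nhds

theorem continuous_odd {f : ℂⁿ → ℂ} (hf : Continuous f) (i : ι) (z : ℂⁿ) :
    Continuous (R.odd f i z) :=
  (hf.comp (R.continuous_path i z)).sub (hf.comp ((R.continuous_path i z).comp continuous_neg))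

theorem differentiable_odd {f : ℂⁿ → ℂ} (hf : Differentiable ℂ f) (i : ι)
    (z : ℂⁿ) : Differentiable ℂ (R.odd f i z) := by
  have hp : Differentiable ℂ (R.path i z) := by unfold path; fun_prop
  exact (hf.comp hp).sub (hf.comp (hp.comp differentiable_neg))

theorem odd_neg (f : ℂⁿ → ℂ) (i : ι) (z : ℂⁿ) (t : ℂ) : R.odd f i z (-t) = -R.odd f i z t := by
  simp [odd]

theorem odd_zero (f : ℂⁿ → ℂ) (i : ι) (z : ℂⁿ) : R.odd f i z 0 = 0 := by
  simp [odd]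

theorem QI.odd_eq_zero {R : EuclRoots ι n} {f : ℂⁿ → ℂ} (h : R.QI lq f) {i : ι}
    {k : ℤ} (hk : |k| ≤ R.mult i) {z : ℂⁿ}
    (hz : qpow lq (2 * (cvec (R.coroot i) ⬝ᵥ z)) = 1) : R.odd f i z k = 0 :=
  sub_eq_zero.2 (h.int hk hz)

theorem tendsto_mul_coeff (hq : NotRootOfUnity lq) {O : Finset ℝⁿ}
    (hO : R.MQ O) {τ : ℝⁿ} (hτ : τ ∈ O) {i : ι} {z : ℂⁿ}
    (hz : qpow lq (2 * (cvec (R.coroot i) ⬝ᵥ z)) = 1) (hoth : R.OtherReg lq i z) {k : ℤ}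
    (hk : R.coroot i ⬝ᵥ τ = k) :
    ∃ C : ℂ, Tendsto (fun t : ℂ => t * R.coeff lq τ (R.path i z t)) (𝓝[≠] 0) (𝓝 C) ∧
      ((R.mult i : ℤ) < |k| → C = 0) ∧ (k = 0 → C = 0) := by
  classical
  obtain ⟨k', hk', hk2, -, -⟩ := hO.int' hτ i
  have : k = k' := by rw [hk] at hk'; exact_mod_cast hk'
  subst this
  obtain ⟨C, hC, h1, h2⟩ := tendsto_mul_fac_fac hq hz (R.mult i) hk2
  have ho := tendsto_nhdsNE (R.tendsto_other hoth τ (γ := R.path i z) (t0 := 0)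
    (R.continuous_path i z).continuousAt (R.path_zero i z))
  refine ⟨_, (hC.mul ho).congr fun t => ?_, fun h => by rw [h1 h, zero_mul],
    fun h => by rw [h2 h, zero_mul]⟩
  rw [R.coeff_split lq τ _ i, hk, R.coroot_dot_path_self]
  ring

/-- The Macdonald operator preserves regularity on the walls. -/
theorem tendsto_mul_Dop_zero (hq : NotRootOfUnity lq) {O : Finset ℝⁿ}
    (hO : R.MQ O) {f : ℂⁿ → ℂ} (hf : Continuous f) (hQI : R.QI lq f) {i : ι}
    {z : ℂⁿ} (hz : qpow lq (2 * (cvec (R.coroot i) ⬝ᵥ z)) = 1) (hoth : R.OtherReg lq i z) :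
    Tendsto (fun t : ℂ => t * R.Dop lq O f (R.path i z t)) (𝓝[≠] 0) (𝓝 0) := by
  have hkτ : ∀ τ ∈ O, ∃ k : ℤ, R.coroot i ⬝ᵥ τ = k := fun τ hτ =>
    (hO.int τ hτ i).imp fun k hk => hk.1
  choose! k hk using hkτ
  have hCτ : ∀ τ ∈ O, ∃ C : ℂ,
      Tendsto (fun t : ℂ => t * R.coeff lq τ (R.path i z t)) (𝓝[≠] 0) (𝓝 C) ∧
      ((R.mult i : ℤ) < |k τ| → C = 0) ∧ (k τ = 0 → C = 0) := fun τ hτ =>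
    R.tendsto_mul_coeff hq hO hτ hz hoth (hk τ hτ)
  choose! C hC hC1 hC2 using hCτ
  have hid : Tendsto (fun t : ℂ => t) (𝓝[≠] 0) (𝓝 0) := tendsto_id.mono_left nhdsWithin_le_nhds
  have hp : ContinuousAt (R.path i z) 0 := (R.continuous_path i z).continuousAt
  set B := ∑ τ ∈ O, qpow lq (-2 * ((R.rhoV R.y0 ⬝ᵥ τ : ℝ) : ℂ)) with hB
  have hL : ∃ L, Tendsto (fun t : ℂ => t * R.Dop lq O f (R.path i z t)) (𝓝[≠] 0) (𝓝 L) := by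
    refine ⟨_, ((tendsto_finsetSum O fun τ hτ => (hC τ hτ).mul (tendsto_nhdsNE
      (g := fun t => f (R.path i z t + cvec τ) - f (R.path i z t)) ?_)).add
      (hid.mul (tendsto_nhdsNE (g := fun t => B * f (R.path i z t)) ?_))).congr fun t => ?_⟩
    · exact ((hf.comp ((R.continuous_path i z).add continuous_const)).sub
        (hf.comp (R.continuous_path i z))).continuousAt
    · exact (continuous_const.mul (hf.comp (R.continuous_path i z))).continuousAt
    · rw [Dop, mul_add, Finset.mul_sum]
      congr 1
      refine Finset.sum_congr rfl fun τ _ => ?_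
      ring
  obtain ⟨L, hL⟩ := hL
  have hneg : Tendsto (fun t : ℂ => -t) (𝓝[≠] 0) (𝓝[≠] 0) := by
    refine tendsto_nhdsWithin_of_tendsto_nhds_of_eventually_within _ ?_ ?_
    · simpa using (continuous_neg.tendsto (0 : ℂ)).mono_left nhdsWithin_le_nhds
    · filter_upwards [self_mem_nhdsWithin] with t ht
      simpa using ht
  have h2L := hL.add (hL.comp hneg)
  have hz0 : Tendsto (fun t : ℂ => t * R.odd (R.Dop lq O f) i z t) (𝓝[≠] 0) (𝓝 0) := by
    have hsum : Tendsto (fun t : ℂ => ∑ τ ∈ O, (t * R.coeff lq τ (R.path i z t)) *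
      (R.odd f i (R.trans i τ z) (t + ((R.coroot i ⬝ᵥ τ : ℝ) : ℂ)) - R.odd f i z t) +
      t * (B * R.odd f i z t)) (𝓝[≠] 0) (𝓝 (∑ τ ∈ O, C τ *
      (R.odd f i (R.trans i τ z) (0 + ((R.coroot i ⬝ᵥ τ : ℝ) : ℂ)) - R.odd f i z 0) +
      0 * (B * R.odd f i z 0))) := by
      refine (tendsto_finsetSum O fun τ hτ => (hC τ hτ).mul (tendsto_nhdsNE
        (g := fun t => R.odd f i (R.trans i τ z) (t + ((R.coroot i ⬝ᵥ τ : ℝ) : ℂ)) -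
          R.odd f i z t) ?_)).add (hid.mul (tendsto_nhdsNE (g := fun t => B * R.odd f i z t) ?_))
      · exact (((R.continuous_odd hf i _).comp (continuous_id.add continuous_const)).sub
          (R.continuous_odd hf i z)).continuousAt
      · exact (continuous_const.mul (R.continuous_odd hf i z)).continuousAt
    have h0 : ∑ τ ∈ O, C τ *
      (R.odd f i (R.trans i τ z) (0 + ((R.coroot i ⬝ᵥ τ : ℝ) : ℂ)) - R.odd f i z 0) +
      0 * (B * R.odd f i z 0) = 0 := by
      rw [zero_mul, add_zero]
      refine Finset.sum_eq_zero fun τ hτ => ?_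
      rw [odd_zero, sub_zero, zero_add, hk τ hτ]
      by_cases hm : |k τ| ≤ (R.mult i : ℤ)
      · have := hQI.odd_eq_zero hm (z := R.trans i τ z) (by rwa [coroot_dot_trans])
        push_cast
        rw [this, mul_zero]
      · rw [hC1 τ hτ (not_le.1 hm), zero_mul]
    rw [h0] at hsum
    refine hsum.congr fun t => ?_
    rw [R.Dop_odd hO f hz, mul_add, Finset.mul_sum]
    congr 1
    refine Finset.sum_congr rfl fun τ _ => ?_
    ring
  have : L + L = 0 := by
    refine tendsto_nhds_unique h2L (hz0.congr fun t => ?_)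
    simp only [odd, Function.comp]
    ring
  have hL0 : L = 0 := by
    rw [← two_mul] at this
    exact (mul_eq_zero.1 this).resolve_left two_ne_zero
  rwa [hL0] at hL

theorem continuousAt_coeff {τ : ℝⁿ} {z : ℂⁿ}
    (h : ∀ j, (0 < R.coroot j ⬝ᵥ τ → qbr lq (cvec (R.coroot j) ⬝ᵥ z) ≠ 0) ∧
      (R.coroot j ⬝ᵥ τ = 2 → qbr lq (cvec (R.coroot j) ⬝ᵥ z + 1) ≠ 0)) :
    ContinuousAt (R.coeff lq τ) z := by
  unfold coeff
  refine tendsto_finsetProd _ fun j _ => ?_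
  exact ContinuousAt.comp (g := fac lq (R.mult j) (R.coroot j ⬝ᵥ τ))
    (f := fun z => cvec (R.coroot j) ⬝ᵥ z) (continuousAt_fac (h j).1 (h j).2)
    (differentiable_dot _).continuous.continuousAt

theorem tendsto_mul_Dop_one (hq : NotRootOfUnity lq) {O : Finset ℝⁿ}
    (hO : R.MQ O) {f : ℂⁿ → ℂ} (hf : Continuous f) (hQI : R.QI lq f) {i : ι}
    {z : ℂⁿ} (hz : qpow lq (2 * (cvec (R.coroot i) ⬝ᵥ z + 1)) = 1) (hoth : R.OtherReg lq i z) :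
    Tendsto (fun t : ℂ => t * R.Dop lq O f (R.path i z t)) (𝓝[≠] 0) (𝓝 0) := by
  classical
  have hy : ∀ k : ℤ, k ≠ 1 → qbr lq (cvec (R.coroot i) ⬝ᵥ z + k) ≠ 0 := by
    intro k hk
    have := qbr_add_intCast_ne_zero hq hz (k := k - 1) (by omega)
    convert this using 2
    push_cast; ring
  have hy0 : qbr lq (cvec (R.coroot i) ⬝ᵥ z) ≠ 0 := by
    have := hy 0 (by norm_num); simpa using this
  have hyn : ∀ k : ℤ, k ≠ -1 → qbr lq (-(cvec (R.coroot i) ⬝ᵥ z) + k) ≠ 0 := by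
    intro k hk
    have := hy (-k) (by omega)
    rw [← neg_ne_zero, ← qbr_neg] at this
    convert this using 2
    push_cast; ring
  have hid : Tendsto (fun t : ℂ => t) (𝓝[≠] 0) (𝓝 0) := tendsto_id.mono_left nhdsWithin_le_nhds
  set B := ∑ τ ∈ O, qpow lq (-2 * ((R.rhoV R.y0 ⬝ᵥ τ : ℝ) : ℂ)) with hB
  have hterm : ∀ τ ∈ O, Tendsto (fun t : ℂ => t * (R.coeff lq τ (R.path i z t) *
      (f (R.path i z t + cvec τ) - f (R.path i z t)))) (𝓝[≠] 0) (𝓝 0) := by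
    intro τ hτ
    obtain ⟨k, hk, hk2, hkp, -⟩ := hO.int' hτ i
    have hfc := tendsto_nhdsNE (t0 := 0) (g := fun t => f (R.path i z t + cvec τ) - f (R.path i z t))
      ((hf.comp ((R.continuous_path i z).add continuous_const)).sub
        (hf.comp (R.continuous_path i z))).continuousAt
    have ho := tendsto_nhdsNE (R.tendsto_other hoth τ (γ := R.path i z) (t0 := 0)
      (R.continuous_path i z).continuousAt (R.path_zero i z))
    by_cases hk' : k = 2
    · have hτr := hkp hk'
      obtain ⟨C, hC, hC0⟩ := tendsto_mul_fac_two hq hz (R.mult i)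
      have := (hC.mul ho).mul hfc
      have h0 : C * (∏ j ∈ Finset.univ \ {i, R.neg i}, fac lq (R.mult j) (R.coroot j ⬝ᵥ τ)
          (cvec (R.coroot j) ⬝ᵥ R.path i z 0)) *
          (f (R.path i z 0 + cvec τ) - f (R.path i z 0)) = 0 := by
        rcases Nat.eq_zero_or_pos (R.mult i) with hm | hm
        · rw [hC0 hm, zero_mul, zero_mul]
        · have := hQI i 1 le_rfl hm (R.path i z 1) (by rwa [coroot_dot_path_self])
          have e1 : R.path i (R.path i z 1) ((1 : ℕ) : ℂ) = R.path i z 0 + cvec τ := by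
            rw [hτr]; unfold path; push_cast; module
          have e2 : R.path i (R.path i z 1) (-((1 : ℕ) : ℂ)) = R.path i z 0 := by
            unfold path; push_cast; module
          rw [e1, e2] at this
          rw [this, sub_self, mul_zero]
      rw [h0] at this
      refine this.congr fun t => ?_
      rw [R.coeff_split lq τ _ i, hk, hk', R.coroot_dot_path_self]
      rw [fac_of_nonpos lq _ (k := -((2 : ℤ) : ℝ)) (by norm_num)]
      push_cast
      ring
    · have hc : ContinuousAt (R.coeff lq τ) z := by
        refine R.continuousAt_coeff fun j => ?_
        by_cases h1 : j = i
        · subst h1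
          refine ⟨fun _ => hy0, fun h2 => absurd ?_ hk'⟩
          rw [hk] at h2; exact_mod_cast h2
        by_cases h2 : j = R.neg i
        · subst h2
          have a1 := hyn 0 (by norm_num)
          have a2 := hyn 1 (by norm_num)
          simp only [Int.cast_zero, add_zero, Int.cast_one] at a1 a2
          rw [← neg_dotProduct, ← cvec_neg, ← R.coroot_neg] at a1 a2
          exact ⟨fun _ => a1, fun _ => a2⟩
        · have := hoth j h1 h2
          rw [wall_ne_zero_iff, wall_ne_zero_iff, add_zero] at this
          exact ⟨fun _ => this.1, fun _ => this.2⟩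
      have hc' : ContinuousAt (fun t => R.coeff lq τ (R.path i z t)) 0 :=
        ContinuousAt.comp (g := R.coeff lq τ) (by rwa [path_zero])
          (R.continuous_path i z).continuousAt
      have := hid.mul ((tendsto_nhdsNE hc').mul hfc)
      rwa [zero_mul] at this
  have h2 := hid.mul (tendsto_nhdsNE (t0 := 0) (g := fun t => B * f (R.path i z t))
    (continuous_const.mul (hf.comp (R.continuous_path i z))).continuousAt)
  have := (tendsto_finsetSum O hterm).add h2
  simp only [Finset.sum_const_zero, zero_mul, add_zero] at this
  refine this.congr fun t => ?_
  rw [Dop, mul_add, Finset.mul_sum]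

theorem Dop_continuousAt {O : Finset ℝⁿ} {f : ℂⁿ → ℂ}
    (hf : Continuous f) {z : ℂⁿ} (h : ∀ τ ∈ O, ContinuousAt (R.coeff lq τ) z) :
    ContinuousAt (R.Dop lq O f) z := by
  unfold Dop
  refine ContinuousAt.add (tendsto_finsetSum _ fun τ hτ => ?_) (by fun_prop)
  exact (h τ hτ).mul (by fun_prop)

/-- Points near a point of a wall are regular if the other factors are. -/
theorem eventually_regPt (hq : NotRootOfUnity lq) {i : ι} {z : ℂⁿ} {t0 : ℂ}
    (hoth : R.OtherReg lq i (R.path i z t0)) : ∀ᶠ t in 𝓝[≠] t0, R.RegPt lq (R.path i z t) := by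
  have hone : ∀ j c, (j = i ∨ j = R.neg i) →
      ∀ᶠ t in 𝓝[≠] t0, R.wall lq j c (R.path i z t) ≠ 0 := by
    intro j c hj
    have hsub : Tendsto (fun t : ℂ => t - t0) (𝓝[≠] t0) (𝓝[≠] 0) := by
      refine tendsto_nhdsWithin_of_tendsto_nhds_of_eventually_within _ ?_ ?_
      · have : ContinuousAt (fun t : ℂ => t - t0) t0 := by fun_prop
        simpa using this.tendsto.mono_left nhdsWithin_le_nhds
      · filter_upwards [self_mem_nhdsWithin] with t ht
        simpa [sub_eq_zero] using ht
    have hdot : R.coroot j ⬝ᵥ R.root i ≠ 0 := by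
      rcases hj with rfl | rfl
      · rw [R.coroot_dot_root_self]; norm_num
      · rw [R.coroot_neg, neg_dotProduct, R.coroot_dot_root_self]; norm_num
    have := hsub.eventually (eventually_qpow_ne hq.ne_zero
      (cvec (R.coroot j) ⬝ᵥ R.path i z t0 + c) (((R.coroot j ⬝ᵥ R.root i : ℝ) : ℂ) / 2)
      (div_ne_zero (by exact_mod_cast hdot) two_ne_zero))
    filter_upwards [this] with t ht
    rw [wall, sub_ne_zero]
    convert ht using 3
    rw [R.coroot_dot_path, R.coroot_dot_path]
    ring
  refine Filter.eventually_all.2 fun j => ?_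
  by_cases h1 : j = i
  · exact (hone j 0 (Or.inl h1)).and (hone j 1 (Or.inl h1))
  by_cases h2 : j = R.neg i
  · exact (hone j 0 (Or.inr h2)).and (hone j 1 (Or.inr h2))
  have hc : ∀ c, ContinuousAt (fun t => R.wall lq j c (R.path i z t)) t0 := fun c =>
    ((R.differentiable_wall lq j c).continuous.comp (R.continuous_path i z)).continuousAt
  have h := hoth j h1 h2
  exact (((hc 0).eventually_ne h.1).filter_mono nhdsWithin_le_nhds).and
    (((hc 1).eventually_ne h.2).filter_mono nhdsWithin_le_nhds)

/-- The limit of the antisymmetrized operator at a shifted wall. -/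
theorem tendsto_Dop_odd (hq : NotRootOfUnity lq) {O : Finset ℝⁿ}
    (hO : R.MQ O) {f : ℂⁿ → ℂ} (hf : Differentiable ℂ f) (hQI : R.QI lq f) {i : ι}
    {z : ℂⁿ} (hz : qpow lq (2 * (cvec (R.coroot i) ⬝ᵥ z)) = 1) {s : ℕ} (hs : 1 ≤ s)
    (hsm : s ≤ R.mult i) (hoth : R.OtherReg lq i (R.path i z s)) :
    Tendsto (R.odd (R.Dop lq O f) i z) (𝓝[≠] (s : ℂ)) (𝓝 0) := by
  classical
  set y := cvec (R.coroot i) ⬝ᵥ z with hy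
  have hys : ∀ k : ℤ, (s : ℤ) + k ≠ 0 → qbr lq (y + s + k) ≠ 0 := by
    intro k hk
    have := qbr_add_intCast_ne_zero hq hz hk
    convert this using 2
    push_cast; ring
  have hys0 : ∀ k : ℤ, (s : ℤ) + k = 0 → qbr lq (y + s + k) = 0 := by
    intro k hk
    have : (s : ℂ) + k = 0 := by exact_mod_cast congrArg (Int.cast (R := ℂ)) hk
    rw [add_assoc, this, add_zero, qbr_eq_zero_iff]; exact hz
  have hcod : ∀ z', Continuous (R.odd f i z') := fun z' => R.continuous_odd hf.continuous i z'
  have hos : R.odd f i z s = 0 := by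
    have := hQI.odd_eq_zero (k := s) (by simpa using hsm) hz; exact_mod_cast this
  have hterm : ∀ τ ∈ O, Tendsto (fun t : ℂ => R.coeff lq τ (R.path i z t) *
      (R.odd f i (R.trans i τ z) (t + ((R.coroot i ⬝ᵥ τ : ℝ) : ℂ)) - R.odd f i z t))
      (𝓝[≠] (s : ℂ)) (𝓝 0) := by
    intro τ hτ
    obtain ⟨k, hk, hk2, -, hkn⟩ := hO.int' hτ i
    rw [abs_le] at hk2
    have ho := tendsto_nhdsNE (R.tendsto_other hoth τ (γ := R.path i z) (t0 := s)
      (R.continuous_path i z).continuousAt rfl)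
    by_cases hsing : k = -2 ∧ s = 1
    · obtain ⟨hk', rfl⟩ := hsing
      have hτr := hkn hk'
      have hz1 : qpow lq (2 * ((-(y + 1)) + 1)) = 1 := by
        rw [show 2 * (-(y + 1) + 1) = -(2 * y) by ring, qpow_neg, hz, inv_one]
      obtain ⟨C, hC, -⟩ := tendsto_mul_fac_two hq hz1 (R.mult i)
      have hsub : Tendsto (fun t : ℂ => -(t - 1)) (𝓝[≠] 1) (𝓝[≠] 0) := by
        refine tendsto_nhdsWithin_of_tendsto_nhds_of_eventually_within _ ?_ ?_
        · have : ContinuousAt (fun t : ℂ => -(t - 1)) 1 := by fun_prop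
          simpa using this.tendsto.mono_left nhdsWithin_le_nhds
        · filter_upwards [self_mem_nhdsWithin] with t ht
          simp only [Set.mem_compl_iff, Set.mem_singleton_iff] at ht ⊢
          rw [neg_eq_zero, sub_eq_zero]; exact ht
      have htr : R.path i (R.trans i τ z) = R.path i z := by
        funext t
        have : R.trans i τ z = z := by
          rw [trans, hτr, dotProduct_neg, R.coroot_dot_root_self, cvec_neg]
          push_cast; module
        rw [this]
      have hod : ∀ t, R.odd f i (R.trans i τ z) t = R.odd f i z t := fun t => by
        rw [odd, odd, htr]
      have hdiff : Tendsto (fun t : ℂ => (R.odd f i z (t - 2) - R.odd f i z t) / (-(t - 1)))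
          (𝓝[≠] 1) (𝓝 0) := by
        have hd1 : HasDerivAt (R.odd f i z) (deriv (R.odd f i z) 1) 1 :=
          (R.differentiable_odd hf i z 1).hasDerivAt
        have hd2 : HasDerivAt (fun t : ℂ => R.odd f i z (2 - t)) (deriv (R.odd f i z) 1 * -1) 1 := by
          have h21 : (2 : ℂ) - 1 = 1 := by norm_num
          have hd1' : HasDerivAt (R.odd f i z) (deriv (R.odd f i z) 1) (2 - 1) := by rwa [h21]
          exact hd1'.comp (1 : ℂ) ((hasDerivAt_id (1 : ℂ)).const_sub 2)
        have hd := hd2.add hd1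
        rw [hasDerivAt_iff_tendsto_slope] at hd
        have he : deriv (R.odd f i z) 1 * -1 + deriv (R.odd f i z) 1 = 0 := by ring
        rw [he] at hd
        refine hd.congr fun t => ?_
        have h1 : R.odd f i z 1 = 0 := by simpa using hos
        rw [slope_def_field]
        simp only [Pi.add_apply]
        rw [show (2 : ℂ) - 1 = 1 by norm_num, h1, add_zero, sub_zero,
          show t - 2 = -(2 - t) by ring, R.odd_neg, ← neg_div_neg_eq]
        congr 1; ring
      rw [Nat.cast_one] at ho
      have := ((hC.comp hsub).mul ho).mul hdiff
      rw [mul_zero] at this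
      have hne : ∀ᶠ t in 𝓝[≠] (1 : ℂ), -(t - 1) ≠ 0 := by
        filter_upwards [self_mem_nhdsWithin] with t ht
        simp only [Set.mem_compl_iff, Set.mem_singleton_iff] at ht
        rw [Ne, neg_eq_zero, sub_eq_zero]; exact ht
      rw [Nat.cast_one]
      refine this.congr' ?_
      filter_upwards [hne] with t ht
      rw [R.coeff_split lq τ _ i, hk, hk', R.coroot_dot_path_self, hod]
      rw [fac_of_nonpos lq _ (k := ((-2 : ℤ) : ℝ)) (by norm_num)]
      simp only [Function.comp]
      rw [← hy, show -(y + 1) + -(t - 1) = -(y + t) by ring]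
      push_cast
      rw [show -(-2 : ℝ) = 2 by norm_num, show t + -2 = t - 2 by ring]
      have ht' : t - 1 ≠ 0 := fun h => ht (by rw [h, neg_zero])
      field_simp
    · have hcf : ContinuousAt (fac lq (R.mult i) (k : ℝ)) (y + s) := by
        refine continuousAt_fac (fun _ => ?_) fun _ => ?_
        · have := hys 0 (by omega); simpa using this
        · have := hys 1 (by omega); simpa using this
      have hcn : ContinuousAt (fac lq (R.mult i) (-(k : ℝ))) (-(y + s)) := by
        refine continuousAt_fac (fun _ => ?_) fun h2 => ?_
        · rw [qbr_neg, neg_ne_zero]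
          have := hys 0 (by omega); simpa using this
        · have : k = -2 := by
            have : (k : ℝ) = ((-2 : ℤ) : ℝ) := by push_cast; linarith
            exact_mod_cast this
          have := hys (-1) (by omega)
          rw [← neg_ne_zero, ← qbr_neg] at this
          convert this using 2
          push_cast; ring
      have hc1 : ContinuousAt (fun t : ℂ => fac lq (R.mult i) (k : ℝ) (y + t)) s :=
        ContinuousAt.comp (g := fac lq (R.mult i) (k : ℝ)) hcf (by fun_prop)
      have hc2 : ContinuousAt (fun t : ℂ => fac lq (R.mult i) (-(k : ℝ)) (-(y + t))) s :=
        ContinuousAt.comp (g := fac lq (R.mult i) (-(k : ℝ))) hcn (by fun_prop)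
      have hc3 : ContinuousAt (fun t : ℂ => R.odd f i (R.trans i τ z) (t + (k : ℂ)) -
          R.odd f i z t) s :=
        (((hcod _).comp (continuous_id.add continuous_const)).sub (hcod z)).continuousAt
      have := (tendsto_nhdsNE hc1).mul (((tendsto_nhdsNE hc2).mul ho).mul (tendsto_nhdsNE hc3))
      have h0 : fac lq (R.mult i) (k : ℝ) (y + s) *
          (R.odd f i (R.trans i τ z) (s + (k : ℂ)) - R.odd f i z s) = 0 := by
        rw [hos, sub_zero]
        by_cases hm : |(s : ℤ) + k| ≤ (R.mult i : ℤ)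
        · have := hQI.odd_eq_zero hm (z := R.trans i τ z) (by rwa [coroot_dot_trans])
          push_cast at this
          rw [this, mul_zero]
        · rw [abs_le] at hm
          have hm' : (R.mult i : ℤ) < s + k := by
            by_contra hcon
            exact hm ⟨by omega, by omega⟩
          have hk12 : (k = 1 ∧ R.mult i = s) ∨ (k = 2 ∧ (R.mult i = s ∨ R.mult i = s + 1)) := by
            omega
          have e1 : qbr lq (y + s - s) = 0 := by
            have := hys0 (-s) (by ring); push_cast at this; rwa [← sub_eq_add_neg] at this
          rcases hk12 with ⟨rfl, hs'⟩ | ⟨rfl, hs' | hs'⟩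
          · rw [Int.cast_one, fac_one, hs', e1]; simp
          · rw [Int.cast_ofNat, fac_two, hs', e1]; simp
          · have e2 : qbr lq (y + s - ((s + 1 : ℕ) : ℂ) + 1) = 0 := by
              rw [← e1]; congr 1; push_cast; ring
            rw [Int.cast_ofNat, fac_two, hs', e2]; simp
      have h0' : ∀ a b : ℂ, fac lq (R.mult i) (k : ℝ) (y + s) * (a * b *
          (R.odd f i (R.trans i τ z) (s + (k : ℂ)) - R.odd f i z s)) = 0 := fun a b => by
        linear_combination (a * b) * h0
      rw [h0'] at this
      refine this.congr fun t => ?_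
      rw [R.coeff_split lq τ _ i, hk, R.coroot_dot_path_self]
      push_cast
      ring
  have h2 := tendsto_nhdsNE (t0 := (s : ℂ)) (g := fun t => (∑ τ ∈ O, qpow lq (-2 *
    ((R.rhoV R.y0 ⬝ᵥ τ : ℝ) : ℂ))) * R.odd f i z t) (continuous_const.mul (hcod z)).continuousAt
  rw [hos, mul_zero] at h2
  have := (tendsto_finsetSum O hterm).add h2
  simp only [Finset.sum_const_zero, add_zero] at this
  exact this.congr fun t => (R.Dop_odd hO f hz t).symm

end EuclRoots

namespace EuclRoots

variable (R : EuclRoots ι n) [Fintype ι]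

/-- The shift defining a wall. -/
def sh (a : ι × Bool) : ℂ := if a.2 then 1 else 0

theorem forall_wall_ne_iff {z : ℂⁿ} :
    (∀ a ∈ (Finset.univ : Finset (ι × Bool)), R.wall lq a.1 (sh a) z ≠ 0) ↔ R.RegPt lq z := by
  constructor
  · intro h j
    exact ⟨by simpa [sh] using h (j, false) (Finset.mem_univ _),
      by simpa [sh] using h (j, true) (Finset.mem_univ _)⟩
  · rintro h ⟨j, b⟩ -
    cases b
    · simpa [sh] using (h j).1
    · simpa [sh] using (h j).2

/-- The common denominator of the coefficients. -/
def den (lq : ℂ) (z : ℂⁿ) : ℂ := ∏ a : ι × Bool, R.wall lq a.1 (sh a) z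

theorem den_eq (lq : ℂ) (z : ℂⁿ) : R.den lq z = ∏ j, (R.wall lq j 0 z * R.wall lq j 1 z) := by
  rw [den, Fintype.prod_prod_type]
  refine Finset.prod_congr rfl fun j _ => ?_
  simp [sh, mul_comm]

theorem den_ne_zero_iff {z : ℂⁿ} : R.den lq z ≠ 0 ↔ R.RegPt lq z := by
  rw [den, Finset.prod_ne_zero_iff, forall_wall_ne_iff]

theorem den_mem_expSpan (lq : ℂ) : R.den lq ∈ expSpan lq (R.corootLattice : Set ℝⁿ) :=
  prod_mem_expSpan _ _ _ fun _ _ => R.wall_mem_expSpan lq _ _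

theorem differentiable_den (lq : ℂ) : Differentiable ℂ (R.den lq) :=
  differentiable_of_mem_expSpan (R.den_mem_expSpan lq)

theorem exists_wall_ne_zero (hq : NotRootOfUnity lq) (j : ι) (c : ℂ) :
    ∃ z, R.wall lq j c z ≠ 0 := by
  refine ⟨((1 - c) / 2) • cvec (R.root j), ?_⟩
  rw [wall, sub_ne_zero, dotProduct_smul, cvec_dot_cvec, R.coroot_dot_root_self]
  have := hq 2 (by norm_num)
  convert this using 2
  push_cast; simp only [smul_eq_mul]; ring

theorem exists_den_ne_zero (hq : NotRootOfUnity lq) : ∃ z, R.den lq z ≠ 0 :=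
  exists_prod_ne_zero _ _ (fun _ _ => R.differentiable_wall _ _ _)
    fun _ _ => R.exists_wall_ne_zero hq _ _

theorem residual_regPt (hq : NotRootOfUnity lq) : ∀ᶠ z in residual ℂⁿ, R.RegPt lq z :=
  (residual_ne_zero (R.differentiable_den lq) (R.exists_den_ne_zero hq)).mono
    fun _ h => R.den_ne_zero_iff.1 h

theorem dense_regPt (hq : NotRootOfUnity lq) : Dense {z | R.RegPt lq z} :=
  dense_of_mem_residual (R.residual_regPt hq)

/-- The numerator of a coefficient over the common denominator. -/
def numer (lq : ℂ) (τ : ℝⁿ) (z : ℂⁿ) : ℂ :=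
  ∏ j, ((if 0 < R.coroot j ⬝ᵥ τ then qpow lq (R.mult j) * R.wall lq j (-R.mult j) z
      else R.wall lq j 0 z) *
    if R.coroot j ⬝ᵥ τ = 2 then qpow lq (R.mult j) * R.wall lq j (-R.mult j + 1) z
      else R.wall lq j 1 z)

theorem numer_mem_expSpan (lq : ℂ) (τ : ℝⁿ) :
    R.numer lq τ ∈ expSpan lq (R.corootLattice : Set ℝⁿ) := by
  refine prod_mem_expSpan _ _ _ fun j _ => ?_
  refine mul_mem_expSpan (S := (R.corootLattice : Set ℝⁿ))
    (T := (R.corootLattice : Set ℝⁿ)) (fun s hs t ht => add_mem hs ht)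
    (f := fun z => if 0 < R.coroot j ⬝ᵥ τ then qpow lq (R.mult j) * R.wall lq j (-R.mult j) z
      else R.wall lq j 0 z)
    (g := fun z => if R.coroot j ⬝ᵥ τ = 2 then qpow lq (R.mult j) * R.wall lq j (-R.mult j + 1) z
      else R.wall lq j 1 z) ?_ ?_
  · split_ifs
    · exact const_mul_mem_expSpan _ (R.wall_mem_expSpan lq _ _)
    · exact R.wall_mem_expSpan lq _ _
  · split_ifs
    · exact const_mul_mem_expSpan _ (R.wall_mem_expSpan lq _ _)
    · exact R.wall_mem_expSpan lq _ _

theorem qbr_div_mul_wall {lq y a b w : ℂ} (hw : w = qpow lq (2 * b) - 1) (h : w ≠ 0)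
    (hab : a = b - y) : qbr lq a / qbr lq b * w = qpow lq y * (qpow lq (2 * a) - 1) := by
  rw [qbr_eq lq b, ← hw, qbr_eq lq a, hab, show -(b - y) = -b + y by ring, qpow_add]
  have := qpow_ne_zero lq (-b)
  field_simp

theorem coeff_mul_den (τ : ℝⁿ) {z : ℂⁿ} (h : R.RegPt lq z) :
    R.den lq z * R.coeff lq τ z = R.numer lq τ z := by
  rw [den_eq, coeff, numer, ← Finset.prod_mul_distrib]
  refine Finset.prod_congr rfl fun j _ => ?_
  have h0 := (h j).1
  have h1 := (h j).2
  have e0 := qbr_div_mul_wall (lq := lq) (y := R.mult j)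
    (a := cvec (R.coroot j) ⬝ᵥ z - R.mult j) (b := cvec (R.coroot j) ⬝ᵥ z) (w := R.wall lq j 0 z)
    (by rw [wall, add_zero]) h0 rfl
  have e1 := qbr_div_mul_wall (lq := lq) (y := R.mult j)
    (a := cvec (R.coroot j) ⬝ᵥ z - R.mult j + 1) (b := cvec (R.coroot j) ⬝ᵥ z + 1)
    (w := R.wall lq j 1 z) rfl h1 (by ring)
  rw [mul_comm, fac, mul_mul_mul_comm]
  congr 1
  · split_ifs
    · rw [e0, wall, ← sub_eq_add_neg]
    · rw [one_mul]
  · split_ifs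
    · rw [e1, wall]; congr 3; ring
    · rw [one_mul]

/-- Macdonald operators preserve quasi-invariance. -/
theorem QI_of_eq_Dop (hq : NotRootOfUnity lq) {O : Finset ℝⁿ}
    (hO : R.MQ O) {f h : ℂⁿ → ℂ} (hf : Differentiable ℂ f) (hQI : R.QI lq f)
    (hh : Continuous h) (he : ∀ z, R.RegPt lq z → h z = R.Dop lq O f z) : R.QI lq h := by
  classical
  intro i s hs hsm z hz
  have main := R.eq_zero_on_wall hq
    ((Finset.univ : Finset ((ι × Bool) × Bool)).filter fun a => a.1.1 ≠ i ∧ a.1.1 ≠ R.neg i)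
    (fun a => a.1.1) (fun a => sh a.1 + (if a.2 then 1 else -1) * s *
      ((R.coroot a.1.1 ⬝ᵥ R.root i : ℝ) : ℂ) / 2) (i := i) (c := 0)
    (fun j hj => (Finset.mem_filter.1 hj).2)
    (G := fun z => h (R.path i z s) - h (R.path i z (-s)))
    ((hh.comp (by unfold path; fun_prop)).sub (hh.comp (by unfold path; fun_prop))) ?_ z
    (by rw [wall_eq_zero, add_zero]; exact hz)
  · exact sub_eq_zero.1 main
  clear hz z
  intro z hz hgen
  rw [wall_eq_zero, add_zero] at hz
  have hoth : ∀ b : Bool, R.OtherReg lq i (R.path i z ((if b then 1 else -1) * s)) := by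
    intro b j h1 h2
    have key : ∀ d : Bool, R.wall lq j (sh (j, d)) (R.path i z ((if b then 1 else -1) * s)) ≠ 0 := by
      intro d
      have := hgen ((j, d), b) (by simp [h1, h2])
      simp only [wall] at this ⊢
      rw [R.coroot_dot_path]
      convert this using 4
      ring
    exact ⟨by simpa [sh] using key false, by simpa [sh] using key true⟩
  have hp : R.OtherReg lq i (R.path i z s) := by simpa using hoth true
  have hn : R.OtherReg lq i (R.path i z (-s)) := by simpa using hoth false
  have h1 := R.tendsto_Dop_odd hq hO hf hQI hz hs hsm hp
  have h2 := tendsto_nhdsNE (R.continuous_odd hh i z).continuousAt (t0 := (s : ℂ))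
  have e1 := R.eventually_regPt hq hp
  have e2 := R.eventually_regPt hq hn
  have hneg : Tendsto (fun t : ℂ => -t) (𝓝[≠] (s : ℂ)) (𝓝[≠] (-s : ℂ)) := by
    refine tendsto_nhdsWithin_of_tendsto_nhds_of_eventually_within _ ?_ ?_
    · exact (continuous_neg.tendsto (s : ℂ)).mono_left nhdsWithin_le_nhds
    · filter_upwards [self_mem_nhdsWithin] with t ht
      simpa using ht
  refine tendsto_nhds_unique h2 (h1.congr' ?_)
  filter_upwards [e1, hneg.eventually e2] with t ht1 ht2
  rw [odd, odd, he _ ht1, he _ ht2]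

theorem qpow_dot_add (lq : ℂ) (x z : ℂⁿ) (τ : ℝⁿ) :
    qpow lq (2 * (x ⬝ᵥ (z + cvec τ))) = qpow lq (2 * (x ⬝ᵥ z)) * ex lq τ x := by
  rw [dotProduct_add, mul_add, qpow_add, ex, dotProduct_comm x (cvec τ)]

/-- The reduced operator. -/
theorem Dop_bf (lq : ℂ) (O : Finset ℝⁿ) (x : ℂⁿ) (c : ℝⁿ →₀ ℂ)
    (z : ℂⁿ) : R.Dop lq O (bf lq x c) z = qpow lq (2 * (x ⬝ᵥ z)) *
      (∑ τ ∈ O, R.coeff lq τ z * (ex lq τ x * ep lq c (z + cvec τ) - ep lq c z) +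
      (∑ τ ∈ O, qpow lq (-2 * ((R.rhoV R.y0 ⬝ᵥ τ : ℝ) : ℂ))) * ep lq c z) := by
  rw [Dop, mul_add, Finset.mul_sum]
  congr 1
  · refine Finset.sum_congr rfl fun τ _ => ?_
    rw [bf, bf, qpow_dot_add]; ring
  · rw [bf]; ring

/-- Macdonald operators act on quasi-invariant exponential polynomials. -/
theorem exists_Dop_eq (hq : NotRootOfUnity lq) {O : Finset ℝⁿ}
    (hO : R.MQ O) {S : Set ℝⁿ} (hS : R.Stable S) {x : ℂⁿ} {c : ℝⁿ →₀ ℂ}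
    (hc : (c.support : Set ℝⁿ) ⊆ S) (hQI : R.QI lq (bf lq x c)) :
    ∃ c' : ℝⁿ →₀ ℂ, (c'.support : Set ℝⁿ) ⊆ S ∧ R.QI lq (bf lq x c') ∧
      ∀ z, R.RegPt lq z → R.Dop lq O (bf lq x c) z = bf lq x c' z := by
  set B := ∑ τ ∈ O, qpow lq (-2 * ((R.rhoV R.y0 ⬝ᵥ τ : ℝ) : ℂ)) with hB
  set g : ℂⁿ → ℂ := fun z =>
    ∑ τ ∈ O, R.coeff lq τ z * (ex lq τ x * ep lq c (z + cvec τ) - ep lq c z) + B * ep lq c z with hg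
  set F : ℂⁿ → ℂ := fun z =>
    ∑ τ ∈ O, (R.numer lq τ * fun z => ex lq τ x * ep lq c (z + cvec τ) - ep lq c z) z +
      (R.den lq * fun z => B * ep lq c z) z with hF
  have hcm := ep_mem_expSpan lq hc
  have hadd : ∀ s ∈ (R.corootLattice : Set ℝⁿ), ∀ t ∈ S, s + t ∈ S := fun s hs t ht => by
    rw [add_comm]; exact hS.2 t ht s hs
  have hFm : F ∈ expSpan lq S := by
    have h1 := sum_mem_expSpan O
      (fun τ => R.numer lq τ * fun z => ex lq τ x * ep lq c (z + cvec τ) - ep lq c z)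
      (fun τ _ => mul_mem_expSpan hadd (R.numer_mem_expSpan lq τ)
        (sub_mem (const_mul_mem_expSpan (ex lq τ x) (shift_mem_expSpan (cvec τ) hcm)) hcm))
    exact add_mem h1 (mul_mem_expSpan hadd (R.den_mem_expSpan lq) (const_mul_mem_expSpan B hcm))
  have hbf := differentiable_bf lq x c
  suffices hex : ∃ h ∈ expSpan lq S, ∀ z, (∀ a ∈ (Finset.univ : Finset (ι × Bool)),
      R.wall lq a.1 (sh a) z ≠ 0) → h z = g z by
    obtain ⟨h, hh, he⟩ := hex
    obtain ⟨c', hc', rfl⟩ := mem_expSpan_iff.1 hh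
    have hDe : ∀ z, R.RegPt lq z → R.Dop lq O (bf lq x c) z = bf lq x c' z := by
      intro z hz
      rw [bf, he z (R.forall_wall_ne_iff.2 hz), Dop_bf]
    exact ⟨c', hc', R.QI_of_eq_Dop hq hO hbf hQI (differentiable_bf lq x c').continuous
      fun z hz => (hDe z hz).symm, hDe⟩
  refine R.exists_expSpan_of_removable hq hS (Finset.univ : Finset (ι × Bool))
    (fun a => a.1) sh (f := F) (g := g) hFm ?_ ?_
  · intro z hz
    rw [forall_wall_ne_iff] at hz
    change F z = R.den lq z * g z
    rw [hF, hg]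
    simp only [Pi.mul_apply]
    rw [mul_add, Finset.mul_sum]
    congr 1
    refine Finset.sum_congr rfl fun τ _ => ?_
    rw [← R.coeff_mul_den τ hz]; ring
  · rintro ⟨i, b⟩ - z hz hgen
    have hoth : R.OtherReg lq i z := by
      intro j h1 h2
      have a1 := hgen (j, false) (Finset.mem_univ _) h1 h2
      have a2 := hgen (j, true) (Finset.mem_univ _) h1 h2
      simp only [sh] at a1 a2
      exact ⟨by simpa using a1, by simpa using a2⟩
    have hlim : Tendsto (fun t : ℂ => t * R.Dop lq O (bf lq x c) (R.path i z t)) (𝓝[≠] 0) (𝓝 0) := by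
      cases b
      · refine R.tendsto_mul_Dop_zero hq hO hbf.continuous hQI ?_ hoth
        rw [wall_eq_zero] at hz
        simpa [sh] using hz
      · refine R.tendsto_mul_Dop_one hq hO hbf.continuous hQI ?_ hoth
        rw [wall_eq_zero] at hz
        simpa [sh] using hz
    have hE : Tendsto (fun t : ℂ => (qpow lq (2 * (x ⬝ᵥ R.path i z t)))⁻¹) (𝓝[≠] 0)
        (𝓝 ((qpow lq (2 * (x ⬝ᵥ R.path i z 0)))⁻¹)) := by
      refine tendsto_nhdsNE (g := fun t : ℂ => (qpow lq (2 * (x ⬝ᵥ R.path i z t)))⁻¹) ?_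
      have hc1 : Continuous (fun t : ℂ => qpow lq (2 * (x ⬝ᵥ R.path i z t))) :=
        (differentiable_qpow lq).continuous.comp (continuous_const.mul
          ((differentiable_dot x).continuous.comp (R.continuous_path i z)))
      exact hc1.continuousAt.inv₀ (qpow_ne_zero _ _)
    have := hlim.mul hE
    rw [zero_mul] at this
    refine this.congr fun t => ?_
    rw [Dop_bf]
    have := qpow_ne_zero lq (2 * (x ⬝ᵥ R.path i z t))
    simp only [hg]
    rw [mul_comm (qpow _ _), ← mul_assoc, mul_inv_cancel_right₀ this]

/-! ### Asymptotics -/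

theorem tendsto_qbr_div (hlq : lq ≠ 0) {a : ℝ} (ha : a ≠ 0) (y b : ℂ) (m : ℕ) :
    Tendsto (fun t : ℝ => qbr lq (y + t / (2 * lq) * a - m + b) / qbr lq (y + t / (2 * lq) * a + b))
      atTop (𝓝 (qpow lq (-((SignType.sign a : ℝ) : ℂ) * m))) := by
  have hq1 : ∀ t : ℝ, qpow lq (2 * (t / (2 * lq) * a)) = (Real.exp (t * a) : ℂ) := by
    intro t
    rw [qpow]; push_cast; congr 1; field_simp
  rcases lt_or_gt_of_ne ha with h | h
  · have he := tendsto_exp_neg h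
    have h1 : ∀ u : ℂ, Tendsto (fun t : ℝ => qpow lq (2 * u) * (Real.exp (t * a) : ℂ) - 1) atTop
        (𝓝 (-1)) := by
      intro u
      have := (he.const_mul (qpow lq (2 * u))).sub_const 1
      simpa using this
    have := ((h1 (y - m + b)).div (h1 (y + b)) (by norm_num)).const_mul (qpow lq m)
    rw [div_self (by norm_num), mul_one] at this
    rw [sign_neg h]
    simp only [SignType.coe_neg_one, Complex.ofReal_neg, Complex.ofReal_one, _root_.neg_neg, one_mul]
    refine this.congr fun t => ?_
    simp only [Pi.div_apply]
    rw [qbr_eq, qbr_eq, ← hq1, ← qpow_add _ (2 * (y - m + b)), ← qpow_add _ (2 * (y + b)),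
      show -(y + t / (2 * lq) * a - m + b) = -(y + t / (2 * lq) * a + b) + m by ring,
      qpow_add _ (-(y + t / (2 * lq) * a + b)),
      show 2 * (y - m + b) + 2 * (t / (2 * lq) * a) = 2 * (y + t / (2 * lq) * a - m + b) by ring,
      show 2 * (y + b) + 2 * (t / (2 * lq) * a) = 2 * (y + t / (2 * lq) * a + b) by ring]
    have := qpow_ne_zero lq (-(y + t / (2 * lq) * a + b))
    rw [mul_assoc, mul_div_mul_left _ _ this, mul_div_assoc]
  · have he := tendsto_exp_neg (neg_neg_of_pos h)
    have h1 : ∀ u : ℂ, Tendsto (fun t : ℝ => 1 - qpow lq (-(2 * u)) * (Real.exp (t * -a) : ℂ)) atTop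
        (𝓝 1) := by
      intro u
      have := (he.const_mul (qpow lq (-(2 * u)))).const_sub 1
      simpa using this
    have := ((h1 (y - m + b)).div (h1 (y + b)) (by norm_num)).const_mul (qpow lq (-m))
    rw [div_self (by norm_num), mul_one] at this
    rw [sign_pos h]
    simp only [SignType.coe_one, Complex.ofReal_one, neg_mul, one_mul]
    refine this.congr fun t => ?_
    have hq2 : (Real.exp (t * -a) : ℂ) = qpow lq (-(2 * (t / (2 * lq) * a))) := by
      rw [qpow_neg, hq1, mul_neg, Real.exp_neg]; push_cast; rfl
    have hqb : ∀ u, qbr lq u = qpow lq u * (1 - qpow lq (-(2 * u))) := by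
      intro u
      rw [qbr, mul_sub, mul_one, ← qpow_add]; congr 2; ring
    simp only [Pi.div_apply]
    rw [hqb, hqb, hq2, ← qpow_add _ (-(2 * (y - m + b))), ← qpow_add _ (-(2 * (y + b))),
      show (y + t / (2 * lq) * a - m + b) = (y + t / (2 * lq) * a + b) + -m by ring,
      qpow_add _ (y + t / (2 * lq) * a + b),
      show -(2 * (y - m + b)) + -(2 * (t / (2 * lq) * a)) =
        -(2 * (y + t / (2 * lq) * a + b + -m)) by ring,
      show -(2 * (y + b)) + -(2 * (t / (2 * lq) * a)) = -(2 * (y + t / (2 * lq) * a + b)) by ring]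
    have := qpow_ne_zero lq (y + t / (2 * lq) * a + b)
    rw [mul_assoc, mul_div_mul_left _ _ this, mul_div_assoc]

theorem tendsto_fac (hlq : lq ≠ 0) {a : ℝ} (ha : a ≠ 0) (y : ℂ) (m : ℕ) {k : ℤ}
    (hk : |k| ≤ 2) : Tendsto (fun t : ℝ => fac lq m k (y + t / (2 * lq) * a)) atTop
      (𝓝 (qpow lq (-(((if (0 : ℝ) < k then (SignType.sign a : ℝ) * m * k else 0 : ℝ)) : ℂ)))) := by
  rw [abs_le] at hk
  rcases (by omega : k ≤ 0 ∨ k = 1 ∨ k = 2) with h | rfl | rfl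
  · have hk0 : (k : ℝ) ≤ 0 := by exact_mod_cast h
    simp only [fac_of_nonpos lq m hk0, if_neg hk0.not_gt, Complex.ofReal_zero, neg_zero, qpow_zero]
    exact tendsto_const_nhds
  · have := tendsto_qbr_div hlq ha y 0 m
    simp only [add_zero] at this
    simp only [Int.cast_one, fac_one, zero_lt_one, if_true, mul_one]
    push_cast
    rwa [neg_mul] at this
  · have h1 := tendsto_qbr_div hlq ha y 0 m
    have h2 := tendsto_qbr_div hlq ha y 1 m
    simp only [add_zero] at h1
    have := h1.mul h2
    rw [← qpow_add] at this
    simp only [Int.cast_ofNat, fac_two, zero_lt_two, if_true]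
    push_cast
    convert this using 3
    ring

theorem tendsto_coeff_ray (hlq : lq ≠ 0) {O : Finset ℝⁿ} (hO : R.MQ O)
    {τ : ℝⁿ} (hτ : τ ∈ O) {v : ℝⁿ} (hv : R.Reg v) (z : ℂⁿ) :
    Tendsto (fun t : ℝ => R.coeff lq τ (ray lq z v t)) atTop
      (𝓝 (qpow lq (-2 * ((R.rhoV v ⬝ᵥ τ : ℝ) : ℂ)))) := by
  classical
  have hprod : ∀ (s : Finset ι) (u : ι → ℂ), ∏ j ∈ s, qpow lq (u j) = qpow lq (∑ j ∈ s, u j) := by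
    intro s u
    induction s using Finset.induction_on with
    | empty => simp [qpow_zero]
    | insert a s ha ih => rw [Finset.prod_insert ha, Finset.sum_insert ha, qpow_add, ih]
  have h2 : 2 * (R.rhoV v ⬝ᵥ τ) = ∑ j, if 0 < R.coroot j ⬝ᵥ τ then
      (SignType.sign (R.coroot j ⬝ᵥ v) : ℝ) * R.mult j * (R.coroot j ⬝ᵥ τ) else 0 := by
    rw [← Finset.sum_filter, R.sum_filter_pos, rhoV_dot]
    · ring
    · intro j
      rw [R.coroot_neg, neg_dotProduct, Left.sign_neg, R.mult_neg, neg_dotProduct]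
      simp
    · intro j; rw [R.coroot_neg, neg_dotProduct]
    · intro j hj; rw [hj, mul_zero]
  have h3 : qpow lq (-2 * ((R.rhoV v ⬝ᵥ τ : ℝ) : ℂ)) = ∏ j, qpow lq (-(((if 0 < R.coroot j ⬝ᵥ τ then
      (SignType.sign (R.coroot j ⬝ᵥ v) : ℝ) * R.mult j * (R.coroot j ⬝ᵥ τ) else 0 : ℝ)) : ℂ)) := by
    rw [hprod, Finset.sum_neg_distrib, ← Complex.ofReal_sum, ← h2]
    push_cast; congr 1; ring
  rw [h3]
  unfold coeff
  refine tendsto_finsetProd _ fun j _ => ?_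
  obtain ⟨k, hk, hk2, -, -⟩ := hO.int' hτ j
  have := tendsto_fac hlq (R.dual_reg.2 hv j) (cvec (R.coroot j) ⬝ᵥ z) (R.mult j) hk2
  simp only [dot_ray, hk]
  exact this

theorem eventually_regPt_ray (hlq : lq ≠ 0) {v : ℝⁿ} (hv : R.Reg v)
    (z : ℂⁿ) : ∀ᶠ t in atTop, R.RegPt lq (ray lq z v t) := by
  have key : ∀ j c, ∀ᶠ t in (atTop : Filter ℝ), R.wall lq j c (ray lq z v t) ≠ 0 := by
    intro j c
    have hw : ∀ t : ℝ, R.wall lq j c (ray lq z v t) =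
        qpow lq (2 * c) * ex lq (R.coroot j) z * (Real.exp (t * (R.coroot j ⬝ᵥ v)) : ℂ) - 1 := by
      intro t; rw [wall_eq, ex_ray hlq]; ring
    rcases lt_or_gt_of_ne (R.dual_reg.2 hv j) with h | h
    · have := ((tendsto_exp_neg h).const_mul
        (qpow lq (2 * c) * ex lq (R.coroot j) z)).sub_const 1
      rw [mul_zero, zero_sub] at this
      filter_upwards [this.eventually_ne (neg_ne_zero.2 one_ne_zero)] with t ht
      rw [hw]; exact ht
    · have := (tendsto_exp_neg (neg_neg_of_pos h))
      have h0 : qpow lq (2 * c) * ex lq (R.coroot j) z ≠ 0 :=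
        mul_ne_zero (qpow_ne_zero _ _) (ex_ne_zero _ _ _)
      filter_upwards [this.eventually_ne h0.symm] with t ht
      rw [hw, sub_ne_zero]
      intro he
      apply ht
      rw [mul_neg, Real.exp_neg, Complex.ofReal_inv]
      exact (eq_inv_of_mul_eq_one_left he).symm
  exact Filter.eventually_all.2 fun j => (key j 0).and (key j 1)

/-- The orbit sum. -/
def mO (lq : ℂ) (O : Finset ℝⁿ) (x : ℂⁿ) : ℂ := ∑ τ ∈ O, ex lq τ x

/-- Faces of the result of applying a Macdonald operator. -/
theorem Dop_face (hlq : lq ≠ 0) {O : Finset ℝⁿ} (hO : R.MQ O) {x : ℂⁿ} {c c' : ℝⁿ →₀ ℂ}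
    (hD : ∀ z, R.RegPt lq z → R.Dop lq O (bf lq x c) z = bf lq x c' z) {v : ℝⁿ}
    (hv : R.Reg v) {θ : ℝ} (hc : ∀ ν ∈ c.support, ν ⬝ᵥ v ≤ θ) : (∀ ν ∈ c'.support, ν ⬝ᵥ v ≤ θ) ∧
      ∀ ν, ν ⬝ᵥ v = θ → c' ν = mO lq O (x + cvec (ν - R.rhoV v)) * c ν := by
  classical
  set c0 := c.filter (fun ν => ν ⬝ᵥ v = θ) with hc0
  have hB : ∑ τ ∈ O, qpow lq (-2 * ((R.rhoV R.y0 ⬝ᵥ τ : ℝ) : ℂ)) =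
      ∑ τ ∈ O, qpow lq (-2 * ((R.rhoV v ⬝ᵥ τ : ℝ) : ℂ)) :=
    R.sum_rhoV_eq (fun r : ℝ => qpow lq (-2 * (r : ℂ))) O hO.s_mem R.reg_y0 hv
  have hlim : ∀ z, Tendsto (fun t : ℝ => (Real.exp (-(t * θ)) : ℂ) * ep lq c' (ray lq z v t)) atTop
      (𝓝 (ep lq (c0.mapRange id rfl) z * 0 + ∑ τ ∈ O, qpow lq (-2 * ((R.rhoV v ⬝ᵥ τ : ℝ) : ℂ)) *
        ex lq τ x * ep lq c0 (z + cvec τ))) := by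
    intro z
    have h1 : Tendsto (fun t : ℝ => ∑ τ ∈ O, R.coeff lq τ (ray lq z v t) *
        (ex lq τ x * ((Real.exp (-(t * θ)) : ℂ) * ep lq c (ray lq (z + cvec τ) v t)) -
          (Real.exp (-(t * θ)) : ℂ) * ep lq c (ray lq z v t)) +
        (∑ τ ∈ O, qpow lq (-2 * ((R.rhoV R.y0 ⬝ᵥ τ : ℝ) : ℂ))) *
          ((Real.exp (-(t * θ)) : ℂ) * ep lq c (ray lq z v t))) atTop
        (𝓝 (∑ τ ∈ O, qpow lq (-2 * ((R.rhoV v ⬝ᵥ τ : ℝ) : ℂ)) *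
          (ex lq τ x * ep lq c0 (z + cvec τ) - ep lq c0 z) +
          (∑ τ ∈ O, qpow lq (-2 * ((R.rhoV R.y0 ⬝ᵥ τ : ℝ) : ℂ))) * ep lq c0 z)) := by
      refine (tendsto_finsetSum O fun τ hτ => (R.tendsto_coeff_ray hlq hO hτ hv z).mul
        (((tendsto_ep_ray_face hlq c v θ hc _).const_mul _).sub
          (tendsto_ep_ray_face hlq c v θ hc z))).add
        ((tendsto_ep_ray_face hlq c v θ hc z).const_mul _)
    have h2 : ∑ τ ∈ O, qpow lq (-2 * ((R.rhoV v ⬝ᵥ τ : ℝ) : ℂ)) *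
          (ex lq τ x * ep lq c0 (z + cvec τ) - ep lq c0 z) +
          (∑ τ ∈ O, qpow lq (-2 * ((R.rhoV R.y0 ⬝ᵥ τ : ℝ) : ℂ))) * ep lq c0 z =
          ep lq (c0.mapRange id rfl) z * 0 + ∑ τ ∈ O, qpow lq (-2 * ((R.rhoV v ⬝ᵥ τ : ℝ) : ℂ)) *
        ex lq τ x * ep lq c0 (z + cvec τ) := by
      rw [hB, Finset.sum_mul, ← Finset.sum_add_distrib, mul_zero, zero_add]
      refine Finset.sum_congr rfl fun τ _ => ?_
      ring
    rw [h2] at h1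
    refine h1.congr' ?_
    filter_upwards [R.eventually_regPt_ray hlq hv z] with t ht
    have := hD _ ht
    rw [Dop_bf, bf] at this
    have := mul_left_cancel₀ (qpow_ne_zero _ _) this
    rw [← this, mul_add, Finset.mul_sum]
    congr 1
    · refine Finset.sum_congr rfl fun τ _ => ?_
      rw [ray_add]; ring
    · ring
  obtain ⟨h1, h2⟩ := face_of_tendsto hlq hlim
  refine ⟨h1, fun ν hν => ?_⟩
  set d : ℝⁿ →₀ ℂ :=
    ∑ μ ∈ c0.support, Finsupp.single μ (mO lq O (x + cvec (μ - R.rhoV v)) * c μ) with hd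
  have h3 : c'.filter (fun ν => ν ⬝ᵥ v = θ) = d := by
    refine ep_injective' hlq fun z => ?_
    rw [h2, hd, ep_sum, mul_zero, zero_add]
    simp only [ep_single]
    have : ∀ τ ∈ O, qpow lq (-2 * ((R.rhoV v ⬝ᵥ τ : ℝ) : ℂ)) * ex lq τ x * ep lq c0 (z + cvec τ) =
        ∑ μ ∈ c0.support, ex lq τ (x + cvec (μ - R.rhoV v)) * c μ * ex lq μ z := by
      intro τ _
      rw [ep_eq_sum lq c0 _ subset_rfl, Finset.mul_sum]
      refine Finset.sum_congr rfl fun μ hμ => ?_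
      have hμc : c0 μ = c μ := by
        rw [hc0, Finsupp.filter_apply, if_pos]
        rw [hc0, Finsupp.support_filter, Finset.mem_filter] at hμ
        exact hμ.2
      have h4 : qpow lq (-2 * ((R.rhoV v ⬝ᵥ τ : ℝ) : ℂ)) = (ex lq τ (cvec (R.rhoV v)))⁻¹ := by
        rw [ex, cvec_dot_cvec, ← qpow_neg, dotProduct_comm τ]; congr 1; ring
      rw [hμc, h4, cvec_sub, sub_eq_add_neg, ex_apply_add, ex_apply_add, ex_apply_add,
        ex_apply_neg, ex_cvec_comm lq μ τ]
      ring
    rw [Finset.sum_congr rfl this, Finset.sum_comm]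
    refine Finset.sum_congr rfl fun μ _ => ?_
    rw [mO, Finset.sum_mul, Finset.sum_mul]
  have h5 := DFunLike.congr_fun h3 ν
  rw [Finsupp.filter_apply, if_pos hν, hd, Finsupp.finsetSum_apply] at h5
  rw [h5]
  simp only [Finsupp.single_apply]
  rw [Finset.sum_ite_eq' ]
  split_ifs with h6
  · rfl
  · have : c ν = 0 := by
      rw [Finsupp.notMem_support_iff, hc0, Finsupp.filter_apply, if_pos hν] at h6
      exact h6
    rw [this, mul_zero]

/-- Macdonald operators preserve bounds on the exponents. -/
theorem Dop_body (hlq : lq ≠ 0) {O : Finset ℝⁿ} (hO : R.MQ O) {x : ℂⁿ} {c c' : ℝⁿ →₀ ℂ}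
    (hD : ∀ z, R.RegPt lq z → R.Dop lq O (bf lq x c) z = bf lq x c' z) {H : ℝⁿ → ℝ}
    (hH : Continuous H) (hc : (c.support : Set ℝⁿ) ⊆ body H) : (c'.support : Set ℝⁿ) ⊆ body H := by
  classical
  intro ν hν
  have hcl : IsClosed {v : ℝⁿ | ν ⬝ᵥ v ≤ H v} := by
    refine isClosed_le ?_ hH
    unfold dotProduct; fun_prop
  have hd := dense_dot_ne_zero (Finset.univ.image R.root) (by
    intro d hd; obtain ⟨i, -, rfl⟩ := Finset.mem_image.1 hd; exact R.root_ne i)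
  have : closure {v : ℝⁿ | ∀ d ∈ Finset.univ.image R.root, d ⬝ᵥ v ≠ 0} ⊆
      {v : ℝⁿ | ν ⬝ᵥ v ≤ H v} := by
    refine closure_minimal ?_ hcl
    intro v hv
    have hreg : R.Reg v := fun i => hv _ (Finset.mem_image_of_mem _ (Finset.mem_univ i))
    exact (R.Dop_face hlq hO hD hreg fun μ hμ => hc hμ v).1 ν hν
  intro v
  exact this (by rw [hd.closure_eq]; trivial)

end EuclRoots

namespace EuclRoots

variable (R : EuclRoots ι n) [Fintype ι]

/-! ### Short roots -/

/-- Roots of minimal length. -/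
def Short (i : ι) : Prop := ∀ j, R.root i ⬝ᵥ R.root i ≤ R.root j ⬝ᵥ R.root j

open Classical in
/-- The set of short roots. -/
def Osh : Finset ℝⁿ := (Finset.univ.filter R.Short).image R.root

theorem mem_Osh {τ : ℝⁿ} : τ ∈ R.Osh ↔ ∃ i, R.Short i ∧ R.root i = τ := by
  simp [Osh]

theorem Short.refl {R : EuclRoots ι n} {j : ι} (h : R.Short j) (i : ι) : R.Short (R.refl i j) := by
  intro k
  rw [R.root_refl', s_dot_s]
  exact h k

theorem exists_short : ∃ i, R.Short i := by
  have := R.nonempty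
  obtain ⟨i, -, hi⟩ := Finset.univ.exists_min_image (fun i => R.root i ⬝ᵥ R.root i)
    Finset.univ_nonempty
  exact ⟨i, fun j => hi j (Finset.mem_univ j)⟩

theorem abs_coroot_dot_short {i j : ι} (h : R.Short j) : |R.coroot i ⬝ᵥ R.root j| ≤ 2 := by
  have h1 := R.root_sq_pos i
  have hj := h i
  have key : ∀ ε : ℝ, ε ^ 2 = 1 → -(2 * ε * (R.root i ⬝ᵥ R.root j)) ≤
      2 * (R.root i ⬝ᵥ R.root i) := by
    intro ε hε
    have h2 : 0 ≤ (R.root j + ε • R.root i) ⬝ᵥ (R.root j + ε • R.root i) :=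
      Finset.sum_nonneg fun k _ => mul_self_nonneg _
    rw [add_dotProduct, dotProduct_add, dotProduct_add, smul_dotProduct, dotProduct_smul,
      smul_dotProduct, dotProduct_smul, dotProduct_comm (R.root j) (R.root i)] at h2
    simp only [smul_eq_mul] at h2
    have : ε * (ε * (R.root i ⬝ᵥ R.root i)) = R.root i ⬝ᵥ R.root i := by
      rw [← mul_assoc, ← sq, hε, one_mul]
    linarith
  rw [R.coroot_dot, abs_le, div_mul_eq_mul_div, le_div_iff₀ h1, div_le_iff₀ h1]
  have a := key 1 (by norm_num)
  have b := key (-1) (by norm_num)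
  constructor <;> linarith

theorem MQ_Osh : R.MQ R.Osh where
  s_mem i τ hτ := by
    obtain ⟨j, hj, rfl⟩ := R.mem_Osh.1 hτ
    exact R.mem_Osh.2 ⟨_, hj.refl i, R.root_refl' i j⟩
  int τ hτ i := by
    obtain ⟨j, hj, rfl⟩ := R.mem_Osh.1 hτ
    obtain ⟨k, hk⟩ := R.int j i
    rw [dotProduct_comm] at hk
    have hab := R.abs_coroot_dot_short (i := i) hj
    refine ⟨k, hk, ?_⟩
    by_cases h1 : |k| ≤ 1
    · exact Or.inl h1
    right
    rw [hk] at hab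
    have hab' : |k| ≤ 2 := by exact_mod_cast hab
    rw [abs_le] at h1 hab'
    have hri := R.root_sq_pos i
    have hsh := hj i
    have main : ∀ ε : ℝ, ε ^ 2 = 1 → (k : ℝ) = 2 * ε → R.root j = ε • R.root i := by
      intro ε hε hkε
      rw [R.coroot_dot, hkε, div_mul_eq_mul_div, div_eq_iff hri.ne'] at hk
      have : (R.root j - ε • R.root i) ⬝ᵥ (R.root j - ε • R.root i) ≤ 0 := by
        rw [sub_dotProduct, dotProduct_sub, dotProduct_sub, smul_dotProduct, dotProduct_smul,
          smul_dotProduct, dotProduct_smul, dotProduct_comm (R.root j) (R.root i)]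
        simp only [smul_eq_mul]
        have e1 : R.root i ⬝ᵥ R.root j = ε * (R.root i ⬝ᵥ R.root i) := by linarith
        have e2 : ε * (ε * (R.root i ⬝ᵥ R.root i)) = R.root i ⬝ᵥ R.root i := by
          rw [← mul_assoc, ← sq, hε, one_mul]
        rw [e1]; linarith
      have h0 : 0 ≤ (R.root j - ε • R.root i) ⬝ᵥ (R.root j - ε • R.root i) :=
        Finset.sum_nonneg fun k _ => mul_self_nonneg _
      exact sub_eq_zero.1 (dotProduct_self_eq_zero.1 (le_antisymm this h0))
    rcases (by omega : k = 2 ∨ k = -2) with rfl | rfl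
    · left; simpa using main 1 (by norm_num) (by norm_num)
    · right; simpa using main (-1) (by norm_num) (by norm_num)

theorem Osh_subset : (R.Osh : Set ℝⁿ) ⊆ R.dual.corootLattice := by
  intro τ hτ
  obtain ⟨j, -, rfl⟩ := R.mem_Osh.1 hτ
  exact R.dual.coroot_mem j

theorem eq_zero_of_forall_dot_Osh {v : ℝⁿ} (h : ∀ τ ∈ R.Osh, τ ⬝ᵥ v = 0) : v = 0 := by
  have hU : Submodule.span ℝ (R.Osh : Set ℝⁿ) = ⊤ := by
    refine (R.irr _ fun i u hu => ?_).resolve_left fun h0 => ?_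
    · induction hu using Submodule.span_induction with
      | mem x hx => exact Submodule.subset_span (R.MQ_Osh.s_mem i x hx)
      | zero => simp
      | add x y _ _ hx hy =>
        have := add_mem hx hy
        convert this using 1
        rw [add_dotProduct]; module
      | smul a x _ hx =>
        have := Submodule.smul_mem _ a hx
        convert this using 1
        rw [smul_dotProduct]; simp only [smul_eq_mul]; module
    · obtain ⟨i, hi⟩ := R.exists_short
      have : R.root i ∈ Submodule.span ℝ (R.Osh : Set ℝⁿ) :=
        Submodule.subset_span (R.mem_Osh.2 ⟨i, hi, rfl⟩)
      rw [h0, Submodule.mem_bot] at this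
      exact R.root_ne i this
  have hv : v ∈ Submodule.span ℝ (R.Osh : Set ℝⁿ) := by rw [hU]; trivial
  have : ∀ w ∈ Submodule.span ℝ (R.Osh : Set ℝⁿ), w ⬝ᵥ v = 0 := by
    intro w hw
    induction hw using Submodule.span_induction with
    | mem x hx => exact h x hx
    | zero => simp
    | add x y _ _ hx hy => rw [add_dotProduct, hx, hy, add_zero]
    | smul a x _ hx => rw [smul_dotProduct, hx, smul_zero]
  exact dotProduct_self_eq_zero.1 (this v hv)

/-! ### Walls -/

theorem exists_wall_point (i : ι) : ∃ v1 : ℝⁿ, R.root i ⬝ᵥ v1 = 0 ∧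
    ∀ j, j ≠ i → j ≠ R.neg i → R.root j ⬝ᵥ v1 ≠ 0 := by
  classical
  set D : Finset ℝⁿ := (Finset.univ.image fun j =>
      R.root j - (R.root j ⬝ᵥ R.coroot i / 2) • R.root i).filter (· ≠ 0) with hD
  obtain ⟨u, hu⟩ := (dense_dot_ne_zero D (by simp [hD])).nonempty
  refine ⟨u - (R.coroot i ⬝ᵥ u / 2) • R.root i, ?_, fun j h1 h2 => ?_⟩
  · rw [dotProduct_sub, dotProduct_smul, R.coroot_dot, smul_eq_mul]
    have := R.root_sq_pos i
    field_simp
    ring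
  · have hd : R.root j - (R.root j ⬝ᵥ R.coroot i / 2) • R.root i ≠ 0 := by
      intro h0
      rcases R.eq_or_eq_neg_of_smul (sub_eq_zero.1 h0) with h | h
      · exact h1 h
      · exact h2 h
    have := hu _ (Finset.mem_filter.2 ⟨Finset.mem_image_of_mem _ (Finset.mem_univ j), hd⟩)
    convert this using 1
    rw [sub_dotProduct, dotProduct_sub, smul_dotProduct, dotProduct_smul, R.coroot_dot,
      dotProduct_comm (R.root j) (R.coroot i), R.coroot_dot, dotProduct_comm (R.root j) (R.root i)]
    simp only [smul_eq_mul]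
    ring

theorem exists_adj {i : ι} {v1 : ℝⁿ} (h : R.root i ⬝ᵥ v1 = 0)
    (hne : ∀ j, j ≠ i → j ≠ R.neg i → R.root j ⬝ᵥ v1 ≠ 0) : ∃ v w, R.Adj i v1 v w := by
  have hc : ∀ j, Continuous fun t : ℝ => R.root j ⬝ᵥ (v1 + t • R.root i) := by
    intro j; unfold dotProduct; fun_prop
  have hev : ∀ᶠ t in 𝓝 (0 : ℝ), ∀ j, j ≠ i → j ≠ R.neg i →
      SignType.sign (R.root j ⬝ᵥ (v1 + t • R.root i)) = SignType.sign (R.root j ⬝ᵥ v1) := by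
    refine Filter.eventually_all.2 fun j => ?_
    by_cases hj1 : j = i
    · exact Eventually.of_forall fun t h1 => absurd hj1 h1
    by_cases hj2 : j = R.neg i
    · exact Eventually.of_forall fun t _ h2 => absurd hj2 h2
    have h0 : R.root j ⬝ᵥ (v1 + (0 : ℝ) • R.root i) = R.root j ⬝ᵥ v1 := by simp
    rcases lt_or_gt_of_ne (hne j hj1 hj2) with hn | hp
    · filter_upwards [(hc j).continuousAt.eventually_lt continuousAt_const (by rwa [h0])]
        with t ht _ _
      rw [sign_neg hn, sign_neg ht]
    · filter_upwards [continuousAt_const.eventually_lt (hc j).continuousAt (by rwa [h0])]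
        with t ht _ _
      rw [sign_pos hp, sign_pos ht]
  have hneg : ∀ᶠ t in 𝓝 (0 : ℝ), ∀ j, j ≠ i → j ≠ R.neg i →
      SignType.sign (R.root j ⬝ᵥ (v1 + (-t) • R.root i)) = SignType.sign (R.root j ⬝ᵥ v1) := by
    have : Tendsto (fun t : ℝ => -t) (𝓝 0) (𝓝 0) := by
      simpa using (continuous_neg.tendsto (0 : ℝ))
    exact this.eventually hev
  obtain ⟨t, ⟨ht1, ht2⟩, ht3⟩ := (((hev.and hneg).filter_mono nhdsWithin_le_nhds).and
    (self_mem_nhdsWithin (a := (0 : ℝ)) (s := Set.Ioi 0))).exists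
  have ht : 0 < t := ht3
  have hr := R.root_sq_pos i
  refine ⟨v1 + t • R.root i, v1 + (-t) • R.root i, h, hne, ht1, ht2, ?_, ?_⟩
  · rw [dotProduct_add, h, dotProduct_smul, smul_eq_mul, zero_add]; positivity
  · rw [dotProduct_add, h, dotProduct_smul, smul_eq_mul, zero_add]; nlinarith

theorem rhoV_sub_mem {v w : ℝⁿ} (hv : R.Reg v) (hw : R.Reg w) :
    R.rhoV v - R.rhoV w ∈ R.corootLattice := by
  refine R.chain (fun w => R.rhoV v - R.rhoV w ∈ R.corootLattice) (fun a b _ hab h => ?_)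
    (fun i v1 a b hab h => ?_) hv hw (by simp)
  · rwa [← R.rhoV_congr hab]
  · have h2 : R.rhoV a - R.rhoV b = ((R.mult i : ℤ) : ℝ) • R.coroot i := by
      rw [hab.rhoV_left, hab.rhoV_right]; push_cast; module
    have h3 := add_mem h (h2 ▸ R.intCast_smul_coroot_mem i (R.mult i))
    simpa using h3

theorem rhoV_mem_coweight {v : ℝⁿ} (hv : R.Reg v) : R.rhoV v ∈ R.coweight := by
  intro i
  obtain ⟨v1, h1, h2⟩ := R.exists_wall_point i
  obtain ⟨a, b, hab⟩ := R.exists_adj h1 h2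
  obtain ⟨k, hk⟩ := R.corootLattice_le (R.rhoV_sub_mem hv hab.reg) i
  refine ⟨k + R.mult i, ?_⟩
  rw [sub_dotProduct, sub_eq_iff_eq_add, hab.rhoV_left, add_dotProduct, R.rhoV_dot_root_wall h1,
    smul_dotProduct, R.coroot_dot_root_self] at hk
  rw [hk]; push_cast; simp only [smul_eq_mul]; ring

theorem four_rhoV_mem (v : ℝⁿ) : (4 : ℝ) • R.rhoV v ∈ R.corootLattice := by
  rw [rhoV, smul_smul, show (4 : ℝ) * (1 / 4) = 1 by norm_num, one_smul]
  refine sum_mem fun i _ => ?_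
  have : (SignType.sign (R.coroot i ⬝ᵥ v) : ℝ) * R.mult i =
      (((SignType.sign (R.coroot i ⬝ᵥ v) : ℤ) * R.mult i : ℤ) : ℝ) := by
    push_cast
    rcases SignType.sign (R.coroot i ⬝ᵥ v) with _ | _ | _ <;> simp
  rw [this]
  exact R.intCast_smul_coroot_mem i _

/-! ### Generic spectral parameters -/

/-- The spectral parameters for which the eigenvalues of the Macdonald operator are simple. -/
def Good (lq : ℂ) (x : ℂⁿ) : Prop :=
  Set.InjOn (fun μ : ℝⁿ => mO lq R.Osh (x + cvec μ)) R.coweight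

theorem differentiable_mO (lq : ℂ) (O : Finset ℝⁿ) : Differentiable ℂ (mO lq O) := by
  unfold mO
  exact Differentiable.fun_sum fun τ _ => differentiable_ex lq τ

theorem mO_mem_expSpan (lq : ℂ) {O : Finset ℝⁿ} {S : Set ℝⁿ}
    (h : (O : Set ℝⁿ) ⊆ S) : mO lq O ∈ expSpan lq S :=
  sum_mem_expSpan _ _ fun _ hτ => ex_mem_expSpan lq (h hτ)

theorem Osh_dot_coweight {τ μ : ℝⁿ} (hτ : τ ∈ R.Osh) (hμ : μ ∈ R.coweight) :
    ∃ k : ℤ, τ ⬝ᵥ μ = k := by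
  obtain ⟨j, -, rfl⟩ := R.mem_Osh.1 hτ
  rw [dotProduct_comm]; exact hμ j

theorem ex_eq_one_iff (hq : NotRootOfUnity lq) {τ μ : ℝⁿ} {k : ℤ}
    (h : τ ⬝ᵥ μ = k) : ex lq τ (cvec μ) = 1 ↔ τ ⬝ᵥ μ = 0 := by
  rw [ex, cvec_dot_cvec, h]
  have : (2 : ℂ) * (((k : ℤ) : ℝ) : ℂ) = ((2 * k : ℤ) : ℂ) := by push_cast; ring
  rw [this]
  constructor
  · intro h1
    by_contra hk
    refine hq (2 * k) ?_ h1
    have : k ≠ 0 := by exact_mod_cast hk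
    omega
  · intro h1
    have : k = 0 := by exact_mod_cast h1
    rw [this]; simp [qpow_zero]

theorem exists_mO_sub_ne_zero (hq : NotRootOfUnity lq) {μ μ' : ℝⁿ}
    (hμ : μ ∈ R.coweight) (hμ' : μ' ∈ R.coweight) (hne : μ ≠ μ') :
    ∃ x, mO lq R.Osh (x + cvec μ) - mO lq R.Osh (x + cvec μ') ≠ 0 := by
  by_contra! hcon
  apply hne
  rw [← sub_eq_zero]
  refine R.eq_zero_of_forall_dot_Osh fun τ hτ => ?_
  obtain ⟨k, hk⟩ := R.Osh_dot_coweight hτ (sub_mem hμ hμ')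
  rw [← ex_eq_one_iff hq hk]
  set d : ℝⁿ →₀ ℂ :=
    ∑ τ ∈ R.Osh, Finsupp.single τ (ex lq τ (cvec μ) - ex lq τ (cvec μ')) with hd
  have h0 : d = 0 := by
    refine ep_injective hq.ne_zero fun x => ?_
    rw [hd, ep_sum, ← hcon x, mO, mO, ← Finset.sum_sub_distrib]
    refine Finset.sum_congr rfl fun τ _ => ?_
    rw [ep_single, ex_apply_add, ex_apply_add]; ring
  have h1 := DFunLike.congr_fun h0 τ
  rw [hd, Finsupp.finsetSum_apply] at h1
  simp only [Finsupp.single_apply, Finset.sum_ite_eq', hτ, if_true, Finsupp.coe_zero,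
    Pi.zero_apply] at h1
  rw [cvec_sub, sub_eq_add_neg, ex_apply_add, ex_apply_neg, sub_eq_zero.1 h1,
    mul_inv_cancel₀ (ex_ne_zero _ _ _)]

theorem differentiable_mO_shift (lq : ℂ) (O : Finset ℝⁿ) (μ : ℝⁿ) :
    Differentiable ℂ (fun x => mO lq O (x + cvec μ)) :=
  (differentiable_mO lq O).comp (differentiable_id.add_const _)

theorem countable_coweight : (R.coweight : Set ℝⁿ).Countable := by
  refine Set.MapsTo.countable_of_injOn (f := fun ν : ℝⁿ => fun i => ν ⬝ᵥ R.root i)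
    (t := Set.range fun k : ι → ℤ => fun i => (k i : ℝ)) ?_ ?_ (Set.countable_range _)
  · intro ν hν
    choose k hk using hν
    exact ⟨k, by ext i; exact (hk i).symm⟩
  · intro μ _ ν _ h
    have h0 : μ - ν = 0 := R.eq_zero_of_forall_dot_root fun i => by
      rw [sub_dotProduct, sub_eq_zero]; exact congrFun h i
    exact sub_eq_zero.1 h0

theorem residual_good (hq : NotRootOfUnity lq) : ∀ᶠ x in residual ℂⁿ, R.Good lq x := by
  have h1 : ∀ᶠ x in residual ℂⁿ, ∀ μ ∈ (R.coweight : Set ℝⁿ),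
      ∀ μ' ∈ (R.coweight : Set ℝⁿ),
      mO lq R.Osh (x + cvec μ) = mO lq R.Osh (x + cvec μ') → μ = μ' := by
    rw [eventually_countable_ball R.countable_coweight]
    intro μ hμ
    rw [eventually_countable_ball R.countable_coweight]
    intro μ' hμ'
    by_cases hne : μ = μ'
    · exact Eventually.of_forall fun _ _ => hne
    · refine (residual_ne_zero ((differentiable_mO_shift lq R.Osh μ).sub
        (differentiable_mO_shift lq R.Osh μ'))
        (R.exists_mO_sub_ne_zero hq hμ hμ' hne)).mono fun x hx he => absurd (sub_eq_zero.2 he) hx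
  exact h1.mono fun x hx μ hμ μ' hμ' he => hx μ hμ μ' hμ' he

theorem Good.add {R : EuclRoots ι n} {x : ℂⁿ} (h : R.Good lq x) {μ : ℝⁿ}
    (hμ : μ ∈ R.coweight) : R.Good lq (x + cvec μ) := by
  intro a ha b hb hab
  simp only [add_assoc, ← cvec_add] at hab
  exact add_left_cancel (h (add_mem hμ ha) (add_mem hμ hb) hab)

theorem dense_reg : Dense {v : ℝⁿ | R.Reg v} := by
  classical
  have hd := dense_dot_ne_zero (Finset.univ.image R.root) (by
    intro d hd; obtain ⟨i, -, rfl⟩ := Finset.mem_image.1 hd; exact R.root_ne i)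
  refine hd.mono ?_
  intro v hv i
  exact hv _ (Finset.mem_image_of_mem _ (Finset.mem_univ i))

/-- Directions separating a finite set are available in every chamber. -/
theorem exists_separating (T : Finset ℝⁿ) {v : ℝⁿ} (hv : R.Reg v) :
    ∃ w, (∀ μ ∈ T, ∀ ν ∈ T, μ ≠ ν → μ ⬝ᵥ w ≠ ν ⬝ᵥ w) ∧ R.Reg w ∧ R.rhoV w = R.rhoV v := by
  obtain ⟨w, hw1, hw2⟩ := (dense_separating T ∅ (by simp)).inter_open_nonempty _
      (R.isOpen_setOf_sign v hv) ⟨v, fun i => rfl⟩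
  exact ⟨w, hw2.1, R.reg_of_sign hv hw1, R.rhoV_congr hw1⟩

theorem dense_separating_reg (T : Finset ℝⁿ) :
    Dense {w | (∀ μ ∈ T, ∀ ν ∈ T, μ ≠ ν → μ ⬝ᵥ w ≠ ν ⬝ᵥ w) ∧ R.Reg w} := by
  classical
  have hd := dense_separating T (Finset.univ.image R.root) (by
    intro d hd; obtain ⟨i, -, rfl⟩ := Finset.mem_image.1 hd; exact R.root_ne i)
  refine hd.mono ?_
  intro v hv
  exact ⟨hv.1, fun i => hv.2 _ (Finset.mem_image_of_mem _ (Finset.mem_univ i))⟩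

end EuclRoots

section Interpolation

/-- The coefficients of an exponential polynomial can be recovered from its values on a dense
set. -/
theorem exists_interp (h : lq ≠ 0) {P : Set ℂⁿ} (hP : Dense P)
    (T : Finset ℝⁿ) {ν : ℝⁿ} (hν : ν ∈ T) : ∃ l : ℂⁿ →₀ ℂ, (l.support : Set ℂⁿ) ⊆ P ∧
      ∀ c : ℝⁿ →₀ ℂ, c.support ⊆ T → c ν = l.sum fun p a => a * ep lq c p := by
  classical
  set φ : ℂⁿ → Module.Dual ℂ (T → ℂ) := fun p =>
    ∑ μ : T, ex lq μ p • LinearMap.proj μ with hφ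
  have hφa : ∀ p d, φ p d = ∑ μ : T, d μ * ex lq μ p := by
    intro p d
    simp [hφ, mul_comm]
  set W := Submodule.span ℂ (φ '' P) with hW
  have hWtop : W = ⊤ := by
    rw [← Subspace.dualCoannihilator_dualAnnihilator_eq (W := W)]
    have : W.dualCoannihilator = ⊥ := by
      rw [Submodule.eq_bot_iff]
      intro d hd
      rw [Submodule.mem_dualCoannihilator] at hd
      set c : ℝⁿ →₀ ℂ := ∑ μ : T, Finsupp.single (μ : ℝⁿ) (d μ) with hc
      have hep : ∀ p, ep lq c p = φ p d := by
        intro p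
        rw [hc, ep_sum, hφa]
        simp only [ep_single]
      have hc0 : c = 0 := by
        refine ep_injective h fun z => ?_
        refine congrFun ((differentiable_ep lq c).continuous.ext_on hP
          (continuous_const (y := (0 : ℂ))) fun p hp => ?_) z
        rw [hep]
        exact hd _ (Submodule.subset_span ⟨p, hp, rfl⟩)
      ext μ
      have := DFunLike.congr_fun hc0 (μ : ℝⁿ)
      rw [hc, Finsupp.finsetSum_apply] at this
      simp only [Finsupp.single_apply, Subtype.coe_inj] at this
      simpa using this
    rw [this, Submodule.dualAnnihilator_bot]
  have hmem : (LinearMap.proj (⟨ν, hν⟩ : T) : Module.Dual ℂ (T → ℂ)) ∈ W := by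
    rw [hWtop]; trivial
  rw [hW, Finsupp.mem_span_image_iff_linearCombination] at hmem
  obtain ⟨l, hl, he⟩ := hmem
  refine ⟨l, hl, fun c hc => ?_⟩
  have := LinearMap.congr_fun he (fun μ : T => c μ)
  rw [Finsupp.linearCombination_apply, Finsupp.sum] at this
  simp only [LinearMap.sum_apply, LinearMap.smul_apply, LinearMap.proj_apply, smul_eq_mul] at this
  rw [← this, Finsupp.sum]
  refine Finset.sum_congr rfl fun p _ => ?_
  rw [hφa, ep_eq_sum lq c p hc, ← Finset.sum_coe_sort T]

end Interpolation

namespace EuclRoots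

variable (R : EuclRoots ι n) [Fintype ι]

/-- The reduced Macdonald operator. -/
def red (lq : ℂ) (O : Finset ℝⁿ) (x p : ℂⁿ) : (ℝⁿ →₀ ℂ) →ₗ[ℂ] ℂ :=
  ∑ τ ∈ O, R.coeff lq τ p • (ex lq τ x • (LinearMap.proj (p + cvec τ)).comp (epLin lq) -
    (LinearMap.proj p).comp (epLin lq)) +
    (∑ τ ∈ O, qpow lq (-2 * ((R.rhoV R.y0 ⬝ᵥ τ : ℝ) : ℂ))) • (LinearMap.proj p).comp (epLin lq)

theorem red_apply (lq : ℂ) (O : Finset ℝⁿ) (x p : ℂⁿ) (c : ℝⁿ →₀ ℂ) :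
    R.red lq O x p c = ∑ τ ∈ O, R.coeff lq τ p * (ex lq τ x * ep lq c (p + cvec τ) - ep lq c p) +
      (∑ τ ∈ O, qpow lq (-2 * ((R.rhoV R.y0 ⬝ᵥ τ : ℝ) : ℂ))) * ep lq c p := by
  simp [red, LinearMap.sum_apply, epLin_apply]

theorem Dop_eq_red (lq : ℂ) (O : Finset ℝⁿ) (x : ℂⁿ) (c : ℝⁿ →₀ ℂ)
    (z : ℂⁿ) : R.Dop lq O (bf lq x c) z = qpow lq (2 * (x ⬝ᵥ z)) * R.red lq O x z c := by
  rw [Dop_bf, red_apply]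

open Classical in
/-- Interpolation weights. -/
def interp (lq : ℂ) (T : Finset ℝⁿ) (ν : ℝⁿ) : ℂⁿ →₀ ℂ :=
  if h : ∃ l : ℂⁿ →₀ ℂ, (l.support : Set ℂⁿ) ⊆ {z | R.RegPt lq z} ∧
      ∀ c : ℝⁿ →₀ ℂ, c.support ⊆ T → c ν = l.sum fun p a => a * ep lq c p
  then h.choose else 0

theorem interp_spec (hq : NotRootOfUnity lq) {T : Finset ℝⁿ} {ν : ℝⁿ}
    (hν : ν ∈ T) : ((R.interp lq T ν).support : Set ℂⁿ) ⊆ {z | R.RegPt lq z} ∧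
      ∀ c : ℝⁿ →₀ ℂ, c.support ⊆ T →
        c ν = (R.interp lq T ν).sum fun p a => a * ep lq c p := by
  have h := exists_interp hq.ne_zero (R.dense_regPt hq) T hν
  rw [interp, dif_pos h]
  exact h.choose_spec

/-- The action of the Macdonald operator on coefficients. -/
def Dl (lq : ℂ) (O T : Finset ℝⁿ) (x : ℂⁿ) : (ℝⁿ →₀ ℂ) →ₗ[ℂ] (ℝⁿ →₀ ℂ) :=
  ∑ ν ∈ T, ∑ p ∈ (R.interp lq T ν).support,
    (Finsupp.lsingle ν).comp (R.interp lq T ν p • R.red lq O x p)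

theorem Dl_apply (lq : ℂ) (O T : Finset ℝⁿ) (x : ℂⁿ) (c : ℝⁿ →₀ ℂ) :
    R.Dl lq O T x c = ∑ ν ∈ T, ∑ p ∈ (R.interp lq T ν).support,
      Finsupp.single ν (R.interp lq T ν p * R.red lq O x p c) := by
  simp [Dl, LinearMap.sum_apply]

theorem Dl_apply_apply (lq : ℂ) (O T : Finset ℝⁿ) (x : ℂⁿ) (c : ℝⁿ →₀ ℂ) {ν : ℝⁿ} (hν : ν ∈ T) :
    R.Dl lq O T x c ν = ∑ p ∈ (R.interp lq T ν).support,
      R.interp lq T ν p * R.red lq O x p c := by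
  classical
  rw [Dl_apply, Finsupp.finsetSum_apply]
  simp only [Finsupp.finsetSum_apply, Finsupp.single_apply]
  rw [Finset.sum_eq_single ν]
  · simp
  · intro μ _ hμ
    simp [hμ]
  · exact fun h => absurd hν h

theorem Dl_support (lq : ℂ) (O T : Finset ℝⁿ) (x : ℂⁿ) (c : ℝⁿ →₀ ℂ) :
    (R.Dl lq O T x c).support ⊆ T := by
  classical
  intro ν hν
  by_contra hcon
  refine Finsupp.mem_support_iff.1 hν ?_
  rw [Dl_apply, Finsupp.finsetSum_apply]
  refine Finset.sum_eq_zero fun μ hμ => ?_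
  rw [Finsupp.finsetSum_apply]
  refine Finset.sum_eq_zero fun p _ => ?_
  rw [Finsupp.single_apply, if_neg]
  rintro rfl
  exact hcon hμ

theorem Dl_eq (hq : NotRootOfUnity lq) {O T : Finset ℝⁿ} {x : ℂⁿ}
    {c c' : ℝⁿ →₀ ℂ} (hc' : c'.support ⊆ T)
    (h : ∀ z, R.RegPt lq z → R.Dop lq O (bf lq x c) z = bf lq x c' z) : R.Dl lq O T x c = c' := by
  ext ν
  by_cases hν : ν ∈ T
  · obtain ⟨h1, h2⟩ := R.interp_spec hq hν
    rw [R.Dl_apply_apply lq O T x c hν, h2 c' hc', Finsupp.sum]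
    refine Finset.sum_congr rfl fun p hp => ?_
    have := h p (h1 hp)
    rw [Dop_eq_red, bf] at this
    rw [mul_left_cancel₀ (qpow_ne_zero _ _) this]
  · rw [Finsupp.notMem_support_iff.1 fun h => hν (R.Dl_support lq O T x c h),
      Finsupp.notMem_support_iff.1 fun h => hν (hc' h)]

/-- The operator acts on families with exponential polynomial coefficients. -/
theorem Dl_mem_expSpan (lq : ℂ) {O T : Finset ℝⁿ} (L : AddSubgroup ℝⁿ)
    (hO : (O : Set ℝⁿ) ⊆ L) {c : ℂⁿ → ℝⁿ →₀ ℂ} (hT : ∀ x, (c x).support ⊆ T)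
    (hc : ∀ ν, (fun x => c x ν) ∈ expSpan lq (L : Set ℝⁿ)) (ν : ℝⁿ) :
    (fun x => R.Dl lq O T x (c x) ν) ∈ expSpan lq (L : Set ℝⁿ) := by
  by_cases hν : ν ∈ T
  · simp only [R.Dl_apply_apply lq O T _ _ hν]
    refine sum_mem_expSpan _ _ fun p _ => const_mul_mem_expSpan _ ?_
    have hep : ∀ z, (fun x => ep lq (c x) z) ∈ expSpan lq (L : Set ℝⁿ) := by
      intro z
      simp only [fun x => ep_eq_sum lq (c x) z (hT x)]
      refine sum_mem_expSpan _ _ fun μ _ => ?_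
      have := const_mul_mem_expSpan (ex lq μ z) (hc μ)
      simpa only [mul_comm] using this
    simp only [red_apply]
    refine add_mem (sum_mem_expSpan O (fun τ x => R.coeff lq τ p *
      (ex lq τ x * ep lq (c x) (p + cvec τ) - ep lq (c x) p)) fun τ hτ =>
        const_mul_mem_expSpan _ ?_) (const_mul_mem_expSpan _ (hep p))
    exact sub_mem (mul_mem_expSpan (S := (L : Set ℝⁿ)) (T := (L : Set ℝⁿ))
      (fun s hs t ht => add_mem hs ht) (ex_mem_expSpan lq (hO hτ)) (hep _)) (hep p)
  · have : (fun x => R.Dl lq O T x (c x) ν) = fun _ => 0 := by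
      ext x
      exact Finsupp.notMem_support_iff.1 fun h => hν (R.Dl_support lq O T x (c x) h)
    rw [this]
    exact Submodule.zero_mem _

/-- The space of quasi-invariant exponential polynomials with given exponents. -/
def qiSpace (lq : ℂ) (x : ℂⁿ) (S : Set ℝⁿ) : Submodule ℂ (ℝⁿ →₀ ℂ) where
  carrier := {c | (c.support : Set ℝⁿ) ⊆ S ∧ R.QI lq (bf lq x c)}
  add_mem' {a b} ha hb := by
    classical
    refine ⟨fun ν hν => ?_, fun i s h1 h2 z hz => ?_⟩
    · rcases Finset.mem_union.1 (Finsupp.support_add hν) with h | h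
      · exact ha.1 h
      · exact hb.1 h
    · have e1 := ha.2 i s h1 h2 z hz
      have e2 := hb.2 i s h1 h2 z hz
      simp only [bf, ep_add, mul_add] at e1 e2 ⊢
      rw [e1, e2]
  zero_mem' := ⟨by simp, fun i s h1 h2 z hz => by simp [bf, ep_zero]⟩
  smul_mem' a c hc := by
    refine ⟨fun ν hν => hc.1 (Finsupp.support_smul hν), fun i s h1 h2 z hz => ?_⟩
    have e1 := hc.2 i s h1 h2 z hz
    simp only [bf, ep_smul] at e1 ⊢
    linear_combination a * e1

/-- The finite set of coweights in a body. -/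
def wts (H : ℝⁿ → ℝ) : Finset ℝⁿ := (R.finite_coweight_body H).toFinset

theorem mem_wts {H : ℝⁿ → ℝ} {ν : ℝⁿ} : ν ∈ R.wts H ↔ ν ∈ R.coweight ∧ ν ∈ body H := by
  simp [wts]

theorem Dl_mem_qiSpace (hq : NotRootOfUnity lq) {O : Finset ℝⁿ} (hO : R.MQ O)
    {S : Set ℝⁿ} (hS : R.Stable S) {H : ℝⁿ → ℝ} (hH : Continuous H)
    {x : ℂⁿ} {c : ℝⁿ →₀ ℂ} (hc : c ∈ R.qiSpace lq x (S ∩ body H)) :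
    R.Dl lq O (R.wts H) x c ∈ R.qiSpace lq x (S ∩ body H) ∧
      ∀ z, R.RegPt lq z → R.Dop lq O (bf lq x c) z = bf lq x (R.Dl lq O (R.wts H) x c) z := by
  obtain ⟨c', h1, h2, h3⟩ := R.exists_Dop_eq hq hO hS (fun ν hν => (hc.1 hν).1) hc.2
  have h4 := R.Dop_body hq.ne_zero hO h3 hH (fun ν hν => (hc.1 hν).2)
  have h5 : R.Dl lq O (R.wts H) x c = c' :=
    R.Dl_eq hq (fun ν hν => R.mem_wts.2 ⟨hS.1 (h1 hν), h4 hν⟩) h3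
  rw [h5]
  exact ⟨⟨fun ν hν => ⟨h1 hν, h4 hν⟩, h2⟩, h3⟩

open Polynomial in
/-- The product of the top eigenvalue factors annihilates. -/
theorem aeval_prod_eq_zero (hq : NotRootOfUnity lq) {O : Finset ℝⁿ}
    (hO : R.MQ O) {S : Set ℝⁿ} (hS : R.Stable S) {H : ℝⁿ → ℝ}
    (hH : Continuous H) {x : ℂⁿ} {v : ℝⁿ} (hv : R.Reg v)
    (hsep : ∀ μ ∈ R.wts H, ∀ ν ∈ R.wts H, μ ≠ ν → μ ⬝ᵥ v ≠ ν ⬝ᵥ v) (T : Finset ℝⁿ) :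
    T ⊆ R.wts H → (∀ ν ∈ R.wts H, ∀ ν' ∈ T, ν ⬝ᵥ v ≤ ν' ⬝ᵥ v → ν ∈ T) →
    ∀ c ∈ R.qiSpace lq x (S ∩ body H), c.support ⊆ T →
      aeval (R.Dl lq O (R.wts H) x)
        (∏ ν ∈ T, (X - C (mO lq O (x + cvec (ν - R.rhoV v))))) c = 0 := by
  classical
  induction T using Finset.induction_on_max_value (fun ν : ℝⁿ => ν ⬝ᵥ v) with
  | empty =>
    intro _ _ c _ hc
    have : c = 0 := by simpa using hc
    rw [this, map_zero]
  | insert a T ha hmax ih =>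
    intro hT hlow c hcU hc
    have haT : a ∈ R.wts H := hT (Finset.mem_insert_self _ _)
    rw [Finset.prod_insert ha, mul_comm, map_mul, Module.End.mul_apply]
    obtain ⟨hD1, hD2⟩ := R.Dl_mem_qiSpace hq hO hS hH hcU
    have he : aeval (R.Dl lq O (R.wts H) x) (X - C (mO lq O (x + cvec (a - R.rhoV v)))) c =
        R.Dl lq O (R.wts H) x c - mO lq O (x + cvec (a - R.rhoV v)) • c := by
      simp [Module.algebraMap_end_apply]
    rw [he]
    have hU := sub_mem hD1 (Submodule.smul_mem _ (mO lq O (x + cvec (a - R.rhoV v))) hcU)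
    refine ih (fun ν hν => hT (Finset.mem_insert_of_mem hν)) ?_ _ hU ?_
    · intro ν hν ν' hν' hle
      rcases Finset.mem_insert.1 (hlow ν hν ν' (Finset.mem_insert_of_mem hν') hle) with h | h
      · have h1 := hmax ν' hν'
        subst h
        by_contra hcon
        refine hsep ν hν ν' (hT (Finset.mem_insert_of_mem hν')) ?_ (le_antisymm hle h1)
        rintro rfl
        exact ha hν'
      · exact h
    · intro ν hν
      have hνw : ν ∈ R.wts H := R.mem_wts.2 ⟨hS.1 (hU.1 hν).1, (hU.1 hν).2⟩
      have hθ : ∀ μ ∈ c.support, μ ⬝ᵥ v ≤ a ⬝ᵥ v := by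
        intro μ hμ
        rcases Finset.mem_insert.1 (hc hμ) with h | h
        · rw [h]
        · exact hmax μ h
      obtain ⟨hF1, hF2⟩ := R.Dop_face hq.ne_zero hO hD2 hv hθ
      have hνa : ν ≠ a := by
        rintro rfl
        refine Finsupp.mem_support_iff.1 hν ?_
        rw [Finsupp.sub_apply, Finsupp.smul_apply, hF2 ν rfl, smul_eq_mul, sub_self]
      have hle : ν ⬝ᵥ v ≤ a ⬝ᵥ v := by
        by_contra hcon
        refine Finsupp.mem_support_iff.1 hν ?_
        rw [Finsupp.sub_apply, Finsupp.smul_apply,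
          Finsupp.notMem_support_iff.1 fun h => hcon (hF1 ν h),
          Finsupp.notMem_support_iff.1 fun h => hcon (hθ ν h), smul_zero, sub_zero]
      exact (Finset.mem_insert.1 (hlow ν hνw a (Finset.mem_insert_self _ _) hle)).resolve_left hνa

/-- The exponents of an eigenvector of the Macdonald operator. -/
theorem eigen_support (hq : NotRootOfUnity lq) {S : Set ℝⁿ} (hS : R.Stable S)
    {H : ℝⁿ → ℝ} (hH : Continuous H) {x : ℂⁿ} {F : Set ℝⁿ}
    (hF : ∀ ν ∈ R.wts H, ∀ v, R.Reg v → ν - R.rhoV v ∈ F)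
    (hinj : Set.InjOn (fun μ : ℝⁿ => mO lq R.Osh (x + cvec μ)) F)
    {c : ℝⁿ →₀ ℂ} (hc : c ∈ R.qiSpace lq x (S ∩ body H)) {μ : ℝⁿ} (hμ : μ ∈ F)
    (heig : R.Dl lq R.Osh (R.wts H) x c = mO lq R.Osh (x + cvec μ) • c) (hne : c ≠ 0) :
    (∀ v, R.Reg v → c (μ + R.rhoV v) ≠ 0) ∧
      ∀ ν ∈ c.support, ∀ v, ν ⬝ᵥ v ≤ μ ⬝ᵥ v + R.hN v := by
  obtain ⟨-, hD2⟩ := R.Dl_mem_qiSpace hq R.MQ_Osh hS hH hc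
  rw [heig] at hD2
  have main : ∀ v, (∀ a ∈ c.support, ∀ b ∈ c.support, a ≠ b → a ⬝ᵥ v ≠ b ⬝ᵥ v) → R.Reg v →
      c (μ + R.rhoV v) ≠ 0 ∧ ∀ ν ∈ c.support, ν ⬝ᵥ v ≤ μ ⬝ᵥ v + R.hN v := by
    intro v hsep hv
    obtain ⟨ν₀, h₀, hmax⟩ := exists_top hne hsep
    have hθ : ∀ ν ∈ c.support, ν ⬝ᵥ v ≤ ν₀ ⬝ᵥ v := fun ν hν => by
      by_cases h : ν = ν₀
      · rw [h]
      · exact (hmax ν hν h).le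
    obtain ⟨-, hF2⟩ := R.Dop_face hq.ne_zero R.MQ_Osh hD2 hv hθ
    have h1 := hF2 ν₀ rfl
    rw [Finsupp.smul_apply, smul_eq_mul] at h1
    have h2 := mul_right_cancel₀ (Finsupp.mem_support_iff.1 h₀) h1
    have hν₀ : ν₀ ∈ R.wts H := R.mem_wts.2 ⟨hS.1 (hc.1 h₀).1, (hc.1 h₀).2⟩
    have h3 : μ = ν₀ - R.rhoV v := hinj hμ (hF ν₀ hν₀ v hv) h2
    have h4 : μ + R.rhoV v = ν₀ := by rw [h3, sub_add_cancel]
    rw [h4]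
    refine ⟨Finsupp.mem_support_iff.1 h₀, fun ν hν => ?_⟩
    rw [← R.rhoV_dot_self, ← add_dotProduct, h4]
    exact hθ ν hν
  refine ⟨fun v hv => ?_, fun ν hν => ?_⟩
  · obtain ⟨w, hw1, hw2, hw3⟩ := R.exists_separating c.support hv
    rw [← hw3]
    exact (main w hw1 hw2).1
  · have hcl : IsClosed {v : ℝⁿ | ν ⬝ᵥ v ≤ μ ⬝ᵥ v + R.hN v} := by
      have := R.continuous_hN
      refine isClosed_le ?_ (Continuous.add ?_ this) <;> (unfold dotProduct; fun_prop)
    have : closure {w | (∀ a ∈ c.support, ∀ b ∈ c.support, a ≠ b → a ⬝ᵥ w ≠ b ⬝ᵥ w) ∧ R.Reg w} ⊆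
        {v : ℝⁿ | ν ⬝ᵥ v ≤ μ ⬝ᵥ v + R.hN v} := by
      refine closure_minimal ?_ hcl
      intro v hv
      exact (main v hv.1 hv.2).2 ν hν
    intro v
    exact this (by rw [(R.dense_separating_reg c.support).closure_eq]; trivial)

open Polynomial in
/-- Spectral decomposition of quasi-invariant exponential polynomials. -/
theorem exists_spectral (hq : NotRootOfUnity lq) {S : Set ℝⁿ} (hS : R.Stable S)
    {H : ℝⁿ → ℝ} (hH : Continuous H) {x : ℂⁿ} {F : Set ℝⁿ}
    (hF : ∀ ν ∈ R.wts H, ∀ v, R.Reg v → ν - R.rhoV v ∈ F)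
    (hinj : Set.InjOn (fun μ : ℝⁿ => mO lq R.Osh (x + cvec μ)) F)
    {c : ℝⁿ →₀ ℂ} (hc : c ∈ R.qiSpace lq x (S ∩ body H)) :
    ∃ (M : Finset ℝⁿ) (cc : ℝⁿ → ℝⁿ →₀ ℂ), c = ∑ μ ∈ M, cc μ ∧
      ∀ μ ∈ M, μ ∈ F ∧ cc μ ∈ R.qiSpace lq x (S ∩ body H) ∧ (cc μ ≠ 0 →
        (∀ v, R.Reg v → cc μ (μ + R.rhoV v) ≠ 0) ∧
          ∀ ν ∈ (cc μ).support, ∀ v, ν ⬝ᵥ v ≤ μ ⬝ᵥ v + R.hN v) := by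
  classical
  obtain ⟨v, hsep, hv, -⟩ := R.exists_separating (R.wts H) R.reg_y0
  set T := R.wts H with hT
  set A := R.Dl lq R.Osh T x with hA
  set e : ℝⁿ → ℂ := fun μ => mO lq R.Osh (x + cvec μ) with he
  set M := T.image (fun ν => ν - R.rhoV v) with hM
  have hMF : ∀ μ ∈ M, μ ∈ F := by
    intro μ hμ
    obtain ⟨ν, hν, rfl⟩ := Finset.mem_image.1 hμ
    exact hF ν hν v hv
  have hkill : aeval A (∏ μ ∈ M, (X - C (e μ))) c = 0 := by
    rw [hM, Finset.prod_image (fun a _ b _ h => sub_left_injective h)]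
    refine R.aeval_prod_eq_zero hq R.MQ_Osh hS hH hv hsep T subset_rfl (fun ν hν _ _ _ => hν) c hc ?_
    intro ν hν
    exact R.mem_wts.2 ⟨hS.1 (hc.1 hν).1, (hc.1 hν).2⟩
  have hinv : ∀ p : ℂ[X], ∀ d ∈ R.qiSpace lq x (S ∩ body H),
      aeval A p d ∈ R.qiSpace lq x (S ∩ body H) := by
    intro p d hd
    induction p using Polynomial.induction_on' with
    | add p q hp hq => rw [map_add, LinearMap.add_apply]; exact add_mem hp hq
    | monomial k a =>
      rw [aeval_monomial, Module.End.mul_apply, Module.algebraMap_end_apply]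
      refine Submodule.smul_mem _ _ ?_
      induction k with
      | zero => simpa using hd
      | succ k ih =>
        rw [pow_succ', Module.End.mul_apply]
        exact (R.Dl_mem_qiSpace hq R.MQ_Osh hS hH ih).1
  refine ⟨M, fun μ => aeval A (Lagrange.basis M e μ) c, ?_, fun μ hμ => ⟨hMF μ hμ, hinv _ c hc, ?_⟩⟩
  · by_cases hMn : M.Nonempty
    · have h1 := Lagrange.sum_basis (s := M) (v := e) (fun a ha b hb h =>
        hinj (hMF a ha) (hMF b hb) h) hMn
      have h2 := congrArg (fun p => aeval A p c) h1
      simp only [map_sum, map_one, Module.End.one_apply, LinearMap.sum_apply] at h2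
      exact h2.symm
    · rw [Finset.not_nonempty_iff_eq_empty] at hMn
      rw [hMn, Finset.prod_empty, map_one, Module.End.one_apply] at hkill
      rw [hMn, hkill]; simp
  · intro hne
    refine R.eigen_support hq hS hH hF hinj (hinv _ c hc) (hMF μ hμ) ?_ hne
    have h1 : (X - C (e μ)) * Lagrange.basis M e μ =
        C (∏ j ∈ M.erase μ, (e μ - e j)⁻¹) * ∏ j ∈ M, (X - C (e j)) := by
      rw [Lagrange.basis]
      simp only [Lagrange.basisDivisor]
      rw [Finset.prod_mul_distrib, ← map_prod, ← Finset.mul_prod_erase M _ hμ]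
      ring
    have h2 := congrArg (fun p => aeval A p c) h1
    simp only [map_mul, Module.End.mul_apply, hkill, map_zero] at h2
    rw [map_sub, aeval_X, aeval_C, LinearMap.sub_apply, Module.algebraMap_end_apply,
      sub_eq_zero] at h2
    exact h2

end EuclRoots

theorem ex_sum (lq : ℂ) {κ : Type*} (s : Finset κ) (f : κ → ℝⁿ) (z : ℂⁿ) :
    ex lq (∑ k ∈ s, f k) z = ∏ k ∈ s, ex lq (f k) z := by
  classical
  induction s using Finset.induction_on with
  | empty => simp [ex_zero]
  | insert a s ha ih => rw [Finset.sum_insert ha, Finset.prod_insert ha, ex_add, ih]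

theorem ex_natCast_smul (lq : ℂ) (k : ℕ) (ν : ℝⁿ) (z : ℂⁿ) :
    ex lq ((k : ℝ) • ν) z = ex lq ν z ^ k := by
  rw [ex, ex, cvec_smul, smul_dotProduct, ← qpow_natCast_mul]
  congr 1
  push_cast; simp only [smul_eq_mul]; ring

theorem ex_intCast_smul (lq : ℂ) (k : ℤ) (ν : ℝⁿ) (z : ℂⁿ) :
    ex lq ((k : ℝ) • ν) z = ex lq ν z ^ k := by
  rw [ex, ex, cvec_smul, smul_dotProduct, ← qpow_intCast_mul]
  congr 1
  push_cast; simp only [smul_eq_mul]; ring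

theorem differentiable_prod {κ : Type*} (s : Finset κ) (f : κ → ℂⁿ → ℂ)
    (h : ∀ k ∈ s, Differentiable ℂ (f k)) : Differentiable ℂ (fun x => ∏ k ∈ s, f k x) := by
  classical
  induction s using Finset.induction_on with
  | empty => simp
  | insert a s ha ih =>
    simp only [Finset.prod_insert ha]
    exact (h a (Finset.mem_insert_self _ _)).mul
      (ih fun k hk => h k (Finset.mem_insert_of_mem hk))

theorem eq_zero_of_dense {D : Set ℝⁿ} (hD : Dense D) {μ : ℝⁿ}
    (h : ∀ v ∈ D, μ ⬝ᵥ v = 0) : μ = 0 := by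
  have h1 : Continuous fun v : ℝⁿ => μ ⬝ᵥ v := by unfold dotProduct; fun_prop
  have := congrFun (h1.ext_on hD (continuous_const (y := (0 : ℝ))) h) μ
  exact dotProduct_self_eq_zero.1 this

namespace EuclRoots

variable (R : EuclRoots ι n) [Fintype ι]

theorem stable_corootLattice : R.Stable R.corootLattice :=
  ⟨R.corootLattice_le, fun _ h _ h' => add_mem h h'⟩

/-- The positive half sum. -/
def rho : ℝⁿ := R.rhoV R.y0

theorem rho_mem : R.rho ∈ R.coweight := R.rhoV_mem_coweight R.reg_y0

/-- The exponents of the Baker--Akhiezer function. -/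
def rhoCoset : Set ℝⁿ := {ν | ν - R.rho ∈ R.corootLattice}

theorem stable_rhoCoset : R.Stable R.rhoCoset := by
  refine ⟨fun ν hν => ?_, fun ν hν μ hμ => ?_⟩
  · have := add_mem (R.corootLattice_le hν) R.rho_mem
    rwa [sub_add_cancel] at this
  · have := add_mem hν hμ
    change ν + μ - R.rho ∈ R.corootLattice
    rwa [add_sub_right_comm]

theorem rhoV_mem_rhoCoset {v : ℝⁿ} (hv : R.Reg v) : R.rhoV v ∈ R.rhoCoset :=
  R.rhoV_sub_mem hv R.reg_y0

theorem Good.ne_int {R : EuclRoots ι n} {x : ℂⁿ} (h : R.Good lq x) (i : ι)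
    (k : ℤ) : qpow lq (2 * (cvec (R.root i) ⬝ᵥ x - k)) ≠ 1 := by
  have main : ∀ x, R.Good lq x → ∀ k : ℤ, k ≠ 0 → qpow lq (2 * (cvec (R.root i) ⬝ᵥ x - k)) ≠ 1 := by
    intro x h k hk he
    have hmem : -((k : ℝ) • R.coroot i) ∈ R.coweight :=
      neg_mem (R.corootLattice_le (R.intCast_smul_coroot_mem i k))
    have h0 : -((k : ℝ) • R.coroot i) = 0 := by
      refine h hmem R.coweight.zero_mem ?_
      simp only [mO, cvec_zero, add_zero]
      refine Finset.sum_nbij' (R.s i) (R.s i) (R.MQ_Osh.s_mem i) (R.MQ_Osh.s_mem i)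
        (fun j _ => R.s_s i j) (fun j _ => R.s_s i j) fun τ hτ => ?_
      obtain ⟨l, hl, -⟩ := R.MQ_Osh.int τ hτ i
      rw [ex, ex, s, cvec_sub, cvec_smul, sub_dotProduct, smul_dotProduct, dotProduct_add,
        cvec_neg, cvec_smul, dotProduct_neg, dotProduct_smul, cvec_dot_cvec,
        dotProduct_comm τ (R.coroot i), hl]
      have h1 : qpow lq (l * (2 * (cvec (R.root i) ⬝ᵥ x - k))) = 1 := by
        rw [qpow_intCast_mul, he, one_zpow]
      have h2 : 2 * (cvec τ ⬝ᵥ x + -(((k : ℝ) : ℂ) • (((l : ℤ) : ℝ) : ℂ))) =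
        2 * (cvec τ ⬝ᵥ x - (((l : ℤ) : ℝ) : ℂ) • (cvec (R.root i) ⬝ᵥ x)) +
          l * (2 * (cvec (R.root i) ⬝ᵥ x - k)) := by
        push_cast; simp only [smul_eq_mul]; ring
      rw [h2, qpow_add, h1, mul_one]
    rw [neg_eq_zero, smul_eq_zero] at h0
    rcases h0 with h0 | h0
    · exact hk (by exact_mod_cast h0)
    · exact R.coroot_ne i h0
  by_cases hk : k = 0
  · have := main _ (h.add (R.coroot_mem_coweight i)) 2 (by norm_num)
    rw [dotProduct_add, cvec_dot_cvec, R.root_dot_coroot_self] at this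
    convert this using 3
    rw [hk]; push_cast; ring
  · exact main x h k hk

/-- A nonzero quasi-invariant exponential polynomial of minimal size has nonzero coefficients at
all vertices. -/
theorem eq_zero_of_coeff_eq_zero (hq : NotRootOfUnity lq) {x : ℂⁿ}
    {F : Set ℝⁿ} (hF : ∀ ν ∈ R.wts R.hN, ∀ v, R.Reg v → ν - R.rhoV v ∈ F)
    (hinj : Set.InjOn (fun μ : ℝⁿ => mO lq R.Osh (x + cvec μ)) F)
    {c : ℝⁿ →₀ ℂ} (hc : c ∈ R.qiSpace lq x (R.coweight ∩ body R.hN)) {v : ℝⁿ}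
    (hv : R.Reg v) (h0 : c (R.rhoV v) = 0) : c = 0 := by
  classical
  obtain ⟨M, cc, hsum, hM⟩ := R.exists_spectral hq R.stable_coweight R.continuous_hN hF hinj hc
  have hzero : ∀ μ ∈ M, cc μ ≠ 0 → μ = 0 := by
    intro μ hμ hne
    obtain ⟨-, hU, h1⟩ := hM μ hμ
    have hle : ∀ w, R.Reg w → μ ⬝ᵥ w ≤ 0 := by
      intro w hw
      have := (hU.1 (Finsupp.mem_support_iff.2 ((h1 hne).1 w hw))).2 w
      rw [add_dotProduct, R.rhoV_dot_self] at this
      linarith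
    refine eq_zero_of_dense R.dense_reg fun w hw => ?_
    have h2 := hle w hw
    have h3 := hle (-w) hw.neg
    rw [dotProduct_neg] at h3
    linarith
  have hc0 : c = if (0 : ℝⁿ) ∈ M then cc 0 else 0 := by
    rw [hsum, ← Finset.sum_ite_eq' M (0 : ℝⁿ)]
    refine Finset.sum_congr rfl fun μ hμ => ?_
    split_ifs with h
    · rfl
    · by_contra hne
      exact h (hzero μ hμ hne)
  split_ifs at hc0 with hm
  · by_contra hne
    rw [hc0] at hne h0
    have := ((hM 0 hm).2.2 hne).1 v hv
    rw [zero_add] at this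
    exact this h0
  · exact hc0

theorem Good.eq_zero {R : EuclRoots ι n} (hq : NotRootOfUnity lq) {x : ℂⁿ}
    (h : R.Good lq x) {c : ℝⁿ →₀ ℂ} (hc : c ∈ R.qiSpace lq x (R.coweight ∩ body R.hN)) {v : ℝⁿ}
    (hv : R.Reg v) (h0 : c (R.rhoV v) = 0) : c = 0 :=
  R.eq_zero_of_coeff_eq_zero hq (fun _ hν _ hv =>
    sub_mem (R.mem_wts.1 hν).1 (R.rhoV_mem_coweight hv)) h hc hv h0

theorem exists_generic_eq_zero (hq : NotRootOfUnity lq) :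
    ∃ d : ℂⁿ → ℂ, Differentiable ℂ d ∧ (∃ x, d x ≠ 0) ∧ ∀ x, d x ≠ 0 →
      ∀ c ∈ R.qiSpace lq x (R.coweight ∩ body R.hN), c R.rho = 0 → c = 0 := by
  classical
  set F := R.wts (fun v => R.hN v + R.hN v) with hF
  set P := (F ×ˢ F).filter (fun p => p.1 ≠ p.2) with hP
  set d : ℝⁿ × ℝⁿ → ℂⁿ → ℂ := fun p x =>
    mO lq R.Osh (x + cvec p.1) - mO lq R.Osh (x + cvec p.2) with hd
  have hdd : ∀ p, Differentiable ℂ (d p) := fun p =>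
    (differentiable_mO_shift lq R.Osh p.1).sub (differentiable_mO_shift lq R.Osh p.2)
  refine ⟨fun x => ∏ p ∈ P, d p x, differentiable_prod P d fun p _ => hdd p,
    exists_prod_ne_zero P d (fun p _ => hdd p) fun p hp => ?_, fun x hx c hc h0 => ?_⟩
  · simp only [hP, Finset.mem_filter, Finset.mem_product] at hp
    exact R.exists_mO_sub_ne_zero hq (R.mem_wts.1 hp.1.1).1 (R.mem_wts.1 hp.1.2).1 hp.2
  · refine R.eq_zero_of_coeff_eq_zero hq (F := F) (fun ν hν v hv => ?_) ?_ hc R.reg_y0 h0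
    · obtain ⟨h1, h2⟩ := R.mem_wts.1 hν
      refine R.mem_wts.2 ⟨sub_mem h1 (R.rhoV_mem_coweight hv), fun w => ?_⟩
      have h3 := R.rhoV_dot_le v (-w)
      have h4 := h2 w
      have h5 : R.hN (-w) = R.hN w := by simp [hN, dotProduct_neg]
      rw [dotProduct_neg, h5] at h3
      rw [sub_dotProduct]
      linarith
    · intro μ hμ μ' hμ' he
      by_contra hne
      refine Finset.prod_ne_zero_iff.1 hx (μ, μ') ?_ (sub_eq_zero.2 he)
      simp only [hP, Finset.mem_filter, Finset.mem_product]
      exact ⟨⟨hμ, hμ'⟩, hne⟩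

/-- The symmetric quasi-invariant used to construct the Baker--Akhiezer function. -/
def symQ (lq : ℂ) (z : ℂⁿ) : ℂ :=
  ∏ i, ∏ s ∈ Finset.Icc 1 (R.mult i), (ex lq (R.coroot i) z + ex lq (-R.coroot i) z -
    (qpow lq (2 * s) + qpow lq (-(2 * s))))

theorem symQ_mem (lq : ℂ) : R.symQ lq ∈ expSpan lq (R.corootLattice : Set ℝⁿ) := by
  refine prod_mem_expSpan _ _ _ fun i _ => prod_mem_expSpan _ _ _ fun s _ => ?_
  exact sub_mem (add_mem (ex_mem_expSpan lq (R.coroot_mem i))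
    (ex_mem_expSpan lq (neg_mem (R.coroot_mem i))))
    (const_mem_expSpan lq R.corootLattice.zero_mem _)

theorem symQ_path {i : ι} {s : ℕ} (h1 : 1 ≤ s) (h2 : s ≤ R.mult i) {z : ℂⁿ}
    (hz : qpow lq (2 * (cvec (R.coroot i) ⬝ᵥ z)) = 1) {t : ℂ} (ht : t = s ∨ t = -s) :
    R.symQ lq (R.path i z t) = 0 := by
  refine Finset.prod_eq_zero (Finset.mem_univ i) (Finset.prod_eq_zero (Finset.mem_Icc.2 ⟨h1, h2⟩) ?_)
  have : ex lq (R.coroot i) (R.path i z t) = qpow lq (2 * t) := by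
    rw [ex, coroot_dot_path_self, mul_add, qpow_add, hz, one_mul]
  rw [ex_neg, this, ← qpow_neg]
  rcases ht with rfl | rfl
  · ring
  · rw [mul_neg, _root_.neg_neg]; ring

theorem symQ_tendsto (hlq : lq ≠ 0) {v : ℝⁿ} (hv : R.Reg v) (z : ℂⁿ) :
    Tendsto (fun t : ℝ => (Real.exp (-(t * (4 * R.hN v))) : ℂ) * R.symQ lq (ray lq z v t)) atTop
      (𝓝 (ex lq ((4 : ℝ) • R.rhoV v) z)) := by
  have hfac : ∀ i, ∀ K : ℂ, Tendsto (fun t : ℝ => (Real.exp (-(t * |R.coroot i ⬝ᵥ v|)) : ℂ) *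
      (ex lq (R.coroot i) (ray lq z v t) + ex lq (-R.coroot i) (ray lq z v t) - K)) atTop
      (𝓝 (ex lq ((SignType.sign (R.coroot i ⬝ᵥ v) : ℝ) • R.coroot i) z)) := by
    intro i K
    have h0 := R.dual_reg.2 hv i
    set a := R.coroot i ⬝ᵥ v with ha
    have ha0 : a ≠ 0 := h0
    have e1 : Tendsto (fun t : ℝ => (Real.exp (t * (-|a|)) : ℂ)) atTop (𝓝 0) :=
      tendsto_exp_neg (by simpa using abs_pos.2 ha0)
    have e2 : Tendsto (fun t : ℝ => (Real.exp (t * (-(2 * |a|))) : ℂ)) atTop (𝓝 0) :=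
      tendsto_exp_neg (by simpa using abs_pos.2 ha0)
    rcases lt_or_gt_of_ne ha0 with h | h
    · rw [sign_neg h]
      have := ((e2.const_mul (ex lq (R.coroot i) z)).add_const (ex lq (-R.coroot i) z)).sub
        (e1.mul_const K)
      simp only [mul_zero, zero_mul, zero_add, sub_zero] at this
      simp only [SignType.coe_neg_one, neg_smul, one_smul]
      refine this.congr fun t => ?_
      rw [ex_ray hlq, ex_ray hlq, neg_dotProduct, ← ha, abs_of_neg h, mul_sub, mul_add]
      have a1 : Real.exp (t * (-(2 * -a))) = Real.exp (-(t * -a)) * Real.exp (t * a) := by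
        rw [← Real.exp_add]; ring_nf
      have a2 : Real.exp (-(t * -a)) * Real.exp (t * -a) = 1 := by
        rw [← Real.exp_add]; simp
      have a2' : (Real.exp (-(t * -a)) : ℂ) * Real.exp (t * -a) = 1 := by exact_mod_cast a2
      rw [a1]
      push_cast at a2' ⊢
      rw [show (t : ℂ) * -(-(a : ℂ)) = -((t : ℂ) * -(a : ℂ)) by ring]
      linear_combination (-(ex lq (-R.coroot i) z)) * a2'
    · rw [sign_pos h]
      have := ((e2.const_mul (ex lq (-R.coroot i) z)).add_const (ex lq (R.coroot i) z)).sub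
        (e1.mul_const K)
      simp only [mul_zero, zero_mul, zero_add, sub_zero] at this
      simp only [SignType.coe_one, one_smul]
      refine this.congr fun t => ?_
      rw [ex_ray hlq, ex_ray hlq, neg_dotProduct, ← ha, abs_of_pos h, mul_sub, mul_add]
      have a1 : Real.exp (t * (-(2 * a))) = Real.exp (-(t * a)) * Real.exp (t * -a) := by
        rw [← Real.exp_add]; ring_nf
      have a2 : Real.exp (-(t * a)) * Real.exp (t * a) = 1 := by
        rw [← Real.exp_add]; simp
      have a2' : (Real.exp (-(t * a)) : ℂ) * Real.exp (t * a) = 1 := by exact_mod_cast a2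
      rw [a1]
      push_cast at a2' ⊢
      rw [show (t : ℂ) * -(a : ℂ) = -((t : ℂ) * (a : ℂ)) by ring]
      linear_combination (-(ex lq (R.coroot i) z)) * a2'
  have hprod := tendsto_finsetProd Finset.univ fun i _ =>
    tendsto_finsetProd (Finset.Icc 1 (R.mult i)) fun s _ =>
      hfac i (qpow lq (2 * s) + qpow lq (-(2 * s)))
  have hlim : ∏ i, ∏ _s ∈ Finset.Icc 1 (R.mult i),
      ex lq ((SignType.sign (R.coroot i ⬝ᵥ v) : ℝ) • R.coroot i) z =
      ex lq ((4 : ℝ) • R.rhoV v) z := by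
    rw [rhoV, smul_smul, show (4 : ℝ) * (1 / 4) = 1 by norm_num, one_smul, ex_sum]
    refine Finset.prod_congr rfl fun i _ => ?_
    rw [Finset.prod_const, Nat.card_Icc, Nat.add_sub_cancel, ← ex_natCast_smul, smul_smul, mul_comm]
  rw [hlim] at hprod
  refine hprod.congr fun t => ?_
  simp only [Finset.prod_mul_distrib, Finset.prod_const, Nat.card_Icc, Nat.add_sub_cancel]
  rw [symQ]
  congr 1
  rw [hN, ← mul_assoc 4, show (4 : ℝ) * (1 / 4) = 1 by norm_num, one_mul, Finset.mul_sum,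
    ← Finset.sum_neg_distrib, Real.exp_sum]
  push_cast
  refine Finset.prod_congr rfl fun i _ => ?_
  rw [← Complex.exp_nat_mul]
  congr 1; ring

theorem exists_symQ_coeff (hq : NotRootOfUnity lq) : ∃ c : ℝⁿ →₀ ℂ,
    (∀ x, c ∈ R.qiSpace lq x (R.corootLattice ∩ body fun v => 4 * R.hN v)) ∧
    ∀ v, R.Reg v → c ((4 : ℝ) • R.rhoV v) = 1 := by
  obtain ⟨c, hc, he⟩ := mem_expSpan_iff.1 (R.symQ_mem lq)
  have hface : ∀ v, R.Reg v → (∀ ν ∈ c.support, ν ⬝ᵥ v ≤ 4 * R.hN v) ∧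
      c ((4 : ℝ) • R.rhoV v) = 1 := by
    intro v hv
    have h1 := R.symQ_tendsto hq.ne_zero hv
    rw [he] at h1
    obtain ⟨h2, h3⟩ := face_of_tendsto hq.ne_zero h1
    refine ⟨h2, ?_⟩
    have h4 : c.filter (fun ν => ν ⬝ᵥ v = 4 * R.hN v) = Finsupp.single ((4 : ℝ) • R.rhoV v) 1 :=
      ep_injective' hq.ne_zero fun z => by rw [h3, ep_single, one_mul]
    have h5 := DFunLike.congr_fun h4 ((4 : ℝ) • R.rhoV v)
    rwa [Finsupp.filter_apply, if_pos (by rw [smul_dotProduct, R.rhoV_dot_self, smul_eq_mul]),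
      Finsupp.single_eq_same] at h5
  refine ⟨c, fun x => ⟨fun ν hν => ⟨hc hν, fun v => ?_⟩, ?_⟩, fun v hv => (hface v hv).2⟩
  · have hcl : IsClosed {v : ℝⁿ | ν ⬝ᵥ v ≤ 4 * R.hN v} := by
      have := R.continuous_hN
      refine isClosed_le ?_ (this.const_mul 4)
      unfold dotProduct; fun_prop
    have : closure {w | R.Reg w} ⊆ {v : ℝⁿ | ν ⬝ᵥ v ≤ 4 * R.hN v} :=
      closure_minimal (fun v hv => (hface v hv).1 ν hν) hcl
    exact this (by rw [R.dense_reg.closure_eq]; trivial)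
  · intro i s h1 h2 z hz
    rw [bf, bf, ← he, R.symQ_path h1 h2 hz (Or.inl rfl), R.symQ_path h1 h2 hz (Or.inr rfl),
      mul_zero, mul_zero]

end EuclRoots

namespace EuclRoots

variable (R : EuclRoots ι n) [Fintype ι]

open Polynomial in
/-- The image of a fixed quasi-invariant under a product of factors of the Macdonald operator. -/
def proj (lq : ℂ) (T T' : Finset ℝⁿ) (c : ℝⁿ →₀ ℂ) (x : ℂⁿ) : ℝⁿ →₀ ℂ :=
  aeval (R.Dl lq R.Osh T x) (∏ ν ∈ T', (X - C (mO lq R.Osh (x + cvec (ν - R.rho))))) c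

theorem proj_empty (lq : ℂ) (T : Finset ℝⁿ) (c : ℝⁿ →₀ ℂ) (x : ℂⁿ) : R.proj lq T ∅ c x = c := by
  simp [proj]

theorem proj_insert (lq : ℂ) (T : Finset ℝⁿ) [DecidableEq ℝⁿ]
    {T' : Finset ℝⁿ} {a : ℝⁿ} (ha : a ∉ T') (c : ℝⁿ →₀ ℂ) (x : ℂⁿ) : R.proj lq T (insert a T') c x =
      R.Dl lq R.Osh T x (R.proj lq T T' c x) -
        mO lq R.Osh (x + cvec (a - R.rho)) • R.proj lq T T' c x := by
  rw [proj, Finset.prod_insert ha, map_mul, Module.End.mul_apply]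
  simp [proj, Module.algebraMap_end_apply]

theorem proj_support (lq : ℂ) {T : Finset ℝⁿ} (T' : Finset ℝⁿ)
    {c : ℝⁿ →₀ ℂ} (hc : c.support ⊆ T) (x : ℂⁿ) : (R.proj lq T T' c x).support ⊆ T := by
  classical
  induction T' using Finset.induction_on with
  | empty => rwa [proj_empty]
  | insert a T' ha ih =>
    rw [R.proj_insert lq T ha]
    intro ν hν
    rcases Finset.mem_union.1 (Finsupp.support_sub hν) with h | h
    · exact R.Dl_support lq _ _ _ _ h
    · exact ih (Finsupp.support_smul h)

theorem proj_mem_expSpan (lq : ℂ) {T : Finset ℝⁿ} (T' : Finset ℝⁿ)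
    {c : ℝⁿ →₀ ℂ} (hc : c.support ⊆ T) (ν : ℝⁿ) :
    (fun x => R.proj lq T T' c x ν) ∈ expSpan lq (R.dual.corootLattice : Set ℝⁿ) := by
  classical
  induction T' using Finset.induction_on generalizing ν with
  | empty =>
    simp only [proj_empty]
    exact const_mem_expSpan lq (zero_mem _) _
  | insert a T' ha ih =>
    simp only [R.proj_insert lq T ha, Finsupp.sub_apply, Finsupp.smul_apply, smul_eq_mul]
    refine sub_mem (R.Dl_mem_expSpan lq _ R.Osh_subset (fun x => R.proj_support lq T' hc x) ih ν) ?_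
    exact mul_mem_expSpan (S := (R.dual.corootLattice : Set ℝⁿ))
      (T := (R.dual.corootLattice : Set ℝⁿ)) (fun s hs t ht => add_mem hs ht)
      (shift_mem_expSpan (cvec (a - R.rho)) (mO_mem_expSpan lq R.Osh_subset)) (ih ν)

/-- Existence of Baker--Akhiezer functions with exponential polynomial coefficients. -/
theorem exists_BA (hq : NotRootOfUnity lq) : ∃ K : ℂⁿ → ℝⁿ →₀ ℂ,
      (∀ x, K x ∈ R.qiSpace lq x (R.rhoCoset ∩ body R.hN)) ∧
      (∀ ν, (fun x => K x ν) ∈ expSpan lq (R.dual.corootLattice : Set ℝⁿ)) ∧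
      ∀ x, R.Good lq x → K x R.rho ≠ 0 := by
  classical
  obtain ⟨c, hc, hc1⟩ := R.exists_symQ_coeff hq
  set H : ℝⁿ → ℝ := fun v => 4 * R.hN v with hH
  have hHc : Continuous H := R.continuous_hN.const_mul 4
  set T := R.wts H with hT
  set μ0 : ℝⁿ := (4 : ℝ) • R.rho with hμ0
  have hS := R.stable_corootLattice
  have hcT : c.support ⊆ T := fun ν hν =>
    R.mem_wts.2 ⟨R.corootLattice_le ((hc 0).1 hν).1, ((hc 0).1 hν).2⟩
  have hμ0T : μ0 ∈ T := hcT (Finsupp.mem_support_iff.2 (by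
    rw [hμ0, rho, hc1 _ R.reg_y0]; exact one_ne_zero))
  have hU : ∀ T' x, R.proj lq T T' c x ∈ R.qiSpace lq x (R.corootLattice ∩ body H) := by
    intro T' x
    induction T' using Finset.induction_on with
    | empty => rw [proj_empty]; exact hc x
    | insert a T' ha ih =>
      rw [R.proj_insert lq T ha]
      exact sub_mem (R.Dl_mem_qiSpace hq R.MQ_Osh hS hHc ih).1 (Submodule.smul_mem _ _ ih)
  obtain ⟨w, hw1, hw2, hw3⟩ := R.exists_separating T R.reg_y0
  have hw3' : R.rhoV w = R.rho := hw3
  have hH4 : μ0 ⬝ᵥ w = H w := by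
    rw [hμ0, ← hw3', smul_dotProduct, R.rhoV_dot_self, smul_eq_mul]
  have hcoef : ∀ T' x, R.proj lq T T' c x μ0 =
      ∏ ν ∈ T', (mO lq R.Osh (x + cvec (μ0 - R.rho)) - mO lq R.Osh (x + cvec (ν - R.rho))) := by
    intro T' x
    induction T' using Finset.induction_on with
    | empty => rw [proj_empty, Finset.prod_empty, hμ0, rho, hc1 _ R.reg_y0]
    | insert a T' ha ih =>
      obtain ⟨-, hD⟩ := R.Dl_mem_qiSpace hq R.MQ_Osh hS hHc (hU T' x)
      obtain ⟨-, hF⟩ := R.Dop_face hq.ne_zero R.MQ_Osh hD hw2 (θ := H w)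
        fun ν hν => ((hU T' x).1 hν).2 w
      rw [R.proj_insert lq T ha, Finsupp.sub_apply, Finsupp.smul_apply, hF μ0 hH4, hw3', ih,
        Finset.prod_insert ha, smul_eq_mul]
      ring
  set Φ := R.proj lq T (T.erase μ0) c with hΦ
  have heig : ∀ x, R.Dl lq R.Osh T x (Φ x) = mO lq R.Osh (x + cvec (μ0 - R.rho)) • Φ x := by
    intro x
    have h1 : R.proj lq T (insert μ0 (T.erase μ0)) c x = 0 := by
      rw [Finset.insert_erase hμ0T, proj, ← hw3']
      exact R.aeval_prod_eq_zero hq R.MQ_Osh hS hHc hw2 hw1 T subset_rfl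
        (fun ν hν _ _ _ => hν) c (hc x) hcT
    rw [R.proj_insert lq T (Finset.notMem_erase _ _)] at h1
    exact sub_eq_zero.1 h1
  have hwtc : ∀ ν ∈ T, ν ∈ R.coweight := fun ν hν => (R.mem_wts.1 hν).1
  have hΦμ0 : ∀ x, R.Good lq x → Φ x μ0 ≠ 0 := by
    intro x hx
    rw [hΦ, hcoef, Finset.prod_ne_zero_iff]
    intro ν hν h0
    have hν' := Finset.mem_erase.1 hν
    have := hx (sub_mem (hwtc _ hμ0T) R.rho_mem) (sub_mem (hwtc _ hν'.2) R.rho_mem)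
      (sub_eq_zero.1 h0)
    exact hν'.1 (sub_left_injective this).symm
  have h3 : μ0 - R.rho = (3 : ℝ) • R.rho := by rw [hμ0]; module
  have h3mem : (3 : ℝ) • R.rho ∈ R.coweight := by
    rw [← h3]; exact sub_mem (hwtc _ hμ0T) R.rho_mem
  have hsupp : ∀ x, ∀ ν ∈ (Φ x).support, ∀ v, ν ⬝ᵥ v ≤ ((3 : ℝ) • R.rho) ⬝ᵥ v + R.hN v := by
    intro x ν hν v
    by_contra hcon
    refine Finsupp.mem_support_iff.1 hν ?_
    have hcont : Continuous fun x => Φ x ν :=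
      (differentiable_of_mem_expSpan (R.proj_mem_expSpan lq _ hcT ν)).continuous
    refine congrFun (eq_of_residual hcont (continuous_const (y := (0 : ℂ)))
      ((R.residual_good hq).mono fun y hy => ?_)) x
    by_contra hne
    have hne' : Φ y ≠ 0 := fun h => hne (by rw [h]; rfl)
    have := R.eigen_support hq hS hHc (x := y) (F := R.coweight)
      (fun ν hν v hv => sub_mem (hwtc ν hν) (R.rhoV_mem_coweight hv)) hy (hU _ y) h3mem
      (by rw [← h3]; exact heig y) hne'
    exact hcon (this.2 ν (Finsupp.mem_support_iff.2 hne) v)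
  have hinj : Function.Injective fun ν : ℝⁿ => ν - (3 : ℝ) • R.rho := sub_left_injective
  set K : ℂⁿ → ℝⁿ →₀ ℂ := fun x =>
    (Φ (x - cvec ((3 : ℝ) • R.rho))).mapDomain (fun ν => ν - (3 : ℝ) • R.rho) with hK
  have hKapply : ∀ x ν, K x ν = Φ (x - cvec ((3 : ℝ) • R.rho)) (ν + (3 : ℝ) • R.rho) := by
    intro x ν
    have := Finsupp.mapDomain_apply hinj (Φ (x - cvec ((3 : ℝ) • R.rho))) (ν + (3 : ℝ) • R.rho)
    simp only [add_sub_cancel_right] at this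
    exact this
  have hbf : ∀ x, bf lq x (K x) = bf lq (x - cvec ((3 : ℝ) • R.rho))
      (Φ (x - cvec ((3 : ℝ) • R.rho))) := by
    intro x
    funext z
    rw [bf, bf, ep, ep, hK]
    simp only
    rw [Finsupp.sum_mapDomain_index_inj hinj, sub_dotProduct, Finsupp.mul_sum, Finsupp.mul_sum]
    refine Finset.sum_congr rfl fun ν _ => ?_
    dsimp only
    rw [ex_sub, mul_sub, qpow_sub, ← ex]
    ring
  refine ⟨K, fun x => ⟨fun ν hν => ?_, ?_⟩, fun ν => ?_, fun x hx => ?_⟩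
  · have hν' : ν + (3 : ℝ) • R.rho ∈ (Φ (x - cvec ((3 : ℝ) • R.rho))).support := by
      rw [Finsupp.mem_support_iff, ← hKapply]; exact Finsupp.mem_support_iff.1 hν
    refine ⟨?_, fun v => ?_⟩
    · have h1 := ((hU _ _).1 hν').1
      have h2 := sub_mem h1 (R.four_rhoV_mem R.y0)
      have : ν + (3 : ℝ) • R.rho - (4 : ℝ) • R.rhoV R.y0 = ν - R.rho := by rw [rho]; module
      rwa [this] at h2
    · have := hsupp _ _ hν' v
      rw [add_dotProduct] at this
      linarith
  · rw [hbf]; exact (hU _ _).2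
  · simp only [hKapply, sub_eq_add_neg]
    exact shift_mem_expSpan (-cvec ((3 : ℝ) • R.rho)) (R.proj_mem_expSpan lq _ hcT _)
  · rw [hKapply]
    have hg : R.Good lq (x - cvec ((3 : ℝ) • R.rho)) := by
      have := hx.add (neg_mem h3mem)
      rwa [cvec_neg, ← sub_eq_add_neg] at this
    have := hΦμ0 _ hg
    rwa [hμ0, show (4 : ℝ) • R.rho = R.rho + (3 : ℝ) • R.rho by module] at this

end EuclRoots

namespace EuclRoots

variable (R : EuclRoots ι n)

/-- The spectral parameter along a string. -/
def spec (i : ι) (x : ℂⁿ) (μ : ℝⁿ) : ℂ :=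
  cvec (R.root i) ⬝ᵥ x + ((μ ⬝ᵥ R.root i : ℝ) : ℂ)

/-- The symmetric function of the spectral parameter. -/
def symX (lq a : ℂ) : ℂ := qpow lq a + qpow lq (-a)

theorem symX_mul_qbr (lq a : ℂ) (s : ℕ) : qbr lq ((s + 1 : ℕ) * a) * symX lq a =
    qbr lq ((s + 2 : ℕ) * a) + qbr lq (s * a) := by
  simp only [qbr, symX, sub_mul, mul_add, ← qpow_add]
  rw [show ((s + 1 : ℕ) : ℂ) * a + a = ((s + 2 : ℕ) : ℂ) * a by push_cast; ring,
    show ((s + 1 : ℕ) : ℂ) * a + -a = s * a by push_cast; ring,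
    show -(((s + 1 : ℕ) : ℂ) * a) + a = -(s * a) by push_cast; ring,
    show -(((s + 1 : ℕ) : ℂ) * a) + -a = -(((s + 2 : ℕ) : ℂ) * a) by push_cast; ring]
  ring

theorem symX_sub (lq a b : ℂ) :
    symX lq a - symX lq b = qbr lq ((a + b) / 2) * qbr lq ((a - b) / 2) := by
  have := qbr_mul_qbr lq (a / 2) (b / 2)
  rw [show a / 2 + b / 2 = (a + b) / 2 by ring, show a / 2 - b / 2 = (a - b) / 2 by ring,
    mul_div_cancel₀ a two_ne_zero, mul_div_cancel₀ b two_ne_zero] at this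
  exact this.symm

variable [Fintype ι]

open Classical in
/-- The part of the support on a string. -/
def strSupp (i : ι) (c : ℝⁿ →₀ ℂ) (ν : ℝⁿ) : Finset ℝⁿ :=
  c.support.filter fun μ => R.strRep i μ = R.strRep i ν

theorem mem_strSupp {i : ι} {c : ℝⁿ →₀ ℂ} {ν μ : ℝⁿ} :
    μ ∈ R.strSupp i c ν ↔ μ ∈ c.support ∧ ∃ k : ℤ, μ = ν + (k : ℝ) • R.coroot i := by
  rw [strSupp, Finset.mem_filter, strRep_eq_iff]

theorem string_sum (hlq : lq ≠ 0) {x : ℂⁿ} {c : ℝⁿ →₀ ℂ}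
    {S : Set ℝⁿ} (hS : S ⊆ R.coweight) (hc : c ∈ R.qiSpace lq x S) {i : ι} {s : ℕ}
    (hs : s ≤ R.mult i) (ν : ℝⁿ) : ∑ μ ∈ R.strSupp i c ν, c μ * qbr lq (s * R.spec i x μ) = 0 := by
  classical
  rcases Nat.eq_zero_or_pos s with rfl | hs1
  · simp [qbr_zero]
  set d : ℝⁿ →₀ ℂ :=
    ∑ μ ∈ c.support, Finsupp.single μ (c μ * qbr lq (s * R.spec i x μ)) with hd
  have hdμ : ∀ μ, d μ = c μ * qbr lq (s * R.spec i x μ) := by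
    intro μ
    rw [hd, Finsupp.finsetSum_apply]
    simp only [Finsupp.single_apply]
    rw [Finset.sum_ite_eq']
    split_ifs with h
    · rfl
    · rw [Finsupp.notMem_support_iff.1 h, zero_mul]
  have hds : d.support ⊆ c.support := fun μ hμ => by
    rw [Finsupp.mem_support_iff, hdμ] at hμ
    exact Finsupp.mem_support_iff.2 (left_ne_zero_of_mul hμ)
  have hvan : ∀ z, R.wall lq i 0 z = 0 → ep lq d z = 0 := by
    intro z hz
    rw [wall_eq_zero, add_zero] at hz
    have h := hc.2 i s hs1 hs z hz
    have e1 : ∀ t : ℂ, bf lq x c (R.path i z t) = qpow lq (2 * (x ⬝ᵥ z)) *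
        ∑ μ ∈ c.support, c μ * ex lq μ z * qpow lq (t * R.spec i x μ) := by
      intro t
      rw [bf, ep_eq_sum lq c _ subset_rfl, path, dotProduct_add, dotProduct_smul, mul_add, qpow_add,
        mul_assoc, Finset.mul_sum]
      congr 1
      refine Finset.sum_congr rfl fun μ _ => ?_
      rw [ex_apply_add, ex_apply_smul_root, spec, mul_add, qpow_add, dotProduct_comm x]
      rw [show 2 * ((t / 2) • (cvec (R.root i) ⬝ᵥ x)) = t * (cvec (R.root i) ⬝ᵥ x) by
        simp only [smul_eq_mul]; ring,
        show 2 * (t / 2) * ((μ ⬝ᵥ R.root i : ℝ) : ℂ) = t * ((μ ⬝ᵥ R.root i : ℝ) : ℂ) by ring]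
      ring
    rw [e1, e1] at h
    have h2 := mul_left_cancel₀ (qpow_ne_zero _ _) h
    rw [ep_eq_sum lq d z hds, ← sub_eq_zero.2 h2, ← Finset.sum_sub_distrib]
    refine Finset.sum_congr rfl fun μ _ => ?_
    rw [hdμ, qbr, neg_mul]; ring
  have h1 := R.string_sum_eq_zero hlq (fun μ hμ => hS (hc.1 (hds hμ))) hvan
  have h2 := DFunLike.congr_fun h1 (R.strRep i ν)
  rw [Finsupp.finsetSum_apply] at h2
  simp only [Finsupp.single_apply, mul_zero, neg_zero, zero_mul, qpow_zero, mul_one,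
    Finsupp.coe_zero, Pi.zero_apply] at h2
  refine Eq.trans ?_ h2
  rw [strSupp, Finset.sum_filter]
  rw [← Finset.sum_subset hds]
  · refine Finset.sum_congr rfl fun μ _ => ?_
    rw [hdμ]
  · intro μ _ hμ
    rw [← hdμ, Finsupp.notMem_support_iff.1 hμ, ite_self]

theorem string_pow (hlq : lq ≠ 0) {x : ℂⁿ} {c : ℝⁿ →₀ ℂ}
    {S : Set ℝⁿ} (hS : S ⊆ R.coweight) (hc : c ∈ R.qiSpace lq x S) {i : ι}
    (ν : ℝⁿ) (d : ℕ) : ∀ s, s + d ≤ R.mult i →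
    ∑ μ ∈ R.strSupp i c ν, c μ * qbr lq (s * R.spec i x μ) * symX lq (R.spec i x μ) ^ d = 0 := by
  induction d with
  | zero => intro s hs; simpa using R.string_sum hlq hS hc hs ν
  | succ d ih =>
    intro s hs
    rcases s with _ | s
    · simp [qbr_zero]
    have h1 := ih (s + 2) (by omega)
    have h2 := ih s (by omega)
    have h3 : ∀ μ, c μ * qbr lq ((s + 1 : ℕ) * R.spec i x μ) * symX lq (R.spec i x μ) ^ (d + 1) =
        c μ * qbr lq ((s + 2 : ℕ) * R.spec i x μ) * symX lq (R.spec i x μ) ^ d +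
        c μ * qbr lq (s * R.spec i x μ) * symX lq (R.spec i x μ) ^ d := by
      intro μ
      have := symX_mul_qbr lq (R.spec i x μ) s
      rw [pow_succ]
      linear_combination c μ * symX lq (R.spec i x μ) ^ d * this
    rw [Finset.sum_congr rfl fun μ _ => h3 μ, Finset.sum_add_distrib, h1, h2, add_zero]

theorem string_poly (hlq : lq ≠ 0) {x : ℂⁿ} {c : ℝⁿ →₀ ℂ}
    {S : Set ℝⁿ} (hS : S ⊆ R.coweight) (hc : c ∈ R.qiSpace lq x S) {i : ι}
    (ν : ℝⁿ) (p : Polynomial ℂ) (hp : p.natDegree < R.mult i) :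
    ∑ μ ∈ R.strSupp i c ν, c μ * qbr lq (R.spec i x μ) * p.eval (symX lq (R.spec i x μ)) = 0 := by
  simp only [Polynomial.eval_eq_sum_range, Finset.mul_sum]
  rw [Finset.sum_comm]
  refine Finset.sum_eq_zero fun d hd => ?_
  have h1 := R.string_pow hlq hS hc (i := i) ν d 1 (by rw [Finset.mem_range] at hd; omega)
  have : ∑ μ ∈ R.strSupp i c ν, c μ * qbr lq (R.spec i x μ) *
      (p.coeff d * symX lq (R.spec i x μ) ^ d) = p.coeff d * ∑ μ ∈ R.strSupp i c ν,
        c μ * qbr lq ((1 : ℕ) * R.spec i x μ) * symX lq (R.spec i x μ) ^ d := by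
    rw [Finset.mul_sum]
    refine Finset.sum_congr rfl fun μ _ => ?_
    rw [Nat.cast_one, one_mul]; ring
  rw [this, h1, mul_zero]

theorem spec_add (i : ι) (x : ℂⁿ) (μ : ℝⁿ) (k : ℤ) :
    R.spec i x (μ + (k : ℝ) • R.coroot i) = R.spec i x μ + 2 * k := by
  rw [spec, add_dotProduct, smul_dotProduct, R.coroot_dot_root_self, spec]
  push_cast; simp only [smul_eq_mul]; push_cast; ring

/-- A root is nonresonant at `x`. -/
def NonRes (lq : ℂ) (i : ι) (x : ℂⁿ) : Prop :=
  ∀ k : ℤ, qpow lq (2 * (cvec (R.root i) ⬝ᵥ x - k)) ≠ 1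

theorem NonRes.qbr_ne {R : EuclRoots ι n} {i : ι} {x : ℂⁿ} (h : R.NonRes lq i x)
    (k : ℤ) : qbr lq (cvec (R.root i) ⬝ᵥ x + k) ≠ 0 := by
  rw [Ne, qbr_eq_zero_iff]
  have := h (-k)
  convert this using 3
  push_cast; ring

/-- At a nonresonant root all strings are long. -/
theorem exists_long_string (hq : NotRootOfUnity lq) {x : ℂⁿ}
    {c : ℝⁿ →₀ ℂ} {S : Set ℝⁿ} (hS : S ⊆ R.coweight)
    (hc : c ∈ R.qiSpace lq x S) {i : ι} (hx : R.NonRes lq i x) {ν : ℝⁿ}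
    (hν : ν ∈ c.support) : ∃ a b : ℤ, ν + (a : ℝ) • R.coroot i ∈ c.support ∧
      ν + (b : ℝ) • R.coroot i ∈ c.support ∧ (R.mult i : ℤ) ≤ b - a := by
  classical
  have hspec : ∀ μ ∈ S, ∃ k : ℤ, R.spec i x μ = cvec (R.root i) ⬝ᵥ x + k := by
    intro μ hμ
    obtain ⟨k, hk⟩ := hS hμ i
    exact ⟨k, by rw [spec, hk]; push_cast; rfl⟩
  have hinj : ∀ μ ∈ R.strSupp i c ν, ∀ μ' ∈ R.strSupp i c ν, μ ≠ μ' →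
      symX lq (R.spec i x μ) - symX lq (R.spec i x μ') ≠ 0 := by
    intro μ hμ μ' hμ' hne
    obtain ⟨h1, k, hk⟩ := R.mem_strSupp.1 hμ
    obtain ⟨h1', k', hk'⟩ := R.mem_strSupp.1 hμ'
    obtain ⟨l, hl⟩ := hspec ν (hc.1 hν)
    have hkk : k - k' ≠ 0 := by
      intro h
      rw [sub_eq_zero] at h
      rw [hk, hk', h] at hne
      exact hne rfl
    rw [symX_sub, hk, hk', spec_add, spec_add]
    refine mul_ne_zero ?_ ?_
    · have := hx.qbr_ne (l + k + k')
      convert this using 2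
      rw [hl]; push_cast; ring
    · have := qbr_intCast_ne_zero hq hkk
      convert this using 2
      push_cast; ring
  have hcard : R.mult i < (R.strSupp i c ν).card := by
    by_contra! hle
    have hmem : ν ∈ R.strSupp i c ν := R.mem_strSupp.2 ⟨hν, 0, by simp⟩
    rcases Nat.eq_zero_or_pos (R.mult i) with h0 | h0
    · have := Finset.card_pos.2 ⟨ν, hmem⟩
      omega
    have := R.string_poly hq.ne_zero hS hc (i := i) ν
      (∏ μ ∈ (R.strSupp i c ν).erase ν, (Polynomial.X - Polynomial.C (symX lq (R.spec i x μ)))) (by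
        rw [Polynomial.natDegree_prod_of_monic _ _ fun μ _ => Polynomial.monic_X_sub_C _]
        simp only [Polynomial.natDegree_X_sub_C, Finset.sum_const, smul_eq_mul, mul_one]
        rw [Finset.card_erase_of_mem hmem]; omega)
    rw [Finset.sum_eq_single_of_mem ν hmem] at this
    · rw [Polynomial.eval_prod, mul_eq_zero, mul_eq_zero, Finset.prod_eq_zero_iff] at this
      rcases this with (h | h) | ⟨μ, hμ, h⟩
      · exact Finsupp.mem_support_iff.1 hν h
      · obtain ⟨l, hl⟩ := hspec ν (hc.1 hν)
        rw [hl] at h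
        exact hx.qbr_ne l h
      · rw [Finset.mem_erase] at hμ
        simp only [Polynomial.eval_sub, Polynomial.eval_X, Polynomial.eval_C] at h
        exact hinj ν hmem μ hμ.2 hμ.1.symm h
    · intro μ hμ hne
      rw [Polynomial.eval_prod, Finset.prod_eq_zero (Finset.mem_erase.2 ⟨hne, hμ⟩), mul_zero]
      simp
  have hk : ∀ μ ∈ R.strSupp i c ν, ∃ k : ℤ, μ = ν + (k : ℝ) • R.coroot i := fun μ hμ =>
    (R.mem_strSupp.1 hμ).2
  choose! k hk using hk
  have hne : ((R.strSupp i c ν).image k).Nonempty :=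
    ⟨k ν, Finset.mem_image_of_mem _ (R.mem_strSupp.2 ⟨hν, 0, by simp⟩)⟩
  have hkinj : Set.InjOn k (R.strSupp i c ν) := by
    intro μ hμ μ' hμ' h
    rw [hk μ hμ, hk μ' hμ', h]
  obtain ⟨a, ha, ha'⟩ := Finset.mem_image.1 (Finset.min'_mem _ hne)
  obtain ⟨b, hb, hb'⟩ := Finset.mem_image.1 (Finset.max'_mem _ hne)
  refine ⟨k a, k b, ?_, ?_, ?_⟩
  · rw [← hk a ha]; exact (R.mem_strSupp.1 ha).1
  · rw [← hk b hb]; exact (R.mem_strSupp.1 hb).1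
  · have h1 : (R.strSupp i c ν).image k ⊆ Finset.Icc (k a) (k b) := by
      intro l hl
      rw [ha', hb', Finset.mem_Icc]
      exact ⟨Finset.min'_le _ _ hl, Finset.le_max' _ _ hl⟩
    have h2 := Finset.card_le_card h1
    rw [Finset.card_image_of_injOn hkinj, Int.card_Icc] at h2
    omega

/-! ### The sweep argument -/

theorem sum_le_of_chain {κ : Type*} (J : Finset κ) (t p q : κ → ℝ) (a : ℝ)
    (ha : ∀ j ∈ J, a ≤ p j) (hpq : ∀ j ∈ J, p j ≤ q j)
    (hc : ∀ j ∈ J, ∀ k ∈ J, t j < t k → q j ≤ p k) (ht : ∀ j ∈ J, ∀ k ∈ J, j ≠ k → t j ≠ t k) :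
    ∀ b, a ≤ b → (∀ j ∈ J, q j ≤ b) → ∑ j ∈ J, (q j - p j) ≤ b - a := by
  classical
  induction J using Finset.induction_on_max_value t with
  | empty => intro b hab _; simpa using hab
  | insert j J hj hmax ih =>
    intro b hab hb
    have hj' := Finset.mem_insert_self j J
    have hJ : ∀ k ∈ J, k ∈ insert j J := fun k hk => Finset.mem_insert_of_mem hk
    have := ih (fun k hk => ha k (hJ k hk)) (fun k hk => hpq k (hJ k hk))
      (fun k hk l hl => hc k (hJ k hk) l (hJ l hl)) (fun k hk l hl => ht k (hJ k hk) l (hJ l hl))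
      (p j) (ha j hj') fun k hk => hc k (hJ k hk) j hj'
        (lt_of_le_of_ne (hmax k hk) (ht k (hJ k hk) j hj' (by rintro rfl; exact hj hk)))
    rw [Finset.sum_insert hj]
    have := hb j hj'
    linarith

/-- A set of exponents with long strings reaches the boundary. -/
theorem sweep (S : Finset ℝⁿ) (hne : S.Nonempty) (hS : (S : Set ℝⁿ) ⊆ body R.hN)
    (v1 : ℝⁿ) (hstr : ∀ j, R.root j ⬝ᵥ v1 ≠ 0 → ∀ ν ∈ S, ∃ a b : ℝ,
      ν + a • R.coroot j ∈ S ∧ ν + b • R.coroot j ∈ S ∧ R.mult j ≤ b - a) :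
    ∃ ν ∈ S, ν ⬝ᵥ v1 = R.hN v1 := by
  classical
  set J : Finset ι := Finset.univ.filter fun j => 0 < R.root j ⬝ᵥ v1 with hJ
  have hJp : ∀ j ∈ J, 0 < R.root j ⬝ᵥ v1 := fun j hj => (Finset.mem_filter.1 hj).2
  set D : Finset ℝⁿ := ((J ×ˢ J).image fun jk =>
      (R.root jk.2 ⬝ᵥ v1) • R.root jk.1 - (R.root jk.1 ⬝ᵥ v1) • R.root jk.2).filter (· ≠ 0) with hD
  obtain ⟨v, hv⟩ := (dense_dot_ne_zero D (by simp [hD])).nonempty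
  set t : ι → ℝ := fun j => -(R.root j ⬝ᵥ v) / (R.root j ⬝ᵥ v1) with ht
  have htne : ∀ j ∈ J, ∀ k ∈ J, j ≠ k → t j ≠ t k := by
    intro j hj k hk hjk he
    have h1 := hJp j hj
    have h2 := hJp k hk
    simp only [ht] at he
    rw [div_eq_div_iff h1.ne' h2.ne'] at he
    have hd : (R.root k ⬝ᵥ v1) • R.root j - (R.root j ⬝ᵥ v1) • R.root k ≠ 0 := by
      intro h0
      have h3 : R.root j = ((R.root j ⬝ᵥ v1) / (R.root k ⬝ᵥ v1)) • R.root k := by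
        rw [div_eq_inv_mul, mul_smul, ← sub_eq_zero.1 h0, smul_smul, inv_mul_cancel₀ h2.ne',
          one_smul]
      rcases R.eq_or_eq_neg_of_smul h3 with h | h
      · exact hjk h
      · rw [h, R.root_neg, neg_dotProduct] at h1
        linarith
    refine hv _ (Finset.mem_filter.2 ⟨Finset.mem_image.2 ⟨(j, k),
      Finset.mem_product.2 ⟨hj, hk⟩, rfl⟩, hd⟩) ?_
    rw [sub_dotProduct, smul_dotProduct, smul_dotProduct, smul_eq_mul, smul_eq_mul]
    linarith
  have hpq : ∀ j ∈ J, ∃ p q : ℝⁿ, p ∈ S ∧ q ∈ S ∧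
      (∀ ν ∈ S, ν ⬝ᵥ (v + t j • v1) ≤ p ⬝ᵥ (v + t j • v1)) ∧
      (∀ ν ∈ S, ν ⬝ᵥ (v + t j • v1) ≤ q ⬝ᵥ (v + t j • v1)) ∧
      R.mult j * (R.coroot j ⬝ᵥ v1) ≤ q ⬝ᵥ v1 - p ⬝ᵥ v1 := by
    intro j hj
    have hjp := hJp j hj
    obtain ⟨ν, hν, hmax⟩ := S.exists_max_image (fun ν => ν ⬝ᵥ (v + t j • v1)) hne
    obtain ⟨a, b, ha, hb, hab⟩ := hstr j hjp.ne' ν hν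
    have h0 : R.coroot j ⬝ᵥ (v + t j • v1) = 0 := by
      rw [R.coroot_dot_eq_zero, dotProduct_add, dotProduct_smul, smul_eq_mul]
      simp only [ht]
      field_simp
      ring
    have hsame : ∀ a : ℝ, (ν + a • R.coroot j) ⬝ᵥ (v + t j • v1) = ν ⬝ᵥ (v + t j • v1) := by
      intro a
      rw [add_dotProduct, smul_dotProduct, h0, smul_zero, add_zero]
    refine ⟨_, _, ha, hb, fun μ hμ => ?_, fun μ hμ => ?_, ?_⟩
    · rw [hsame]; exact hmax μ hμ
    · rw [hsame]; exact hmax μ hμ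
    · rw [add_dotProduct, add_dotProduct, smul_dotProduct, smul_dotProduct, smul_eq_mul, smul_eq_mul]
      have := mul_le_mul_of_nonneg_right hab (R.coroot_dot_pos.2 hjp).le
      linarith
  choose! p q hp hq hpm hqm hw using hpq
  obtain ⟨νm, hνm, hmax⟩ := S.exists_max_image (fun ν => ν ⬝ᵥ v1) hne
  have hlow : ∀ ν ∈ S, -R.hN v1 ≤ ν ⬝ᵥ v1 := by
    intro ν hν
    have := hS hν (-v1)
    have h5 : R.hN (-v1) = R.hN v1 := by simp [hN, dotProduct_neg]
    rw [dotProduct_neg, h5] at this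
    linarith
  have hsum := sum_le_of_chain J t (fun j => p j ⬝ᵥ v1) (fun j => q j ⬝ᵥ v1) (-R.hN v1)
    (fun j hj => hlow _ (hp j hj)) (fun j hj => by
      have h1 := hw j hj
      have h2 := mul_nonneg (Nat.cast_nonneg (α := ℝ) (R.mult j))
        (R.coroot_dot_pos.2 (hJp j hj)).le
      linarith) (fun j hj k hk hlt => by
      have h1 := hqm j hj _ (hp k hk)
      have h2 := hpm k hk _ (hq j hj)
      simp only [dotProduct_add, dotProduct_smul, smul_eq_mul] at h1 h2 ⊢
      nlinarith) htne (νm ⬝ᵥ v1) (hlow _ hνm) (fun j hj => hmax _ (hq j hj))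
  have hwsum : 2 * R.hN v1 ≤ ∑ j ∈ J, (q j ⬝ᵥ v1 - p j ⬝ᵥ v1) := by
    refine le_trans (le_of_eq ?_) (Finset.sum_le_sum fun j hj => hw j hj)
    have h1 := R.sum_filter_pos (fun j => R.mult j * |R.coroot j ⬝ᵥ v1|) (fun j => R.root j ⬝ᵥ v1)
      (fun j => by rw [R.mult_neg, R.coroot_neg, neg_dotProduct, abs_neg])
      (fun j => by rw [R.root_neg, neg_dotProduct])
      (fun j hj => by rw [R.coroot_dot_eq_zero.2 hj, abs_zero, mul_zero])
    have h2 : ∑ j ∈ J, (R.mult j : ℝ) * (R.coroot j ⬝ᵥ v1) =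
        ∑ j ∈ J, R.mult j * |R.coroot j ⬝ᵥ v1| :=
      Finset.sum_congr rfl fun j hj => by rw [abs_of_pos (R.coroot_dot_pos.2 (hJp j hj))]
    rw [h2, hJ, h1, hN]; ring
  exact ⟨νm, hνm, le_antisymm (hS hνm v1) (by linarith)⟩

end EuclRoots

section RealRay

open Polynomial

namespace EuclRoots

variable (R : EuclRoots ι n) [Fintype ι]

theorem Adj.rhoV_dot_root {R : EuclRoots ι n} {i : ι} {v1 v w : ℝⁿ} (h : R.Adj i v1 v w) :
    R.rhoV v ⬝ᵥ R.root i = R.mult i := by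
  rw [h.rhoV_left, add_dotProduct, R.rhoV_dot_root_wall h.wall, smul_dotProduct,
    R.coroot_dot_root_self, smul_eq_mul]
  ring

theorem Adj.mem_string {R : EuclRoots ι n} {i : ι} {v1 v w : ℝⁿ} (h : R.Adj i v1 v w)
    {k : ℝ} (hk : R.rhoV v - k • R.coroot i ∈ body R.hN) : 0 ≤ k ∧ k ≤ R.mult i := by
  have h1 := hk v
  have h2 := hk w
  have e : R.rhoV v = R.rhoV w + (R.mult i : ℝ) • R.coroot i := by
    rw [h.rhoV_left, h.rhoV_right]; module
  have p := R.coroot_dot_pos.2 h.pos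
  have q : R.coroot i ⬝ᵥ w < 0 := by
    rw [R.coroot_dot]; exact mul_neg_of_pos_of_neg (R.coef_pos i) h.neg
  rw [sub_dotProduct, R.rhoV_dot_self, smul_dotProduct, smul_eq_mul] at h1
  rw [sub_dotProduct, e, add_dotProduct, R.rhoV_dot_self, smul_dotProduct, smul_dotProduct,
    smul_eq_mul, smul_eq_mul] at h2
  constructor
  · by_contra! hc
    nlinarith
  · by_contra! hc
    nlinarith

/-- Two coefficients on the edge dual to a wall are proportional, with an explicit ratio. -/
theorem edge_relation (hlq : lq ≠ 0) {x : ℂⁿ} {c : ℝⁿ →₀ ℂ}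
    {S : Set ℝⁿ} (hS : S ⊆ R.coweight) (hc : c ∈ R.qiSpace lq x (S ∩ body R.hN))
    {i : ι} {v1 v w : ℝⁿ} (h : R.Adj i v1 v w) (hx : R.NonRes lq i x) {l : ℕ} (h1 : 1 ≤ l)
    (hl : l ≤ R.mult i) :
    c (R.rhoV v) * (∏ t ∈ Finset.range l, qbr lq (cvec (R.root i) ⬝ᵥ x + R.mult i - t)) *
        ∏ k ∈ ((Finset.range (R.mult i + 1)).erase 0).erase l, qbr lq k =
      -(c (R.rhoV v - (l : ℝ) • R.coroot i) *
        (∏ j ∈ Finset.range l, qbr lq (cvec (R.root i) ⬝ᵥ x - (j + 1 : ℕ))) *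
        ∏ k ∈ ((Finset.range (R.mult i + 1)).erase 0).erase l, qbr lq (k - l)) := by
  classical
  set m := R.mult i with hm
  set y := cvec (R.root i) ⬝ᵥ x with hy
  set J := ((Finset.range (m + 1)).erase 0).erase l with hJ
  set f : ℕ → ℝⁿ := fun k => R.rhoV v - (k : ℝ) • R.coroot i with hf
  have hspec : ∀ k, R.spec i x (f k) = y + m - 2 * k := by
    intro k
    rw [spec, hf, sub_dotProduct, h.rhoV_dot_root, smul_dotProduct, R.coroot_dot_root_self]
    rw [smul_eq_mul]; push_cast; ring
  have hl0 : l ≠ 0 := by omega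
  have hcard : J.card < m := by
    rw [hJ, Finset.card_erase_of_mem (by simp; omega), Finset.card_erase_of_mem (by simp),
      Finset.card_range]
    omega
  have hp := R.string_poly hlq (fun μ hμ => hS hμ.1) hc (i := i) (R.rhoV v)
    (∏ k ∈ J, (X - C (symX lq (y + m - 2 * k))))
    (by rwa [natDegree_prod_of_monic _ _ fun k _ => monic_X_sub_C _, Finset.sum_congr rfl
      fun k _ => natDegree_X_sub_C _, Finset.sum_const, smul_eq_mul, mul_one])
  have hinj : Set.InjOn f (Finset.range (m + 1)) := by
    intro a _ b _ hab
    have h2 : ((a : ℝ) - b) • R.coroot i = 0 := by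
      have := sub_eq_zero.2 hab
      rw [hf] at this
      rw [← neg_eq_zero, ← this]; module
    have h3 := (smul_eq_zero.1 h2).resolve_right (R.coroot_ne i)
    exact_mod_cast sub_eq_zero.1 h3
  have hsub : R.strSupp i c (R.rhoV v) ⊆ (Finset.range (m + 1)).image f := by
    intro μ hμ
    obtain ⟨hμc, k, hk⟩ := R.mem_strSupp.1 hμ
    have h2 : μ = R.rhoV v - (-(k : ℝ)) • R.coroot i := by rw [hk]; module
    have h3 := h.mem_string (h2 ▸ (hc.1 hμc).2)
    have h4 : 0 ≤ -k ∧ -k ≤ m := ⟨by exact_mod_cast h3.1, by exact_mod_cast h3.2⟩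
    refine Finset.mem_image.2 ⟨(-k).toNat, by simp; omega, ?_⟩
    rw [h2]
    have : (((-k).toNat : ℕ) : ℝ) = -(k : ℝ) := by
      have := Int.toNat_of_nonneg h4.1
      exact_mod_cast this
    simp only [hf, this]
  rw [Finset.sum_subset hsub, Finset.sum_image hinj] at hp
  swap
  · intro μ hμ hμ'
    obtain ⟨k, -, rfl⟩ := Finset.mem_image.1 hμ
    have : c (f k) = 0 := by
      by_contra hne
      refine hμ' (R.mem_strSupp.2 ⟨Finsupp.mem_support_iff.2 hne, -k, ?_⟩)
      rw [hf]; push_cast; module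
    rw [this, zero_mul, zero_mul]
  simp only [hspec, eval_prod, eval_sub, eval_X, eval_C] at hp
  rw [Finset.sum_eq_add (0 : ℕ) l (Ne.symm hl0)] at hp
  rotate_left
  · intro k hk hne
    rw [Finset.prod_eq_zero (i := k), mul_zero]
    · simp [hJ, hne.1, hne.2]; simpa using hk
    · rw [sub_self]
  · intro h0; simp at h0
  · intro h0; simp at h0; omega
  have hX : ∀ a b : ℕ, symX lq (y + m - 2 * a) - symX lq (y + m - 2 * b) =
      qbr lq (y + m - a - b) * qbr lq (b - a) := by
    intro a b
    rw [symX_sub]; congr 2 <;> ring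
  have hX0 : ∀ b : ℕ, symX lq (y + m) - symX lq (y + m - 2 * b) =
      qbr lq (y + m - b) * qbr lq b := by
    intro b
    rw [symX_sub]; congr 2 <;> ring
  simp only [Nat.cast_zero, mul_zero, sub_zero, hX0, hX, Finset.prod_mul_distrib] at hp
  have hf0 : f 0 = R.rhoV v := by simp [hf]
  rw [hf0] at hp
  have hu : ∀ k : ℕ, qbr lq (y + m - k) ≠ 0 := by
    intro k
    have := hx.qbr_ne (m - k)
    push_cast at this
    rwa [← add_sub_assoc] at this
  have hcom : ∏ u ∈ Finset.Ico (l + 1) (m + 1), qbr lq (y + m - u) ≠ 0 :=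
    Finset.prod_ne_zero_iff.2 fun k _ => hu k
  have hA : qbr lq (y + m) * ∏ k ∈ J, qbr lq (y + m - k) =
      (∏ t ∈ Finset.range l, qbr lq (y + m - t)) *
        ∏ u ∈ Finset.Ico (l + 1) (m + 1), qbr lq (y + m - u) := by
    have e1 := Finset.mul_prod_erase (Finset.range (m + 1)) (fun k : ℕ => qbr lq (y + m - k))
      (a := 0) (by simp)
    have e2 := Finset.mul_prod_erase ((Finset.range (m + 1)).erase 0)
      (fun k : ℕ => qbr lq (y + m - k)) (a := l) (by simp; omega)
    have e3 := Finset.prod_range_mul_prod_Ico (fun k : ℕ => qbr lq (y + m - k))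
      (show l ≤ m + 1 by omega)
    rw [Finset.prod_eq_prod_Ico_succ_bot (show l < m + 1 by omega), ← e1, ← e2] at e3
    refine mul_left_cancel₀ (hu l) ?_
    simp only [Nat.cast_zero, sub_zero] at e3
    linear_combination -e3
  have hB : qbr lq (y + m - 2 * l) * ∏ k ∈ J, qbr lq (y + m - l - k) =
      (∏ j ∈ Finset.range l, qbr lq (y - (j + 1 : ℕ))) *
        ∏ u ∈ Finset.Ico (l + 1) (m + 1), qbr lq (y + m - u) := by
    have e2 := Finset.mul_prod_erase ((Finset.range (m + 1)).erase 0)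
      (fun k : ℕ => qbr lq (y + m - l - k)) (a := l) (by simp; omega)
    have e4 : (Finset.range (m + 1)).erase 0 = Finset.Ico 1 (m + 1) := by
      ext k; simp; omega
    have e5 := Finset.prod_Ico_add' (fun k : ℕ => qbr lq (y + m - k)) 1 (m + 1) l
    have e6 := Finset.prod_Ico_consecutive (fun k : ℕ => qbr lq (y + m - k))
      (show l + 1 ≤ m + 1 by omega) (show m + 1 ≤ m + 1 + l by omega)
    have e7 := Finset.prod_Ico_add' (fun k : ℕ => qbr lq (y + m - k)) 0 l (m + 1)
    rw [show 2 * (l : ℂ) = l + l by ring, ← sub_sub, e2, e4]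
    rw [zero_add, add_comm l (m + 1)] at e7
    rw [add_comm 1 l] at e5
    rw [← e7] at e6
    refine Eq.trans ?_ (Eq.trans (e5.trans e6.symm) ?_)
    · refine Finset.prod_congr rfl fun k _ => ?_
      push_cast; congr 1; ring
    · rw [mul_comm, Nat.Ico_zero_eq_range]
      congr 1
      refine Finset.prod_congr rfl fun k _ => ?_
      push_cast; congr 1; ring
  refine mul_right_cancel₀ hcom ?_
  linear_combination hp - c (R.rhoV v) * (∏ k ∈ J, qbr lq k) * hA -
    c (f l) * (∏ k ∈ J, qbr lq (k - l)) * hB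

end EuclRoots

end RealRay

namespace EuclRoots

variable (R : EuclRoots ι n) [Fintype ι]

/-- The normalization factor attached to the chamber of `v`. -/
def nrm (lq : ℂ) (v : ℝⁿ) (x : ℂⁿ) : ℂ :=
  ∏ i, if 0 < R.root i ⬝ᵥ v then
    ∏ j ∈ Finset.range (R.mult i), qbr lq ((j + 1 : ℕ) - cvec (R.root i) ⬝ᵥ x) else 1

theorem nrm_congr (lq : ℂ) {v w : ℝⁿ}
    (h : ∀ i, SignType.sign (R.root i ⬝ᵥ v) = SignType.sign (R.root i ⬝ᵥ w)) (x : ℂⁿ) :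
    R.nrm lq v x = R.nrm lq w x := by
  refine Finset.prod_congr rfl fun i _ => ?_
  exact if_congr (by rw [← sign_eq_one_iff, h i, sign_eq_one_iff]) rfl rfl

theorem differentiable_nrm (lq : ℂ) (v : ℝⁿ) : Differentiable ℂ (R.nrm lq v) := by
  refine differentiable_prod _ _ fun i _ => ?_
  split_ifs
  · exact differentiable_prod _ _ fun j _ =>
      (differentiable_qbr lq).comp ((differentiable_dot _).const_sub _)
  · exact differentiable_const _

theorem nrm_ne_zero {v : ℝⁿ} {x : ℂⁿ}
    (h : ∀ i, 0 < R.root i ⬝ᵥ v → R.NonRes lq i x) : R.nrm lq v x ≠ 0 := by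
  refine Finset.prod_ne_zero_iff.2 fun i _ => ?_
  split_ifs with hi
  · refine Finset.prod_ne_zero_iff.2 fun j _ => ?_
    have := (h i hi).qbr_ne (-((j + 1 : ℕ) : ℤ))
    rw [← neg_sub, qbr_neg, neg_ne_zero, sub_eq_add_neg]
    exact_mod_cast this
  · exact one_ne_zero

theorem Good.nonRes {R : EuclRoots ι n} {x : ℂⁿ} (h : R.Good lq x) (i : ι) :
    R.NonRes lq i x := h.ne_int i

theorem Good.nrm_ne_zero {R : EuclRoots ι n} {x : ℂⁿ} (h : R.Good lq x)
    (v : ℝⁿ) : R.nrm lq v x ≠ 0 := R.nrm_ne_zero fun i _ => h.nonRes i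

theorem Adj.nrm_eq {R : EuclRoots ι n} {i : ι} {v1 v w : ℝⁿ} (h : R.Adj i v1 v w) (lq : ℂ) :
    ∃ N : ℂⁿ → ℂ, Differentiable ℂ N ∧ ∀ x,
      R.nrm lq v x = (∏ j ∈ Finset.range (R.mult i),
        qbr lq ((j + 1 : ℕ) - cvec (R.root i) ⬝ᵥ x)) * N x ∧
      R.nrm lq w x = (∏ j ∈ Finset.range (R.mult i),
        qbr lq (cvec (R.root i) ⬝ᵥ x + (j + 1 : ℕ))) * N x := by
  classical
  refine ⟨fun x => ∏ k ∈ Finset.univ \ {i, R.neg i}, if 0 < R.root k ⬝ᵥ v then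
    ∏ j ∈ Finset.range (R.mult k), qbr lq ((j + 1 : ℕ) - cvec (R.root k) ⬝ᵥ x) else 1, ?_,
    fun x => ⟨?_, ?_⟩⟩
  · refine differentiable_prod _ _ fun i _ => ?_
    split_ifs
    · exact differentiable_prod _ _ fun j _ =>
        (differentiable_qbr lq).comp ((differentiable_dot _).const_sub _)
    · exact differentiable_const _
  · rw [nrm, ← Finset.prod_sdiff (Finset.subset_univ {i, R.neg i}),
      Finset.prod_pair (R.neg_ne i).symm, if_pos h.pos, if_neg, mul_one, mul_comm]
    rw [R.root_neg, neg_dotProduct]; linarith [h.pos]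
  · rw [nrm, ← Finset.prod_sdiff (Finset.subset_univ {i, R.neg i}),
      Finset.prod_pair (R.neg_ne i).symm, if_neg h.neg.le.not_gt, if_pos, one_mul, mul_comm,
      R.mult_neg]
    · congr 1
      · refine Finset.prod_congr rfl fun j _ => ?_
        rw [R.root_neg, cvec_neg, neg_dotProduct, sub_neg_eq_add, add_comm]
      · refine Finset.prod_congr rfl fun k hk => ?_
        have hk' : k ≠ i ∧ k ≠ R.neg i := by simpa using hk
        exact if_congr (by rw [← sign_eq_one_iff, h.right k hk'.1 hk'.2,
          ← h.left k hk'.1 hk'.2, sign_eq_one_iff]) rfl rfl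
    · rw [R.root_neg, neg_dotProduct]; linarith [h.neg]

theorem Adj.dual {R : EuclRoots ι n} {i : ι} {v1 v w : ℝⁿ} (h : R.Adj i v1 v w) :
    R.dual.Adj i v1 v w where
  wall := R.coroot_dot_eq_zero.2 h.wall
  ne j h1 h2 h3 := h.ne j h1 h2 (R.coroot_dot_eq_zero.1 h3)
  left j h1 h2 := by
    change SignType.sign (R.coroot j ⬝ᵥ _) = SignType.sign (R.coroot j ⬝ᵥ _)
    rw [R.sign_coroot, R.sign_coroot]; exact h.left j h1 h2
  right j h1 h2 := by
    change SignType.sign (R.coroot j ⬝ᵥ _) = SignType.sign (R.coroot j ⬝ᵥ _)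
    rw [R.sign_coroot, R.sign_coroot]; exact h.right j h1 h2
  pos := R.coroot_dot_pos.2 h.pos
  neg := by
    change R.coroot i ⬝ᵥ w < 0
    rw [R.coroot_dot]; exact mul_neg_of_pos_of_neg (R.coef_pos i) h.neg

/-- Quasi-invariant functions take the same value at all vectors `ρ` of the dual root system. -/
theorem QI.apply_rhoV_dual {R : EuclRoots ι n} {f : ℂⁿ → ℂ} (hf : R.QI lq f)
    {v w : ℝⁿ} (hv : R.Reg v) (hw : R.Reg w) :
    f (cvec (R.dual.rhoV v)) = f (cvec (R.dual.rhoV w)) := by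
  refine R.chain (fun u => f (cvec (R.dual.rhoV v)) = f (cvec (R.dual.rhoV u))) ?_ ?_ hv hw rfl
  · intro u u' _ hs he
    rw [he, R.dual.rhoV_congr (v := u) (w := u') fun i => by
      change SignType.sign (R.coroot i ⬝ᵥ _) = SignType.sign (R.coroot i ⬝ᵥ _)
      rw [R.sign_coroot, R.sign_coroot]; exact hs i]
  · intro i v1 u u' h he
    have hz : qpow lq (2 * (cvec (R.coroot i) ⬝ᵥ cvec (R.dual.rhoV v1))) = 1 := by
      have := R.dual.rhoV_dot_root_wall (i := i) (R.coroot_dot_eq_zero.2 h.wall)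
      change _ ⬝ᵥ R.coroot i = 0 at this
      rw [cvec_dot_cvec, dotProduct_comm, this]
      simp [qpow_zero]
    have := hf.int (i := i) (k := R.mult i) (by simp) hz
    rw [path, path] at this
    rw [he, h.dual.rhoV_left, h.dual.rhoV_right, sub_eq_add_neg, ← neg_smul, cvec_add, cvec_add,
      cvec_smul, cvec_smul]
    change f (_ + _ • cvec (R.root i)) = f (_ + _ • cvec (R.root i))
    simp only [dual_mult]
    push_cast at this ⊢
    rw [this, neg_div]

/-- A family of quasi-invariant functions with the exponents of a Baker--Akhiezer function, whose
coefficients are exponential polynomials. -/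
structure IsFam (lq : ℂ) (K : ℂⁿ → ℝⁿ →₀ ℂ) : Prop where
  mem : ∀ x, K x ∈ R.qiSpace lq x (R.rhoCoset ∩ body R.hN)
  exp : ∀ ν, (fun x => K x ν) ∈ expSpan lq (R.dual.corootLattice : Set ℝⁿ)
  ne : ∀ x, R.Good lq x → K x R.rho ≠ 0

theorem rhoCoset_subset : R.rhoCoset ⊆ R.coweight := fun ν hν => by
  have := add_mem (R.corootLattice_le hν) R.rho_mem
  rwa [sub_add_cancel] at this

variable {R}

theorem IsFam.continuous {K : ℂⁿ → ℝⁿ →₀ ℂ} (hK : R.IsFam lq K)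
    (ν : ℝⁿ) : Continuous fun x => K x ν :=
  (differentiable_of_mem_expSpan (hK.exp ν)).continuous

theorem IsFam.edge (hq : NotRootOfUnity lq) {K : ℂⁿ → ℝⁿ →₀ ℂ}
    (hK : R.IsFam lq K) {i : ι} {v1 v w : ℝⁿ} (h : R.Adj i v1 v w) {l : ℕ} (h1 : 1 ≤ l)
    (hl : l ≤ R.mult i) (x : ℂⁿ) :
    K x (R.rhoV v) * (∏ t ∈ Finset.range l, qbr lq (cvec (R.root i) ⬝ᵥ x + R.mult i - t)) *
        ∏ k ∈ ((Finset.range (R.mult i + 1)).erase 0).erase l, qbr lq k =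
      -(K x (R.rhoV v - (l : ℝ) • R.coroot i) *
        (∏ j ∈ Finset.range l, qbr lq (cvec (R.root i) ⬝ᵥ x - (j + 1 : ℕ))) *
        ∏ k ∈ ((Finset.range (R.mult i + 1)).erase 0).erase l, qbr lq (k - l)) := by
  refine congrFun (eq_of_residual (f := fun x => _) (g := fun x => _) ?_ ?_
    ((R.residual_good hq).mono fun x hx => R.edge_relation hq.ne_zero R.rhoCoset_subset
      (hK.mem x) h (hx.nonRes i) h1 hl)) x
  · refine ((hK.continuous _).mul (differentiable_prod _ _ fun t _ => (differentiable_qbr lq).comp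
      (((differentiable_dot _).add_const _).sub_const _)).continuous).mul continuous_const
  · refine (((hK.continuous _).mul (differentiable_prod _ _ fun t _ => (differentiable_qbr lq).comp
      ((differentiable_dot _).sub_const _)).continuous).mul continuous_const).neg

theorem IsFam.adj (hq : NotRootOfUnity lq) {K : ℂⁿ → ℝⁿ →₀ ℂ}
    (hK : R.IsFam lq K) {i : ι} {v1 v w : ℝⁿ} (h : R.Adj i v1 v w) (x : ℂⁿ) :
    K x (R.rhoV v) * ∏ j ∈ Finset.range (R.mult i), qbr lq (cvec (R.root i) ⬝ᵥ x + (j + 1 : ℕ)) =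
      K x (R.rhoV w) *
        ∏ j ∈ Finset.range (R.mult i), qbr lq ((j + 1 : ℕ) - cvec (R.root i) ⬝ᵥ x) := by
  classical
  have hw : R.rhoV w = R.rhoV v - (R.mult i : ℝ) • R.coroot i := by
    rw [h.rhoV_left, h.rhoV_right]; module
  rcases Nat.eq_zero_or_pos (R.mult i) with h0 | hpos
  · rw [hw]; simp [h0]
  have he := hK.edge hq h hpos le_rfl x
  rw [← hw] at he
  set m := R.mult i with hm
  set J := ((Finset.range (m + 1)).erase 0).erase m with hJ
  have hJ0 : ∏ k ∈ J, qbr lq k ≠ 0 := by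
    refine Finset.prod_ne_zero_iff.2 fun k hk => qbr_natCast_ne_zero hq ?_
    simp [hJ] at hk; omega
  have hcard : J.card = m - 1 := by
    rw [hJ, Finset.card_erase_of_mem (by simp; omega), Finset.card_erase_of_mem (by simp),
      Finset.card_range]; omega
  have hJm : ∏ k ∈ J, qbr lq (k - m) = (-1) ^ (m - 1) * ∏ k ∈ J, qbr lq k := by
    have e1 : ∏ k ∈ J, qbr lq (m - k) = ∏ k ∈ J, qbr lq k := by
      have hmem : ∀ k ∈ J, m - k ∈ J ∧ k ≤ m := by
        intro k hk; simp [hJ] at hk ⊢; omega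
      refine Finset.prod_nbij' (fun k => m - k) (fun k => m - k) (fun k hk => (hmem k hk).1)
        (fun k hk => (hmem k hk).1) (fun k hk => ?_) (fun k hk => ?_) fun k hk => ?_
      · have := (hmem k hk).2; omega
      · have := (hmem k hk).2; omega
      · rw [Nat.cast_sub (hmem k hk).2]
    rw [← e1, ← hcard, ← Finset.prod_const, ← Finset.prod_mul_distrib]
    refine Finset.prod_congr rfl fun k _ => ?_
    rw [← neg_sub, qbr_neg]; ring
  have h2 : ∏ j ∈ Finset.range m, qbr lq (cvec (R.root i) ⬝ᵥ x - (j + 1 : ℕ)) =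
      (-1) ^ m * ∏ j ∈ Finset.range m, qbr lq ((j + 1 : ℕ) - cvec (R.root i) ⬝ᵥ x) := by
    conv_rhs => rw [← Finset.card_range m, ← Finset.prod_const, Finset.card_range,
      ← Finset.prod_mul_distrib]
    refine Finset.prod_congr rfl fun k _ => ?_
    rw [← neg_sub, qbr_neg]; ring
  have h3 : ∏ t ∈ Finset.range m, qbr lq (cvec (R.root i) ⬝ᵥ x + m - t) =
      ∏ j ∈ Finset.range m, qbr lq (cvec (R.root i) ⬝ᵥ x + (j + 1 : ℕ)) := by
    rw [← Finset.prod_range_reflect]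
    refine Finset.prod_congr rfl fun k hk => ?_
    have hk' : k < m := Finset.mem_range.1 hk
    congr 1
    rw [Nat.cast_sub (by omega), Nat.cast_sub (by omega)]
    push_cast; ring
  rw [hJm, h2, h3] at he
  have hs : ((-1 : ℂ) ^ m) * (-1) ^ (m - 1) = -1 := by
    rw [← pow_add, Odd.neg_one_pow ⟨m - 1, by omega⟩]
  refine mul_right_cancel₀ hJ0 ?_
  linear_combination he - K x (R.rhoV w) *
    (∏ j ∈ Finset.range m, qbr lq ((j + 1 : ℕ) - cvec (R.root i) ⬝ᵥ x)) *
    (∏ k ∈ J, qbr lq k) * hs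

/-- The extreme coefficients of a Baker--Akhiezer function are proportional to the normalization
factors. -/
theorem IsFam.rhoV_mul_nrm (hq : NotRootOfUnity lq)
    {K : ℂⁿ → ℝⁿ →₀ ℂ} (hK : R.IsFam lq K) {v w : ℝⁿ} (hv : R.Reg v) (hw : R.Reg w) (x : ℂⁿ) :
    K x (R.rhoV v) * R.nrm lq w x = K x (R.rhoV w) * R.nrm lq v x := by
  have hg : ∀ᶠ x in residual ℂⁿ,
      K x (R.rhoV v) * R.nrm lq w x = K x (R.rhoV w) * R.nrm lq v x := by
    filter_upwards [R.residual_good hq] with x hx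
    refine R.chain (fun u => K x (R.rhoV v) * R.nrm lq u x = K x (R.rhoV u) * R.nrm lq v x)
      ?_ ?_ hv hw rfl
    · intro u u' _ hs he
      rw [← R.nrm_congr lq hs, ← R.rhoV_congr hs, he]
    · intro i v1 u u' h he
      obtain ⟨N, -, hN⟩ := h.nrm_eq lq
      obtain ⟨h1, h2⟩ := hN x
      have h3 := hK.adj hq h x
      have h4 := hx.nrm_ne_zero u
      rw [h1] at he h4
      rw [h2]
      refine mul_left_cancel₀ (left_ne_zero_of_mul h4) ?_
      linear_combination (∏ j ∈ Finset.range (R.mult i),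
        qbr lq (cvec (R.root i) ⬝ᵥ x + (j + 1 : ℕ))) * he + R.nrm lq v x * h3
  refine congrFun (eq_of_residual (f := fun x => _) (g := fun x => _) ?_ ?_ hg) x
  · exact (hK.continuous _).mul (R.differentiable_nrm lq w).continuous
  · exact (hK.continuous _).mul (R.differentiable_nrm lq v).continuous

end EuclRoots

theorem tendsto_qbr_ray (hlq : lq ≠ 0) {a : ℝ} (ha : a ≠ 0) (y b : ℂ) :
    Tendsto (fun t : ℝ => (Real.exp (-(t * (|a| / 2))) : ℂ) * qbr lq (b - (y + t / (2 * lq) * a)))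
      atTop (𝓝 (if 0 < a then -(qpow lq (-b) * qpow lq y) else qpow lq (b - y))) := by
  have key : ∀ t : ℝ, qbr lq (b - (y + t / (2 * lq) * a)) =
      qpow lq (b - y) * (Real.exp (-(t * (a / 2))) : ℂ) -
        qpow lq (-b) * qpow lq y * (Real.exp (t * (a / 2)) : ℂ) := by
    intro t
    rw [qbr, show b - (y + t / (2 * lq) * a) = (b - y) + -(t / (2 * lq) * a) by ring, qpow_add,
      show -((b - y) + -(t / (2 * lq) * a)) = -b + y + t / (2 * lq) * a by ring,
      qpow_add lq (-b + y), qpow_add lq (-b)]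
    congr 2
    · rw [qpow]; push_cast; congr 1; field_simp
    · rw [qpow]; push_cast; congr 1; field_simp
  have h0 := tendsto_exp_neg (neg_lt_zero.2 (abs_pos.2 ha))
  rcases lt_or_gt_of_ne ha with h | h
  · rw [if_neg h.le.not_gt]
    have h1 := (h0.const_mul (qpow lq (-b) * qpow lq y)).const_sub (qpow lq (b - y))
    rw [mul_zero, sub_zero] at h1
    refine h1.congr fun t => ?_
    rw [key, abs_of_neg h, mul_sub, mul_left_comm, mul_left_comm _ (qpow lq (-b) * _),
      ← Complex.ofReal_mul, ← Complex.ofReal_mul, ← Real.exp_add, ← Real.exp_add]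
    ring_nf
    simp
  · rw [if_pos h]
    have h1 := (h0.const_mul (qpow lq (b - y))).sub_const (qpow lq (-b) * qpow lq y)
    rw [mul_zero, zero_sub] at h1
    refine h1.congr fun t => ?_
    rw [key, abs_of_pos h, mul_sub, mul_left_comm, mul_left_comm _ (qpow lq (-b) * _),
      ← Complex.ofReal_mul, ← Complex.ofReal_mul, ← Real.exp_add, ← Real.exp_add]
    ring_nf
    simp

namespace EuclRoots

variable (R : EuclRoots ι n) [Fintype ι]

theorem rhoV_eq_sum_filter {v : ℝⁿ} (hv : R.Reg v) :
    R.rhoV v = ∑ i with 0 < R.root i ⬝ᵥ v, ((R.mult i : ℝ) / 2) • R.coroot i := by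
  ext k
  have := R.sum_filter_pos
    (fun i => (SignType.sign (R.coroot i ⬝ᵥ v) : ℝ) * R.mult i * R.coroot i k)
    (fun i => R.root i ⬝ᵥ v) (fun i => by
      rw [R.coroot_neg, R.mult_neg, neg_dotProduct, Left.sign_neg]; simp)
    (fun i => by rw [R.root_neg, neg_dotProduct]) (fun i h0 => absurd h0 (hv i))
  rw [rhoV, Pi.smul_apply, Finset.sum_apply, Finset.sum_apply, smul_eq_mul]
  simp only [Pi.smul_apply, smul_eq_mul]
  rw [show (1 / 4 : ℝ) = (1 / 2) * (1 / 2) by norm_num, mul_assoc, ← this, Finset.mul_sum]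
  refine Finset.sum_congr rfl fun i hi => ?_
  rw [sign_pos (R.coroot_dot_pos.2 (Finset.mem_filter.1 hi).2)]
  simp; ring

theorem prod_qpow_dot {v : ℝⁿ} (hv : R.Reg v) (lq : ℂ) (z : ℂⁿ) : (∏ i, if 0 < R.root i ⬝ᵥ v then
      ∏ _j ∈ Finset.range (R.mult i), qpow lq (cvec (R.coroot i) ⬝ᵥ z) else 1) =
      ex lq (R.rhoV v) z := by
  rw [R.rhoV_eq_sum_filter hv, ex_sum, Finset.prod_filter]
  refine Finset.prod_congr rfl fun i _ => if_congr Iff.rfl ?_ rfl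
  rw [Finset.prod_const, Finset.card_range, ex, cvec_smul, smul_dotProduct, ← qpow_natCast_mul]
  congr 1
  push_cast
  rw [smul_eq_mul]; ring

/-- The ratio between the two normalizations of the leading coefficient. -/
def kap (lq : ℂ) (v : ℝⁿ) : ℂ :=
  ∏ i, if 0 < R.root i ⬝ᵥ v then
    ∏ j ∈ Finset.range (R.mult i), -qpow lq (-((j + 1 : ℕ) : ℂ)) else 1

theorem dual_kap (lq : ℂ) (v : ℝⁿ) : R.dual.kap lq v = R.kap lq v :=
  Finset.prod_congr rfl fun _ _ => if_congr R.coroot_dot_pos rfl rfl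

theorem kap_ne_zero (lq : ℂ) (v : ℝⁿ) : R.kap lq v ≠ 0 := by
  refine Finset.prod_ne_zero_iff.2 fun i _ => ?_
  split_ifs
  · exact Finset.prod_ne_zero_iff.2 fun j _ => neg_ne_zero.2 (qpow_ne_zero _ _)
  · exact one_ne_zero

theorem tendsto_nrm_ray (hlq : lq ≠ 0) (v : ℝⁿ) {w : ℝⁿ} (hw : R.Reg w)
    (z : ℂⁿ) : ∃ L, L ≠ 0 ∧ (R.Reg v → v = w → L = R.kap lq v * ex lq (R.dual.rhoV v) z) ∧
      Tendsto (fun t : ℝ => (Real.exp (-(t * ∑ i, if 0 < R.root i ⬝ᵥ v then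
        (R.mult i : ℝ) * (|R.root i ⬝ᵥ w| / 2) else 0)) : ℂ) * R.nrm lq v (ray lq z w t))
      atTop (𝓝 L) := by
  refine ⟨∏ i, if 0 < R.root i ⬝ᵥ v then ∏ j ∈ Finset.range (R.mult i),
    (if 0 < R.root i ⬝ᵥ w then -(qpow lq (-((j + 1 : ℕ) : ℂ)) * qpow lq (cvec (R.root i) ⬝ᵥ z))
      else qpow lq ((j + 1 : ℕ) - cvec (R.root i) ⬝ᵥ z)) else 1, ?_, ?_, ?_⟩
  · refine Finset.prod_ne_zero_iff.2 fun i _ => ?_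
    split_ifs
    · exact Finset.prod_ne_zero_iff.2 fun j _ => neg_ne_zero.2
        (mul_ne_zero (qpow_ne_zero _ _) (qpow_ne_zero _ _))
    · exact Finset.prod_ne_zero_iff.2 fun j _ => qpow_ne_zero _ _
    · exact one_ne_zero
  · rintro hv rfl
    have h1 := R.dual.prod_qpow_dot (R.dual_reg.2 hv) lq z
    rw [← h1, ← R.dual_kap, kap, ← Finset.prod_mul_distrib]
    refine Finset.prod_congr rfl fun i _ => ?_
    have e : (0 < R.dual.root i ⬝ᵥ v) ↔ 0 < R.root i ⬝ᵥ v := R.coroot_dot_pos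
    by_cases hi : 0 < R.root i ⬝ᵥ v
    · rw [if_pos hi, if_pos (e.2 hi), if_pos (e.2 hi), ← Finset.prod_mul_distrib]
      refine Finset.prod_congr rfl fun j _ => ?_
      rw [if_pos hi, neg_mul]; rfl
    · rw [if_neg hi, if_neg (mt e.1 hi), if_neg (mt e.1 hi), mul_one]
  · have h1 : ∀ t : ℝ, (Real.exp (-(t * ∑ i, if 0 < R.root i ⬝ᵥ v then
        (R.mult i : ℝ) * (|R.root i ⬝ᵥ w| / 2) else 0)) : ℂ) * R.nrm lq v (ray lq z w t) =
        ∏ i, if 0 < R.root i ⬝ᵥ v then ∏ j ∈ Finset.range (R.mult i),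
          ((Real.exp (-(t * (|R.root i ⬝ᵥ w| / 2))) : ℂ) * qbr lq ((j + 1 : ℕ) -
            (cvec (R.root i) ⬝ᵥ z + t / (2 * lq) * ((R.root i ⬝ᵥ w : ℝ) : ℂ)))) else 1 := by
      intro t
      rw [nrm, Finset.mul_sum, ← Finset.sum_neg_distrib, Real.exp_sum, Complex.ofReal_prod,
        ← Finset.prod_mul_distrib]
      refine Finset.prod_congr rfl fun i _ => ?_
      split_ifs
      · rw [Finset.prod_mul_distrib, Finset.prod_const, Finset.card_range, ← Complex.ofReal_pow,
          ← Real.exp_nat_mul]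
        congr 1
        · congr 2; ring
        · simp only [dot_ray]
      · simp
    simp only [h1]
    refine tendsto_finsetProd _ fun i _ => ?_
    split_ifs with hi hiw
    · refine tendsto_finsetProd _ fun j _ => ?_
      have := tendsto_qbr_ray hlq (hw i) (cvec (R.root i) ⬝ᵥ z) (j + 1 : ℕ)
      rwa [if_pos hiw] at this
    · refine tendsto_finsetProd _ fun j _ => ?_
      have := tendsto_qbr_ray hlq (hw i) (cvec (R.root i) ⬝ᵥ z) (j + 1 : ℕ)
      rwa [if_neg hiw] at this
    · exact tendsto_const_nhds

theorem sum_filter_abs {v : ℝⁿ} (hv : R.Reg v) (w : ℝⁿ) :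
    (∑ i, if 0 < R.root i ⬝ᵥ v then (R.mult i : ℝ) * (|R.root i ⬝ᵥ w| / 2) else 0) =
      R.dual.hN w := by
  rw [← Finset.sum_filter, R.sum_filter_pos (fun i => (R.mult i : ℝ) * (|R.root i ⬝ᵥ w| / 2))
    (fun i => R.root i ⬝ᵥ v) (fun i => by
      rw [R.root_neg, R.mult_neg, neg_dotProduct, abs_neg])
    (fun i => by rw [R.root_neg, neg_dotProduct]) (fun i h0 => absurd h0 (hv i)), hN,
    Finset.mul_sum, Finset.mul_sum]
  refine Finset.sum_congr rfl fun i _ => ?_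
  change _ = 1 / 4 * ((R.mult i : ℝ) * |R.root i ⬝ᵥ w|)
  ring

theorem wall_eq_qbr (lq : ℂ) (i : ι) (s : ℂ) (z : ℂⁿ) : R.wall lq i (-s) z =
    -qpow lq (-s) * qpow lq (cvec (R.coroot i) ⬝ᵥ z) * qbr lq (s - cvec (R.coroot i) ⬝ᵥ z) := by
  rw [wall_eq, ex, qbr, mul_sub, neg_mul, neg_mul, neg_mul, ← qpow_add, ← qpow_add, ← qpow_add,
    ← qpow_add]
  rw [show -s + cvec (R.coroot i) ⬝ᵥ z + (s - cvec (R.coroot i) ⬝ᵥ z) = 0 by ring, qpow_zero,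
    show 2 * -s + 2 * (cvec (R.coroot i) ⬝ᵥ z) =
      -s + cvec (R.coroot i) ⬝ᵥ z + -(s - cvec (R.coroot i) ⬝ᵥ z) by ring]
  ring

/-- Division by the walls on which the leading vector of a Baker--Akhiezer function vanishes. -/
theorem exists_eq_prod_wall (hq : NotRootOfUnity lq) {v : ℝⁿ}
    {f : ℂⁿ → ℂ} (hf : f ∈ expSpan lq (R.coweight : Set ℝⁿ))
    (T : Finset (ι × ℕ)) (hT : ∀ p ∈ T, 0 < R.root p.1 ⬝ᵥ v ∧
      ∀ z, R.wall lq p.1 (-((p.2 + 1 : ℕ) : ℂ)) z = 0 → f z = 0) :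
    ∃ g ∈ expSpan lq (R.coweight : Set ℝⁿ),
      ∀ z, f z = (∏ p ∈ T, R.wall lq p.1 (-((p.2 + 1 : ℕ) : ℂ)) z) * g z := by
  classical
  induction T using Finset.induction_on with
  | empty => exact ⟨f, hf, by simp⟩
  | insert p T hp ih =>
    obtain ⟨g, hg, hfg⟩ := ih fun p' hp' => hT p' (Finset.mem_insert_of_mem hp')
    obtain ⟨hpos, hvan⟩ := hT p (Finset.mem_insert_self _ _)
    obtain ⟨h, hh, hgh⟩ := R.exists_eq_wall_mul hq.ne_zero R.stable_coweight hg
      (i := p.1) (c := -((p.2 + 1 : ℕ) : ℂ)) (by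
        refine R.eq_zero_on_wall hq (T.filter fun l => l.1 ≠ p.1) Prod.fst
          (fun l => -((l.2 + 1 : ℕ) : ℂ)) ?_ (differentiable_of_mem_expSpan hg).continuous ?_
        · intro l hl
          rw [Finset.mem_filter] at hl
          refine ⟨hl.2, fun he => ?_⟩
          have := (hT l (Finset.mem_insert_of_mem hl.1)).1
          rw [he, R.root_neg, neg_dotProduct] at this
          linarith
        · intro z hz hne
          have h0 := hvan z hz
          rw [hfg] at h0
          refine (mul_eq_zero.1 h0).resolve_left (Finset.prod_ne_zero_iff.2 fun l hl => ?_)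
          by_cases he : l.1 = p.1
          · rw [Ne, wall_eq_zero, he]
            rw [wall_eq_zero] at hz
            intro h1
            have hlp : l.2 ≠ p.2 := fun h2 => hp (by rwa [← Prod.ext he h2])
            refine hq (2 * ((p.2 : ℤ) - l.2)) (by omega) ?_
            have h2 : qpow lq (2 * (cvec (R.coroot p.1) ⬝ᵥ z + -((l.2 + 1 : ℕ) : ℂ)) -
                2 * (cvec (R.coroot p.1) ⬝ᵥ z + -((p.2 + 1 : ℕ) : ℂ))) = 1 := by
              rw [qpow_sub, h1, hz, inv_one, mul_one]
            refine Eq.trans ?_ h2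
            congr 1
            push_cast; ring
          · exact hne l (Finset.mem_filter.2 ⟨hl, he⟩))
    refine ⟨h, hh, fun z => ?_⟩
    rw [hfg, Finset.prod_insert hp, hgh]; ring

end EuclRoots

namespace EuclRoots

variable (R : EuclRoots ι n) [Fintype ι]

/-- The leading vector of a Baker--Akhiezer function is determined by its vanishing. -/
theorem ep_mul_kap (hq : NotRootOfUnity lq) {v : ℝⁿ} (hv : R.Reg v)
    {G : ℝⁿ →₀ ℂ} (hG : (G.support : Set ℝⁿ) ⊆ R.coweight ∩ body R.hN)
    (hvan : ∀ i, 0 < R.root i ⬝ᵥ v → ∀ j < R.mult i, ∀ z,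
      R.wall lq i (-((j + 1 : ℕ) : ℂ)) z = 0 → ep lq G z = 0) (z : ℂⁿ) :
    ep lq G z * R.kap lq v = G (R.rhoV v) * R.dual.nrm lq v z := by
  classical
  obtain ⟨g, hg, hGg⟩ := R.exists_eq_prod_wall hq (v := v)
    (ep_mem_expSpan lq fun ν hν => (hG hν).1)
    ((Finset.univ.filter fun i => 0 < R.root i ⬝ᵥ v).biUnion fun i =>
      (Finset.range (R.mult i)).image (Prod.mk i)) (by
        intro p hp
        simp only [Finset.mem_biUnion, Finset.mem_filter, Finset.mem_univ, true_and,
          Finset.mem_image, Finset.mem_range] at hp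
        obtain ⟨i, hi, j, hj, rfl⟩ := hp
        exact ⟨hi, hvan i hi j hj⟩)
  obtain ⟨d, -, hd⟩ := mem_expSpan_iff.1 (const_mul_mem_expSpan (R.kap lq v)
    (mul_mem_expSpan (U := (R.coweight : Set ℝⁿ)) (fun _ h1 _ h2 => add_mem h1 h2)
      (ex_mem_expSpan lq (R.rhoV_mem_coweight hv)) hg))
  have hGd : ∀ z, ep lq G z = R.dual.nrm lq v z * ep lq d z := by
    intro z
    rw [hGg, ← hd]
    change _ = R.dual.nrm lq v z * (R.kap lq v * (ex lq (R.rhoV v) z * g z))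
    rw [← R.prod_qpow_dot hv, ← mul_assoc, ← mul_assoc, kap, nrm, ← Finset.prod_mul_distrib, ← Finset.prod_mul_distrib]
    congr 1
    rw [Finset.prod_finset_product (s := Finset.univ.filter fun i => 0 < R.root i ⬝ᵥ v)
      (t := fun i => Finset.range (R.mult i))]
    · rw [Finset.prod_filter]
      refine Finset.prod_congr rfl fun i _ => ?_
      have e : (0 < R.dual.root i ⬝ᵥ v) ↔ 0 < R.root i ⬝ᵥ v := R.coroot_dot_pos
      by_cases hi : 0 < R.root i ⬝ᵥ v
      · simp only [if_pos hi, if_pos (e.2 hi), dual_mult]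
        rw [← Finset.prod_mul_distrib, ← Finset.prod_mul_distrib]
        refine Finset.prod_congr rfl fun j _ => ?_
        rw [wall_eq_qbr]
        change _ = qbr lq ((j + 1 : ℕ) - cvec (R.coroot i) ⬝ᵥ z) * _ * _
        ring
      · simp only [if_neg hi, if_neg (mt e.1 hi), mul_one]
    · rintro ⟨i, j⟩
      simp
  have hd0 : ∀ ν ∈ d.support, ν = 0 := by
    intro ν hν
    have hcl : ∀ w : ℝⁿ, ν ⬝ᵥ w ≤ 0 := by
      have hc : IsClosed {w : ℝⁿ | ν ⬝ᵥ w ≤ 0} :=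
        isClosed_le (by unfold dotProduct; fun_prop) continuous_const
      refine fun w => hc.closure_subset_iff.2 ?_ ((R.dense_separating_reg d.support) w)
      rintro w ⟨hsep, hw⟩
      obtain ⟨L, hL, -, hlim⟩ := R.dual.tendsto_nrm_ray hq.ne_zero v (R.dual_reg.2 hw) 0
      rw [R.dual.sum_filter_abs (R.dual_reg.2 hv)] at hlim
      have h2 := tendsto_ep_ray_face hq.ne_zero G w (R.hN w) (fun μ hμ => (hG hμ).2 w) 0
      refine exponent_le_of_tendsto hq.ne_zero hsep (z := 0) ((h2.div hlim hL).congr' ?_) ν hν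
      filter_upwards [hlim.eventually_ne hL] with t ht
      rw [Pi.div_apply, hGd, mul_zero, neg_zero, Real.exp_zero, Complex.ofReal_one, one_mul,
        div_eq_iff ht]
      change _ = _ * ((Real.exp (-(t * R.hN w)) : ℂ) * _)
      ring
    have h1 : 0 ≤ ν ⬝ᵥ ν := Finset.sum_nonneg fun k _ => mul_self_nonneg _
    exact dotProduct_self_eq_zero.1 (le_antisymm (hcl ν) h1)
  have hep : ∀ z, ep lq d z = d 0 := by
    intro z
    rw [ep_eq_sum lq d z (S := {0}) fun ν hν => Finset.mem_singleton.2 (hd0 ν hν)]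
    simp [ex_zero]
  have hfil : G.filter (fun ν => ν ⬝ᵥ v = R.hN v) =
      Finsupp.single (R.rhoV v) (R.kap lq v * d 0) := by
    refine ep_injective' hq.ne_zero fun z => ?_
    obtain ⟨L, -, hLe, hlim⟩ := R.dual.tendsto_nrm_ray hq.ne_zero v (R.dual_reg.2 hv) z
    rw [R.dual.sum_filter_abs (R.dual_reg.2 hv)] at hlim
    rw [hLe (R.dual_reg.2 hv) rfl, dual_kap] at hlim
    have h2 := tendsto_ep_ray_face hq.ne_zero G v (R.hN v) (fun μ hμ => (hG hμ).2 v) z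
    refine tendsto_nhds_unique h2 ?_
    have h3 := hlim.mul_const (d 0)
    rw [ep_single]
    convert h3 using 2
    · rw [hGd, hep]
      rw [mul_assoc]; rfl
    · change _ = R.kap lq v * ex lq (R.rhoV v) z * d 0
      ring
  have := DFunLike.congr_fun hfil (R.rhoV v)
  rw [Finsupp.filter_apply, if_pos (R.rhoV_dot_self v), Finsupp.single_eq_same] at this
  rw [this, hGd, hep]; ring

variable {R}

/-- Asymptotics of a Baker--Akhiezer function in the spectral variable. -/
theorem IsFam.tendsto (hq : NotRootOfUnity lq) {K : ℂⁿ → ℝⁿ →₀ ℂ}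
    (hK : R.IsFam lq K) {v : ℝⁿ} (hv : R.Reg v) :
    ∀ᶠ x in residual ℂⁿ, ∀ z, Tendsto (fun t : ℝ => R.nrm lq v (ray lq x v t) *
      ex lq (-R.dual.rhoV v) (ray lq x v t) * (ep lq (K (ray lq x v t)) z /
        K (ray lq x v t) (R.rhoV v))) atTop (𝓝 (R.dual.nrm lq v z)) := by
  classical
  set T := R.wts R.hN with hT
  have hKT : ∀ x, (K x).support ⊆ T := fun x ν hν =>
    R.mem_wts.2 ⟨R.rhoCoset_subset ((hK.mem x).1 hν).1, ((hK.mem x).1 hν).2⟩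
  choose k _ hk using fun ν => mem_expSpan_iff.1 (hK.exp ν)
  have hk' : ∀ x ν, K x ν = ep lq (k ν) x := fun x ν => congrFun (hk ν) x
  obtain ⟨x0, hx0⟩ := (dense_of_mem_residual (R.residual_good hq)).nonempty
  have hne : ((T ×ˢ T.biUnion fun ν => (k ν).support).filter fun p => p.2 ∈ (k p.1).support).Nonempty
      := by
    have h0 := hK.ne x0 hx0
    rw [hk'] at h0
    obtain ⟨κ, hκ⟩ : (k R.rho).support.Nonempty := by
      rw [Finsupp.support_nonempty_iff]
      rintro h1
      rw [h1, ep_zero] at h0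
      exact h0 rfl
    have hρ : R.rho ∈ T := R.mem_wts.2 ⟨R.rho_mem, R.rhoV_mem_body _⟩
    exact ⟨(R.rho, κ), by simpa [hρ] using ⟨⟨_, hρ, by simpa using hκ⟩, by simpa using hκ⟩⟩
  obtain ⟨⟨ν0, κ0⟩, hp, hmax⟩ := Finset.exists_max_image _ (fun p => p.2 ⬝ᵥ v) hne
  set θ := κ0 ⬝ᵥ v with hθ
  simp only [Finset.mem_filter, Finset.mem_product, Finset.mem_biUnion] at hp hmax
  have hle : ∀ ν ∈ T, ∀ κ ∈ (k ν).support, κ ⬝ᵥ v ≤ θ := fun ν hν κ hκ =>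
    hmax (ν, κ) ⟨⟨hν, ν, hν, hκ⟩, hκ⟩
  have hlim : ∀ x, ∀ ν ∈ T, Tendsto (fun t : ℝ => (Real.exp (-(t * θ)) : ℂ) * K (ray lq x v t) ν)
      atTop (𝓝 (ep lq ((k ν).filter fun κ => κ ⬝ᵥ v = θ) x)) := by
    intro x ν hν
    simp only [hk']
    exact tendsto_ep_ray_face hq.ne_zero (k ν) v θ (hle ν hν) x
  have hgen : ∀ᶠ x in residual ℂⁿ, ep lq ((k ν0).filter fun κ => κ ⬝ᵥ v = θ) x ≠ 0 := by
    refine residual_ne_zero (differentiable_ep lq _) ?_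
    by_contra! hc
    have := DFunLike.congr_fun (ep_injective hq.ne_zero hc) κ0
    rw [Finsupp.filter_apply, if_pos hθ.symm] at this
    exact Finsupp.mem_support_iff.1 hp.2 this
  filter_upwards [hgen] with x hx z
  set G : ℝⁿ →₀ ℂ := ∑ ν ∈ T,
    Finsupp.single ν (ep lq ((k ν).filter fun κ => κ ⬝ᵥ v = θ) x) with hGdef
  have hGν : ∀ ν ∈ T, G ν = ep lq ((k ν).filter fun κ => κ ⬝ᵥ v = θ) x := by
    intro ν hν
    rw [hGdef, Finsupp.finsetSum_apply]
    simp [Finsupp.single_apply, hν]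
  have hGs : G.support ⊆ T := by
    intro ν hν
    by_contra hc
    refine Finsupp.mem_support_iff.1 hν ?_
    rw [hGdef, Finsupp.finsetSum_apply]
    simp [Finsupp.single_apply, hc]
  have hep : ∀ z, Tendsto (fun t : ℝ => (Real.exp (-(t * θ)) : ℂ) * ep lq (K (ray lq x v t)) z)
      atTop (𝓝 (ep lq G z)) := by
    intro z
    rw [ep_eq_sum lq G z hGs]
    simp only [ep_eq_sum lq _ z (hKT _), Finset.mul_sum, ← mul_assoc]
    refine tendsto_finsetSum _ fun ν hν => ?_
    rw [hGν ν hν]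
    exact (hlim x ν hν).mul_const _
  have hmain := R.ep_mul_kap hq hv (G := G) (fun ν hν => R.mem_wts.1 (hGs hν)) (by
    intro i hi j hj z hz
    rw [wall_eq_zero] at hz
    set z0 := R.path i z (-((j + 1 : ℕ) : ℂ)) with hz0
    have hz0' : qpow lq (2 * (cvec (R.coroot i) ⬝ᵥ z0)) = 1 := by
      rwa [hz0, coroot_dot_path_self]
    have hp1 : R.path i z0 ((j + 1 : ℕ) : ℂ) = z := by
      rw [hz0, path, path]; module
    have h1 : ∀ t : ℝ, (Real.exp (-(t * θ)) : ℂ) * ep lq (K (ray lq x v t)) z =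
        qpow lq (-2 * (j + 1 : ℕ) * (cvec (R.root i) ⬝ᵥ x)) *
        (Real.exp (t * (-((j + 1 : ℕ) * (R.root i ⬝ᵥ v)))) : ℂ) *
        ((Real.exp (-(t * θ)) : ℂ) *
          ep lq (K (ray lq x v t)) (R.path i z0 (-((j + 1 : ℕ) : ℂ)))) := by
      intro t
      have h := (hK.mem (ray lq x v t)).2 i (j + 1) (by omega) (by omega) z0 hz0'
      rw [hp1, bf, bf] at h
      have e1 : qpow lq (2 * (ray lq x v t ⬝ᵥ R.path i z0 (-((j + 1 : ℕ) : ℂ)))) =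
          qpow lq (2 * (ray lq x v t ⬝ᵥ z)) *
          (qpow lq (-2 * (j + 1 : ℕ) * (cvec (R.root i) ⬝ᵥ x)) *
            (Real.exp (t * (-((j + 1 : ℕ) * (R.root i ⬝ᵥ v)))) : ℂ)) := by
        have e2 : (Real.exp (t * (-((j + 1 : ℕ) * (R.root i ⬝ᵥ v)))) : ℂ) =
            qpow lq (-2 * (j + 1 : ℕ) * (t / (2 * lq) * ((R.root i ⬝ᵥ v : ℝ) : ℂ))) := by
          have := hq.ne_zero
          rw [qpow]; push_cast; congr 1; field_simp
        rw [e2, ← qpow_add, ← mul_add, ← dot_ray, ← qpow_add, ← hp1, path, path, dotProduct_add,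
          dotProduct_add, dotProduct_smul, dotProduct_smul, dotProduct_comm _ (cvec (R.root i))]
        congr 1
        simp only [smul_eq_mul]; ring
      rw [e1, mul_assoc] at h
      rw [mul_left_cancel₀ (qpow_ne_zero _ _) h]; ring
    have h2 := ((tendsto_exp_neg (a := -((j + 1 : ℕ) * (R.root i ⬝ᵥ v)))
      (neg_lt_zero.2 (mul_pos (by positivity) hi))).const_mul
        (qpow lq (-2 * (j + 1 : ℕ) * (cvec (R.root i) ⬝ᵥ x)))).mul
        (hep (R.path i z0 (-((j + 1 : ℕ) : ℂ))))
    rw [mul_zero, zero_mul] at h2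
    exact tendsto_nhds_unique (hep z) (h2.congr fun t => (h1 t).symm))
  have hρT : R.rhoV v ∈ T := R.mem_wts.2 ⟨R.rhoV_mem_coweight hv, R.rhoV_mem_body v⟩
  have hGρ : G (R.rhoV v) ≠ 0 := by
    intro h0
    have : G = 0 := ep_injective hq.ne_zero fun z => by
      have := hmain z
      rw [h0, zero_mul] at this
      exact (mul_eq_zero.1 this).resolve_right (R.kap_ne_zero lq v)
    exact hx (by rw [← hGν ν0 hp.1.1, this]; rfl)
  obtain ⟨L, -, hLe, hnrm⟩ := R.tendsto_nrm_ray hq.ne_zero v hv x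
  rw [R.sum_filter_abs hv, hLe hv rfl] at hnrm
  have hl := (hnrm.mul_const (ex lq (-R.dual.rhoV v) x)).mul ((hep z).div (by
    have := hlim x _ hρT
    rwa [← hGν _ hρT] at this) hGρ)
  convert hl using 2
  · rw [ex_ray hq.ne_zero, Pi.div_apply,
      mul_div_mul_left _ _ (Complex.ofReal_ne_zero.2 (Real.exp_ne_zero _)), neg_dotProduct,
      R.dual.rhoV_dot_self, mul_neg]
    ring
  · rw [ex_neg, mul_assoc (R.kap lq v), mul_inv_cancel₀ (ex_ne_zero _ _ _), mul_one,
      eq_comm, mul_div_assoc', div_eq_iff hGρ, mul_comm, hmain z]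
    ring

end EuclRoots

namespace EuclRoots

variable (R : EuclRoots ι n) [Fintype ι]

/-- Ratios of squared lengths in an irreducible root system. -/
theorem exists_sq_eq {k0 : ι} (h0 : R.dual.Short k0) (j : ι) : ∃ r : ℤ, 1 ≤ r ∧ r ≤ 3 ∧
    R.coroot j ⬝ᵥ R.coroot j = r * (R.coroot k0 ⬝ᵥ R.coroot k0) := by
  obtain ⟨τ, hτ, hne⟩ : ∃ τ ∈ R.dual.Osh, τ ⬝ᵥ R.coroot j ≠ 0 := by
    by_contra! hc
    exact R.coroot_ne j (R.dual.eq_zero_of_forall_dot_Osh hc)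
  obtain ⟨k, hk, rfl⟩ := R.dual.mem_Osh.1 hτ
  have hs : R.coroot k ⬝ᵥ R.coroot k = R.coroot k0 ⬝ᵥ R.coroot k0 := le_antisymm (hk k0) (h0 k)
  rw [← hs]
  change R.coroot k ⬝ᵥ R.coroot j ≠ 0 at hne
  have hN := hk j
  change R.coroot k ⬝ᵥ R.coroot k ≤ R.coroot j ⬝ᵥ R.coroot j at hN
  have hspos : 0 < R.coroot k ⬝ᵥ R.coroot k := R.dual.root_sq_pos k
  obtain ⟨A, hA⟩ := R.coroot_mem_coweight j k
  obtain ⟨B, hB⟩ := R.coroot_mem_coweight k j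
  rw [R.root_eq, dotProduct_smul, smul_eq_mul, div_mul_eq_mul_div, div_eq_iff hspos.ne'] at hA
  rw [R.root_eq, dotProduct_smul, smul_eq_mul, div_mul_eq_mul_div,
    div_eq_iff (hspos.trans_le hN).ne'] at hB
  rw [dotProduct_comm] at hA
  set s := R.coroot k ⬝ᵥ R.coroot k with hsd
  set N := R.coroot j ⬝ᵥ R.coroot j with hNd
  set d := R.coroot k ⬝ᵥ R.coroot j with hd
  have hAB : (A : ℝ) * s = B * N := by rw [← hA, hB]
  have hNpos : 0 < N := hspos.trans_le hN
  have hsq : (R.coroot j - ((A : ℝ) / 2) • R.coroot k) ⬝ᵥ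
      (R.coroot j - ((A : ℝ) / 2) • R.coroot k) = N - A ^ 2 / 4 * s := by
    simp only [sub_dotProduct, dotProduct_sub, smul_dotProduct, dotProduct_smul, smul_eq_mul]
    rw [dotProduct_comm (R.coroot j) (R.coroot k), ← hd, ← hNd, ← hsd]
    linear_combination -(A : ℝ) / 2 * hA
  have hnn : 0 ≤ N - (A : ℝ) ^ 2 / 4 * s := by
    rw [← hsq]; exact Finset.sum_nonneg fun k _ => mul_self_nonneg _
  have hB0 : B ≠ 0 := by
    rintro rfl
    rw [Int.cast_zero, zero_mul] at hB
    exact hne (by linarith)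
  have e1 : (A : ℝ) ^ 2 * s = (A * B : ℤ) * N := by push_cast; linear_combination (A : ℝ) * hAB
  have e2 : (B : ℝ) ^ 2 * N = (A * B : ℤ) * s := by push_cast; linear_combination -(B : ℝ) * hAB
  have hp4 : A * B ≤ 4 := by
    have : ((A * B : ℤ) : ℝ) ≤ 4 := by nlinarith
    exact_mod_cast this
  have hp0 : 0 < A * B := by
    have h1 : 0 < (B : ℝ) ^ 2 * N := by positivity
    rw [e2] at h1
    exact_mod_cast (pos_iff_pos_of_mul_pos h1).2 hspos
  have hBp : B ^ 2 ≤ A * B := by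
    have h1 : (B : ℝ) ^ 2 * N ≤ (A * B : ℤ) * N := by
      rw [e2]; exact mul_le_mul_of_nonneg_left hN (by exact_mod_cast hp0.le)
    have := le_of_mul_le_mul_right h1 hNpos
    exact_mod_cast this
  have hB2 : B ^ 2 = 1 ∨ B ^ 2 = 4 := by
    have h1 : B ≤ 2 := by nlinarith
    have h2 : -2 ≤ B := by nlinarith
    interval_cases B <;> simp_all
  rcases hB2 with h | h
  · have h' : (B : ℝ) ^ 2 = 1 := by exact_mod_cast h
    rw [h', one_mul] at e2
    refine ⟨A * B, hp0, ?_, e2⟩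
    by_contra! hc
    have h4 : A * B = 4 := by omega
    rw [h4] at e1 e2
    have hA4 : (A : ℝ) ^ 2 = 16 := by
      refine mul_right_cancel₀ hspos.ne' ?_
      rw [e1, e2]; push_cast; ring
    have hz : R.coroot j - ((A : ℝ) / 2) • R.coroot k = 0 := by
      rw [← dotProduct_self_eq_zero, hsq, hA4, e2]; push_cast; ring
    rcases R.dual.reduced k j _ (sub_eq_zero.1 hz) with h5 | h5
    · rw [show (A : ℝ) = 2 by linarith] at hA4; norm_num at hA4
    · rw [show (A : ℝ) = -2 by linarith] at hA4; norm_num at hA4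
  · have h' : (B : ℝ) ^ 2 = 4 := by exact_mod_cast h
    rw [h', show A * B = 4 by omega] at e2
    refine ⟨1, le_rfl, by norm_num, ?_⟩
    push_cast at e2 ⊢; linarith

theorem two_mul_dot_mem {k0 : ι} (h0 : R.dual.Short k0) {μ ν : ℝⁿ} (hμ : μ ∈ R.coweight)
    (hν : ν ∈ R.corootLattice) : ∃ l : ℤ, 2 * (μ ⬝ᵥ ν) = l * (R.coroot k0 ⬝ᵥ R.coroot k0) := by
  refine AddSubgroup.closure_induction (p := fun ν _ => ∃ l : ℤ, 2 * (μ ⬝ᵥ ν) =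
    l * (R.coroot k0 ⬝ᵥ R.coroot k0)) ?_ ⟨0, by simp⟩ ?_ ?_ hν
  · rintro _ ⟨j, rfl⟩
    obtain ⟨r, -, -, hr⟩ := R.exists_sq_eq h0 j
    obtain ⟨a, ha⟩ := hμ j
    have hpos : R.coroot j ⬝ᵥ R.coroot j ≠ 0 := (R.dual.root_sq_pos j).ne'
    rw [R.root_eq, dotProduct_smul, smul_eq_mul, div_mul_eq_mul_div, div_eq_iff hpos, hr] at ha
    exact ⟨a * r, by rw [ha]; push_cast; ring⟩
  · rintro a b _ _ ⟨l, hl⟩ ⟨l', hl'⟩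
    exact ⟨l + l', by rw [dotProduct_add]; push_cast; linarith⟩
  · rintro a _ ⟨l, hl⟩
    exact ⟨-l, by rw [dotProduct_neg]; push_cast; linarith⟩

theorem dot_self_mem {k0 : ι} (h0 : R.dual.Short k0) {ν : ℝⁿ} (hν : ν ∈ R.corootLattice) :
    ∃ l : ℤ, ν ⬝ᵥ ν = l * (R.coroot k0 ⬝ᵥ R.coroot k0) := by
  refine AddSubgroup.closure_induction (p := fun ν _ => ∃ l : ℤ, ν ⬝ᵥ ν =
    l * (R.coroot k0 ⬝ᵥ R.coroot k0)) ?_ ⟨0, by simp⟩ ?_ ?_ hν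
  · rintro _ ⟨j, rfl⟩
    obtain ⟨r, -, -, hr⟩ := R.exists_sq_eq h0 j
    exact ⟨r, hr⟩
  · rintro a b ha hb ⟨l, hl⟩ ⟨l', hl'⟩
    obtain ⟨l2, hl2⟩ := R.two_mul_dot_mem h0 (R.corootLattice_le ha) hb
    refine ⟨l + l' + l2, ?_⟩
    rw [add_dotProduct, dotProduct_add, dotProduct_add, dotProduct_comm b a]
    push_cast; linarith
  · rintro a _ ⟨l, hl⟩
    exact ⟨l, by rw [neg_dotProduct, dotProduct_neg, _root_.neg_neg, hl]⟩

theorem exists_int_of_smul_mem {t : ℝ} {i : ι} (h : t • R.coroot i ∈ R.corootLattice) :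
    ∃ k : ℤ, t = k := by
  obtain ⟨k0, h0⟩ := R.dual.exists_short
  obtain ⟨r, hr1, hr3, hr⟩ := R.exists_sq_eq h0 i
  obtain ⟨l, hl⟩ := R.dot_self_mem h0 h
  obtain ⟨a, ha⟩ := R.corootLattice_le h i
  rw [smul_dotProduct, R.coroot_dot_root_self, smul_eq_mul] at ha
  rw [smul_dotProduct, dotProduct_smul, hr, smul_eq_mul, smul_eq_mul, ← mul_assoc, ← mul_assoc] at hl
  have hl' := mul_right_cancel₀ (R.dual.root_sq_pos k0).ne' hl
  have h4 : a * a * r = 4 * l := by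
    have : (a : ℝ) * a * r = 4 * l := by rw [← ha, ← hl']; ring
    exact_mod_cast this
  rcases Int.even_or_odd' a with ⟨b, rfl | rfl⟩
  · exact ⟨b, by push_cast at ha; linarith⟩
  · exfalso
    have : 4 * ((b * b + b) * r) + r = 4 * l := by rw [← h4]; ring
    omega

/-- An element of the coroot lattice in the convex hull of the short coroots is a short coroot or
zero. -/
theorem mem_Osh_or_eq_zero {μ : ℝⁿ} (hμ : μ ∈ R.corootLattice)
    (h : ∃ τ ∈ R.dual.Osh, μ ⬝ᵥ μ ≤ τ ⬝ᵥ μ) : μ ∈ R.dual.Osh ∨ μ = 0 := by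
  obtain ⟨τ, hτ, hle⟩ := h
  obtain ⟨k, hk, rfl⟩ := R.dual.mem_Osh.1 hτ
  obtain ⟨l, hl⟩ := R.dot_self_mem hk hμ
  change μ ⬝ᵥ μ ≤ R.coroot k ⬝ᵥ μ at hle
  have hs : 0 < R.coroot k ⬝ᵥ R.coroot k := R.dual.root_sq_pos k
  have hd : (R.coroot k - μ) ⬝ᵥ (R.coroot k - μ) =
      R.coroot k ⬝ᵥ R.coroot k - 2 * (R.coroot k ⬝ᵥ μ) + μ ⬝ᵥ μ := by
    rw [sub_dotProduct, dotProduct_sub, dotProduct_sub, dotProduct_comm μ (R.coroot k)]; ring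
  have h1 : 0 ≤ (R.coroot k - μ) ⬝ᵥ (R.coroot k - μ) :=
    Finset.sum_nonneg fun k _ => mul_self_nonneg _
  have h2 : 0 ≤ μ ⬝ᵥ μ := Finset.sum_nonneg fun k _ => mul_self_nonneg _
  have hl0 : 0 ≤ l := by
    rw [hl] at h2
    exact_mod_cast nonneg_of_mul_nonneg_left h2 hs
  have hl1 : l ≤ 1 := by
    have : (l : ℝ) ≤ 1 := by
      by_contra! hc
      nlinarith
    exact_mod_cast this
  have : l = 0 ∨ l = 1 := by omega
  rcases this with rfl | rfl
  · right
    rw [← dotProduct_self_eq_zero, hl]; simp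
  · left
    have h3 : R.coroot k - μ = 0 := by
      rw [← dotProduct_self_eq_zero]
      refine le_antisymm ?_ h1
      rw [hd, hl]; push_cast; rw [hl] at hle; push_cast at hle; linarith
    rw [← sub_eq_zero.1 h3]; exact hτ

/-- A face of the polytope is orthogonal to the directions in which the supporting functional can
be moved. -/
theorem sub_rhoV_dot_eq_zero {v1 ν u : ℝⁿ} (hν : ν ∈ body R.hN) (h1 : ν ⬝ᵥ v1 = R.hN v1)
    (hu : ∀ j, R.root j ⬝ᵥ v1 = 0 → R.root j ⬝ᵥ u = 0) : (ν - R.rhoV v1) ⬝ᵥ u = 0 := by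
  have key : ∀ u : ℝⁿ, (∀ j, R.root j ⬝ᵥ v1 = 0 → R.root j ⬝ᵥ u = 0) →
      (ν - R.rhoV v1) ⬝ᵥ u ≤ 0 := by
    intro u hu
    have hev : ∀ᶠ ε in 𝓝[>] (0 : ℝ), ∀ j,
        SignType.sign (R.root j ⬝ᵥ (v1 + ε • u)) = SignType.sign (R.root j ⬝ᵥ v1) := by
      rw [eventually_all]
      intro j
      by_cases hj : R.root j ⬝ᵥ v1 = 0
      · exact Eventually.of_forall fun ε => by
          rw [dotProduct_add, dotProduct_smul, hj, hu j hj, smul_zero, add_zero]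
      · have hc : ContinuousAt (fun ε : ℝ => SignType.sign (R.root j ⬝ᵥ (v1 + ε • u))) 0 := by
          refine ContinuousAt.comp (f := fun ε : ℝ => R.root j ⬝ᵥ (v1 + ε • u))
            (g := SignType.sign) ?_ ?_
          · refine continuousAt_sign_of_ne_zero ?_
            simpa using hj
          · unfold dotProduct; fun_prop
        have := hc.tendsto.eventually ((isOpen_discrete {SignType.sign (R.root j ⬝ᵥ v1)}).mem_nhds
          (by simp))
        exact (this.filter_mono nhdsWithin_le_nhds)
    obtain ⟨ε, hε, hpos⟩ := (hev.and self_mem_nhdsWithin).exists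
    have hpos' : 0 < ε := hpos
    have h2 := hν (v1 + ε • u)
    rw [← R.rhoV_dot_self, R.rhoV_congr hε, dotProduct_add, dotProduct_add, h1, R.rhoV_dot_self,
      dotProduct_smul, dotProduct_smul, smul_eq_mul, smul_eq_mul] at h2
    rw [sub_dotProduct]
    nlinarith
  have h2 := key u hu
  have h3 := key (-u) fun j hj => by rw [dotProduct_neg, hu j hj, neg_zero]
  rw [dotProduct_neg] at h3
  linarith

theorem eq_rhoV {v ν : ℝⁿ} (hv : R.Reg v) (hν : ν ∈ body R.hN) (h1 : ν ⬝ᵥ v = R.hN v) :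
    ν = R.rhoV v := by
  have := R.sub_rhoV_dot_eq_zero hν h1 (u := ν - R.rhoV v) fun j hj => absurd hj (hv j)
  exact sub_eq_zero.1 (dotProduct_self_eq_zero.1 this)

theorem Adj.eq_of_mem_face {R : EuclRoots ι n} {i : ι} {v1 v w ν : ℝⁿ}
    (h : R.Adj i v1 v w) (hν : ν ∈ R.rhoCoset ∩ body R.hN) (h1 : ν ⬝ᵥ v1 = R.hN v1) :
    ∃ l : ℕ, l ≤ R.mult i ∧ ν = R.rhoV v - (l : ℝ) • R.coroot i := by
  set μ := ν - R.rhoV v1 with hμ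
  set t := (μ ⬝ᵥ R.root i) / 2 with ht
  have hu : R.root i ⬝ᵥ (μ - t • R.coroot i) = 0 := by
    rw [dotProduct_sub, dotProduct_smul, R.root_dot_coroot_self, dotProduct_comm, ht, smul_eq_mul]
    ring
  have h2 : μ ⬝ᵥ (μ - t • R.coroot i) = 0 := R.sub_rhoV_dot_eq_zero hν.2 h1 fun j hj => by
    by_cases hji : j = i
    · rw [hji]; exact hu
    · by_cases hjn : j = R.neg i
      · rw [hjn, R.root_neg, neg_dotProduct, hu, neg_zero]
      · exact absurd hj (h.ne j hji hjn)
  have h3 : μ - t • R.coroot i = 0 := by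
    rw [← dotProduct_self_eq_zero]
    nth_rw 1 [sub_dotProduct]
    rw [h2, smul_dotProduct, R.coroot_dot_eq_zero.2 hu, smul_zero, sub_zero]
  have h4 : ν = R.rhoV v - ((R.mult i : ℝ) / 2 - t) • R.coroot i := by
    rw [h.rhoV_left, sub_smul, ← sub_eq_zero.1 h3, hμ]; module
  have h5 : ((R.mult i : ℝ) / 2 - t) • R.coroot i ∈ R.corootLattice := by
    have := sub_mem (show R.rhoV v - R.rho ∈ R.corootLattice from R.rhoV_mem_rhoCoset h.reg)
      (show ν - R.rho ∈ R.corootLattice from hν.1)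
    rwa [sub_sub_sub_cancel_right, h4, sub_sub_cancel] at this
  obtain ⟨k, hk⟩ := R.exists_int_of_smul_mem h5
  rw [hk] at h4
  obtain ⟨h6, h7⟩ := h.mem_string (h4 ▸ hν.2)
  have h6' : 0 ≤ k := by exact_mod_cast h6
  have h7' : k ≤ R.mult i := by exact_mod_cast h7
  refine ⟨k.toNat, by omega, ?_⟩
  rw [h4]
  congr 2
  have := Int.toNat_of_nonneg h6'
  exact_mod_cast this.symm

end EuclRoots

/-- The restriction of an entire function to a complex line. -/
def line (x y : ℂⁿ) (f : ℂⁿ → ℂ) (ζ : ℂ) : ℂ := f (x + ζ • y)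

theorem analyticAt_line {f : ℂⁿ → ℂ} (hf : Differentiable ℂ f) (x y : ℂⁿ)
    (ζ : ℂ) : AnalyticAt ℂ (line x y f) ζ := by
  have : Differentiable ℂ (line x y f) := hf.comp (by fun_prop)
  exact this.analyticAt ζ

theorem order_line_ne_top {f : ℂⁿ → ℂ} (hf : Differentiable ℂ f) {x y : ℂⁿ}
    (h0 : f x ≠ 0) (ζ : ℂ) : analyticOrderAt (line x y f) ζ ≠ ⊤ := by
  have ha : AnalyticOnNhd ℂ (line x y f) Set.univ := fun z _ => analyticAt_line hf x y z
  intro h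
  have h1 := ha.eqOn_zero_of_preconnected_of_eventuallyEq_zero isPreconnected_univ
    (Set.mem_univ ζ) (analyticOrderAt_eq_top.1 h) (Set.mem_univ (0 : ℂ))
  simp [line] at h1
  exact h0 h1

theorem order_mul_line {f g : ℂⁿ → ℂ} (hf : Differentiable ℂ f)
    (hg : Differentiable ℂ g) (x y : ℂⁿ) (ζ : ℂ) : analyticOrderAt (line x y fun x => f x * g x) ζ =
      analyticOrderAt (line x y f) ζ + analyticOrderAt (line x y g) ζ :=
  analyticOrderAt_mul (analyticAt_line hf x y ζ) (analyticAt_line hg x y ζ)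

open Polynomial in
theorem exists_polynomial_line {x : ℂⁿ} {y : ℝⁿ}
    {S : Set ℝⁿ} (hS : ∀ κ ∈ S, ∃ a : ℤ, κ ⬝ᵥ y = a) {f : ℂⁿ → ℂ}
    (hf : f ∈ expSpan lq S) : ∃ (N : ℕ) (P : ℂ[X]), ∀ ζ : ℂ,
      P.eval (qpow lq (2 * ζ)) = qpow lq (2 * ζ) ^ N * line x (cvec y) f ζ := by
  classical
  obtain ⟨c, hc, rfl⟩ := mem_expSpan_iff.1 hf
  choose! a ha using hS
  set N := c.support.sup fun κ => (a κ).natAbs with hN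
  refine ⟨N, ∑ κ ∈ c.support, C (c κ * ex lq κ x) * X ^ (a κ + N).toNat, fun ζ => ?_⟩
  rw [line, ep_eq_sum lq c _ subset_rfl, Finset.mul_sum, eval_finsetSum]
  refine Finset.sum_congr rfl fun κ hκ => ?_
  have h1 : (a κ).natAbs ≤ N := Finset.le_sup (f := fun κ => (a κ).natAbs) hκ
  have h2 : (((a κ + N).toNat : ℤ)) = a κ + N := Int.toNat_of_nonneg (by omega)
  rw [eval_mul, eval_C, eval_pow, eval_X, ex_apply_add, ← zpow_natCast, h2,
    zpow_add₀ (qpow_ne_zero _ _), zpow_natCast]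
  have h3 : ex lq κ (ζ • cvec y) = qpow lq (2 * ζ) ^ (a κ) := by
    rw [ex, dotProduct_smul, cvec_dot_cvec, ha κ (hc hκ), ← qpow_intCast_mul]
    congr 1
    push_cast; rw [smul_eq_mul]; ring
  rw [h3]; ring

theorem exists_qpow_eq {lq T : ℂ} (hlq : lq ≠ 0) (hT : T ≠ 0) : ∃ ζ, qpow lq (2 * ζ) = T :=
  ⟨Complex.log T / (2 * lq), by
    rw [qpow, show 2 * (Complex.log T / (2 * lq)) * lq = Complex.log T by field_simp,
      Complex.exp_log hT]⟩

open Polynomial in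
/-- Divisibility of Laurent polynomials in terms of the orders of vanishing. -/
theorem exists_dvd_mul_pow (hlq : lq ≠ 0) (d : ℕ) : ∀ P Q : ℂ[X], Q.natDegree ≤ d → Q ≠ 0 →
    (∀ ζ, analyticOrderAt (fun ζ : ℂ => Q.eval (qpow lq (2 * ζ))) ζ ≤
      analyticOrderAt (fun ζ : ℂ => P.eval (qpow lq (2 * ζ))) ζ) → ∃ M : ℕ, Q ∣ P * X ^ M := by
  have hd : ∀ P : ℂ[X], Differentiable ℂ fun ζ : ℂ => P.eval (qpow lq (2 * ζ)) := fun P =>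
    P.differentiable.comp ((differentiable_qpow lq).comp (differentiable_id.const_mul 2))
  have hmul : ∀ (P Q : ℂ[X]) (ζ : ℂ), analyticOrderAt (fun ζ : ℂ => (P * Q).eval (qpow lq (2 * ζ))) ζ
      = analyticOrderAt (fun ζ : ℂ => P.eval (qpow lq (2 * ζ))) ζ +
        analyticOrderAt (fun ζ : ℂ => Q.eval (qpow lq (2 * ζ))) ζ := by
    intro P Q ζ
    rw [← analyticOrderAt_mul ((hd P).analyticAt ζ) ((hd Q).analyticAt ζ)]
    congr 1
    ext; simp
  induction d with
  | zero =>
    intro P Q hQ hQ0 _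
    refine ⟨0, (isUnit_iff_degree_eq_zero.2 ?_).dvd⟩
    rw [degree_eq_natDegree hQ0]
    exact_mod_cast Nat.le_zero.1 hQ
  | succ d ih =>
    intro P Q hQ hQ0 h
    rcases Nat.eq_zero_or_pos Q.natDegree with h0 | hpos
    · exact ⟨0, (isUnit_iff_degree_eq_zero.2 (by
        rw [degree_eq_natDegree hQ0, h0]; rfl)).dvd⟩
    obtain ⟨T, hT⟩ := IsAlgClosed.exists_root Q (by
      rw [degree_eq_natDegree hQ0]; exact_mod_cast hpos.ne')
    obtain ⟨Q', rfl⟩ := dvd_iff_isRoot.2 hT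
    have hQ'0 : Q' ≠ 0 := right_ne_zero_of_mul hQ0
    have hdeg : Q'.natDegree ≤ d := by
      rw [natDegree_mul (X_sub_C_ne_zero T) hQ'0, natDegree_X_sub_C] at hQ; omega
    by_cases hT0 : T = 0
    · subst hT0
      obtain ⟨M, hM⟩ := ih P Q' hdeg hQ'0 fun ζ => by
        refine le_trans ?_ (h ζ)
        rw [hmul]
        exact le_add_self
      refine ⟨M + 1, ?_⟩
      rw [C_0, sub_zero, pow_succ, ← mul_assoc, mul_comm X]
      exact mul_dvd_mul_right hM X
    · obtain ⟨ζ0, hζ0⟩ := exists_qpow_eq hlq hT0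
      have hroot : P.IsRoot T := by
        have h1 := h ζ0
        rw [hmul] at h1
        have h2 : analyticOrderAt (fun ζ : ℂ => (X - C T).eval (qpow lq (2 * ζ))) ζ0 ≠ 0 :=
          ((hd _).analyticAt ζ0).analyticOrderAt_ne_zero.2 (by simp [hζ0])
        have h3 : analyticOrderAt (fun ζ : ℂ => P.eval (qpow lq (2 * ζ))) ζ0 ≠ 0 := by
          intro h4
          rw [h4] at h1
          exact h2 (by simpa using (le_zero_iff.1 (le_trans le_self_add h1)))
        have := ((hd P).analyticAt ζ0).analyticOrderAt_ne_zero.1 h3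
        rwa [hζ0] at this
      obtain ⟨P', rfl⟩ := dvd_iff_isRoot.2 hroot
      obtain ⟨M, hM⟩ := ih P' Q' hdeg hQ'0 fun ζ => by
        have h1 := h ζ
        rw [hmul, hmul] at h1
        refine (ENat.add_le_add_iff_left ?_).1 h1
        rw [Ne, analyticOrderAt_eq_top]
        intro h5
        have h6 := (hd (X - C T)).differentiableOn.analyticOnNhd isOpen_univ
          |>.eqOn_zero_of_preconnected_of_eventuallyEq_zero isPreconnected_univ (Set.mem_univ ζ) h5
        obtain ⟨ζ1, hζ1⟩ := exists_qpow_eq hlq (T := T + T) (by simpa using hT0)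
        have h7 := h6 (Set.mem_univ ζ1)
        simp [hζ1] at h7
        exact hT0 h7
      exact ⟨M, by rw [mul_assoc]; exact mul_dvd_mul_left _ hM⟩

open Polynomial in
/-- A Laurent polynomial with limits along the positive real axis is constant. -/
theorem coeff_eq_zero_of_tendsto (U : ℂ[X]) (M : ℕ) {L L' : ℂ}
    (h1 : Tendsto (fun t : ℝ => U.eval (Real.exp t : ℂ) / (Real.exp t : ℂ) ^ M) atTop (𝓝 L))
    (h2 : Tendsto (fun t : ℝ => U.eval (Real.exp (-t) : ℂ) / (Real.exp (-t) : ℂ) ^ M) atTop (𝓝 L')) :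
    ∀ T : ℂ, U.eval T = L * T ^ M := by
  classical
  set e : ℝ → Fin 1 → ℝ := fun a _ => a with he
  set c : (Fin 1 → ℝ) →₀ ℂ := ∑ k ∈ U.support, Finsupp.single (e ((k : ℝ) - M)) (U.coeff k) with hc
  have hinj : ∀ a b : ℝ, e a = e b → a = b := fun a b h => congrFun h 0
  have hdot : ∀ a b : ℝ, e a ⬝ᵥ e b = a * b := fun a b => by simp [he, dotProduct]
  have hep : ∀ s t : ℝ, ep 1 c (ray 1 0 (e s) t) =
      U.eval (Real.exp (t * s) : ℂ) / (Real.exp (t * s) : ℂ) ^ M := by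
    intro s t
    rw [hc, ep_sum, eval_eq_sum, Polynomial.sum, Finset.sum_div]
    refine Finset.sum_congr rfl fun k _ => ?_
    rw [ep_single, ex_ray one_ne_zero, ex_apply_zero, one_mul, hdot, mul_div_assoc]
    congr 1
    rw [eq_div_iff (pow_ne_zero _ (Complex.ofReal_ne_zero.2 (Real.exp_ne_zero _))),
      ← Complex.ofReal_pow, ← Complex.ofReal_pow, ← Complex.ofReal_mul, ← Real.exp_nat_mul,
      ← Real.exp_nat_mul, ← Real.exp_add]
    congr 2; ring
  have hsep : ∀ s : ℝ, s ≠ 0 → ∀ μ ∈ c.support, ∀ ν ∈ c.support, μ ≠ ν → μ ⬝ᵥ e s ≠ ν ⬝ᵥ e s := by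
    intro s hs μ _ ν _ hne h
    refine hne (funext fun k => ?_)
    have h3 : μ 0 * s = ν 0 * s := by simpa [he, dotProduct] using h
    rw [Subsingleton.elim k 0]
    exact mul_right_cancel₀ hs h3
  have hup := exponent_le_of_tendsto one_ne_zero (hsep 1 one_ne_zero) (θ := 0) (z := 0) (L := L)
    (h1.congr fun t => by rw [hep]; simp)
  have hdn := exponent_le_of_tendsto one_ne_zero (hsep (-1) (by norm_num)) (θ := 0) (z := 0)
    (L := L') (h2.congr fun t => by rw [hep]; simp)
  have hcoef : ∀ k, U.coeff k ≠ 0 → k = M := by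
    intro k hk
    have hk1 : e ((k : ℝ) - M) ∈ c.support := by
      rw [Finsupp.mem_support_iff, hc, Finsupp.finsetSum_apply, Finset.sum_eq_single k]
      · simpa using hk
      · intro k' _ hne
        rw [Finsupp.single_apply, if_neg]
        intro h
        have := hinj _ _ h
        exact hne (by exact_mod_cast (sub_left_inj.1 this))
      · intro h; simpa using h
    have h3 := hup _ hk1
    have h4 := hdn _ hk1
    rw [hdot] at h3 h4
    have : (k : ℝ) = M := by linarith
    exact_mod_cast this
  have hU : U = C (U.coeff M) * X ^ M := by
    ext k
    rw [coeff_C_mul_X_pow]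
    split_ifs with h
    · rw [h]
    · by_contra h3; exact h (hcoef k h3)
  have hL : L = U.coeff M := by
    refine tendsto_nhds_unique h1 (tendsto_const_nhds.congr fun t => ?_)
    rw [hU]
    simp only [eval_mul, eval_C, eval_pow, eval_X, coeff_C_mul_X_pow, if_true]
    rw [mul_div_cancel_right₀]
    exact pow_ne_zero _ (Complex.ofReal_ne_zero.2 (Real.exp_ne_zero _))
  intro T
  rw [hU, hL, eval_mul, eval_C, eval_pow, eval_X]

namespace EuclRoots

variable {R : EuclRoots ι n} [Fintype ι]

theorem IsFam.support_subset {K : ℂⁿ → ℝⁿ →₀ ℂ} (hK : R.IsFam lq K)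
    (x : ℂⁿ) : (K x).support ⊆ R.wts R.hN := fun _ hν =>
  R.mem_wts.2 ⟨R.rhoCoset_subset ((hK.mem x).1 hν).1, ((hK.mem x).1 hν).2⟩

theorem IsFam.differentiable {K : ℂⁿ → ℝⁿ →₀ ℂ} (hK : R.IsFam lq K)
    (ν : ℝⁿ) : Differentiable ℂ fun x => K x ν := differentiable_of_mem_expSpan (hK.exp ν)

theorem bf_eq_sum {x : ℂⁿ} {c : ℝⁿ →₀ ℂ} {T : Finset ℝⁿ} (hc : c.support ⊆ T) (p : ℂⁿ) :
    bf lq x c p = ∑ ν ∈ T, c ν * (qpow lq (2 * (x ⬝ᵥ p)) * ex lq ν p) := by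
  rw [bf, ep_eq_sum lq c p hc, Finset.mul_sum]
  exact Finset.sum_congr rfl fun ν _ => by ring

theorem IsFam.differentiable_bf {K : ℂⁿ → ℝⁿ →₀ ℂ} (hK : R.IsFam lq K)
    (p : ℂⁿ) : Differentiable ℂ fun x => bf lq x (K x) p := by
  simp only [bf_eq_sum (hK.support_subset _)]
  refine Differentiable.fun_sum fun ν _ => (hK.differentiable ν).mul (Differentiable.mul_const ?_ _)
  exact (differentiable_qpow lq).comp (Differentiable.const_mul
    (by simpa only [dotProduct_comm] using differentiable_dot p) 2)

/-- The leading coefficients of a family along a line form a quasi-invariant vector. -/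
theorem IsFam.exists_leading {K : ℂⁿ → ℝⁿ →₀ ℂ} (hK : R.IsFam lq K)
    {x1 y : ℂⁿ} (h1 : K x1 R.rho ≠ 0) (ζ0 : ℂ) : ∃ (k : ℕ) (c : ℝⁿ →₀ ℂ), c ≠ 0 ∧
      c ∈ R.qiSpace lq (x1 + ζ0 • y) (R.rhoCoset ∩ body R.hN) ∧
      (∀ ν, c ν ≠ 0 → analyticOrderAt (line x1 y fun x => K x ν) ζ0 ≤ k) ∧
      ∀ p, (k : ℕ∞) ≤ analyticOrderAt (line x1 y fun x => bf lq x (K x) p) ζ0 := by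
  classical
  set T := R.wts R.hN with hT
  have hρ : R.rho ∈ T := R.mem_wts.2 ⟨R.rho_mem, R.rhoV_mem_body _⟩
  obtain ⟨ν0, hν0, hmin⟩ := T.exists_min_image
    (fun ν => analyticOrderAt (line x1 y fun x => K x ν) ζ0) ⟨_, hρ⟩
  have htop : analyticOrderAt (line x1 y fun x => K x ν0) ζ0 ≠ ⊤ := fun h => by
    have := hmin _ hρ
    rw [h, top_le_iff] at this
    exact order_line_ne_top (hK.differentiable _) h1 ζ0 this
  obtain ⟨k, hk⟩ := ENat.ne_top_iff_exists.1 htop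
  have hb : ∀ ν, ∃ b : ℂ → ℂ, ν ∈ T → (AnalyticAt ℂ b ζ0 ∧
      ∀ᶠ z in 𝓝 ζ0, line x1 y (fun x => K x ν) z = (z - ζ0) ^ k • b z) := by
    intro ν
    by_cases hν : ν ∈ T
    · have := hmin ν hν
      rw [← hk] at this
      obtain ⟨b, hb⟩ := (natCast_le_analyticOrderAt
        (analyticAt_line (hK.differentiable ν) x1 y ζ0)).1 this
      exact ⟨b, fun _ => hb⟩
    · exact ⟨0, fun h => absurd h hν⟩
  choose b hb using hb
  have hord : ∀ ν ∈ T, analyticOrderAt (line x1 y fun x => K x ν) ζ0 =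
      k + analyticOrderAt (b ν) ζ0 := by
    intro ν hν
    obtain ⟨h2, h3⟩ := hb ν hν
    rw [analyticOrderAt_congr (g := fun z => (z - ζ0) ^ k * b ν z) h3]
    have ha : AnalyticAt ℂ (fun z => (z - ζ0) ^ k) ζ0 := by fun_prop
    have e : analyticOrderAt (fun z => (z - ζ0) ^ k) ζ0 = k :=
      ha.analyticOrderAt_eq_natCast.2 ⟨fun _ => 1, analyticAt_const, one_ne_zero, by simp⟩
    have := analyticOrderAt_mul ha h2
    rw [e] at this
    exact this
  have hbne : ∀ ν ∈ T, b ν ζ0 ≠ 0 → analyticOrderAt (line x1 y fun x => K x ν) ζ0 = k := by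
    intro ν hν h
    rw [hord ν hν, (hb ν hν).1.analyticOrderAt_eq_zero.2 h, add_zero]
  set c : ℝⁿ →₀ ℂ := ∑ ν ∈ T, Finsupp.single ν (b ν ζ0) with hc
  have hcν : ∀ ν, c ν = if ν ∈ T then b ν ζ0 else 0 := by
    intro ν
    rw [hc, Finsupp.finsetSum_apply]
    simp [Finsupp.single_apply]
  have hcT : c.support ⊆ T := by
    intro ν hν
    by_contra h
    exact Finsupp.mem_support_iff.1 hν (by rw [hcν, if_neg h])
  have hline : ∀ᶠ z in 𝓝 ζ0, ∀ ν ∈ T, K (x1 + z • y) ν = (z - ζ0) ^ k * b ν z :=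
    (Finset.eventually_all T).2 fun ν hν => (hb ν hν).2
  have hcont : ∀ p, ContinuousAt (fun z => ∑ ν ∈ T, b ν z *
      (qpow lq (2 * ((x1 + z • y) ⬝ᵥ p)) * ex lq ν p)) ζ0 := by
    intro p
    refine tendsto_finsetSum _ fun ν hν => ((hb ν hν).1.continuousAt).mul ?_
    refine ContinuousAt.mul ?_ continuousAt_const
    refine ((differentiable_qpow lq).continuous.continuousAt).comp ?_
    unfold dotProduct; fun_prop
  have hbf : ∀ p, ∀ᶠ z in 𝓝 ζ0, bf lq (x1 + z • y) (K (x1 + z • y)) p = (z - ζ0) ^ k *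
      ∑ ν ∈ T, b ν z * (qpow lq (2 * ((x1 + z • y) ⬝ᵥ p)) * ex lq ν p) := by
    intro p
    filter_upwards [hline] with z hz
    rw [bf_eq_sum (hK.support_subset _), Finset.mul_sum]
    exact Finset.sum_congr rfl fun ν hν => by rw [hz ν hν]; ring
  have hbfc : ∀ p, bf lq (x1 + ζ0 • y) c p =
      ∑ ν ∈ T, b ν ζ0 * (qpow lq (2 * ((x1 + ζ0 • y) ⬝ᵥ p)) * ex lq ν p) := by
    intro p
    rw [bf_eq_sum hcT]
    exact Finset.sum_congr rfl fun ν hν => by rw [hcν, if_pos hν]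
  refine ⟨k, c, ?_, ⟨?_, ?_⟩, ?_, ?_⟩
  · intro h
    have h2 := hord ν0 hν0
    have h3 : c ν0 = b ν0 ζ0 := by rw [hcν, if_pos hν0]
    rw [h, Finsupp.zero_apply] at h3
    rw [← hk] at h2
    have h4 : analyticOrderAt (b ν0) ζ0 = 0 := by
      have : (k : ℕ∞) + 0 = k + analyticOrderAt (b ν0) ζ0 := by rw [add_zero]; exact h2
      exact ((ENat.add_right_injective_of_ne_top (ENat.natCast_ne_top k)) this).symm
    exact (hb ν0 hν0).1.analyticOrderAt_eq_zero.1 h4 h3.symm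
  · intro ν hν
    have hνT := hcT hν
    by_contra hn
    have h0 : ∀ x, K x ν = 0 := fun x => by
      by_contra h
      exact hn ((hK.mem x).1 (Finsupp.mem_support_iff.2 h))
    have h2 := hbne ν hνT (by
      have := Finsupp.mem_support_iff.1 hν
      rwa [hcν, if_pos hνT] at this)
    have h3 : analyticOrderAt (line x1 y fun x => K x ν) ζ0 = ⊤ :=
      analyticOrderAt_eq_top.2 (Eventually.of_forall fun z => h0 _)
    rw [h3] at h2
    exact ENat.top_ne_natCast k h2
  · intro i s hs1 hs2 z hz
    have hlim : ∀ p, Tendsto (fun ζ => ∑ ν ∈ T, b ν ζ *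
        (qpow lq (2 * ((x1 + ζ • y) ⬝ᵥ p)) * ex lq ν p)) (𝓝[≠] ζ0)
        (𝓝 (bf lq (x1 + ζ0 • y) c p)) := fun p => by
      rw [hbfc]
      exact (hcont p).tendsto.mono_left nhdsWithin_le_nhds
    refine tendsto_nhds_unique (hlim _) ((hlim _).congr' ?_)
    filter_upwards [(hbf (R.path i z s)).filter_mono nhdsWithin_le_nhds,
      (hbf (R.path i z (-s))).filter_mono nhdsWithin_le_nhds, self_mem_nhdsWithin] with ζ h2 h3 h4
    have h5 := (hK.mem (x1 + ζ • y)).2 i s hs1 hs2 z hz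
    rw [h2, h3] at h5
    exact (mul_left_cancel₀ (pow_ne_zero _ (sub_ne_zero.2 h4)) h5).symm
  · intro ν hν
    have hνT := hcT (Finsupp.mem_support_iff.2 hν)
    exact (hbne ν hνT (by rwa [hcν, if_pos hνT] at hν)).le
  · intro p
    refine (natCast_le_analyticOrderAt (analyticAt_line (hK.differentiable_bf p) x1 y ζ0)).2
      ⟨fun z => ∑ ν ∈ T, b ν z * (qpow lq (2 * ((x1 + z • y) ⬝ᵥ p)) * ex lq ν p), ?_, hbf p⟩
    refine Finset.analyticAt_fun_sum _ fun ν hν => (hb ν hν).1.mul (AnalyticAt.mul ?_ analyticAt_const)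
    refine Differentiable.analyticAt ?_ ζ0
    refine (differentiable_qpow lq).comp ?_
    unfold dotProduct; fun_prop

/-- With at most one resonant direction, a quasi-invariant vector reaches an edge. -/
theorem exists_edge_ne_zero (hq : NotRootOfUnity lq) {x : ℂⁿ}
    {c : ℝⁿ →₀ ℂ} (hc : c ∈ R.qiSpace lq x (R.rhoCoset ∩ body R.hN)) (hne : c ≠ 0)
    {i : ι} (hi : ∀ j, j ≠ i → j ≠ R.neg i → R.NonRes lq j x) :
    ∃ v1 v w, R.Adj i v1 v w ∧ ∃ l : ℕ, l ≤ R.mult i ∧ c (R.rhoV v - (l : ℝ) • R.coroot i) ≠ 0 := by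
  obtain ⟨v1, h1, h2⟩ := R.exists_wall_point i
  obtain ⟨v, w, h⟩ := R.exists_adj h1 h2
  obtain ⟨ν, hν, hν1⟩ := R.sweep c.support (Finsupp.support_nonempty_iff.2 hne)
    (fun ν hν => (hc.1 hν).2) v1 (by
      intro j hj ν hν
      have hji : j ≠ i := by rintro rfl; exact hj h1
      have hjn : j ≠ R.neg i := by
        rintro rfl; rw [R.root_neg, neg_dotProduct, h1, neg_zero] at hj; exact hj rfl
      obtain ⟨a, b, ha, hb, hab⟩ := R.exists_long_string hq
        (fun ν hν => R.rhoCoset_subset hν.1) hc (hi j hji hjn) hν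
      exact ⟨a, b, ha, hb, by exact_mod_cast hab⟩)
  obtain ⟨l, hl, rfl⟩ := h.eq_of_mem_face (hc.1 hν) hν1
  exact ⟨v1, v, w, h, l, hl, Finsupp.mem_support_iff.1 hν⟩

/-- The pole order of the normalized Baker--Akhiezer function is compensated by `nrm`. -/
theorem IsFam.order_le (hq : NotRootOfUnity lq) {K : ℂⁿ → ℝⁿ →₀ ℂ} (hK : R.IsFam lq K)
    {x1 y : ℂⁿ} (hx1 : R.Good lq x1) {ζ0 : ℂ}
    (hres : ∃ i, ∀ j, j ≠ i → j ≠ R.neg i → R.NonRes lq j (x1 + ζ0 • y)) (p : ℂⁿ) :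
    analyticOrderAt (line x1 y fun x => K x R.rho) ζ0 ≤
      analyticOrderAt (line x1 y fun x => R.nrm lq R.y0 x * bf lq x (K x) p) ζ0 := by
  obtain ⟨i, hi⟩ := hres
  obtain ⟨k, c, hne, hc, hcν, hk⟩ := hK.exists_leading (hK.ne x1 hx1) (y := y) ζ0
  obtain ⟨v1, v, w, h, l, hl, hcl⟩ := exists_edge_ne_zero hq hc hne hi
  have hdn := R.differentiable_nrm lq
  have key : analyticOrderAt (line x1 y fun x => K x (R.rhoV v)) ζ0 ≤
      k + analyticOrderAt (line x1 y (R.nrm lq v)) ζ0 := by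
    have hC := hcν _ hcl
    rcases Nat.eq_zero_or_pos l with rfl | hpos
    · simp only [Nat.cast_zero, zero_smul, sub_zero] at hC
      exact hC.trans le_self_add
    · obtain ⟨N, hN, hNv⟩ := h.nrm_eq lq
      have hB : Differentiable ℂ fun x : ℂⁿ =>
          ∏ j ∈ Finset.range l, qbr lq (cvec (R.root i) ⬝ᵥ x - (j + 1 : ℕ)) :=
        differentiable_prod _ _ fun j _ =>
          (differentiable_qbr lq).comp ((differentiable_dot _).sub_const _)
      have hA : Differentiable ℂ fun x : ℂⁿ =>
          (∏ t ∈ Finset.range l, qbr lq (cvec (R.root i) ⬝ᵥ x + R.mult i - t)) *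
          ∏ k ∈ ((Finset.range (R.mult i + 1)).erase 0).erase l, qbr lq k :=
        (differentiable_prod _ _ fun j _ => (differentiable_qbr lq).comp
          (((differentiable_dot _).add_const _).sub_const _)).mul_const _
      set γ : ℂ := -∏ k ∈ ((Finset.range (R.mult i + 1)).erase 0).erase l, qbr lq (k - l) with hγ
      have hγ0 : γ ≠ 0 := by
        rw [hγ, neg_ne_zero, Finset.prod_ne_zero_iff]
        intro k hk
        have : (k : ℤ) - l ≠ 0 := by
          have := Finset.ne_of_mem_erase hk; omega
        have := qbr_intCast_ne_zero hq this
        exact_mod_cast this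
      set Q := (Finset.range (R.mult i)).filter fun j => ¬ j < l with hQ
      have hsplit : ∀ x, R.nrm lq v x = (∏ j ∈ Finset.range l,
          qbr lq (cvec (R.root i) ⬝ᵥ x - (j + 1 : ℕ))) * ((-1) ^ l *
          (∏ j ∈ Q, qbr lq ((j + 1 : ℕ) - cvec (R.root i) ⬝ᵥ x)) * N x) := by
        intro x
        rw [(hNv x).1, ← Finset.prod_filter_mul_prod_filter_not _ (fun j => j < l), ← hQ]
        have e1 : (Finset.range (R.mult i)).filter (fun j => j < l) = Finset.range l := by
          ext j; simp; omega
        have e2 : ∏ j ∈ Finset.range l, qbr lq ((j + 1 : ℕ) - cvec (R.root i) ⬝ᵥ x) =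
            (∏ j ∈ Finset.range l, qbr lq (cvec (R.root i) ⬝ᵥ x - (j + 1 : ℕ))) * (-1) ^ l := by
          conv_rhs => rw [← Finset.card_range l, ← Finset.prod_const, Finset.card_range,
            ← Finset.prod_mul_distrib]
          refine Finset.prod_congr rfl fun k _ => ?_
          rw [← neg_sub, qbr_neg]; ring
        rw [e1, e2]; ring
      have hD2 : Differentiable ℂ fun x : ℂⁿ => (-1) ^ l *
          (∏ j ∈ Q, qbr lq ((j + 1 : ℕ) - cvec (R.root i) ⬝ᵥ x)) * N x :=
        ((differentiable_prod _ _ fun j _ => (differentiable_qbr lq).comp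
          ((differentiable_dot _).const_sub _)).const_mul _).mul hN
      have h3 := order_mul_line hB hD2 x1 y ζ0
      rw [← funext hsplit] at h3
      have h4 := order_mul_line (hK.differentiable (R.rhoV v)) hA x1 y ζ0
      have h5 := order_mul_line ((hK.differentiable (R.rhoV v - (l : ℝ) • R.coroot i)).mul hB)
        (differentiable_const γ) x1 y ζ0
      have h6 : analyticOrderAt (line x1 y fun _ => γ) ζ0 = 0 :=
        (analyticAt_line (differentiable_const γ) x1 y ζ0).analyticOrderAt_eq_zero.2 hγ0
      rw [h6, add_zero] at h5
      have h7 := order_mul_line (hK.differentiable (R.rhoV v - (l : ℝ) • R.coroot i)) hB x1 y ζ0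
      have h8 : (fun x => K x (R.rhoV v) *
          ((∏ t ∈ Finset.range l, qbr lq (cvec (R.root i) ⬝ᵥ x + R.mult i - t)) *
          ∏ k ∈ ((Finset.range (R.mult i + 1)).erase 0).erase l, qbr lq k)) = fun x =>
          K x (R.rhoV v - (l : ℝ) • R.coroot i) *
          (∏ j ∈ Finset.range l, qbr lq (cvec (R.root i) ⬝ᵥ x - (j + 1 : ℕ))) * γ := by
        funext x
        have := hK.edge hq h hpos hl x
        rw [hγ]
        linear_combination this
      rw [h8] at h4
      calc _ ≤ _ := le_self_add
        _ = _ := h4.symm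
        _ = _ := h5
        _ = _ := h7
        _ ≤ (k : ℕ∞) + _ := add_le_add hC le_self_add
        _ = _ := by rw [h3]
  have hn0 : ∀ u, analyticOrderAt (line x1 y (R.nrm lq u)) ζ0 ≠ ⊤ := fun u =>
    order_line_ne_top (hdn u) (hx1.nrm_ne_zero u) ζ0
  have h9 : (fun x => K x (R.rhoV v) * R.nrm lq R.y0 x) = fun x => K x R.rho * R.nrm lq v x :=
    funext fun x => hK.rhoV_mul_nrm hq h.reg R.reg_y0 x
  have h10 := order_mul_line (hK.differentiable (R.rhoV v)) (hdn R.y0) x1 y ζ0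
  rw [h9, order_mul_line (hK.differentiable R.rho) (hdn v)] at h10
  rw [order_mul_line (hdn R.y0) (hK.differentiable_bf p)]
  have h11 : analyticOrderAt (line x1 y fun x => K x R.rho) ζ0 +
      analyticOrderAt (line x1 y (R.nrm lq v)) ζ0 ≤
      (analyticOrderAt (line x1 y (R.nrm lq R.y0)) ζ0 + k) +
      analyticOrderAt (line x1 y (R.nrm lq v)) ζ0 := by
    rw [h10]
    calc _ ≤ _ := add_le_add_left key _
      _ = _ := by ring
  refine ((ENat.add_le_add_iff_right (hn0 v)).1 h11).trans (add_le_add_right (hk p) _)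

end EuclRoots

theorem residual_ex_ne (hlq : lq ≠ 0) {μ : ℝⁿ} (hμ : μ ≠ 0) (a : ℂ) :
    ∀ᶠ x in residual ℂⁿ, ex lq μ x ≠ a := by
  have h : ∀ᶠ x in residual ℂⁿ, ex lq μ x - a ≠ 0 := by
    refine residual_ne_zero ((differentiable_ex lq μ).sub_const a) ?_
    by_contra! h
    have := DFunLike.congr_fun (ep_injective' hlq (c := Finsupp.single μ 1)
      (d := Finsupp.single 0 a) fun z => by
        rw [ep_single, ep_single, ex_zero]; linear_combination h z) μ
    rw [Finsupp.single_apply, Finsupp.single_apply, if_pos rfl, if_neg hμ.symm] at this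
    exact one_ne_zero this
  exact h.mono fun x hx => sub_ne_zero.1 hx

namespace EuclRoots

variable {R : EuclRoots ι n} [Fintype ι]

/-- A generic line meets the resonance hyperplanes one at a time. -/
theorem residual_single_resonance (R : EuclRoots ι n) (hq : NotRootOfUnity lq) :
    ∀ᶠ x in residual ℂⁿ, ∀ ζ : ℂ, ∃ i, ∀ j, j ≠ i → j ≠ R.neg i →
      R.NonRes lq j (x + ζ • cvec R.y0) := by
  choose b hb using R.y0_int
  have hb0 : ∀ i, (b i : ℝ) ≠ 0 := fun i => by rw [← hb]; exact R.y0_ne i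
  have hμ : ∀ i j, j ≠ i → j ≠ R.neg i →
      (b j : ℝ) • R.root i - (b i : ℝ) • R.root j ≠ 0 := by
    intro i j h1 h2 h0
    have h3 : R.root j = ((b j : ℝ) / b i) • R.root i := by
      rw [div_eq_inv_mul, mul_smul, sub_eq_zero.1 h0, smul_smul, inv_mul_cancel₀ (hb0 i), one_smul]
    rcases R.eq_or_eq_neg_of_smul h3 with h | h
    · exact h1 h
    · exact h2 h
  have hres : ∀ᶠ x in residual ℂⁿ, ∀ i j, j ≠ i → j ≠ R.neg i → ∀ N : ℤ,
      ex lq ((b j : ℝ) • R.root i - (b i : ℝ) • R.root j) x ≠ qpow lq (2 * N) := by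
    refine eventually_countable_forall.2 fun i => eventually_countable_forall.2 fun j => ?_
    by_cases h1 : j = i
    · exact Eventually.of_forall fun x h => absurd h1 h
    by_cases h2 : j = R.neg i
    · exact Eventually.of_forall fun x _ h => absurd h2 h
    · exact (eventually_countable_forall.2 fun N =>
        residual_ex_ne hq.ne_zero (hμ i j h1 h2) _).mono fun x hx _ _ N => hx N
  filter_upwards [hres] with x hx ζ
  by_cases hall : ∀ j, R.NonRes lq j (x + ζ • cvec R.y0)
  · obtain ⟨i⟩ := R.nonempty
    exact ⟨i, fun j _ _ => hall j⟩
  · push Not at hall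
    obtain ⟨i, hi⟩ := hall
    refine ⟨i, fun j h1 h2 l hl => ?_⟩
    simp only [NonRes, not_forall, not_not] at hi
    obtain ⟨k, hk⟩ := hi
    refine hx i j h1 h2 (b j * k - b i * l) ?_
    have e : ∀ i (k : ℤ), cvec (R.root i) ⬝ᵥ (x + ζ • cvec R.y0) - k =
        cvec (R.root i) ⬝ᵥ x + ζ * b i - k := by
      intro i k
      rw [dotProduct_add, dotProduct_smul, cvec_dot_cvec, hb, smul_eq_mul]
      push_cast; rfl
    rw [e] at hk hl
    have h3 := qpow_intCast_mul lq (b j) (2 * (cvec (R.root i) ⬝ᵥ x + ζ * b i - k))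
    have h4 := qpow_intCast_mul lq (b i) (2 * (cvec (R.root j) ⬝ᵥ x + ζ * b j - l))
    rw [hk, one_zpow] at h3
    rw [hl, one_zpow] at h4
    have h5 : 2 * (cvec ((b j : ℝ) • R.root i - (b i : ℝ) • R.root j) ⬝ᵥ x) =
        b j * (2 * (cvec (R.root i) ⬝ᵥ x + ζ * b i - k)) -
        b i * (2 * (cvec (R.root j) ⬝ᵥ x + ζ * b j - l)) + 2 * ((b j * k - b i * l : ℤ) : ℂ) := by
      rw [cvec_sub, cvec_smul, cvec_smul, sub_dotProduct, smul_dotProduct, smul_dotProduct]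
      push_cast
      simp only [smul_eq_mul]
      ring
    rw [ex, h5, qpow_add, qpow_sub, h3, h4, inv_one, one_mul, one_mul]

theorem dual_corootLattice_dot_y0 {κ : ℝⁿ} (h : κ ∈ R.dual.corootLattice) :
    ∃ a : ℤ, κ ⬝ᵥ R.y0 = a := by
  induction h using AddSubgroup.closure_induction with
  | mem κ h => obtain ⟨i, rfl⟩ := h; exact R.y0_int i
  | zero => exact ⟨0, by simp⟩
  | add a b _ _ ha hb =>
    obtain ⟨k, hk⟩ := ha
    obtain ⟨l, hl⟩ := hb
    exact ⟨k + l, by rw [add_dotProduct, hk, hl]; push_cast; rfl⟩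
  | neg a _ ha =>
    obtain ⟨k, hk⟩ := ha
    exact ⟨-k, by rw [neg_dotProduct, hk]; push_cast; rfl⟩

theorem nrm_mul_ex_mem (R : EuclRoots ι n) (lq : ℂ) {v : ℝⁿ} (hv : R.Reg v) :
    (fun x => R.nrm lq v x * ex lq (-R.dual.rhoV v) x) ∈
      expSpan lq (R.dual.corootLattice : Set ℝⁿ) := by
  have e : ∀ x, R.nrm lq v x * ex lq (-R.dual.rhoV v) x = ∏ i, if 0 < R.root i ⬝ᵥ v then
      ∏ j ∈ Finset.range (R.mult i), (qpow lq (j + 1 : ℕ) * ex lq (-R.root i) x -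
        qpow lq (-(j + 1 : ℕ)) * ex lq 0 x) else 1 := by
    intro x
    rw [ex_neg, ← R.dual.prod_qpow_dot (R.dual_reg.2 hv), ← div_eq_mul_inv, nrm,
      ← Finset.prod_div_distrib]
    refine Finset.prod_congr rfl fun i _ => ?_
    have e : (0 < R.dual.root i ⬝ᵥ v) ↔ 0 < R.root i ⬝ᵥ v := R.coroot_dot_pos
    by_cases hi : 0 < R.root i ⬝ᵥ v
    · simp only [if_pos hi, if_pos (e.2 hi), dual_mult]
      rw [← Finset.prod_div_distrib]
      refine Finset.prod_congr rfl fun j _ => ?_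
      rw [div_eq_iff (qpow_ne_zero _ _), ex_zero, mul_one, ex, cvec_neg, sub_mul, mul_assoc,
        ← qpow_add, ← qpow_add, qbr, ← qpow_add]
      change _ = qpow lq (_ + (_ + cvec (R.root i) ⬝ᵥ x)) - qpow lq (_ + cvec (R.root i) ⬝ᵥ x)
      rw [neg_dotProduct]
      congr 2 <;> ring
    · simp only [if_neg hi, if_neg (mt e.1 hi), div_one]
  rw [funext e]
  refine prod_mem_expSpan _ _ _ fun i _ => ?_
  split_ifs
  · refine prod_mem_expSpan _ _ _ fun j _ => Submodule.sub_mem _ ?_ ?_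
    · exact const_mul_mem_expSpan _ (ex_mem_expSpan lq (neg_mem (R.dual.coroot_mem i)))
    · exact const_mul_mem_expSpan _ (ex_mem_expSpan lq (zero_mem _))
  · exact const_mem_expSpan lq (zero_mem _) 1

theorem bf_rhoV (lq : ℂ) (x : ℂⁿ) (c : ℝⁿ →₀ ℂ) (v : ℝⁿ) :
    bf lq x c (cvec v) = ex lq v x * ep lq c (cvec v) := by
  rw [bf, ex, dotProduct_comm]

theorem eventually_eval_exp_neg_ne {Q : Polynomial ℂ} (hQ : Q ≠ 0) :
    ∀ᶠ t : ℝ in atTop, Q.eval (Real.exp (-t) : ℂ) ≠ 0 := by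
  have hfin : {z | Q.IsRoot z}.Finite := Polynomial.finite_setOfPred_isRoot hQ
  have hinj : Set.InjOn (fun t : ℝ => (Real.exp (-t) : ℂ)) ((fun t : ℝ => (Real.exp (-t) : ℂ)) ⁻¹'
      {z | Q.IsRoot z}) := fun a _ b _ h => by
    have := Real.exp_injective (Complex.ofReal_injective h)
    linarith
  obtain ⟨M, hM⟩ := (hfin.preimage hinj).bddAbove
  filter_upwards [eventually_gt_atTop M] with t ht h
  exact absurd (hM h) (not_le.2 ht)

theorem eventually_nrm_ray_ne (hlq : lq ≠ 0) (v : ℝⁿ) {w : ℝⁿ}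
    (hw : R.Reg w) (z : ℂⁿ) : ∀ᶠ t in atTop, R.nrm lq v (ray lq z w t) ≠ 0 := by
  obtain ⟨L, hL, -, h⟩ := R.tendsto_nrm_ray hlq v hw z
  exact (h.eventually_ne hL).mono fun t ht => right_ne_zero_of_mul ht

/-- The value of the Baker--Akhiezer function at `-ρ`. -/
theorem IsFam.nrm_mul_bf (hq : NotRootOfUnity lq) {K : ℂⁿ → ℝⁿ →₀ ℂ} (hK : R.IsFam lq K) (x : ℂⁿ) :
    R.nrm lq R.y0 x * bf lq x (K x) (cvec (R.dual.rhoV (-R.y0))) =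
      R.dual.nrm lq R.y0 (cvec (R.dual.rhoV (-R.y0))) * K x R.rho := by
  set p := cvec (R.dual.rhoV (-R.y0)) with hp
  set F : ℂⁿ → ℂ := fun x => R.nrm lq R.y0 x * bf lq x (K x) p with hF
  have hFd : Differentiable ℂ F := (R.differentiable_nrm lq _).mul (hK.differentiable_bf p)
  have hFmem : F ∈ expSpan lq (R.dual.corootLattice : Set ℝⁿ) := by
    have e : F = fun x => ∑ ν ∈ R.wts R.hN, ex lq ν p *
        ((fun x => R.nrm lq R.y0 x * ex lq (-R.dual.rhoV R.y0) x) * fun x => K x ν) x := by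
      funext x
      rw [hF]
      simp only [Pi.mul_apply]
      rw [hp, bf_rhoV, ep_eq_sum lq _ _ (hK.support_subset x), rhoV_neg, Finset.mul_sum,
        Finset.mul_sum]
      exact Finset.sum_congr rfl fun ν _ => by ring
    rw [e]
    refine sum_mem_expSpan _ _ fun ν _ => const_mul_mem_expSpan _ ?_
    exact mul_mem_expSpan (fun _ h1 _ h2 => add_mem h1 h2) (R.nrm_mul_ex_mem lq R.reg_y0) (hK.exp ν)
  refine congrFun (eq_of_residual (f := F) (g := fun x => _) hFd.continuous
    ((hK.continuous R.rho).const_mul _) ?_) x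
  filter_upwards [R.residual_good hq, R.residual_single_resonance hq, hK.tendsto hq R.reg_y0,
    hK.tendsto hq R.reg_y0.neg] with x1 hx1 hres hlim1 hlim2
  obtain ⟨N1, P, hP⟩ := exists_polynomial_line (x := x1) (y := R.y0)
    (fun κ hκ => dual_corootLattice_dot_y0 hκ) hFmem
  obtain ⟨N2, Q, hQ⟩ := exists_polynomial_line (x := x1) (y := R.y0)
    (fun κ hκ => dual_corootLattice_dot_y0 hκ) (hK.exp R.rho)
  have hQ0 : Q ≠ 0 := by
    rintro rfl
    have := hQ 0
    rw [Polynomial.eval_zero, mul_zero, qpow_zero, one_pow, one_mul, line, zero_smul,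
      add_zero] at this
    exact hK.ne x1 hx1 this.symm
  have hord : ∀ (N : ℕ) (P : Polynomial ℂ) (f : ℂⁿ → ℂ), Differentiable ℂ f →
      (∀ ζ, P.eval (qpow lq (2 * ζ)) = qpow lq (2 * ζ) ^ N * line x1 (cvec R.y0) f ζ) → ∀ ζ,
      analyticOrderAt (fun ζ : ℂ => P.eval (qpow lq (2 * ζ))) ζ =
        analyticOrderAt (line x1 (cvec R.y0) f) ζ := by
    intro N P f hf h ζ
    have ha : AnalyticAt ℂ (fun ζ => qpow lq (2 * ζ) ^ N) ζ :=
      Differentiable.analyticAt (((differentiable_qpow lq).comp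
        (differentiable_id.const_mul 2)).pow N) ζ
    rw [funext h]
    have := analyticOrderAt_mul ha (analyticAt_line hf x1 (cvec R.y0) ζ)
    rw [ha.analyticOrderAt_eq_zero.2 (pow_ne_zero _ (qpow_ne_zero _ _)), zero_add] at this
    exact this
  obtain ⟨M, U, hU⟩ := exists_dvd_mul_pow hq.ne_zero _ P Q le_rfl hQ0 fun ζ => by
    rw [hord N1 P F hFd hP, hord N2 Q _ (hK.differentiable _) hQ]
    exact hK.order_le hq hx1 (hres ζ) p
  have hquot : ∀ ζ, K (x1 + ζ • cvec R.y0) R.rho ≠ 0 →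
      F (x1 + ζ • cvec R.y0) / K (x1 + ζ • cvec R.y0) R.rho =
      (U * Polynomial.X ^ N2).eval (qpow lq (2 * ζ)) / qpow lq (2 * ζ) ^ (N1 + M) := by
    intro ζ h0
    have hT := qpow_ne_zero lq (2 * ζ)
    have := congrArg (Polynomial.eval (qpow lq (2 * ζ))) hU
    simp only [Polynomial.eval_mul, Polynomial.eval_pow, Polynomial.eval_X] at this ⊢
    rw [hP, hQ, line, line] at this
    rw [div_eq_div_iff h0 (pow_ne_zero _ hT)]
    linear_combination this
  have hray : ∀ (t : ℝ) (w : ℝⁿ) (e : ℝ), w = e • R.y0 → ∃ ζ : ℂ,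
      ray lq x1 w t = x1 + ζ • cvec R.y0 ∧ qpow lq (2 * ζ) = (Real.exp (e * t) : ℂ) := by
    rintro t w e rfl
    refine ⟨(t / (2 * lq)) * e, ?_, ?_⟩
    · rw [ray, cvec_smul, smul_smul]
    · rw [qpow, Complex.ofReal_exp]
      congr 1
      have := hq.ne_zero
      push_cast
      field_simp
  have hKne : ∀ t : ℝ, Q.eval (Real.exp t : ℂ) ≠ 0 → ∀ ζ, qpow lq (2 * ζ) = (Real.exp t : ℂ) →
      K (x1 + ζ • cvec R.y0) R.rho ≠ 0 := by
    intro t h ζ hζ h0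
    rw [← hζ, hQ, line, h0, mul_zero] at h
    exact h rfl
  have hQ1 : ∀ᶠ t : ℝ in atTop, Q.eval (Real.exp t : ℂ) ≠ 0 := by
    have hfin : {z | Q.IsRoot z}.Finite := Polynomial.finite_setOfPred_isRoot hQ0
    have hinj : Set.InjOn (fun t : ℝ => (Real.exp t : ℂ)) ((fun t : ℝ => (Real.exp t : ℂ)) ⁻¹'
        {z | Q.IsRoot z}) := fun a _ b _ h => Real.exp_injective (Complex.ofReal_injective h)
    obtain ⟨M, hM⟩ := (hfin.preimage hinj).bddAbove
    filter_upwards [eventually_gt_atTop M] with t ht h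
    exact absurd (hM h) (not_le.2 ht)
  have hl1 : Tendsto (fun t : ℝ => (U * Polynomial.X ^ N2).eval (Real.exp t : ℂ) /
      (Real.exp t : ℂ) ^ (N1 + M)) atTop (𝓝 (R.dual.nrm lq R.y0 p)) := by
    refine (hlim1 p).congr' ?_
    filter_upwards [hQ1] with t ht
    obtain ⟨ζ, h1, h2⟩ := hray t R.y0 1 (one_smul _ _).symm
    rw [one_mul] at h2
    rw [← h2, ← hquot ζ (hKne t ht ζ h2), ← h1, hF]
    simp only
    rw [hp, bf_rhoV, rhoV_neg, rho]
    ring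
  have hl2 : Tendsto (fun t : ℝ => (U * Polynomial.X ^ N2).eval (Real.exp (-t) : ℂ) /
      (Real.exp (-t) : ℂ) ^ (N1 + M)) atTop
      (𝓝 (R.dual.nrm lq (-R.y0) (cvec (R.dual.rhoV R.y0)))) := by
    refine (hlim2 _).congr' ?_
    filter_upwards [eventually_eval_exp_neg_ne hQ0,
      eventually_nrm_ray_ne hq.ne_zero R.y0 R.reg_y0.neg x1,
      eventually_nrm_ray_ne hq.ne_zero (-R.y0) R.reg_y0.neg x1] with t ht hn1 hn2
    obtain ⟨ζ, h1, h2⟩ := hray t (-R.y0) (-1) (by simp)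
    rw [neg_one_mul] at h2
    have hKr := hKne (-t) ht ζ h2
    rw [← h2, ← hquot ζ hKr, ← h1, hF]
    rw [← h1] at hKr
    set X := ray lq x1 (-R.y0) t with hX
    have h3 := hK.rhoV_mul_nrm hq R.reg_y0.neg R.reg_y0 X
    have h4 : K X (R.rhoV (-R.y0)) ≠ 0 := by
      intro h
      rw [h, zero_mul] at h3
      exact mul_ne_zero hKr hn2 h3.symm
    have h5 : bf lq X (K X) p = bf lq X (K X) (cvec (R.dual.rhoV R.y0)) :=
      (hK.mem X).2.apply_rhoV_dual R.reg_y0.neg R.reg_y0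
    simp only
    rw [h5, bf_rhoV, rhoV_neg, _root_.neg_neg, ← mul_div_assoc, div_eq_div_iff h4 hKr]
    rw [rho] at hKr ⊢
    linear_combination (-(ex lq (R.dual.rhoV R.y0) X) *
      ep lq (K X) (cvec (R.dual.rhoV R.y0))) * h3
  have hfin := coeff_eq_zero_of_tendsto _ _ hl1 hl2 1
  have h0 := hquot 0 (by rw [zero_smul, add_zero]; exact hK.ne x1 hx1)
  rw [zero_smul, add_zero, mul_zero, qpow_zero, hfin, one_pow, mul_one, div_one,
    div_eq_iff (hK.ne x1 hx1)] at h0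
  exact h0

end EuclRoots

/-! ### Shifts of exponential polynomials -/

/-- Translation of the exponents. -/
def shift (τ : ℝⁿ) (c : ℝⁿ →₀ ℂ) : ℝⁿ →₀ ℂ := c.mapDomain (· + τ)

theorem shift_apply (τ : ℝⁿ) (c : ℝⁿ →₀ ℂ) (ν : ℝⁿ) : shift τ c ν = c (ν - τ) := by
  have := Finsupp.mapDomain_apply (add_left_injective τ) c (ν - τ)
  rwa [sub_add_cancel] at this

theorem ep_shift (lq : ℂ) (τ : ℝⁿ) (c : ℝⁿ →₀ ℂ) (z : ℂⁿ) :
    ep lq (shift τ c) z = ex lq τ z * ep lq c z := by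
  rw [ep, shift, Finsupp.sum_mapDomain_index (by simp) (by intros; ring), ep, Finsupp.sum,
    Finsupp.sum, Finset.mul_sum]
  exact Finset.sum_congr rfl fun ν _ => by rw [ex_add]; ring

theorem bf_shift (lq : ℂ) (x : ℂⁿ) (τ : ℝⁿ) (c : ℝⁿ →₀ ℂ) (z : ℂⁿ) :
    bf lq x (shift τ c) z = ex lq τ z * bf lq x c z := by
  rw [bf, bf, ep_shift]; ring

theorem bf_add_cvec (lq : ℂ) (x : ℂⁿ) (τ : ℝⁿ) (c : ℝⁿ →₀ ℂ)
    (z : ℂⁿ) : bf lq (x + cvec τ) c z = bf lq x (shift τ c) z := by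
  rw [bf_shift, bf, bf, add_dotProduct, mul_add, qpow_add, ex]; ring

theorem bf_sub (lq : ℂ) (x : ℂⁿ) (c d : ℝⁿ →₀ ℂ) (z : ℂⁿ) :
    bf lq x (c - d) z = bf lq x c z - bf lq x d z := by rw [bf, bf, bf, ep_sub]; ring

theorem bf_smul (lq : ℂ) (x : ℂⁿ) (a : ℂ) (c : ℝⁿ →₀ ℂ) (z : ℂⁿ) :
    bf lq x (a • c) z = a * bf lq x c z := by rw [bf, bf, ep_smul]; ring

theorem bf_sum (lq : ℂ) (x : ℂⁿ) {κ : Type*} (s : Finset κ) (c : κ → ℝⁿ →₀ ℂ)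
    (z : ℂⁿ) : bf lq x (∑ k ∈ s, c k) z = ∑ k ∈ s, bf lq x (c k) z := by
  simp only [bf, ep_sum, Finset.mul_sum]

/-! ### Shifts of the normalization factor -/

theorem prod_qbr_shift_one (lq u : ℂ) (m : ℕ) :
    qbr lq (u - m) * ∏ j ∈ Finset.range m, qbr lq (j - u) =
      qbr lq u * ∏ j ∈ Finset.range m, qbr lq ((j + 1 : ℕ) - u) := by
  have h1 := Finset.prod_range_succ (fun j : ℕ => qbr lq (j - u)) m
  have h2 := Finset.prod_range_succ' (fun j : ℕ => qbr lq (j - u)) m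
  rw [h1, Nat.cast_zero, zero_sub, qbr_neg, ← neg_sub u, qbr_neg] at h2
  linear_combination -h2

theorem fac_mul_prod_qbr (lq : ℂ) {u : ℂ} (m : ℕ) {k : ℤ} (h0 : 0 ≤ k) (h2 : k ≤ 2)
    (hu : qbr lq u ≠ 0) (hu1 : qbr lq (u + 1) ≠ 0) :
    fac lq m k u * ∏ j ∈ Finset.range m, qbr lq ((j + 1 : ℕ) - (u + k)) =
      ∏ j ∈ Finset.range m, qbr lq ((j + 1 : ℕ) - u) := by
  have h1 := prod_qbr_shift_one lq u m
  have h1' := prod_qbr_shift_one lq (u + 1) m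
  have e1 : ∀ u : ℂ, ∏ j ∈ Finset.range m, qbr lq ((j + 1 : ℕ) - (u + 1)) =
      ∏ j ∈ Finset.range m, qbr lq (j - u) := fun u =>
    Finset.prod_congr rfl fun j _ => by congr 1; push_cast; ring
  obtain rfl | rfl | rfl : k = 0 ∨ k = 1 ∨ k = 2 := by omega
  · rw [fac_of_nonpos lq m (by simp)]; simp
  · have := fac_one lq m u
    rw [Int.cast_one, this, Int.cast_one, e1, div_mul_eq_mul_div, h1, mul_div_cancel_left₀ _ hu]
  · have := fac_two lq m u
    rw [e1] at h1'
    rw [Int.cast_ofNat, this, Int.cast_ofNat, show u + 2 = u + 1 + 1 by ring, e1,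
      show u - m + 1 = u + 1 - m by ring, mul_assoc, div_mul_eq_mul_div (qbr lq (u + 1 - m)), h1',
      mul_div_cancel_left₀ _ hu1, div_mul_eq_mul_div, h1, mul_div_cancel_left₀ _ hu]

namespace EuclRoots

variable {R : EuclRoots ι n} [Fintype ι]

theorem coeff_mul_nrm {x : ℂⁿ} (hx : ∀ i, R.NonRes lq i x) {τ v : ℝⁿ}
    (hτ : τ ∈ R.dual.Osh) (hτv : ∀ i, 0 < R.root i ⬝ᵥ τ → 0 < R.root i ⬝ᵥ v) :
    R.dual.coeff lq τ x * R.nrm lq v (x + cvec τ) = R.nrm lq v x := by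
  rw [coeff, nrm, nrm, ← Finset.prod_mul_distrib]
  refine Finset.prod_congr rfl fun i _ => ?_
  change fac lq (R.mult i) (R.root i ⬝ᵥ τ) (cvec (R.root i) ⬝ᵥ x) * _ = _
  obtain ⟨k, hk, hk2, -⟩ := R.dual.MQ_Osh.int' hτ i
  change R.root i ⬝ᵥ τ = k at hk
  by_cases hi : 0 < R.root i ⬝ᵥ v
  · have hk0 : 0 ≤ k := by
      by_contra! hneg
      have := hτv (R.neg i) (by
        rw [R.root_neg, neg_dotProduct, hk, neg_pos]; exact_mod_cast hneg)
      rw [R.root_neg, neg_dotProduct] at this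
      linarith
    rw [if_pos hi, if_pos hi, hk, dotProduct_add, cvec_dot_cvec, hk]
    have h0 := (hx i).qbr_ne 0
    have h1 := (hx i).qbr_ne 1
    rw [Int.cast_zero, add_zero] at h0
    rw [Int.cast_one] at h1
    have := fac_mul_prod_qbr lq (R.mult i) hk0 (le_of_abs_le hk2) h0 h1
    exact_mod_cast this
  · rw [if_neg hi, if_neg hi, mul_one, fac_of_nonpos]
    by_contra! h
    exact hi (hτv i h)

theorem dual_rho (R : EuclRoots ι n) : R.dual.rho = R.dual.rhoV R.y0 := by
  refine R.dual.rhoV_congr fun i => ?_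
  change SignType.sign (R.coroot i ⬝ᵥ R.w0) = SignType.sign (R.coroot i ⬝ᵥ R.y0)
  rw [R.sign_coroot i R.y0]
  have h1 := R.w0_pos i
  have h2 := R.coroot_dot_w0 i
  have h3 := R.y0_ne i
  rcases lt_or_gt_of_ne h3 with h | h
  · have : R.coroot i ⬝ᵥ R.w0 < 0 := lt_of_le_of_ne (not_lt.1 fun h' => (h1.1 h').not_gt h) h2
    rw [sign_neg h, sign_neg this]
  · rw [sign_pos h, sign_pos (h1.2 h)]

theorem nrm_neg_rho_ne_zero (hq : NotRootOfUnity lq) :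
    R.dual.nrm lq R.y0 (cvec (R.dual.rhoV (-R.y0))) ≠ 0 := by
  refine Finset.prod_ne_zero_iff.2 fun i _ => ?_
  split_ifs with hi
  · refine Finset.prod_ne_zero_iff.2 fun j _ => ?_
    have hi' : 0 < R.root i ⬝ᵥ R.y0 := R.coroot_dot_pos.1 hi
    obtain ⟨k, hk⟩ := R.dual.rhoV_mem_coweight (R.dual_reg.2 R.reg_y0) i
    change R.dual.rhoV R.y0 ⬝ᵥ R.coroot i = k at hk
    have hk0 : 0 ≤ k := by
      have h1 := R.dual.rhoV_dot_le (R.s i R.y0) R.y0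
      rw [← R.dual.rhoV_dot_self, ← R.dual_s, ← R.dual.s_rhoV, R.dual_s, s, sub_dotProduct,
        smul_dotProduct, hk, smul_eq_mul] at h1
      have : (0 : ℝ) ≤ k := by
        by_contra! h
        nlinarith
      exact_mod_cast this
    change qbr lq ((j + 1 : ℕ) - cvec (R.coroot i) ⬝ᵥ _) ≠ 0
    rw [rhoV_neg, cvec_dot_cvec, dotProduct_neg, dotProduct_comm, hk]
    have := qbr_intCast_ne_zero hq (k := (j + 1 : ℕ) + k) (by omega)
    convert this using 2
    push_cast; ring
  · exact one_ne_zero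

theorem QI.mO_mul {f : ℂⁿ → ℂ} (hf : R.QI lq f) {O : Finset ℝⁿ}
    (hO : ∀ i, ∀ τ ∈ O, R.s i τ ∈ O) (hO' : (O : Set ℝⁿ) ⊆ R.coweight) :
    R.QI lq fun z => mO lq O z * f z := by
  intro i s h1 h2 z hz
  have : mO lq O (R.path i z s) = mO lq O (R.path i z (-s)) := by
    refine Finset.sum_nbij' (R.s i) (R.s i) (hO i) (hO i) (fun j _ => R.s_s i j)
      (fun j _ => R.s_s i j) fun τ hτ => ?_
    obtain ⟨k, hk⟩ := hO' hτ i
    rw [path, path, ex_apply_add, ex_apply_add, ex_apply_smul_root, ex_apply_smul_root, R.s_eq',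
      sub_dotProduct, smul_dotProduct, hk, R.coroot_dot_root_self, ex_sub, ex_intCast_smul,
      ex, ex, hz, one_zpow, inv_one, mul_one]
    congr 2
    push_cast
    simp only [smul_eq_mul]; push_cast
    ring
  simp only [this, hf i s h1 h2 z hz]

end EuclRoots

namespace EuclRoots

variable {R : EuclRoots ι n} [Fintype ι]

theorem dual_Osh_subset (R : EuclRoots ι n) : (R.dual.Osh : Set ℝⁿ) ⊆ R.corootLattice :=
  R.dual.Osh_subset

theorem dual_Osh_nonempty (R : EuclRoots ι n) : R.dual.Osh.Nonempty := by
  obtain ⟨i, hi⟩ := R.dual.exists_short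
  exact ⟨_, R.dual.mem_Osh.2 ⟨i, hi, rfl⟩⟩

/-- The support function of the orbit of short coroots. -/
def hO (R : EuclRoots ι n) (v : ℝⁿ) : ℝ :=
  R.dual.Osh.sup' R.dual_Osh_nonempty fun τ => τ ⬝ᵥ v

theorem continuous_hO (R : EuclRoots ι n) : Continuous R.hO := by
  refine Continuous.finset_sup'_apply _ fun τ _ => ?_
  unfold dotProduct; fun_prop

theorem le_hO {τ : ℝⁿ} (h : τ ∈ R.dual.Osh) (v : ℝⁿ) : τ ⬝ᵥ v ≤ R.hO v :=
  Finset.le_sup' (fun τ => τ ⬝ᵥ v) h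

theorem Osh_dot_self {τ τ' : ℝⁿ} (h : τ ∈ R.Osh) (h' : τ' ∈ R.Osh) : τ ⬝ᵥ τ = τ' ⬝ᵥ τ' := by
  obtain ⟨i, hi, rfl⟩ := R.mem_Osh.1 h
  obtain ⟨j, hj, rfl⟩ := R.mem_Osh.1 h'
  exact le_antisymm (hi j) (hj i)

theorem dot_self_pos {v : ℝⁿ} (h : v ≠ 0) : 0 < v ⬝ᵥ v :=
  lt_of_le_of_ne (Finset.sum_nonneg fun i _ => mul_self_nonneg (v i))
    fun h0 => h (dotProduct_self_eq_zero.1 h0.symm)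

theorem Osh_ne_zero {τ : ℝⁿ} (h : τ ∈ R.Osh) : τ ≠ 0 := by
  obtain ⟨i, hi, rfl⟩ := R.mem_Osh.1 h
  exact R.root_ne i

theorem exists_reg_near_Osh {τ0 : ℝⁿ} (h0 : τ0 ∈ R.dual.Osh) : ∃ v, R.Reg v ∧
    (∀ i, 0 < R.root i ⬝ᵥ τ0 → 0 < R.root i ⬝ᵥ v) ∧ 0 < τ0 ⬝ᵥ v ∧
    ∀ τ ∈ R.dual.Osh, τ ≠ τ0 → τ ⬝ᵥ v < τ0 ⬝ᵥ v := by
  have hc : ∀ u : ℝⁿ, Continuous fun v : ℝⁿ => u ⬝ᵥ v := fun u => by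
    unfold dotProduct; fun_prop
  have e1 : ∀ᶠ v in 𝓝 τ0, ∀ i, 0 < R.root i ⬝ᵥ τ0 → 0 < R.root i ⬝ᵥ v :=
    eventually_all.2 fun i => by
      by_cases hi : 0 < R.root i ⬝ᵥ τ0
      · exact ((hc _).continuousAt.eventually (lt_mem_nhds hi)).mono fun _ h _ => h
      · exact Eventually.of_forall fun _ h => absurd h hi
  have hp := dot_self_pos (Osh_ne_zero h0)
  have e2 : ∀ᶠ v in 𝓝 τ0, 0 < τ0 ⬝ᵥ v := (hc _).continuousAt.eventually (lt_mem_nhds hp)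
  have e3 : ∀ᶠ v in 𝓝 τ0, ∀ τ ∈ R.dual.Osh, τ ≠ τ0 → τ ⬝ᵥ v < τ0 ⬝ᵥ v := by
    refine (Finset.eventually_all _).2 fun τ hτ => ?_
    by_cases hne : τ = τ0
    · exact Eventually.of_forall fun _ h => absurd hne h
    · have hlt : τ ⬝ᵥ τ0 < τ0 ⬝ᵥ τ0 := by
        have h1 := dot_self_pos (sub_ne_zero.2 hne)
        have h2 := Osh_dot_self h0 hτ
        rw [sub_dotProduct, dotProduct_sub, dotProduct_sub, dotProduct_comm τ0 τ] at h1
        linarith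
      exact ((hc τ).continuousAt.eventually_lt (hc τ0).continuousAt hlt).mono fun _ h _ => h
  obtain ⟨v, hv, h1, h2, h3⟩ := ((mem_closure_iff_frequently.1 (R.dense_reg τ0)).and_eventually
    (e1.and (e2.and e3))).exists
  exact ⟨v, hv, h1, h2, h3⟩

/-- The normalized coefficients. -/
def psi (R : EuclRoots ι n) (lq : ℂ) (K : ℂⁿ → ℝⁿ →₀ ℂ) (x : ℂⁿ) :
    ℝⁿ →₀ ℂ := (R.nrm lq R.y0 x / K x R.rho) • K x

theorem IsFam.psi_mem {K : ℂⁿ → ℝⁿ →₀ ℂ} (hK : R.IsFam lq K)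
    (x : ℂⁿ) : R.psi lq K x ∈ R.qiSpace lq x (R.rhoCoset ∩ body R.hN) :=
  Submodule.smul_mem _ _ (hK.mem x)

theorem IsFam.psi_rhoV (hq : NotRootOfUnity lq)
    {K : ℂⁿ → ℝⁿ →₀ ℂ} (hK : R.IsFam lq K) {x : ℂⁿ} (hx : R.Good lq x)
    {v : ℝⁿ} (hv : R.Reg v) : R.psi lq K x (R.rhoV v) = R.nrm lq v x := by
  rw [psi, Finsupp.smul_apply, smul_eq_mul, div_mul_eq_mul_div, div_eq_iff (hK.ne x hx)]
  have := hK.rhoV_mul_nrm hq hv R.reg_y0 x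
  rw [rho]
  linear_combination this

theorem IsFam.bf_psi (hq : NotRootOfUnity lq)
    {K : ℂⁿ → ℝⁿ →₀ ℂ} (hK : R.IsFam lq K) {x : ℂⁿ} (hx : R.Good lq x) :
    bf lq x (R.psi lq K x) (cvec (R.dual.rhoV (-R.y0))) =
      R.dual.nrm lq R.y0 (cvec (R.dual.rhoV (-R.y0))) := by
  rw [psi, bf_smul, div_mul_eq_mul_div, div_eq_iff (hK.ne x hx), hK.nrm_mul_bf hq]

/-- The action of the dual Macdonald operator, up to an unknown scalar. -/
theorem IsFam.exists_smul (hq : NotRootOfUnity lq)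
    {K : ℂⁿ → ℝⁿ →₀ ℂ} (hK : R.IsFam lq K) {x : ℂⁿ} (hx : R.Good lq x) :
    ∃ b : ℂ, ∀ z, mO lq R.dual.Osh z * bf lq x (R.psi lq K x) z -
      ∑ τ ∈ R.dual.Osh, R.dual.coeff lq τ x *
        bf lq (x + cvec τ) (R.psi lq K (x + cvec τ)) z = b * bf lq x (R.psi lq K x) z := by
  classical
  set O := R.dual.Osh with hOdef
  have hOcw : (O : Set ℝⁿ) ⊆ R.coweight := R.dual_Osh_subset.trans R.corootLattice_le
  have hgood : ∀ τ ∈ O, R.Good lq (x + cvec τ) := fun τ hτ => hx.add (hOcw hτ)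
  set C : ℝⁿ →₀ ℂ := ∑ τ ∈ O, shift τ (R.psi lq K x) -
    ∑ τ ∈ O, R.dual.coeff lq τ x • shift τ (R.psi lq K (x + cvec τ)) with hC
  have hbfC : ∀ z, bf lq x C z = mO lq O z * bf lq x (R.psi lq K x) z -
      ∑ τ ∈ O, R.dual.coeff lq τ x * bf lq (x + cvec τ) (R.psi lq K (x + cvec τ)) z := by
    intro z
    rw [hC, bf_sub, bf_sum, bf_sum, mO, Finset.sum_mul]
    congr 1
    · exact Finset.sum_congr rfl fun τ _ => bf_shift _ _ _ _ _
    · exact Finset.sum_congr rfl fun τ _ => by rw [bf_smul, ← bf_add_cvec]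
  have hCν : ∀ ν, C ν = ∑ τ ∈ O, (R.psi lq K x (ν - τ) -
      R.dual.coeff lq τ x * R.psi lq K (x + cvec τ) (ν - τ)) := by
    intro ν
    rw [hC, Finsupp.sub_apply, Finsupp.finsetSum_apply, Finsupp.finsetSum_apply,
      ← Finset.sum_sub_distrib]
    exact Finset.sum_congr rfl fun τ _ => by
      rw [Finsupp.smul_apply, shift_apply, shift_apply, smul_eq_mul]
  have hpsi0 : ∀ x ν, ν ∉ R.rhoCoset ∩ body R.hN → R.psi lq K x ν = 0 := fun x ν h => by
    by_contra h0
    exact h ((hK.psi_mem x).1 (Finsupp.mem_support_iff.2 h0))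
  have hCQI : R.QI lq (bf lq x C) := by
    intro i s h1 h2 z hz
    rw [hbfC, hbfC]
    have e1 := ((hK.psi_mem x).2.mO_mul (O := O)
      (fun i τ hτ => by have := R.dual.MQ_Osh.s_mem i τ hτ; rwa [R.dual_s] at this) hOcw)
      i s h1 h2 z hz
    simp only at e1
    rw [e1]
    congr 1
    exact Finset.sum_congr rfl fun τ _ => by rw [(hK.psi_mem (x + cvec τ)).2 i s h1 h2 z hz]
  have hCs : (C.support : Set ℝⁿ) ⊆ R.rhoCoset ∩ body fun v => R.hN v + R.hO v := by
    intro ν hν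
    have hν' := Finsupp.mem_support_iff.1 hν
    rw [hCν] at hν'
    obtain ⟨τ, hτ, hne⟩ := Finset.exists_ne_zero_of_sum_ne_zero hν'
    have hmem : ν - τ ∈ R.rhoCoset ∩ body R.hN := by
      by_contra h
      rw [hpsi0 _ _ h, hpsi0 _ _ h, mul_zero, sub_zero] at hne
      exact hne rfl
    refine ⟨?_, fun v => ?_⟩
    · have := R.stable_rhoCoset.2 _ hmem.1 τ (R.dual_Osh_subset hτ)
      rwa [sub_add_cancel] at this
    · have h1 := hmem.2 v
      have h2 := le_hO hτ v
      rw [sub_dotProduct] at h1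
      linarith
  obtain ⟨M, cc, hsum, hcc⟩ := R.exists_spectral hq R.stable_rhoCoset
    (R.continuous_hN.add R.continuous_hO) (x := x) (F := R.coweight) (fun ν hν v hv =>
      sub_mem (R.mem_wts.1 hν).1 (R.rhoV_mem_coweight hv)) hx (c := C) ⟨hCs, hCQI⟩
  have hμ : ∀ μ ∈ M, cc μ ≠ 0 → μ ∈ O ∨ μ = 0 := by
    intro μ hμM hne
    obtain ⟨-, hmem, h⟩ := hcc μ hμM
    obtain ⟨h1, -⟩ := h hne
    have hin : ∀ v, R.Reg v → μ + R.rhoV v ∈ R.rhoCoset ∩ body fun v => R.hN v + R.hO v :=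
      fun v hv => hmem.1 (Finsupp.mem_support_iff.2 (h1 v hv))
    have hle : ∀ v, μ ⬝ᵥ v ≤ R.hO v := by
      have hcl : IsClosed {v : ℝⁿ | μ ⬝ᵥ v ≤ R.hO v} :=
        isClosed_le (by unfold dotProduct; fun_prop) R.continuous_hO
      intro v
      refine hcl.closure_subset_iff.2 (fun v hv => ?_) (R.dense_reg v)
      have := (hin v hv).2 v
      rw [add_dotProduct, rhoV_dot_self] at this
      change μ ⬝ᵥ v ≤ R.hO v
      linarith
    refine R.mem_Osh_or_eq_zero ?_ ?_
    · have h2 := (hin R.y0 R.reg_y0).1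
      change μ + R.rhoV R.y0 - R.rho ∈ R.corootLattice at h2
      rwa [rho, add_sub_cancel_right] at h2
    · obtain ⟨τ, hτ, h3⟩ := Finset.exists_mem_eq_sup' R.dual_Osh_nonempty fun τ => τ ⬝ᵥ μ
      exact ⟨τ, hτ, (hle μ).trans h3.le⟩
  have hO0 : ∀ τ0 ∈ O, τ0 ∈ M → cc τ0 = 0 := by
    intro τ0 h0 h0M
    by_contra hne
    obtain ⟨v, hv, hv1, hv2, hv3⟩ := exists_reg_near_Osh h0
    have h1 := ((hcc τ0 h0M).2.2 hne).1 v hv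
    apply h1
    have h2 : C (τ0 + R.rhoV v) = cc τ0 (τ0 + R.rhoV v) := by
      rw [hsum, Finsupp.finsetSum_apply, Finset.sum_eq_single_of_mem τ0 h0M]
      intro μ hμM hμne
      by_contra h3
      have hcne : cc μ ≠ 0 := fun h => h3 (by rw [h]; rfl)
      have h4 := ((hcc μ hμM).2.2 hcne).2 _ (Finsupp.mem_support_iff.2 h3) v
      rw [add_dotProduct, rhoV_dot_self] at h4
      rcases hμ μ hμM hcne with h5 | h5
      · have := hv3 μ h5 hμne
        linarith
      · rw [h5, zero_dotProduct] at h4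
        linarith
    rw [← h2, hCν, Finset.sum_eq_single_of_mem τ0 h0]
    · rw [add_sub_cancel_left, hK.psi_rhoV hq hx hv, hK.psi_rhoV hq (hgood τ0 h0) hv,
        coeff_mul_nrm hx.nonRes h0 hv1, sub_self]
    · intro τ hτ hne'
      have : τ0 + R.rhoV v - τ ∉ R.rhoCoset ∩ body R.hN := by
        intro h
        have h3 := h.2 v
        rw [sub_dotProduct, add_dotProduct, rhoV_dot_self] at h3
        have := hv3 τ hτ hne'
        linarith
      rw [hpsi0 _ _ this, hpsi0 _ _ this, mul_zero, sub_zero]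
  have hCbody : (C.support : Set ℝⁿ) ⊆ body R.hN := by
    intro ν hν v
    have hν' := Finsupp.mem_support_iff.1 hν
    rw [hsum, Finsupp.finsetSum_apply] at hν'
    obtain ⟨μ, hμM, hne⟩ := Finset.exists_ne_zero_of_sum_ne_zero hν'
    have hcne : cc μ ≠ 0 := fun h => hne (by rw [h]; rfl)
    have h4 := ((hcc μ hμM).2.2 hcne).2 _ (Finsupp.mem_support_iff.2 hne) v
    rcases hμ μ hμM hcne with h5 | rfl
    · exact absurd (hO0 μ h5 hμM) hcne
    · rwa [zero_dotProduct, zero_add] at h4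
  refine ⟨C R.rho / R.nrm lq R.y0 x, fun z => ?_⟩
  rw [← hbfC, ← bf_smul]
  congr 1
  have hn := hx.nrm_ne_zero R.y0
  rw [← sub_eq_zero]
  refine hx.eq_zero hq (v := R.y0) ?_ R.reg_y0 ?_
  · have hsub : R.rhoCoset ∩ body R.hN ⊆ R.coweight ∩ body R.hN := fun ν h =>
      ⟨R.rhoCoset_subset h.1, h.2⟩
    refine Submodule.sub_mem _ ⟨fun ν hν => ⟨R.rhoCoset_subset (hCs hν).1, hCbody hν⟩, hCQI⟩
      (Submodule.smul_mem _ _ ⟨(hK.psi_mem x).1.trans hsub, (hK.psi_mem x).2⟩)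
  · rw [Finsupp.sub_apply, Finsupp.smul_apply, hK.psi_rhoV hq hx R.reg_y0, smul_eq_mul,
      div_mul_cancel₀ _ hn, rho, sub_self]

/-- The Baker--Akhiezer function is an eigenfunction of the dual Macdonald operator. -/
theorem IsFam.Dop_dual (hq : NotRootOfUnity lq)
    {K : ℂⁿ → ℝⁿ →₀ ℂ} (hK : R.IsFam lq K) {x : ℂⁿ} (hx : R.Good lq x)
    (z : ℂⁿ) : R.dual.Dop lq R.dual.Osh (fun x => bf lq x (R.psi lq K x) z) x =
      mO lq R.dual.Osh z * bf lq x (R.psi lq K x) z := by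
  obtain ⟨b, hb⟩ := hK.exists_smul hq hx
  have hOcw : (R.dual.Osh : Set ℝⁿ) ⊆ R.coweight :=
    R.dual_Osh_subset.trans R.corootLattice_le
  have hp := hb (cvec (R.dual.rhoV (-R.y0)))
  rw [hK.bf_psi hq hx, Finset.sum_congr rfl fun τ hτ => by
    rw [hK.bf_psi hq (hx.add (hOcw hτ))], ← Finset.sum_mul, ← sub_mul] at hp
  have hb' := mul_right_cancel₀ (nrm_neg_rho_ne_zero hq) hp
  have hm : mO lq R.dual.Osh (cvec (R.dual.rhoV (-R.y0))) =
      ∑ τ ∈ R.dual.Osh, qpow lq (-2 * ((R.dual.rhoV R.dual.y0 ⬝ᵥ τ : ℝ) : ℂ)) := by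
    refine Finset.sum_congr rfl fun τ _ => ?_
    have := R.dual_rho
    rw [rho] at this
    rw [this, ex, cvec_dot_cvec, rhoV_neg, dotProduct_neg, dotProduct_comm]
    congr 1
    push_cast; ring
  have hz := hb z
  rw [← hb', hm] at hz
  rw [Dop]
  simp only [mul_sub, Finset.sum_sub_distrib]
  rw [← Finset.sum_mul]
  linear_combination -hz

end EuclRoots

namespace EuclRoots

variable {R : EuclRoots ι n} [Fintype ι]

theorem Good.eq_smul (hq : NotRootOfUnity lq) {O : Finset ℝⁿ} (hO : R.MQ O)
    {x : ℂⁿ} (hx : R.Good lq x) {c : ℝⁿ →₀ ℂ}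
    (hc : c ∈ R.qiSpace lq x (R.rhoCoset ∩ body R.hN)) {z : ℂⁿ} (hz : R.RegPt lq z) :
    R.Dop lq O (bf lq x c) z = mO lq O x * bf lq x c z := by
  obtain ⟨c', h1, h2, h3⟩ := R.exists_Dop_eq hq hO R.stable_rhoCoset (fun ν hν => (hc.1 hν).1) hc.2
  have h4 := R.Dop_body hq.ne_zero hO h3 R.continuous_hN fun ν hν => (hc.1 hν).2
  have h5 := (R.Dop_face hq.ne_zero hO h3 R.reg_y0 (θ := R.hN R.y0)
    fun ν hν => (hc.1 hν).2 _).2 (R.rhoV R.y0) (R.rhoV_dot_self _)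
  rw [sub_self, cvec_zero, add_zero] at h5
  have h6 : c' = mO lq O x • c := by
    rw [← sub_eq_zero]
    refine hx.eq_zero hq (v := R.y0) (Submodule.sub_mem _
      ⟨fun ν hν => ⟨R.rhoCoset_subset (h1 hν), h4 hν⟩, h2⟩ (Submodule.smul_mem _ _
      ⟨fun ν hν => ⟨R.rhoCoset_subset (hc.1 hν).1, (hc.1 hν).2⟩, hc.2⟩)) R.reg_y0 ?_
    rw [Finsupp.sub_apply, Finsupp.smul_apply, h5, smul_eq_mul, sub_self]
  rw [h3 z hz, h6, bf_smul]

theorem Good.regPt_dual {x : ℂⁿ} (hx : R.Good lq x) : R.dual.RegPt lq x := by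
  intro j
  have h0 := hx.nonRes j 0
  have h1 := hx.nonRes j (-1)
  refine ⟨fun h => h0 ?_, fun h => h1 ?_⟩
  · have := R.dual.wall_eq_zero.1 h
    change qpow lq (2 * (cvec (R.root j) ⬝ᵥ x + 0)) = 1 at this
    simpa using this
  · have := R.dual.wall_eq_zero.1 h
    change qpow lq (2 * (cvec (R.root j) ⬝ᵥ x + 1)) = 1 at this
    simpa using this

theorem residual_good_add (hq : NotRootOfUnity lq) (u : ℕ → ℂⁿ) :
    ∀ᶠ x in residual ℂⁿ, ∀ k, R.Good lq (x + u k) :=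
  eventually_countable_forall.2 fun k => (tendsto_residual_of_isOpenMap
    (continuous_add_const (u k)) (isOpenMap_add_right (u k))).eventually (R.residual_good hq)

theorem exists_top_reg (R : EuclRoots ι n) {a b : ℝⁿ →₀ ℂ} (ha : a ≠ 0) (hb : b ≠ 0) :
    ∃ v, R.Reg v ∧ (∃ α ∈ a.support, ∀ ν ∈ a.support, ν ≠ α → ν ⬝ᵥ v < α ⬝ᵥ v) ∧
      ∃ β ∈ b.support, ∀ ν ∈ b.support, ν ≠ β → ν ⬝ᵥ v < β ⬝ᵥ v := by
  classical
  obtain ⟨v, h1, h2⟩ := (R.dense_separating_reg (a.support ∪ b.support)).nonempty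
  exact ⟨v, h2, exists_top ha fun μ hμ ν hν => h1 μ (Finset.mem_union_left _ hμ) ν
    (Finset.mem_union_left _ hν), exists_top hb fun μ hμ ν hν => h1 μ
    (Finset.mem_union_right _ hμ) ν (Finset.mem_union_right _ hν)⟩

theorem tendsto_ratio_ray (hlq : lq ≠ 0) {a b : ℝⁿ →₀ ℂ} {v α β : ℝⁿ}
    (hα' : ∀ ν ∈ a.support, ν ≠ α → ν ⬝ᵥ v < α ⬝ᵥ v) (hβ : β ∈ b.support)
    (hβ' : ∀ ν ∈ b.support, ν ≠ β → ν ⬝ᵥ v < β ⬝ᵥ v) (x : ℂⁿ) :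
    Tendsto (fun k : ℕ => (Real.exp (k * ((β - α) ⬝ᵥ v)) : ℂ) *
      (ep lq a (ray lq x v k) / ep lq b (ray lq x v k))) atTop
      (𝓝 (a α * ex lq α x / (b β * ex lq β x))) := by
  refine (((tendsto_ep_ray hlq a v α hα' x).div (tendsto_ep_ray hlq b v β hβ' x)
    (mul_ne_zero (Finsupp.mem_support_iff.1 hβ) (ex_ne_zero _ _ _))).comp
    tendsto_natCast_atTop_atTop).congr fun k => ?_
  simp only [Function.comp, Pi.div_apply]
  rw [mul_div_mul_comm, ← Complex.ofReal_div, ← Real.exp_sub, sub_dotProduct]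
  congr 3
  ring_nf

/-- The leading exponents of an eigenfunction of a Macdonald operator. -/
theorem mO_eq_of_eigen (hlq : lq ≠ 0) {O : Finset ℝⁿ} (hO : R.MQ O)
    {a b : ℝⁿ →₀ ℂ} {v α β : ℝⁿ} (hv : R.Reg v) (hα : α ∈ a.support)
    (hα' : ∀ ν ∈ a.support, ν ≠ α → ν ⬝ᵥ v < α ⬝ᵥ v) (hβ : β ∈ b.support)
    (hβ' : ∀ ν ∈ b.support, ν ≠ β → ν ⬝ᵥ v < β ⬝ᵥ v) {x z : ℂⁿ} {g : ℂⁿ → ℂ}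
    (hg : ∀ x, g x = ep lq a x / ep lq b x) (h : ∀ k : ℕ, ∑ τ ∈ O, R.coeff lq τ (ray lq x v k) *
        (ex lq τ z * g (ray lq x v k + cvec τ) - g (ray lq x v k)) +
        (∑ τ ∈ O, qpow lq (-2 * ((R.rhoV R.y0 ⬝ᵥ τ : ℝ) : ℂ))) * g (ray lq x v k) =
          mO lq O z * g (ray lq x v k)) : mO lq O (z + cvec (α - β - R.rhoV v)) = mO lq O z := by
  set L : ℂⁿ → ℂ := fun x => a α * ex lq α x / (b β * ex lq β x) with hL
  set e : ℕ → ℂ := fun k => (Real.exp (k * ((β - α) ⬝ᵥ v)) : ℂ) with he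
  have hgL : ∀ x, Tendsto (fun k : ℕ => e k * g (ray lq x v k)) atTop (𝓝 (L x)) := fun x => by
    simp only [hg]
    exact tendsto_ratio_ray hlq hα' hβ hβ' x
  have hL0 : L x ≠ 0 := div_ne_zero
    (mul_ne_zero (Finsupp.mem_support_iff.1 hα) (ex_ne_zero _ _ _))
    (mul_ne_zero (Finsupp.mem_support_iff.1 hβ) (ex_ne_zero _ _ _))
  have hc : ∀ τ ∈ O, Tendsto (fun k : ℕ => R.coeff lq τ (ray lq x v k)) atTop
      (𝓝 (qpow lq (-2 * ((R.rhoV v ⬝ᵥ τ : ℝ) : ℂ)))) := fun τ hτ =>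
    (R.tendsto_coeff_ray hlq hO hτ hv x).comp tendsto_natCast_atTop_atTop
  have h1 : Tendsto (fun k : ℕ => ∑ τ ∈ O, R.coeff lq τ (ray lq x v k) *
      (ex lq τ z * (e k * g (ray lq (x + cvec τ) v k)) - e k * g (ray lq x v k))) atTop
      (𝓝 (∑ τ ∈ O, qpow lq (-2 * ((R.rhoV v ⬝ᵥ τ : ℝ) : ℂ)) *
        (ex lq τ z * L (x + cvec τ) - L x))) :=
    tendsto_finsetSum _ fun τ hτ => (hc τ hτ).mul (((hgL _).const_mul _).sub (hgL x))
  have h2 : ∀ k : ℕ, ∑ τ ∈ O, R.coeff lq τ (ray lq x v k) *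
      (ex lq τ z * (e k * g (ray lq (x + cvec τ) v k)) - e k * g (ray lq x v k)) =
      (mO lq O z - ∑ τ ∈ O, qpow lq (-2 * ((R.rhoV R.y0 ⬝ᵥ τ : ℝ) : ℂ))) *
        (e k * g (ray lq x v k)) := by
    intro k
    have : ∑ τ ∈ O, R.coeff lq τ (ray lq x v k) *
      (ex lq τ z * (e k * g (ray lq (x + cvec τ) v k)) - e k * g (ray lq x v k)) =
      e k * ∑ τ ∈ O, R.coeff lq τ (ray lq x v k) *
        (ex lq τ z * g (ray lq x v k + cvec τ) - g (ray lq x v k)) := by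
      rw [Finset.mul_sum]
      refine Finset.sum_congr rfl fun τ _ => ?_
      rw [ray_add]; ring
    rw [this]
    linear_combination (e k) * h k
  simp only [h2] at h1
  have h3 := tendsto_nhds_unique ((hgL x).const_mul _) h1
  have h4 := R.sum_rhoV_eq (fun r => qpow lq (-2 * (r : ℂ))) O hO.s_mem R.reg_y0 hv
  rw [h4] at h3
  refine mul_right_cancel₀ hL0 ?_
  have h5 : mO lq O (z + cvec (α - β - R.rhoV v)) * L x =
      ∑ τ ∈ O, qpow lq (-2 * ((R.rhoV v ⬝ᵥ τ : ℝ) : ℂ)) * (ex lq τ z * L (x + cvec τ)) := by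
    rw [mO, Finset.sum_mul]
    refine Finset.sum_congr rfl fun τ _ => ?_
    have e1 : L (x + cvec τ) = L x * (ex lq α (cvec τ) * (ex lq β (cvec τ))⁻¹) := by
      rw [hL]
      simp only
      rw [ex_apply_add, ex_apply_add, ← mul_assoc (b β), ← mul_assoc (a α), mul_div_mul_comm,
        div_eq_mul_inv (ex lq α (cvec τ))]
    have e2 : qpow lq (-2 * ((R.rhoV v ⬝ᵥ τ : ℝ) : ℂ)) = (ex lq (R.rhoV v) (cvec τ))⁻¹ := by
      rw [ex, cvec_dot_cvec, ← qpow_neg, neg_mul]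
    rw [e1, e2, ex_apply_add, ex_cvec_comm lq τ, ex_sub, ex_sub]
    ring
  rw [h5]
  simp only [mul_sub, Finset.sum_sub_distrib] at h3
  rw [← Finset.sum_mul] at h3
  linear_combination -h3

/-- The two constructions of the Baker--Akhiezer function agree. -/
theorem IsFam.duality (hq : NotRootOfUnity lq)
    {K Kd : ℂⁿ → ℝⁿ →₀ ℂ} (hK : R.IsFam lq K) (hKd : R.dual.IsFam lq Kd)
    {z : ℂⁿ} (hz : R.dual.Good lq z) (x : ℂⁿ) :
    R.nrm lq R.y0 x * ep lq (K x) z = ep lq (R.dual.psi lq Kd z) x * K x R.rho := by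
  set cd := R.dual.psi lq Kd z with hcd
  have hcdm := hKd.psi_mem z
  rw [← hcd] at hcdm
  have hle : (R.dual.corootLattice : Set ℝⁿ) ⊆ R.dual.coweight := R.dual.corootLattice_le
  have hA : (fun x => R.nrm lq R.y0 x * ep lq (K x) z - ep lq cd x * K x R.rho) ∈
      expSpan lq (R.dual.coweight : Set ℝⁿ) := by
    refine Submodule.sub_mem _ ?_ ?_
    · have e : (fun x => R.nrm lq R.y0 x * ep lq (K x) z) = fun x => ∑ ν ∈ R.wts R.hN, ex lq ν z *
          (ex lq (R.dual.rhoV R.y0) * ((fun x => R.nrm lq R.y0 x *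
            ex lq (-R.dual.rhoV R.y0) x) * fun x => K x ν)) x := by
        funext x
        simp only [Pi.mul_apply]
        rw [ep_eq_sum lq _ _ (hK.support_subset x), Finset.mul_sum]
        refine Finset.sum_congr rfl fun ν _ => ?_
        have := ex_ne_zero lq (R.dual.rhoV R.y0) x
        rw [ex_neg]
        field_simp
      rw [e]
      refine sum_mem_expSpan _ _ fun ν _ => const_mul_mem_expSpan _ ?_
      refine mul_mem_expSpan (fun _ h1 _ h2 => add_mem h1 h2) (ex_mem_expSpan lq
        (R.dual.rhoV_mem_coweight (R.dual_reg.2 R.reg_y0)))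
        (mul_mem_expSpan (fun _ h1 _ h2 => add_mem h1 h2)
        (expSpan_mono lq hle (R.nrm_mul_ex_mem lq R.reg_y0)) (expSpan_mono lq hle (hK.exp ν)))
    · exact mul_mem_expSpan (fun _ h1 _ h2 => add_mem h1 h2) (ep_mem_expSpan lq
        fun ν hν => R.dual.rhoCoset_subset (hcdm.1 hν).1) (expSpan_mono lq hle (hK.exp R.rho))
  obtain ⟨a, has, ha⟩ := mem_expSpan_iff.1 hA
  obtain ⟨b, hbs, hb⟩ := mem_expSpan_iff.1 (hK.exp R.rho)
  have ha' := fun x => congrFun ha x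
  have hb' := fun x => congrFun hb x
  have ha0 : a = 0 := by
    by_contra hne
    have hb0 : b ≠ 0 := by
      rintro rfl
      obtain ⟨x, hx⟩ := (dense_of_mem_residual (R.residual_good hq)).nonempty
      exact hK.ne x hx (by rw [hb', ep_zero])
    obtain ⟨v, hv, ⟨α, hα, hα'⟩, β, hβ, hβ'⟩ := R.exists_top_reg hne hb0
    obtain ⟨x, hgood, hlim⟩ := (dense_of_mem_residual ((R.residual_good_add hq
      fun k : ℕ => ((k : ℝ) / (2 * lq) : ℂ) • cvec v).and (hK.tendsto hq hv))).nonempty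
    have hX : ∀ k : ℕ, R.Good lq (ray lq x v k) := fun k => by
      have := hgood k; rwa [ray]
    set g : ℂⁿ → ℂ := fun x => ep lq a x / ep lq b x with hg
    have hcw : (R.dual.Osh : Set ℝⁿ) ⊆ R.coweight :=
      R.dual_Osh_subset.trans R.corootLattice_le
    have hfg : ∀ x, R.Good lq x → bf lq x (R.psi lq K x) z - bf lq z cd x =
        qpow lq (2 * (z ⬝ᵥ x)) * g x := by
      intro x hx
      have h0 := hK.ne x hx
      rw [hg, psi, bf_smul, bf, bf, dotProduct_comm x z]
      simp only
      rw [← ha', ← hb']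
      field_simp
    have heq : ∀ x, R.Good lq x → ∑ τ ∈ R.dual.Osh, R.dual.coeff lq τ x *
        (ex lq τ z * g (x + cvec τ) - g x) + (∑ τ ∈ R.dual.Osh,
          qpow lq (-2 * ((R.dual.rhoV R.dual.y0 ⬝ᵥ τ : ℝ) : ℂ))) * g x = mO lq R.dual.Osh z * g x := by
      intro x hx
      have h1 := hK.Dop_dual hq hx z
      have h2 := Good.eq_smul hq R.dual.MQ_Osh hz hcdm hx.regPt_dual
      refine mul_left_cancel₀ (qpow_ne_zero lq (2 * (z ⬝ᵥ x))) ?_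
      calc _ = ∑ τ ∈ R.dual.Osh, R.dual.coeff lq τ x *
            ((bf lq (x + cvec τ) (R.psi lq K (x + cvec τ)) z - bf lq z cd (x + cvec τ)) -
              (bf lq x (R.psi lq K x) z - bf lq z cd x)) +
            (∑ τ ∈ R.dual.Osh, qpow lq (-2 * ((R.dual.rhoV R.dual.y0 ⬝ᵥ τ : ℝ) : ℂ))) *
              (bf lq x (R.psi lq K x) z - bf lq z cd x) := by
            rw [hfg x hx, mul_add, Finset.mul_sum]
            congr 1
            · refine Finset.sum_congr rfl fun τ hτ => ?_
              rw [hfg _ (hx.add (hcw hτ)), qpow_dot_add]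
              ring
            · ring
        _ = _ := by
          rw [Dop] at h1 h2
          rw [mul_left_comm, ← hfg x hx]
          simp only [mul_sub, Finset.sum_sub_distrib] at h1 h2 ⊢
          linear_combination h1 - h2
    have haα := Finsupp.mem_support_iff.1 hα
    have hbβ := Finsupp.mem_support_iff.1 hβ
    have hv' := R.dual_reg.2 hv
    have hkey := mO_eq_of_eigen hq.ne_zero R.dual.MQ_Osh hv' hα hα' hβ hβ' (g := g)
      (fun _ => rfl) fun k => heq _ (hX k)
    have hαβ := hz (sub_mem (sub_mem (has hα) (hle (hbs hβ)))
      (R.dual.rhoV_mem_coweight (R.dual_reg.2 hv))) (zero_mem _) (by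
        simpa only [cvec_zero, add_zero] using hkey)
    rw [sub_eq_zero] at hαβ
    have h1 : Tendsto (fun k : ℕ => ex lq (-R.dual.rhoV v) (ray lq x v k) * g (ray lq x v k)) atTop
        (𝓝 (R.dual.nrm lq v z - R.dual.nrm lq v z)) := by
      have h2 := (tendsto_ep_ray hq.ne_zero cd v (R.dual.rhoV v) (fun ν hν hne => by
        rw [rhoV_dot_self]
        exact lt_of_le_of_ne ((hcdm.1 hν).2 v) fun h => hne (R.dual.eq_rhoV hv' (hcdm.1 hν).2 h))
        x).mul_const (ex lq (-R.dual.rhoV v) x)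
      rw [hcd, hKd.psi_rhoV hq hz hv', ex_neg, mul_assoc, mul_inv_cancel₀ (ex_ne_zero _ _ _),
        mul_one] at h2
      refine (((hlim z).sub h2).comp tendsto_natCast_atTop_atTop).congr fun k => ?_
      have h0 := hK.ne _ (hX k)
      have h3 := hK.rhoV_mul_nrm hq hv R.reg_y0 (ray lq x v k)
      have h4 : K (ray lq x v k) (R.rhoV v) ≠ 0 := fun h => by
        rw [h, zero_mul] at h3
        exact mul_ne_zero h0 ((hX k).nrm_ne_zero v) h3.symm
      simp only [Function.comp, hg]
      rw [← ha', ← hb', ← hcd, ex_ray hq.ne_zero, ex_neg, neg_dotProduct, mul_neg]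
      rw [rho] at h0 ⊢
      field_simp
      linear_combination (-(ep lq (K (ray lq x v k)) z) * (ex lq (R.dual.rhoV v) x)⁻¹) * h3
    have h5 := ((tendsto_ratio_ray hq.ne_zero hα' hβ hβ' x).const_mul
      (ex lq (-R.dual.rhoV v) x)).congr (f₂ := fun k : ℕ =>
        ex lq (-R.dual.rhoV v) (ray lq x v k) * g (ray lq x v k)) fun k => by
      rw [ex_ray hq.ne_zero, ← hαβ, neg_sub, hg]
      ring
    have h6 := tendsto_nhds_unique h1 h5
    rw [sub_self] at h6
    exact mul_ne_zero (ex_ne_zero _ _ _) (div_ne_zero (mul_ne_zero haα (ex_ne_zero _ _ _))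
      (mul_ne_zero hbβ (ex_ne_zero _ _ _))) h6.symm
  have := ha' x
  rw [ha0, ep_zero, sub_eq_zero] at this
  exact this

end EuclRoots

namespace EuclRoots

variable {R : EuclRoots ι n} [Fintype ι]

theorem dense_good (R : EuclRoots ι n) (hq : NotRootOfUnity lq) :
    Dense {x | R.Good lq x} := dense_of_mem_residual (R.residual_good hq)

theorem eq_of_good (hq : NotRootOfUnity lq) {f g : ℂⁿ → ℂ} (hf : Continuous f)
    (hg : Continuous g) (h : ∀ x, R.Good lq x → f x = g x) (x : ℂⁿ) : f x = g x :=
  congrFun (eq_of_residual hf hg ((R.residual_good hq).mono h)) x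

/-- An entire family of Baker--Akhiezer functions, normalized everywhere. -/
structure IsEntire (R : EuclRoots ι n) (lq : ℂ) (Ψ : ℂⁿ → ℝⁿ →₀ ℂ) : Prop where
  differentiable : ∀ ν, Differentiable ℂ fun x => Ψ x ν
  mem : ∀ x, Ψ x ∈ R.qiSpace lq x (R.rhoCoset ∩ body R.hN)
  rho : ∀ x, Ψ x R.rho = R.nrm lq R.y0 x

theorem continuous_bf {T : Finset ℝⁿ} {Ψ : ℂⁿ → ℝⁿ →₀ ℂ}
    (hd : ∀ ν, Differentiable ℂ fun x => Ψ x ν) (hT : ∀ x, (Ψ x).support ⊆ T) (lq : ℂ)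
    (p : ℂⁿ) : Continuous fun x => bf lq x (Ψ x) p := by
  simp only [bf_eq_sum (hT _)]
  refine continuous_finsetSum _ fun ν _ => (hd ν).continuous.mul (Continuous.mul ?_ continuous_const)
  refine (differentiable_qpow lq).continuous.comp ?_
  unfold dotProduct; fun_prop

theorem IsEntire.continuous_bf {Ψ : ℂⁿ → ℝⁿ →₀ ℂ}
    (h : R.IsEntire lq Ψ) (p : ℂⁿ) : Continuous fun x => bf lq x (Ψ x) p :=
  EuclRoots.continuous_bf (T := R.wts R.hN) h.differentiable (fun x _ hν =>
    R.mem_wts.2 ⟨R.rhoCoset_subset ((h.mem x).1 hν).1, ((h.mem x).1 hν).2⟩) lq p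

theorem IsFam.exists_entire (hq : NotRootOfUnity lq)
    {K Kd : ℂⁿ → ℝⁿ →₀ ℂ} (hK : R.IsFam lq K) (hKd : R.dual.IsFam lq Kd) :
    ∃ Ψ, R.IsEntire lq Ψ ∧ ∀ x, R.Good lq x → Ψ x = R.psi lq K x := by
  classical
  have hint : ∀ ν, ∃ l : ℂⁿ →₀ ℂ, ν ∈ R.wts R.hN →
      (l.support : Set ℂⁿ) ⊆ {z | R.dual.Good lq z} ∧
      ∀ c : ℝⁿ →₀ ℂ, c.support ⊆ R.wts R.hN → c ν = l.sum fun p a => a * ep lq c p := by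
    intro ν
    by_cases hν : ν ∈ R.wts R.hN
    · obtain ⟨l, hl⟩ := exists_interp hq.ne_zero (R.dual.dense_good hq) (R.wts R.hN) hν
      exact ⟨l, fun _ => hl⟩
    · exact ⟨0, fun h => absurd h hν⟩
  choose l hl using hint
  set Ψ : ℂⁿ → ℝⁿ →₀ ℂ := fun x => ∑ ν ∈ R.wts R.hN,
    Finsupp.single ν ((l ν).sum fun p a => a * ep lq (R.dual.psi lq Kd p) x) with hΨ
  have hΨν : ∀ x ν, Ψ x ν = if ν ∈ R.wts R.hN then
      (l ν).sum fun p a => a * ep lq (R.dual.psi lq Kd p) x else 0 := by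
    intro x ν
    rw [hΨ, Finsupp.finsetSum_apply]
    simp [Finsupp.single_apply]
  have hT : ∀ x, (Ψ x).support ⊆ R.wts R.hN := by
    intro x ν hν
    by_contra h
    exact Finsupp.mem_support_iff.1 hν (by rw [hΨν, if_neg h])
  have hd : ∀ ν, Differentiable ℂ fun x => Ψ x ν := by
    intro ν
    simp only [hΨν]
    split_ifs with hν
    · exact Differentiable.fun_sum fun p _ => (differentiable_ep lq _).const_mul _
    · exact differentiable_const _
  have hgood : ∀ x, R.Good lq x → Ψ x = R.psi lq K x := by
    intro x hx
    have hs : (R.psi lq K x).support ⊆ R.wts R.hN := fun ν hν => R.mem_wts.2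
      ⟨R.rhoCoset_subset ((hK.psi_mem x).1 hν).1, ((hK.psi_mem x).1 hν).2⟩
    ext ν
    rw [hΨν]
    split_ifs with hν
    · rw [(hl ν hν).2 _ hs]
      refine Finset.sum_congr rfl fun p hp => ?_
      have h1 := hK.duality hq hKd ((hl ν hν).1 hp) x
      have e : ep lq (R.psi lq K x) p = R.nrm lq R.y0 x / K x R.rho * ep lq (K x) p := ep_smul ..
      simp only
      rw [e, div_mul_eq_mul_div, h1, mul_div_cancel_right₀ _ (hK.ne x hx)]
    · by_contra h
      exact hν (hs (Finsupp.mem_support_iff.2 (Ne.symm h)))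
  refine ⟨Ψ, ⟨hd, fun x => ⟨?_, ?_⟩, ?_⟩, hgood⟩
  · intro ν hν
    by_contra h
    refine Finsupp.mem_support_iff.1 hν (eq_of_good (R := R) hq (hd ν).continuous continuous_const
      (fun x hx => ?_) x)
    by_contra h0
    rw [hgood x hx] at h0
    exact h ((hK.psi_mem x).1 (Finsupp.mem_support_iff.2 h0))
  · intro i s h1 h2 z hz
    refine eq_of_good (R := R) hq (continuous_bf hd hT lq _) (continuous_bf hd hT lq _) (fun x hx => ?_) x
    rw [hgood x hx]
    exact (hK.psi_mem x).2 i s h1 h2 z hz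
  · refine eq_of_good (R := R) hq (hd R.rho).continuous (R.differentiable_nrm lq _).continuous fun x hx => ?_
    rw [hgood x hx]
    exact hK.psi_rhoV hq hx R.reg_y0

theorem IsEntire.Dop_eq (hq : NotRootOfUnity lq) {Ψ : ℂⁿ → ℝⁿ →₀ ℂ}
    (h : R.IsEntire lq Ψ) {O : Finset ℝⁿ} (hO : R.MQ O) (x : ℂⁿ) {z : ℂⁿ}
    (hz : ∀ τ ∈ O, ContinuousAt (R.coeff lq τ) z) :
    R.Dop lq O (bf lq x (Ψ x)) z = mO lq O x * bf lq x (Ψ x) z := by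
  have h1 : ∀ z, R.RegPt lq z → R.Dop lq O (bf lq x (Ψ x)) z = mO lq O x * bf lq x (Ψ x) z := by
    intro z hz
    refine eq_of_good (R := R) (f := fun x => R.Dop lq O (bf lq x (Ψ x)) z)
      (g := fun x => mO lq O x * bf lq x (Ψ x) z) hq ?_
      ((differentiable_mO lq O).continuous.mul (h.continuous_bf z))
      (fun x hx => hx.eq_smul hq hO (h.mem x) hz) x
    exact (continuous_finsetSum _ fun τ _ => continuous_const.mul
      ((h.continuous_bf _).sub (h.continuous_bf z))).add (continuous_const.mul (h.continuous_bf z))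
  have hc := (differentiable_bf lq x (Ψ x)).continuous
  have := mem_closure_iff_nhdsWithin_neBot.1 (R.dense_regPt hq z)
  refine tendsto_nhds_unique ((R.Dop_continuousAt hc hz).tendsto.mono_left
    (nhdsWithin_le_nhds (s := {z | R.RegPt lq z}))) ?_
  refine ((((hc.const_mul (mO lq O x)).tendsto z).mono_left
    (nhdsWithin_le_nhds (s := {z | R.RegPt lq z})))).congr' ?_
  filter_upwards [self_mem_nhdsWithin] with w hw
  exact (h1 w hw).symm

/-- The Baker--Akhiezer functions of a root system and of its dual agree. -/
theorem exists_entire_pair (R : EuclRoots ι n) (hq : NotRootOfUnity lq) :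
    ∃ Ψ Ψd : ℂⁿ → ℝⁿ →₀ ℂ, R.IsEntire lq Ψ ∧ R.dual.IsEntire lq Ψd ∧
      ∀ x z, bf lq x (Ψ x) z = bf lq z (Ψd z) x := by
  obtain ⟨K, h1, h2, h3⟩ := R.exists_BA hq
  obtain ⟨Kd, h1', h2', h3'⟩ := R.dual.exists_BA hq
  have hK : R.IsFam lq K := ⟨h1, h2, h3⟩
  have hKd : R.dual.IsFam lq Kd := ⟨h1', h2', h3'⟩
  obtain ⟨Ψ, hΨ, hΨK⟩ := hK.exists_entire hq hKd
  obtain ⟨Ψd, hΨd, hΨdK⟩ := IsFam.exists_entire (R := R.dual) hq hKd hK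
  refine ⟨Ψ, Ψd, hΨ, hΨd, fun x z => ?_⟩
  refine eq_of_good (R := R) (f := fun x => bf lq x (Ψ x) z) (g := fun x => bf lq z (Ψd z) x) hq
    (hΨ.continuous_bf z) (differentiable_bf lq z _).continuous (fun x hx => ?_) x
  refine eq_of_good (R := R.dual) (f := fun z => bf lq x (Ψ x) z) (g := fun z => bf lq z (Ψd z) x)
    hq (differentiable_bf lq x _).continuous (hΨd.continuous_bf x) (fun z hz => ?_) z
  have h4 := hK.duality hq hKd hz x
  have e : bf lq x (R.psi lq K x) z = R.nrm lq R.y0 x / K x R.rho * bf lq x (K x) z := bf_smul ..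
  rw [hΨK x hx, hΨdK z hz, e, bf, bf, dotProduct_comm z x, div_mul_eq_mul_div,
    div_eq_iff (hK.ne x hx)]
  linear_combination qpow lq (2 * (x ⬝ᵥ z)) * h4

end EuclRoots

/-- The root system `P` with base `b` and multiplicities `m` is described by `R`. -/
structure IsModel [Fintype ι] (R : EuclRoots ι n)
    (P : RootPairing ι ℝ ℝⁿ ℝⁿ) (b : P.Base) (m : ι → ℕ) : Prop where
  pairing_eq : ∀ u v : ℝⁿ, P.toLinearMap u v = u ⬝ᵥ v
  root : ∀ i, R.root i = P.root i
  coroot : ∀ i, R.coroot i = P.coroot i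
  mult : R.mult = m
  pos : ∀ i, b.IsPos i ↔ 0 < R.root i ⬝ᵥ R.y0
  pos_flip : ∀ i, b.flip.IsPos i ↔ 0 < R.coroot i ⬝ᵥ R.w0

theorem exists_height {P : RootPairing ι ℝ ℝⁿ ℝⁿ} [P.IsRootSystem]
    (b : P.Base) : ∃ y : ℝⁿ, ∀ i, P.root i ⬝ᵥ y = b.height i := by
  set f := b.toWeightBasis.constr ℝ (fun _ => (1 : ℝ)) with hf
  refine ⟨(dotProductEquiv ℝ (Fin n)).symm f, fun i => ?_⟩
  have h1 : P.root i ⬝ᵥ (dotProductEquiv ℝ (Fin n)).symm f = f (P.root i) := by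
    rw [dotProduct_comm, ← dotProductEquiv_apply_apply, LinearEquiv.apply_symm_apply]
  obtain ⟨g, -, -, hg⟩ := b.exists_root_eq_sum_int i
  rw [h1, RootPairing.Base.height_eq_sum hg, hg, map_sum, Int.cast_sum]
  refine Finset.sum_congr rfl fun j hj => ?_
  have h2 : f (P.root j) = 1 := by
    have := b.toWeightBasis.constr_basis ℝ (fun _ => (1 : ℝ)) ⟨j, hj⟩
    rwa [RootPairing.Base.toWeightBasis_apply] at this
  rw [map_zsmul, h2, zsmul_eq_mul, mul_one]

theorem IsEuclidean.exists_model [Fintype ι] {P : RootPairing ι ℝ ℝⁿ ℝⁿ}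
    [P.IsRootSystem] [P.IsCrystallographic] [P.IsReduced] [P.IsIrreducible] (hP : IsEuclidean P)
    (b : P.Base) {m : ι → ℕ} (hm : ∀ i j, m (P.reflectionPerm i j) = m j) :
    ∃ R : EuclRoots ι n, IsModel R P b m := by
  obtain ⟨y, hy⟩ := exists_height b
  obtain ⟨w, hw⟩ := exists_height b.flip
  change ∀ i, P.coroot i ⬝ᵥ w = b.flip.height i at hw
  have hnt : Nontrivial ℝⁿ := RootPairing.IsIrreducible.nontrivial P
  have hsq : ∀ i, 0 < P.root i ⬝ᵥ P.root i := fun i => EuclRoots.dot_self_pos (P.ne_zero i)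
  have hsign : ∀ i, (0 < P.coroot i ⬝ᵥ w ↔ 0 < P.root i ⬝ᵥ y) := by
    have hcl : ∀ v ∈ AddSubmonoid.closure (P.coroot '' b.support), 0 ≤ v ⬝ᵥ y ∧ 0 ≤ v ⬝ᵥ w := by
      intro v hv
      induction hv using AddSubmonoid.closure_induction with
      | mem v h =>
        obtain ⟨j, hj, rfl⟩ := h
        rw [hw, RootPairing.Base.height_one_of_mem_support (b := b.flip) hj, hP.coroot_eq,
          smul_dotProduct, hy, RootPairing.Base.height_one_of_mem_support hj]
        exact ⟨smul_nonneg (div_pos two_pos (hsq j)).le (by norm_num), by norm_num⟩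
      | zero => simp
      | add a b _ _ ha hb =>
        rw [add_dotProduct, add_dotProduct]
        exact ⟨add_nonneg ha.1 hb.1, add_nonneg ha.2 hb.2⟩
    intro i
    have h1 : P.coroot i ⬝ᵥ w ≠ 0 := by rw [hw]; exact_mod_cast b.flip.height_ne_zero i
    have h2 : P.root i ⬝ᵥ y ≠ 0 := by rw [hy]; exact_mod_cast b.height_ne_zero i
    have h3 := div_pos two_pos (hsq i)
    rcases b.coroot_mem_or_neg_mem i with h | h
    · have := hcl _ h
      rw [hP.coroot_eq, smul_dotProduct, smul_eq_mul, ← hP.coroot_eq] at this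
      exact iff_of_true (lt_of_le_of_ne this.2 h1.symm)
        (lt_of_le_of_ne (nonneg_of_mul_nonneg_right this.1 h3) h2.symm)
    · have := hcl _ h
      rw [neg_dotProduct, neg_dotProduct, hP.coroot_eq, smul_dotProduct, smul_eq_mul,
        ← hP.coroot_eq, ← mul_neg] at this
      have h4 := nonneg_of_mul_nonneg_right this.1 h3
      exact iff_of_false (by linarith [this.2]) (by linarith)
  have hint : ∀ i j, ∃ k : ℤ, P.root i ⬝ᵥ P.coroot j = k := fun i j => by
    obtain ⟨k, hk⟩ := P.exists_value (S := ℤ) i j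
    exact ⟨k, by rw [← hP.pairing_eq]; exact hk.symm⟩
  refine ⟨{ root := P.root
            coroot := P.coroot
            refl := fun i j => P.reflectionPerm i j
            mult := m
            y0 := y
            w0 := w
            nonempty := ?_
            root_ne := fun i => P.ne_zero i
            coroot_eq := hP.coroot_eq
            root_refl := fun i j => by rw [← P.reflectionPerm_root, hP.pairing_eq]
            int := hint
            root_inj := P.root.injective
            reduced := fun i j c h => ?_
            mult_refl := hm
            irr := fun U hU => ?_
            y0_int := fun i => ⟨_, hy i⟩
            y0_ne := fun i => by rw [hy]; exact_mod_cast b.height_ne_zero i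
            w0_int := fun i => ⟨_, hw i⟩
            w0_pos := hsign }, ⟨hP.pairing_eq, fun _ => rfl, fun _ => rfl, rfl, fun i => ?_,
              fun i => ?_⟩⟩
  · by_contra hne
    rw [not_nonempty_iff] at hne
    have := RootPairing.IsRootSystem.span_root_eq_top (P := P)
    rw [Set.range_eq_empty, Submodule.span_empty] at this
    exact bot_ne_top this
  · have hli : ¬ LinearIndependent ℝ ![P.root j, P.root i] := by
      rw [LinearIndependent.pair_iff]
      push Not
      exact ⟨1, -c, by rw [h]; simp, by simp⟩
    rcases RootPairing.IsReduced.eq_or_eq_neg j i hli with h1 | h1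
    · left
      have h2 : (c - 1) • P.root i = 0 := by rw [sub_smul, ← h, h1, one_smul, sub_self]
      exact sub_eq_zero.1 ((smul_eq_zero.1 h2).resolve_right (P.ne_zero i))
    · right
      have h2 : (c + 1) • P.root i = 0 := by rw [add_smul, ← h, h1, one_smul, neg_add_cancel]
      exact eq_neg_of_add_eq_zero_left ((smul_eq_zero.1 h2).resolve_right (P.ne_zero i))
  · by_cases h : U = ⊥
    · exact Or.inl h
    · refine Or.inr (RootPairing.IsIrreducible.eq_top_of_invtSubmodule_reflection (P := P) U
        (fun i => ?_) h)
      rw [Module.End.mem_invtSubmodule]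
      intro u hu
      have := hU i u hu
      rw [← hP.pairing_eq] at this
      exact this
  · rw [RootPairing.Base.isPos_iff]
    change _ ↔ 0 < P.root i ⬝ᵥ y
    rw [hy]; exact_mod_cast Iff.rfl
  · rw [RootPairing.Base.isPos_iff]
    change _ ↔ 0 < P.coroot i ⬝ᵥ w
    rw [hw]; exact_mod_cast Iff.rfl

namespace IsModel

variable [Fintype ι] {R : EuclRoots ι n} {P : RootPairing ι ℝ (Fin n → ℝ) (Fin n → ℝ)} {b : P.Base}
  {m : ι → ℕ}

theorem flip (h : IsModel R P b m) : IsModel R.dual P.flip b.flip m :=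
  ⟨fun u v => by rw [dotProduct_comm, ← h.pairing_eq]; rfl, h.coroot, h.root, h.mult, h.pos_flip,
    h.pos⟩

theorem mem_posIdx (h : IsModel R P b m) {i : ι} : i ∈ posIdx P b ↔ 0 < R.root i ⬝ᵥ R.y0 := by
  simp [posIdx, h.pos]

theorem posIdx_eq (h : IsModel R P b m) :
    posIdx P b = Finset.univ.filter fun i => 0 < R.root i ⬝ᵥ R.y0 := by
  ext i; rw [h.mem_posIdx]; simp

theorem rhoCheck_eq (h : IsModel R P b m) : rhoCheck P b m = R.rho := by
  rw [rhoCheck, EuclRoots.rho, R.rhoV_eq_sum_filter R.reg_y0, h.posIdx_eq, Finset.smul_sum]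
  refine Finset.sum_congr rfl fun i _ => ?_
  rw [smul_smul, h.coroot, h.mult]
  congr 1; ring

theorem hN_eq (h : IsModel R P b m) (v : ℝⁿ) :
    R.hN v = ∑ i ∈ posIdx P b, (m i : ℝ) / 2 * |P.coroot i ⬝ᵥ v| := by
  have := R.sum_filter_pos (fun i => (R.mult i : ℝ) / 2 * |R.coroot i ⬝ᵥ v|)
    (fun i => R.root i ⬝ᵥ R.y0) (fun i => by rw [R.mult_neg, R.coroot_neg, neg_dotProduct, abs_neg])
    (fun i => by rw [R.root_neg, neg_dotProduct]) (fun i hi => absurd hi (R.y0_ne i))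
  simp only [h.mult, h.coroot] at this
  rw [h.posIdx_eq, this, EuclRoots.hN, Finset.mul_sum, Finset.mul_sum]
  refine Finset.sum_congr rfl fun i _ => ?_
  rw [h.mult, h.coroot]; ring

theorem sub_sum_dot (l : ι → ℝ) (v : ℝⁿ) :
    (rhoCheck P b m - ∑ i ∈ posIdx P b, l i • P.coroot i) ⬝ᵥ v =
      ∑ i ∈ posIdx P b, ((m i : ℝ) / 2 - l i) * (P.coroot i ⬝ᵥ v) := by
  rw [rhoCheck, Finset.smul_sum, ← Finset.sum_sub_distrib, sum_dotProduct]
  refine Finset.sum_congr rfl fun i _ => ?_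
  rw [smul_smul, ← sub_smul, smul_dotProduct, smul_eq_mul]
  congr 1; ring

theorem polytope_eq (h : IsModel R P b m) : polytope P b m = EuclRoots.body R.hN := by
  classical
  refine Set.Subset.antisymm ?_ ?_
  · rintro ν ⟨l, hl, rfl⟩ v
    rw [sub_sum_dot, h.hN_eq]
    refine Finset.sum_le_sum fun i hi => ?_
    obtain ⟨h1, h2⟩ := hl i hi
    refine (le_abs_self _).trans ?_
    rw [abs_mul]
    exact mul_le_mul_of_nonneg_right (abs_le.2 ⟨by linarith, by linarith⟩) (abs_nonneg _)
  · intro ν hν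
    by_contra hn
    have hcv : Convex ℝ (polytope P b m) := by
      rintro _ ⟨l, hl, rfl⟩ _ ⟨l', hl', rfl⟩ s t hs ht hst
      refine ⟨s • l + t • l', fun i hi => ?_, ?_⟩
      · obtain ⟨h1, h2⟩ := hl i hi
        obtain ⟨h3, h4⟩ := hl' i hi
        simp only [Pi.add_apply, Pi.smul_apply, smul_eq_mul]
        refine ⟨by positivity, ?_⟩
        calc _ ≤ s * m i + t * m i := by gcongr
          _ = _ := by rw [← add_mul, hst, one_mul]
      · have e : rhoCheck P b m = (s + t) • rhoCheck P b m := by rw [hst, one_smul]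
        conv_rhs => rw [e]
        simp only [Pi.add_apply, Pi.smul_apply, smul_eq_mul, add_smul, mul_smul,
          Finset.sum_add_distrib, ← Finset.smul_sum]
        module
    have hcp : IsCompact (polytope P b m) := by
      have hc : IsCompact (Set.Icc (0 : ι → ℝ) fun i => (m i : ℝ)) := isCompact_Icc
      have hcont : Continuous fun l : ι → ℝ =>
          rhoCheck P b m - ∑ i ∈ posIdx P b, l i • P.coroot i := by fun_prop
      convert hc.image hcont using 1
      refine Set.Subset.antisymm ?_ ?_
      · rintro _ ⟨l, hl, rfl⟩
        refine ⟨fun i => if i ∈ posIdx P b then l i else 0, ⟨fun i => ?_, fun i => ?_⟩, ?_⟩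
        · simp only [Pi.zero_apply]; split_ifs with hi
          exacts [(hl i hi).1, le_rfl]
        · simp only; split_ifs with hi
          exacts [(hl i hi).2, Nat.cast_nonneg _]
        · simp only
          congr 1
          exact Finset.sum_congr rfl fun i hi => by rw [if_pos hi]
      · rintro _ ⟨l, hl, rfl⟩
        exact ⟨l, fun i _ => ⟨hl.1 i, hl.2 i⟩, rfl⟩
    obtain ⟨f, u, h1, h2⟩ := geometric_hahn_banach_closed_point hcv hcp.isClosed hn
    set w := (dotProductEquiv ℝ (Fin n)).symm f.toLinearMap with hw
    have hf : ∀ v, f v = v ⬝ᵥ w := fun v => by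
      rw [dotProduct_comm, ← dotProductEquiv_apply_apply, hw, LinearEquiv.apply_symm_apply]; rfl
    have h3 := h1 _ ⟨fun i => if 0 < P.coroot i ⬝ᵥ w then 0 else (m i : ℝ), fun i _ => by
      dsimp only; split_ifs <;> simp, rfl⟩
    have h4 := hν w
    rw [hf, sub_sum_dot] at h3
    rw [hf] at h2
    rw [h.hN_eq] at h4
    have : ∑ i ∈ posIdx P b, ((m i : ℝ) / 2 - if 0 < P.coroot i ⬝ᵥ w then 0 else (m i : ℝ)) *
        (P.coroot i ⬝ᵥ w) = ∑ i ∈ posIdx P b, (m i : ℝ) / 2 * |P.coroot i ⬝ᵥ w| := by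
      refine Finset.sum_congr rfl fun i _ => ?_
      split_ifs with hi
      · rw [abs_of_pos hi, sub_zero]
      · rw [abs_of_nonpos (not_lt.1 hi)]; ring
    linarith

theorem isBAAt_iff (h : IsModel R P b m) {x : ℂⁿ} {f : ℂⁿ → ℂ}
    {c : ℝⁿ →₀ ℂ} : IsBAAt lq P b m x f c ↔
      f = bf lq x c ∧ c ∈ R.qiSpace lq x (R.coweight ∩ EuclRoots.body R.hN) := by
  have hw : ∀ ν, ν ∈ weightLattice P.flip ↔ ν ∈ R.coweight := fun ν =>
    forall_congr' fun i => by rw [h.root]; rfl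
  have hp : ∀ i z (s : ℂ), z - (s / 2) • cvec (P.root i) = R.path i z (-s) := fun i z s => by
    rw [EuclRoots.path, h.root, neg_div, neg_smul, sub_eq_add_neg]
  have hp' : ∀ i z (s : ℂ), z + (s / 2) • cvec (P.root i) = R.path i z s := fun i z s => by
    rw [EuclRoots.path, h.root]
  constructor
  · rintro ⟨h1, h2, h3⟩
    have hf : f = bf lq x c := funext h2
    refine ⟨hf, fun ν hν => ?_, fun i s hs1 hs2 z hz => ?_⟩
    · rw [← h.polytope_eq]; exact ⟨(hw ν).1 (h1 ν hν).1, (h1 ν hν).2⟩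
    · rw [h.mult] at hs2
      rw [h.coroot] at hz
      rw [← hf, ← hp, ← hp']
      exact h3 i s hs1 hs2 z hz
  · rintro ⟨rfl, h1, h2⟩
    refine ⟨fun ν hν => ?_, fun z => rfl, fun i s hs1 hs2 z hz => ?_⟩
    · rw [h.polytope_eq]; exact ⟨(hw ν).2 (h1 hν).1, (h1 hν).2⟩
    · rw [← h.coroot] at hz
      rw [← h.mult] at hs2
      rw [hp, hp']
      exact h2 i s hs1 hs2 z hz

theorem prod_eq_nrm (h : IsModel R P b m) (lq : ℂ) (x : ℂⁿ) :
    ∏ i ∈ posIdx P b, ∏ j ∈ Finset.Icc 1 (m i), qbr lq ((j : ℂ) - cvec (P.root i) ⬝ᵥ x) =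
      R.nrm lq R.y0 x := by
  rw [h.posIdx_eq, Finset.prod_filter, EuclRoots.nrm]
  refine Finset.prod_congr rfl fun i _ => ?_
  split_ifs
  · rw [h.root, h.mult, Finset.range_eq_Ico, Finset.prod_Ico_add' (fun j : ℕ =>
      qbr lq ((j : ℂ) - cvec (P.root i) ⬝ᵥ x)), zero_add]
    rfl
  · rfl

theorem isNormalizedBAAt (h : IsModel R P b m) {Ψ : ℂⁿ → ℝⁿ →₀ ℂ}
    (hΨ : R.IsEntire lq Ψ) (x : ℂⁿ) : IsNormalizedBAAt lq P b m x (bf lq x (Ψ x)) :=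
  ⟨Ψ x, h.isBAAt_iff.2 ⟨rfl, fun ν hν => ⟨R.rhoCoset_subset ((hΨ.mem x).1 hν).1,
    ((hΨ.mem x).1 hν).2⟩, (hΨ.mem x).2⟩, by rw [h.rhoCheck_eq, h.prod_eq_nrm, hΨ.rho]⟩

theorem forGeneric_unique (h : IsModel R P b m) (hq : NotRootOfUnity lq)
    {g : ℂⁿ → ℂⁿ → ℂ} (hg : ∀ x, IsNormalizedBAAt lq P b m x (g x)) :
    ForGeneric fun x => ∀ f, IsNormalizedBAAt lq P b m x f → f = g x := by
  obtain ⟨d, h1, h2, h3⟩ := R.exists_generic_eq_zero hq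
  refine ⟨d, h1, h2, fun x hx f hf => ?_⟩
  obtain ⟨c, hc₀, hc'⟩ := hf
  obtain ⟨c', hd₀, hd'⟩ := hg x
  obtain ⟨rfl, hc⟩ := h.isBAAt_iff.1 hc₀
  obtain ⟨hgx, hd⟩ := h.isBAAt_iff.1 hd₀
  have := h3 x hx (c - c') (Submodule.sub_mem _ hc hd) (by
    rw [Finsupp.sub_apply, ← h.rhoCheck_eq, hc', hd', sub_self])
  rw [hgx, sub_eq_zero.1 this]

theorem reflection_eq (h : IsModel R P b m) (i : ι) (v : ℝⁿ) : P.reflection i v = R.s i v := by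
  rw [RootPairing.reflection_apply, EuclRoots.s, h.root, h.coroot, ← h.pairing_eq]; rfl

theorem mem_weylOrbit [P.IsRootSystem] {ω τ : ℝⁿ} :
    τ ∈ weylOrbit P ω ↔ τ ∈ MulAction.orbit P.weylGroup ω := by
  rw [weylOrbit, Set.Finite.mem_toFinset]

theorem mq_weylOrbit (h : IsModel R P b m) [P.IsRootSystem] {ω : ℝⁿ}
    (hω : IsMinuscule P ω ∨ IsQuasiminuscule P ω) : R.MQ (weylOrbit P ω) := by
  set Q : ℝⁿ → Prop := fun τ => ∀ i, ∃ k : ℤ, R.coroot i ⬝ᵥ τ = k ∧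
    (|k| ≤ 1 ∨ τ = R.root i ∨ τ = -R.root i) with hQ
  have hQs : ∀ i τ, Q τ → Q (R.s i τ) := by
    intro i τ hτ j
    obtain ⟨k, hk, hk'⟩ := hτ (R.refl i j)
    refine ⟨k, by rw [← hk, R.coroot_refl', R.s_dot], hk'.imp_right (Or.imp ?_ ?_)⟩
    · rintro rfl; rw [R.root_refl', R.s_s]
    · rintro rfl
      rw [R.root_refl', ← h.reflection_eq, ← h.reflection_eq, map_neg, h.reflection_eq,
        h.reflection_eq, R.s_s]
  have hQω : Q ω := by
    intro i
    rcases hω with ⟨h1, h2⟩ | ⟨j, rfl, h2⟩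
    · obtain ⟨k, hk⟩ := h1 i
      refine ⟨k, by rw [h.coroot, dotProduct_comm, hk], Or.inl ?_⟩
      have := h2 i
      rw [hk] at this
      exact_mod_cast this
    · obtain ⟨k, hk⟩ := R.int j i
      rw [h.root, h.coroot] at hk
      refine ⟨k, by rw [h.coroot, dotProduct_comm, hk], ?_⟩
      by_cases h3 : P.root i = P.root j
      · exact Or.inr (Or.inl (by rw [h.root, h3]))
      by_cases h4 : P.root i = -P.root j
      · exact Or.inr (Or.inr (by rw [h.root, h4, neg_neg]))
      have := h2 i h3 h4
      rw [hk] at this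
      exact Or.inl (by exact_mod_cast this)
  have horb : ∀ g ∈ P.weylGroup, ∀ τ, Q τ → Q (g • τ) := by
    intro g hg
    induction hg using RootPairing.weylGroup.induction with
    | mem i =>
      intro τ hτ
      rw [RootPairing.Equiv.reflection_smul, h.reflection_eq]
      exact hQs i τ hτ
    | one => intro τ hτ; rwa [one_smul]
    | mul g₁ g₂ hg₁ hg₂ h1 h2 => intro τ hτ; rw [mul_smul]; exact h1 _ (h2 _ hτ)
  refine ⟨fun i τ hτ => ?_, fun τ hτ => ?_⟩
  · rw [mem_weylOrbit] at hτ ⊢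
    obtain ⟨g, rfl⟩ := hτ
    refine ⟨RootPairing.weylGroup.ofIdx P i * g, ?_⟩
    simp only
    rw [mul_smul, RootPairing.weylGroup.ofIdx_smul, RootPairing.Equiv.reflection_smul,
      h.reflection_eq]
  · obtain ⟨g, rfl⟩ := mem_weylOrbit.1 hτ
    exact horb g g.2 ω hQω

theorem macdonaldCoeff_eq (h : IsModel R P b m) (lq : ℂ) (τ : ℝⁿ) (z : ℂⁿ) :
    macdonaldCoeff lq P m τ z = R.coeff lq τ z := by
  rw [macdonaldCoeff, Finset.prod_filter, Finset.prod_filter, ← Finset.prod_mul_distrib,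
    EuclRoots.coeff]
  refine Finset.prod_congr rfl fun i _ => ?_
  rw [fac, h.coroot, h.mult]

theorem macdonaldOp_eq (h : IsModel R P b m) [P.IsRootSystem] (lq : ℂ) (ω : ℝⁿ)
    (f : ℂⁿ → ℂ) (z : ℂⁿ) : macdonaldOp lq P b m ω f z = R.Dop lq (weylOrbit P ω) f z := by
  rw [macdonaldOp, EuclRoots.Dop, h.rhoCheck_eq]
  simp only [h.macdonaldCoeff_eq]
  rfl

theorem macdonaldOp_bf (h : IsModel R P b m) [P.IsRootSystem] (hq : NotRootOfUnity lq)
    {Ψ : ℂⁿ → ℝⁿ →₀ ℂ} (hΨ : R.IsEntire lq Ψ) {ω : ℝⁿ}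
    (hω : IsMinuscule P ω ∨ IsQuasiminuscule P ω) (x : ℂⁿ) {z : ℂⁿ} (hz : IsRegularPoint lq P ω z) :
    macdonaldOp lq P b m ω (bf lq x (Ψ x)) z = orbitSum lq P ω x * bf lq x (Ψ x) z := by
  rw [h.macdonaldOp_eq]
  refine hΨ.Dop_eq hq (h.mq_weylOrbit hω) x fun τ hτ => R.continuousAt_coeff fun j => ?_
  rw [h.coroot]
  exact hz τ hτ j

end IsModel

theorem notRootOfUnity {q lq : ℂ} (hlq : Complex.exp lq = q) (hq : ∀ k : ℕ, 0 < k → q ^ k ≠ 1) :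
    NotRootOfUnity lq := by
  intro k hk h
  rw [qpow, Complex.exp_int_mul, hlq] at h
  obtain ⟨l, rfl | rfl⟩ := k.eq_nat_or_neg
  · rw [zpow_natCast] at h
    exact hq l (by omega) h
  · rw [zpow_neg, zpow_natCast, inv_eq_one] at h
    exact hq l (by omega) h

end BakerAkhiezer

end

theorem mainTheorem2 {ι : Type*} [Fintype ι] {n : ℕ}
    (P : RootPairing ι ℝ (Fin n → ℝ) (Fin n → ℝ)) [P.IsRootSystem]
    [P.IsCrystallographic] [P.IsReduced] [P.IsIrreducible] (hP : IsEuclidean P)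
    (b : P.Base) (m : ι → ℕ) (hm : ∀ i j, m (P.reflectionPerm i j) = m j)
    (q lq : ℂ) (hlq : Complex.exp lq = q) (hq : ∀ k : ℕ, 0 < k → q ^ k ≠ 1) :
    ∃ ψ ψd : (Fin n → ℂ) → (Fin n → ℂ) → ℂ,
      -- `ψ` is the normalized BA function of `(R, m)`
      (∀ x, IsNormalizedBAAt lq P b m x (ψ x)) ∧
      ForGeneric (fun x => ∀ f, IsNormalizedBAAt lq P b m x f → f = ψ x) ∧
      -- `ψd` is the normalized BA function of the dual root system with the same multiplicities
      (∀ x, IsNormalizedBAAt lq P.flip b.flip m x (ψd x)) ∧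
      ForGeneric (fun x => ∀ f, IsNormalizedBAAt lq P.flip b.flip m x f → f = ψd x) ∧
      -- duality
      (∀ x z, ψ x z = ψd z x) ∧
      -- the bispectral system
      (∀ ω, IsMinuscule P ω ∨ IsQuasiminuscule P ω →
        ∀ x z, IsRegularPoint lq P ω z →
          macdonaldOp lq P b m ω (fun z' => ψ x z') z = orbitSum lq P ω x * ψ x z) ∧
      (∀ π, IsMinuscule P.flip π ∨ IsQuasiminuscule P.flip π →
        ∀ x z, IsRegularPoint lq P.flip π x →
          macdonaldOp lq P.flip b.flip m π (fun x' => ψ x' z) x =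
            orbitSum lq P.flip π z * ψ x z) := by
  have hq' := notRootOfUnity hlq hq
  obtain ⟨R, h⟩ := hP.exists_model b hm
  obtain ⟨Ψ, Ψd, hΨ, hΨd, hdual⟩ := R.exists_entire_pair hq'
  refine ⟨fun x z => bf lq x (Ψ x) z, fun x z => bf lq x (Ψd x) z, h.isNormalizedBAAt hΨ,
    h.forGeneric_unique hq' (h.isNormalizedBAAt hΨ), h.flip.isNormalizedBAAt hΨd,
    h.flip.forGeneric_unique hq' (h.flip.isNormalizedBAAt hΨd), hdual,
    fun ω hω x z hz => h.macdonaldOp_bf hq' hΨ hω x hz, fun π hπ x z hz => ?_⟩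
  simp only [hdual]
  exact h.flip.macdonaldOp_bf hq' hΨd hπ z hz
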